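/- Notation. Let $G=\mathrm{PSL}_2(\mathbb C)$ and write $n[z]=\begin{pmatrix}1&z\\0&1\end{pmatrix}$, $h[u]=\begin{pmatrix}u&0\\0&1/u\end{pmatrix}$, $a[r]=h[\sqrt r]$ ($r>0$), $k[\alpha,\beta]=\begin{pmatrix}\alpha&\beta\\-\bar\beta&\bar\alpha\end{pmatrix}$ ($|\alpha|^2+|\beta|^2=1$), $w=\begin{pmatrix}0&-1\\1&0\end{pmatrix}$, all modulo $\pm1$; let $N=\{n[z]\}$, $K=\{k[\alpha,\beta]\}$ with Haar probability measure $dk=\frac1{8\pi^2}\sin\theta\,d\varphi\,d\theta\,d\psi$ in the Euler angles $h[e^{i\varphi/2}]\,k[\cos\frac\theta2,i\sin\frac\theta2]\,h[e^{i\psi/2}]$, let $dn[z]$ be Lebesgue measure on $\mathbb C$, and $d\dot g=r^{-3}dr\,dk$ for $g=a[r]k\in N\backslash G$. Fix integers $l\ge0$ and $|q|\le l$, and $\omega\in\mathbb C\setminus\{0\}$; put $\psi_\omega(n[z])=e^{2\pi i\,\mathrm{Re}(\omega z)}$. For $|p|\le l$ let $\Phi^l_{p,q}(k[\alpha,\beta])$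 be the coefficient of $x^{l-p}$ in $(\alpha x-\bar\beta)^{l-q}(\beta x+\bar\alpha)^{l+q}$, let $\|\Phi^l_{p,q}\|_K=\big(\int_K|\Phi^l_{p,q}|^2dk\big)^{1/2}$, and $\varphi_{l,q}(\nu,p)(n\,a[r]\,k)=r^{1+\nu}\Phi^l_{p,q}(k)$. For each $g\in G$ let $\nu\mapsto\mathcal A_\omega\varphi_{l,q}(\nu,p)(g)$ be the entire function which for $\mathrm{Re}\,\nu>0$ is the Jacquet integral $\int_N\psi_\omega(n)^{-1}\varphi_{l,q}(\nu,p)(wng)\,dn$. Let $P_{l,q}(N\backslash G,\omega)$ be the space of $f\in C^\infty(G)$ with $f(ng)=\psi_\omega(n)f(g)$, of $K$-type $(l,q)$ (that is, $\Omega_{\mathfrak k}f=-\frac12(l^2+l)f$ and $\mathbf H_2f=-iqf$, where $\Omega_{\mathfrak k}=\frac12(\mathbf H_2^2+\mathbf W_1^2+\mathbf W_2^2)$ and $\mathbf H_2=\frac12\begin{pmatrix}i&0\\0&-i\end{pmatrix}$, $\mathbf W_1=\frac12\begin{pmatrix}0&1\\-1&0\end{pmatrix}$, $\mathbf W_2=\frac12\begin{pmatrix}0&i\\i&0\end{pmatrix}$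 act by right differentiation), such that for some $\sigma_0,\sigma_\infty>0$ depending on $f$, uniformly in $k\in K$, $f(a[r]k)=O(r^{1+\sigma_0})$ as $r\downarrow0$ and $f(a[r]k)=O(r^{1-\sigma_\infty})$ as $r\uparrow\infty$. For such $f$, $|p|\le l$ and $|\mathrm{Re}\,\nu|<\sigma_0$ put $$\mathcal L^\omega_{l,q}f(\nu,p)=\Gamma(l+1-\nu)\frac{(\pi|\omega|)^\nu(-i\omega/|\omega|)^{-p}}{\pi^2\|\Phi^l_{p,q}\|_K}\int_{N\backslash G}f(g)\,\overline{\mathcal A_\omega\varphi_{l,q}(-\bar\nu,p)(g)}\,d\dot g ,$$ with the value at $\nu=l+1,l+2,\dots$ (poles of the gamma factor) defined by continuity. Theorem 7.1. Let $\sigma>1$ and let $\eta(\nu,p)$ be defined for $|\mathrm{Re}\,\nu|\le\sigma$ and integers $|p|\le l$, such that (1) for each $p$, $\eta(\cdot,p)$ is holomorphic on a neighbourhood of the strip $|\mathrm{Re}\,\nu|\le\sigma$; (2) for every $A>0$, $\eta(\nu,p)\ll_A e^{-\pi|\mathrm{Im}\,\nu|/2}(1+|\mathrm{Im}\,\nu|)^{-A}$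 on that strip; (3) $\eta(\nu,p)=\eta(-\nu,-p)$. Put $\epsilon(0)=1$, $\epsilon(p)=-1$ for $p\ne0$, and $$\mathcal M^\omega_{l,q}\eta(g)=\frac1{2\pi^3i}\sum_{|p|\le l}\frac{(-i\omega/|\omega|)^p}{\|\Phi^l_{p,q}\|_K}\int_{(0)}\eta(\nu,p)(\pi|\omega|)^{-\nu}\Gamma(l+1+\nu)\,\mathcal A_\omega\varphi_{l,q}(\nu,p)(g)\,\nu^{\epsilon(p)}\sin(\pi\nu)\,d\nu ,$$ the integral being over the imaginary axis. Then these integrals converge absolutely, $\mathcal M^\omega_{l,q}\eta\in P_{l,q}(N\backslash G,\omega)$, and for every $\sigma_0>0$ such that $\mathcal M^\omega_{l,q}\eta(a[r]k)=O(r^{1+\sigma_0})$ as $r\downarrow0$ uniformly in $k\in K$, for all $|p|\le l$ and all $\nu$ with $|\mathrm{Re}\,\nu|\le\sigma$ and $|\mathrm{Re}\,\nu|<\sigma_0$, the integral defining $\mathcal L^\omega_{l,q}\mathcal M^\omega_{l,q}\eta(\nu,p)$ converges absolutely and $$\mathcal L^\omega_{l,q}\mathcal M^\omega_{l,q}\eta(\nu,p)=\frac2\pi\,\frac{\nu^{\epsilon(p)+1}}{p^2-\nu^2}\prod_{1\le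 j\le l}(j^2-\nu^2)\cdot\eta(\nu,p),$$ where the explicit factor, a polynomial in $\nu$ after cancellation, is read with its removable singularities at $\nu^2=p^2$ filled in. -/

import Mathlib

open MeasureTheory Polynomial

noncomputable section

namespace Lebedev

/-! ### The group

`G = PSL₂(ℂ)`. Functions on `G` are functions `f` on `SL₂(ℂ)` with `f (-g) = f g`. -/

/-- `SL₂(ℂ)`, the double cover of `PSL₂(ℂ)`. -/
abbrev SL2 : Type := Matrix.SpecialLinearGroup (Fin 2) ℂ

/-- `n[z] = (1, z; 0, 1)`. -/
def nElt (z : ℂ) : SL2 := ⟨!![1, z; 0, 1], by simp [Matrix.det_fin_two]⟩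

/-- `h[u] = (u, 0; 0, 1/u)` for `u ≠ 0` (and `1` otherwise). -/
def hElt (u : ℂ) : SL2 :=
  if hu : u ≠ 0 then ⟨!![u, 0; 0, u⁻¹], by simp [Matrix.det_fin_two, hu]⟩ else 1

/-- `k[α, β] = (α, β; -β̄, ᾱ)` for `|α|² + |β|² = 1` (and `1` otherwise). -/
def kElt (α β : ℂ) : SL2 :=
  if h : Complex.normSq α + Complex.normSq β = 1 then
    ⟨!![α, β; -(starRingEnd ℂ β), starRingEnd ℂ α], by
      rw [Matrix.det_fin_two]
      simp only [Matrix.of_apply, Matrix.cons_val', Matrix.cons_val_zero, Matrix.cons_val_one,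
        Matrix.cons_val_fin_one]
      rw [mul_neg, sub_neg_eq_add, Complex.mul_conj, Complex.mul_conj]
      exact_mod_cast h⟩
  else 1

/-- `a[r] = h[√r]`, used for `r > 0`. -/
def aElt (r : ℝ) : SL2 := hElt (Real.sqrt r : ℂ)

/-- `w = (0, -1; 1, 0)`. -/
def wElt : SL2 := ⟨!![0, -1; 1, 0], by simp [Matrix.det_fin_two]⟩

/-- The character `ψ_ω(n[z]) = exp(2πi Re(ω z))` of `N`. -/
def psi (ω z : ℂ) : ℂ := Complex.exp (2 * Real.pi * Complex.I * ((ω * z).re : ℂ))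

/-! ### Smooth functions, right differentiation, `K`-type -/

/-- A function on the closed submanifold `SL₂(ℂ)` of `M₂(ℂ)` is smooth if it is the restriction of
a `C^∞` function (over `ℝ`) on a neighbourhood of `SL₂(ℂ)`. -/
def IsSmooth (f : SL2 → ℂ) : Prop :=
  ∃ (U : Set (Fin 2 → Fin 2 → ℂ)) (F : (Fin 2 → Fin 2 → ℂ) → ℂ),
    IsOpen U ∧ (∀ g : SL2, (fun i j => g i j) ∈ U) ∧ ContDiffOn ℝ ((⊤ : ℕ∞) : WithTop ℕ∞) F U ∧
      ∀ g : SL2, F (fun i j => g i j) = f g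

/-- Right differentiation along a one-parameter subgroup `γ`. -/
def rightDeriv (γ : ℝ → SL2) (f : SL2 → ℂ) (g : SL2) : ℂ := deriv (fun t : ℝ => f (g * γ t)) 0

/-- `exp(t H₂)`, where `H₂ = ½ (i, 0; 0, -i)`. -/
def expH2 (t : ℝ) : SL2 := hElt (Complex.exp (Complex.I * t / 2))

/-- `exp(t W₁)`, where `W₁ = ½ (0, 1; -1, 0)`. -/
def expW1 (t : ℝ) : SL2 := kElt (Real.cos (t / 2)) (Real.sin (t / 2))

/-- `exp(t W₂)`, where `W₂ = ½ (0, i; i, 0)`. -/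
def expW2 (t : ℝ) : SL2 := kElt (Real.cos (t / 2)) (Complex.I * Real.sin (t / 2))

/-- The Casimir operator `Ω_k = ½ (H₂² + W₁² + W₂²)` of `K`. -/
def casimirK (f : SL2 → ℂ) (g : SL2) : ℂ :=
  (1 / 2) * (rightDeriv expH2 (rightDeriv expH2 f) g + rightDeriv expW1 (rightDeriv expW1 f) g
    + rightDeriv expW2 (rightDeriv expW2 f) g)

/-- `f` is of `K`-type `(l, q)`: `Ω_k f = -½(l² + l) f` and `H₂ f = -i q f`. -/
def HasKType (l : ℕ) (q : ℤ) (f : SL2 → ℂ) : Prop :=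
  ∀ g : SL2, casimirK f g = -(1 / 2) * ((l : ℂ) ^ 2 + l) * f g ∧
    rightDeriv expH2 f g = -(Complex.I * q) * f g

/-- `f(a[r]k) = O(r^s)` as `r ↓ 0`, uniformly in `k ∈ K`. -/
def GrowthZero (f : SL2 → ℂ) (s : ℝ) : Prop :=
  ∃ C : ℝ, ∃ δ > 0, ∀ r : ℝ, 0 < r → r < δ → ∀ α β : ℂ,
    Complex.normSq α + Complex.normSq β = 1 → ‖f (aElt r * kElt α β)‖ ≤ C * r ^ s

/-- `f(a[r]k) = O(r^s)` as `r ↑ ∞`, uniformly in `k ∈ K`. -/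
def GrowthInfty (f : SL2 → ℂ) (s : ℝ) : Prop :=
  ∃ C : ℝ, ∃ R > 0, ∀ r : ℝ, R < r → ∀ α β : ℂ,
    Complex.normSq α + Complex.normSq β = 1 → ‖f (aElt r * kElt α β)‖ ≤ C * r ^ s

/-- The space `P_{l,q}(N\G, ω)`. The first field says that `f` is a function on `PSL₂(ℂ)`. -/
structure MemP (l : ℕ) (q : ℤ) (ω : ℂ) (f : SL2 → ℂ) : Prop where
  even : ∀ g : SL2, f (-g) = f g
  smooth : IsSmooth f
  equivariant : ∀ (z : ℂ) (g : SL2), f (nElt z * g) = psi ω z * f g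
  kType : HasKType l q f
  growthZero : ∃ σ₀ : ℝ, 0 < σ₀ ∧ GrowthZero f (1 + σ₀)
  growthInfty : ∃ σ_inf : ℝ, 0 < σ_inf ∧ GrowthInfty f (1 - σ_inf)

/-! ### Matrix coefficients of `K` and integration -/

/-- `Φ^l_{p,q}(k[α, β])`: the coefficient of `x^{l-p}` in
`(α x - β̄)^{l-q} (β x + ᾱ)^{l+q}`, and zero unless `|p|, |q| ≤ l`. -/
def Phi (l : ℕ) (p q : ℤ) (α β : ℂ) : ℂ :=
  if |p| ≤ (l : ℤ) ∧ |q| ≤ (l : ℤ) then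
    ((C α * X - C (starRingEnd ℂ β)) ^ ((l : ℤ) - q).toNat *
      (C β * X + C (starRingEnd ℂ α)) ^ ((l : ℤ) + q).toNat : ℂ[X]).coeff ((l : ℤ) - p).toNat
  else 0

/-- The element of `K` with Euler angles `x = (φ, θ, ψ)`:
`h[e^{iφ/2}] k[cos(θ/2), i sin(θ/2)] h[e^{iψ/2}]`. -/
def eulerElt (x : ℝ × ℝ × ℝ) : SL2 :=
  hElt (Complex.exp (Complex.I * x.1 / 2)) *
    kElt (Real.cos (x.2.1 / 2)) (Complex.I * Real.sin (x.2.1 / 2)) *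
    hElt (Complex.exp (Complex.I * x.2.2 / 2))

/-- The Haar probability measure `dk = (8π²)⁻¹ sin θ dφ dθ dψ` of `K = PSU(2)` in Euler angles
`0 < φ ≤ 2π`, `0 ≤ θ ≤ π`, `0 < ψ ≤ 2π`. -/
def haarK : Measure (ℝ × ℝ × ℝ) :=
  (volume.restrict (Set.Ioc 0 (2 * Real.pi) ×ˢ Set.Icc 0 Real.pi ×ˢ
    Set.Ioc 0 (2 * Real.pi))).withDensity
      (fun x => ENNReal.ofReal (Real.sin x.2.1 / (8 * Real.pi ^ 2)))

/-- The measure `r⁻³ dr dk` of `N\G`, in the coordinates `(r, Euler angles)`. -/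
def measNG : Measure (ℝ × (ℝ × ℝ × ℝ)) :=
  ((volume.restrict (Set.Ioi 0)).withDensity (fun r : ℝ => ENNReal.ofReal (r ^ (-3 : ℤ)))).prod
    haarK

/-- The norm `‖Φ^l_{p,q}‖_K = (∫_K |Φ^l_{p,q}(k)|² dk)^{1/2}`. -/
def normPhi (l : ℕ) (p q : ℤ) : ℝ :=
  Real.sqrt (∫ x, ‖Phi l p q (eulerElt x 0 0) (eulerElt x 0 1)‖ ^ 2 ∂haarK)

/-! ### Principal series vectors and the Jacquet operator -/

/-- The height `r` of `g = n[z] a[r] k`, namely `1 / (|c|² + |d|²)` with `(c, d)` the bottom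
row of `g`. -/
def height (g : SL2) : ℝ := 1 / (Complex.normSq (g 1 0) + Complex.normSq (g 1 1))

/-- `φ_{l,q}(ν,p)(n a[r] k) = r^{1+ν} Φ^l_{p,q}(k)`. The component `k = k[α, β]` of a matrix with
bottom row `(c, d)` and height `r` has bottom row `(-β̄, ᾱ) = √r (c, d)`. -/
def phi (l : ℕ) (q : ℤ) (ν : ℂ) (p : ℤ) (g : SL2) : ℂ :=
  (height g : ℂ) ^ (1 + ν) *
    Phi l p q ((Real.sqrt (height g) : ℂ) * starRingEnd ℂ (g 1 1))
      (-((Real.sqrt (height g) : ℂ) * starRingEnd ℂ (g 1 0)))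

theorem phi_iwasawa (l : ℕ) (q : ℤ) (ν : ℂ) (p : ℤ) (z : ℂ) (r : ℝ) (hr : 0 < r) (α β : ℂ)
    (h : Complex.normSq α + Complex.normSq β = 1) :
    phi l q ν p (nElt z * aElt r * kElt α β) = (r : ℂ) ^ (1 + ν) * Phi l p q α β := by
  have hs : 0 < Real.sqrt r := Real.sqrt_pos.2 hr
  have hs' : ((Real.sqrt r : ℝ) : ℂ) ≠ 0 := by exact_mod_cast hs.ne'
  have e0 : (nElt z * aElt r * kElt α β) 1 0 = -((Real.sqrt r : ℂ)⁻¹ * starRingEnd ℂ β) := by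
    rw [Matrix.SpecialLinearGroup.coe_mul, Matrix.SpecialLinearGroup.coe_mul]
    simp [nElt, aElt, hElt, kElt, hs', h, Matrix.mul_apply, Fin.sum_univ_two]
  have e1 : (nElt z * aElt r * kElt α β) 1 1 = (Real.sqrt r : ℂ)⁻¹ * starRingEnd ℂ α := by
    rw [Matrix.SpecialLinearGroup.coe_mul, Matrix.SpecialLinearGroup.coe_mul]
    simp [nElt, aElt, hElt, kElt, hs', h, Matrix.mul_apply, Fin.sum_univ_two]
  have hh : height (nElt z * aElt r * kElt α β) = r := by
    unfold height
    rw [e0, e1, Complex.normSq_neg, Complex.normSq_mul, Complex.normSq_mul, Complex.normSq_conj,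
      Complex.normSq_conj, ← mul_add, add_comm, h, Complex.normSq_inv, Complex.normSq_ofReal,
      Real.mul_self_sqrt hr.le]
    simp
  unfold phi
  rw [hh, e0, e1]
  congr 2
  · simp [hs']
  · simp [hs']

/-- The Jacquet integral `∫_N ψ_ω(n)⁻¹ f(w n g) dn`, with `dn` the Lebesgue measure on `ℂ`. -/
def jacquetIntegral (ω : ℂ) (f : SL2 → ℂ) (g : SL2) : ℂ :=
  ∫ z : ℂ, (psi ω z)⁻¹ * f (wElt * nElt z * g)

/-- The Jacquet operator `A_ω φ_{l,q}(ν, p)` for `ω ≠ 0`: for each `g`, the entire function of `ν`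
which for `Re ν > 0` is the Jacquet integral of `φ_{l,q}(ν, p)`. (There is at most one such entire
function, by the identity theorem.) -/
def jacquet (ω : ℂ) (l : ℕ) (q : ℤ) (ν : ℂ) (p : ℤ) (g : SL2) : ℂ :=
  Classical.epsilon (fun F : ℂ → ℂ => Differentiable ℂ F ∧
    ∀ s : ℂ, 0 < s.re → F s = jacquetIntegral ω (phi l q s p) g) ν

/-! ### The two transforms -/

/-- `ω / |ω|`. -/
def unitPart (ω : ℂ) : ℂ := ω / (‖ω‖ : ℂ)

/-- `ε(0) = 1` and `ε(p) = -1` for `p ≠ 0`. -/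
def eps (p : ℤ) : ℤ := if p = 0 then 1 else -1

/-- The integrand of the integral in the definition of `lebedev`. -/
def lebedevIntegrand (l : ℕ) (q : ℤ) (ω : ℂ) (f : SL2 → ℂ) (ν : ℂ) (p : ℤ)
    (x : ℝ × (ℝ × ℝ × ℝ)) : ℂ :=
  f (aElt x.1 * eulerElt x.2) *
    starRingEnd ℂ (jacquet ω l q (-(starRingEnd ℂ ν)) p (aElt x.1 * eulerElt x.2))

/-- The extended Lebedev transform
`L f(ν,p) = Γ(l+1-ν) (π|ω|)^ν (-iω/|ω|)^{-p} π⁻² ‖Φ^l_{p,q}‖_K⁻¹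
  ∫_{N\G} f(g) conj(A_ω φ_{l,q}(-ν̄, p)(g)) dġ`. -/
def lebedev (l : ℕ) (q : ℤ) (ω : ℂ) (f : SL2 → ℂ) (ν : ℂ) (p : ℤ) : ℂ :=
  Complex.Gamma (l + 1 - ν) * (((Real.pi * ‖ω‖ : ℝ) : ℂ) ^ ν *
    (-Complex.I * unitPart ω) ^ (-p) / ((Real.pi : ℂ) ^ 2 * (normPhi l p q : ℂ))) *
    ∫ x, lebedevIntegrand l q ω f ν p x ∂measNG

/-- The integrand
`η(ν,p) (π|ω|)^{-ν} Γ(l+1+ν) A_ω φ_{l,q}(ν,p)(g) ν^{ε(p)} sin(πν)`. -/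
def inverseIntegrand (l : ℕ) (q : ℤ) (ω : ℂ) (η : ℂ → ℤ → ℂ) (g : SL2) (p : ℤ) (ν : ℂ) : ℂ :=
  η ν p * ((Real.pi * ‖ω‖ : ℝ) : ℂ) ^ (-ν) * Complex.Gamma (l + 1 + ν) * jacquet ω l q ν p g *
    ν ^ eps p * Complex.sin (Real.pi * ν)

/-- `M η(g) = (2π³i)⁻¹ ∑_{|p| ≤ l} (-iω/|ω|)^p ‖Φ^l_{p,q}‖_K⁻¹ ∫_{(0)} (integrand) dν`, the contour
being the imaginary axis `ν = it`, upwards. -/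
def inverseTransform (l : ℕ) (q : ℤ) (ω : ℂ) (η : ℂ → ℤ → ℂ) (g : SL2) : ℂ :=
  1 / (2 * (Real.pi : ℂ) ^ 3 * Complex.I) * ∑ p ∈ Finset.Icc (-(l : ℤ)) (l : ℤ),
    (-Complex.I * unitPart ω) ^ p / (normPhi l p q : ℂ) *
      ∫ t : ℝ, inverseIntegrand l q ω η g p (t * Complex.I) * Complex.I

/-- The polynomial in `ν` which equals
`(2/π) ν^{ε(p)+1} / (p² - ν²) ∏_{1 ≤ j ≤ l} (j² - ν²)` for `ν² ≠ p²`, `|p| ≤ l`. -/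
def factor (l : ℕ) (p : ℤ) (ν : ℂ) : ℂ :=
  if p = 0 then -(2 / Real.pi) * ∏ j ∈ Finset.Icc 1 l, ((j : ℂ) ^ 2 - ν ^ 2)
  else (2 / Real.pi) * ∏ j ∈ (Finset.Icc 1 l).erase p.natAbs, ((j : ℂ) ^ 2 - ν ^ 2)

theorem factor_eq (l : ℕ) (p : ℤ) (hp : |p| ≤ l) (ν : ℂ) (h : ν ^ 2 ≠ (p : ℂ) ^ 2) :
    factor l p ν = 2 / Real.pi * (ν ^ (eps p + 1) / ((p : ℂ) ^ 2 - ν ^ 2)) *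
      ∏ j ∈ Finset.Icc 1 l, ((j : ℂ) ^ 2 - ν ^ 2) := by
  have h' : (p : ℂ) ^ 2 - ν ^ 2 ≠ 0 := sub_ne_zero.2 (Ne.symm h)
  by_cases h0 : p = 0
  · subst h0
    have hν : ν ≠ 0 := by rintro rfl; simp at h
    simp only [factor, eps, if_true]
    have : ν ^ ((1 : ℤ) + 1) = ν ^ 2 := by norm_cast
    rw [this]
    simp only [Int.cast_zero]
    field_simp
    ring
  · have hm : p.natAbs ∈ Finset.Icc 1 l := by
      rw [Finset.mem_Icc]
      have h2 := abs_le.1 hp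
      omega
    have hc : ((p.natAbs : ℕ) : ℂ) ^ 2 = (p : ℂ) ^ 2 := by
      have h3 : ((p.natAbs : ℤ)) ^ 2 = p ^ 2 := Int.natAbs_sq p
      have h4 : (((p.natAbs : ℤ) ^ 2 : ℤ) : ℂ) = ((p ^ 2 : ℤ) : ℂ) := by rw [h3]
      rwa [Int.cast_pow, Int.cast_pow, Int.cast_natCast] at h4
    simp only [factor, eps, if_neg h0]
    rw [← Finset.mul_prod_erase _ _ hm, hc]
    simp only [neg_add_cancel, zpow_zero]
    field_simp

end Lebedev

end

noncomputable section

namespace Lebedev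

open Filter Topology Set Asymptotics
open Complex (I Gamma normSq norm_real conj_ofReal sub_re neg_re add_re abs_re_le_norm mul_conj
  normSq_eq_norm_sq conj_I normSq_ofReal I_sq cpow_add
  norm_cpow_eq_rpow_re_of_pos continuous_re arg_ofReal_of_nonneg Gamma_add_one)
open Real (rpow_nonneg rpow_add rpow_natCast norm_of_nonneg pi_pos)
open scoped Real ComplexConjugate

/-! ### Bounds for the gamma function on vertical lines -/

theorem cpow_mul_exp_integrable {σ δ : ℝ} (hσ : 0 < σ) (hδ : 0 < δ) :
    IntegrableOn (fun t : ℝ => t ^ (σ - 1) * Real.exp (-δ * t)) (Ioi 0) := by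
  have := integrableOn_rpow_mul_exp_neg_mul_rpow (s := σ - 1) (p := 1) (by linarith) one_pos hδ
  simpa using this

theorem norm_cpow_mul_exp (a r : ℂ) {t : ℝ} (ht : 0 < t) :
    ‖(t : ℂ) ^ (a - 1) * Complex.exp (-(r * t))‖ = t ^ (a.re - 1) * Real.exp (-r.re * t) := by
  rw [norm_mul, norm_cpow_eq_rpow_re_of_pos ht, Complex.norm_exp]
  simp

theorem laplace_cpow_differentiableAt {a : ℂ} (ha : 0 < a.re) {r₀ : ℂ} (hr : 0 < r₀.re) :
    DifferentiableAt ℂ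
      (fun r : ℂ => ∫ t in Ioi (0 : ℝ), (t : ℂ) ^ (a - 1) * Complex.exp (-(r * t))) r₀ := by
  have hmeas : ∀ (b : ℂ) (r : ℂ), AEStronglyMeasurable
      (fun t : ℝ => (t : ℂ) ^ b * Complex.exp (-(r * t))) (volume.restrict (Ioi 0)) := by
    intro b r
    refine ContinuousOn.aestronglyMeasurable ?_ measurableSet_Ioi
    intro t ht
    refine ContinuousWithinAt.mul ?_ (by fun_prop)
    exact (Complex.continuousAt_ofReal_cpow_const _ _ (Or.inr (ne_of_gt ht))).continuousWithinAt
  have hball : ∀ r ∈ Metric.ball r₀ (r₀.re / 2), r₀.re / 2 ≤ r.re := by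
    intro r hr'
    have h1 := abs_re_le_norm (r - r₀)
    rw [Metric.mem_ball, dist_eq_norm] at hr'
    have h2 := abs_le.1 (h1.trans hr'.le)
    simp at h2
    linarith [h2.1]
  refine (hasDerivAt_integral_of_dominated_loc_of_deriv_le
    (F := fun r t => (t : ℂ) ^ (a - 1) * Complex.exp (-(r * t)))
    (F' := fun r t => (t : ℂ) ^ (a - 1) * (Complex.exp (-(r * t)) * (-t)))
    (bound := fun t => t ^ (a.re + 1 - 1) * Real.exp (-(r₀.re / 2) * t))
    (Metric.ball_mem_nhds r₀ (by positivity : 0 < r₀.re / 2)) ?_ ?_ ?_ ?_ ?_ ?_).2.differentiableAt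
  · exact Eventually.of_forall fun r => hmeas _ r
  · refine (integrable_norm_iff (hmeas _ _)).1 ?_
    refine (cpow_mul_exp_integrable ha hr).congr_fun ?_ measurableSet_Ioi
    intro t ht
    exact (norm_cpow_mul_exp a r₀ ht).symm
  · have := (hmeas (a - 1) r₀).mul (g := fun t : ℝ => (-t : ℂ))
      (Continuous.aestronglyMeasurable (by fun_prop))
    refine this.congr (Eventually.of_forall fun t => ?_)
    simp [mul_assoc]
  · refine (ae_restrict_iff' measurableSet_Ioi).2 (Eventually.of_forall fun t ht r hr' => ?_)
    have ht' : (0 : ℝ) < t := ht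
    rw [← mul_assoc, norm_mul, norm_cpow_mul_exp a r ht', norm_neg, norm_real,
      norm_of_nonneg ht'.le, show a.re + 1 - 1 = (a.re - 1) + 1 by ring,
      Real.rpow_add_one ht'.ne']
    have := hball r hr'
    have h3 : Real.exp (-r.re * t) ≤ Real.exp (-(r₀.re / 2) * t) := by
      apply Real.exp_le_exp.2; nlinarith
    have h4 : 0 ≤ t ^ (a.re - 1) := rpow_nonneg ht'.le _
    nlinarith [mul_le_mul_of_nonneg_left h3 (mul_nonneg h4 ht'.le)]
  · exact cpow_mul_exp_integrable (by linarith) (by linarith)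
  · refine Eventually.of_forall fun t r _ => ?_
    have h1 : HasDerivAt (fun r : ℂ => -(r * t)) (-(t : ℂ)) r := by
      simpa using ((hasDerivAt_id r).mul_const (t : ℂ)).fun_neg
    exact (h1.cexp).const_mul _

/-- The Laplace transform of a power, for a complex parameter in the right half plane. -/
theorem laplace_cpow {a r : ℂ} (ha : 0 < a.re) (hr : 0 < r.re) :
    ∫ t in Ioi (0 : ℝ), (t : ℂ) ^ (a - 1) * Complex.exp (-(r * t)) = r ^ (-a) * Gamma a := by
  have hU : IsOpen {r : ℂ | 0 < r.re} := isOpen_lt continuous_const continuous_re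
  have h1 : AnalyticOnNhd ℂ (fun r : ℂ => ∫ t in Ioi (0 : ℝ),
      (t : ℂ) ^ (a - 1) * Complex.exp (-(r * t))) {r : ℂ | 0 < r.re} :=
    DifferentiableOn.analyticOnNhd
      (fun r hr => (laplace_cpow_differentiableAt ha hr).differentiableWithinAt) hU
  have h2 : AnalyticOnNhd ℂ (fun r : ℂ => r ^ (-a) * Gamma a) {r : ℂ | 0 < r.re} := by
    refine DifferentiableOn.analyticOnNhd (fun r hr => ?_) hU
    refine (DifferentiableAt.mul_const ?_ _).differentiableWithinAt
    exact differentiableAt_id.cpow_const (Or.inl hr)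
  have hconv : IsPreconnected {r : ℂ | 0 < r.re} := (convex_halfSpace_re_gt 0).isPreconnected
  refine AnalyticOnNhd.eqOn_of_preconnected_of_frequently_eq h1 h2 hconv
    (z₀ := 1) (by simp) ?_ hr
  have ht : Tendsto (fun x : ℝ => (x : ℂ)) (𝓝[≠] (1 : ℝ)) (𝓝[≠] (1 : ℂ)) := by
    refine tendsto_nhdsWithin_of_tendsto_nhds_of_eventually_within _ ?_ ?_
    · have : Tendsto (fun x : ℝ => (x : ℂ)) (𝓝 (1 : ℝ)) (𝓝 ((1 : ℝ) : ℂ)) :=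
        Complex.continuous_ofReal.tendsto _
      simpa using this.mono_left nhdsWithin_le_nhds
    · filter_upwards [self_mem_nhdsWithin] with x hx
      simpa using hx
  refine ht.frequently (Eventually.frequently ?_)
  have hpos : ∀ᶠ x : ℝ in 𝓝[≠] 1, 0 < x :=
    nhdsWithin_le_nhds (lt_mem_nhds one_pos)
  filter_upwards [hpos] with x hx
  rw [Complex.integral_cpow_mul_exp_neg_mul_Ioi ha hx, one_div, Complex.cpow_neg, Complex.inv_cpow]
  rw [arg_ofReal_of_nonneg hx.le]
  exact pi_pos.ne

theorem norm_Gamma_le_of_angle {s : ℂ} (hs : 0 < s.re) {θ : ℝ} (h0 : 0 ≤ θ)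
    (h1 : θ < π / 2) :
    ‖Gamma s‖ ≤ Real.exp (-θ * s.im) * (Real.Gamma s.re * Real.cos θ ^ (-s.re)) := by
  have hc : 0 < Real.cos θ := Real.cos_pos_of_mem_Ioo ⟨by linarith [pi_pos], h1⟩
  set r : ℂ := Complex.exp (θ * I) with hr
  have hre : r.re = Real.cos θ := by rw [hr, Complex.exp_ofReal_mul_I_re]
  have hlog : Complex.log r = θ * I := by
    rw [hr, Complex.log_exp] <;> simp <;> linarith [pi_pos]
  have hr0 : r ≠ 0 := Complex.exp_ne_zero _
  have key := laplace_cpow (a := s) (r := r) hs (by rw [hre]; exact hc)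
  have h2 : ‖∫ t in Ioi (0 : ℝ), (t : ℂ) ^ (s - 1) * Complex.exp (-(r * t))‖ ≤
      Real.Gamma s.re * Real.cos θ ^ (-s.re) := by
    refine (norm_integral_le_integral_norm _).trans (le_of_eq ?_)
    rw [setIntegral_congr_fun measurableSet_Ioi
      (fun t ht => norm_cpow_mul_exp s r ht)]
    simp_rw [hre]
    have := Real.integral_rpow_mul_exp_neg_mul_Ioi hs hc
    simp_rw [← neg_mul] at this
    rw [this, one_div, Real.inv_rpow hc.le, Real.rpow_neg hc.le]
    ring
  have h3 : ‖r ^ (-s)‖ = Real.exp (θ * s.im) := by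
    rw [Complex.cpow_def_of_ne_zero hr0, hlog, Complex.norm_exp]
    simp
  rw [key, norm_mul, h3] at h2
  have := mul_le_mul_of_nonneg_left h2 (Real.exp_pos (-θ * s.im)).le
  rwa [← mul_assoc, ← Real.exp_add, show -θ * s.im + θ * s.im = 0 by ring, Real.exp_zero,
    one_mul] at this

theorem norm_Gamma_le {s : ℂ} (hs : 0 < s.re) :
    ‖Gamma s‖ ≤ Real.exp 1 * Real.exp (-π * |s.im| / 2) *
      (Real.Gamma s.re * (π / 2 * (1 + |s.im|)) ^ s.re) := by
  wlog him : 0 ≤ s.im generalizing s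
  · have := this (s := conj s) (by simpa using hs) (by simp; linarith)
    rw [Complex.Gamma_conj] at this
    simpa using this
  rw [abs_of_nonneg him]
  set φ : ℝ := 1 / (1 + s.im) with hφ
  have hφ0 : 0 < φ := by positivity
  have hφ1 : φ ≤ 1 := by rw [hφ, div_le_one (by positivity)]; linarith
  have hpi := Real.pi_gt_three
  have := norm_Gamma_le_of_angle hs (θ := π / 2 - φ) (by linarith) (by linarith)
  refine this.trans ?_
  rw [Real.cos_pi_div_two_sub]
  have hsin : 2 / π * φ ≤ Real.sin φ := Real.mul_le_sin hφ0.le (by linarith)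
  have e1 : Real.exp (-(π / 2 - φ) * s.im) ≤
      Real.exp 1 * Real.exp (-π * s.im / 2) := by
    rw [← Real.exp_add]
    apply Real.exp_le_exp.2
    have : φ * s.im ≤ 1 := by
      rw [hφ, one_div, inv_mul_le_iff₀ (by positivity)]; linarith
    linarith
  have e2 : Real.sin φ ^ (-s.re) ≤ (π / 2 * (1 + s.im)) ^ s.re := by
    have h0 : 0 < 2 / π * φ := by positivity
    rw [Real.rpow_neg (h0.le.trans hsin), ← Real.inv_rpow (h0.le.trans hsin)]
    refine Real.rpow_le_rpow (inv_nonneg.2 (h0.le.trans hsin)) ?_ hs.le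
    have e3 := inv_anti₀ h0 hsin
    refine e3.trans (le_of_eq ?_)
    rw [hφ]; field_simp
  have hG : 0 ≤ Real.Gamma s.re := (Real.Gamma_pos_of_pos hs).le
  refine mul_le_mul e1 (mul_le_mul_of_nonneg_left e2 hG) ?_ (by positivity)
  exact mul_nonneg hG (rpow_nonneg (by
    have : 0 < 2 / π * φ := by positivity
    linarith) _)

/-- On closed vertical strips in the right half plane, `Γ` decays like `e^{-π|t|/2}` up to a
polynomial factor. -/
theorem exists_norm_Gamma_le {x₁ : ℝ} (h1 : 0 < x₁) (x₂ : ℝ) :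
    ∃ C : ℝ, 0 ≤ C ∧ ∃ n : ℕ, ∀ s : ℂ, x₁ ≤ s.re → s.re ≤ x₂ →
      ‖Gamma s‖ ≤ C * (1 + |s.im|) ^ n * Real.exp (-π * |s.im| / 2) := by
  obtain ⟨n, hn⟩ := exists_nat_ge x₂
  have hcont : ContinuousOn Real.Gamma (Icc x₁ x₂) := by
    intro x hx
    refine (Real.differentiableAt_Gamma fun m => ?_).continuousAt.continuousWithinAt
    have : (0 : ℝ) ≤ m := m.cast_nonneg
    linarith [hx.1]
  obtain ⟨G, hG⟩ := isCompact_Icc.exists_bound_of_continuousOn hcont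
  refine ⟨Real.exp 1 * (|G| * (π / 2) ^ n), by positivity, n, fun s hs1 hs2 => ?_⟩
  have hs : 0 < s.re := h1.trans_le hs1
  refine (norm_Gamma_le hs).trans ?_
  have e1 : Real.Gamma s.re ≤ |G| := (le_abs_self _).trans ((hG _ ⟨hs1, hs2⟩).trans (le_abs_self _))
  have hb : 1 ≤ π / 2 * (1 + |s.im|) := by
    nlinarith [Real.pi_gt_three, abs_nonneg s.im]
  have e2 : (π / 2 * (1 + |s.im|)) ^ s.re ≤ (π / 2 * (1 + |s.im|)) ^ n := by
    rw [← rpow_natCast]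
    exact Real.rpow_le_rpow_of_exponent_le hb (hs2.trans hn)
  rw [mul_pow] at e2
  calc _ ≤ Real.exp 1 * Real.exp (-π * |s.im| / 2) *
        (|G| * ((π / 2) ^ n * (1 + |s.im|) ^ n)) := by
        gcongr
    _ = _ := by ring

/-! ### The Bessel function `V s y = 2 K_s(2 y)` -/

/-- The kernel `exp(-y (u + 1/u))`. -/
def besselKer (y u : ℝ) : ℂ := ((Real.exp (-y * (u + u⁻¹)) : ℝ) : ℂ)

/-- `V s y = ∫₀^∞ u^{s-1} exp(-y (u + 1/u)) du = 2 K_s(2 y)`. -/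
def V (s : ℂ) (y : ℝ) : ℂ := mellin (besselKer y) s

/-- The modified Bessel integral `V` at real parameters. -/
def VR (x y : ℝ) : ℝ := ∫ u in Ioi (0 : ℝ), u ^ (x - 1) * Real.exp (-y * (u + u⁻¹))

theorem norm_besselKer (y u : ℝ) : ‖besselKer y u‖ = Real.exp (-y * (u + u⁻¹)) := by
  rw [besselKer, norm_real, norm_of_nonneg (Real.exp_pos _).le]

theorem besselKer_continuousOn (y : ℝ) : ContinuousOn (besselKer y) (Ioi 0) := by
  unfold besselKer
  have : ContinuousOn (fun u : ℝ => u⁻¹) (Ioi 0) :=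
    continuousOn_inv₀.mono fun u (hu : 0 < u) => hu.ne'
  fun_prop

theorem besselKer_locallyIntegrableOn (y : ℝ) : LocallyIntegrableOn (besselKer y) (Ioi 0) :=
  (besselKer_continuousOn y).locallyIntegrableOn measurableSet_Ioi

theorem besselKer_isBigO_atTop {y : ℝ} (hy : 0 < y) :
    besselKer y =O[atTop] fun t => Real.exp (-y * t) := by
  refine IsBigO.of_bound 1 ?_
  filter_upwards [eventually_gt_atTop 0] with u hu
  rw [norm_besselKer, one_mul, norm_of_nonneg (Real.exp_pos _).le]
  apply Real.exp_le_exp.2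
  have := inv_pos.2 hu
  nlinarith

theorem besselKer_isBigO_zero {y : ℝ} (hy : 0 < y) (b : ℝ) :
    besselKer y =O[𝓝[>] 0] fun t => t ^ (-b) := by
  have h1 : (fun t : ℝ => Real.exp (-y * t⁻¹)) =O[𝓝[>] 0] fun t : ℝ => (t⁻¹) ^ b :=
    ((isLittleO_exp_neg_mul_rpow_atTop hy b).comp_tendsto tendsto_inv_nhdsGT_zero).isBigO
  have h2 : besselKer y =O[𝓝[>] 0] fun t : ℝ => Real.exp (-y * t⁻¹) := by
    refine IsBigO.of_bound 1 ?_
    filter_upwards [self_mem_nhdsWithin] with u hu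
    have hu' : (0 : ℝ) < u := hu
    rw [norm_besselKer, one_mul, norm_of_nonneg (Real.exp_pos _).le]
    apply Real.exp_le_exp.2
    nlinarith
  refine (h2.trans h1).congr' EventuallyEq.rfl ?_
  filter_upwards [self_mem_nhdsWithin] with u hu
  have hu' : (0 : ℝ) < u := hu
  rw [Real.inv_rpow hu'.le, Real.rpow_neg hu'.le]

theorem V_convergent {y : ℝ} (hy : 0 < y) (s : ℂ) : MellinConvergent (besselKer y) s :=
  mellinConvergent_of_isBigO_rpow_exp hy (besselKer_locallyIntegrableOn y)
    (besselKer_isBigO_atTop hy) (besselKer_isBigO_zero hy (s.re - 1)) (by linarith)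

theorem V_differentiable {y : ℝ} (hy : 0 < y) : Differentiable ℂ fun s => V s y := fun s =>
  mellin_differentiableAt_of_isBigO_rpow_exp hy (besselKer_locallyIntegrableOn y)
    (besselKer_isBigO_atTop hy) (besselKer_isBigO_zero hy (s.re - 1)) (by linarith)

theorem V_neg (s : ℂ) (y : ℝ) : V (-s) y = V s y := by
  unfold V
  rw [← mellin_comp_inv]
  congr 1
  ext u
  simp [besselKer, add_comm]

theorem norm_V_integrand (s : ℂ) (y : ℝ) {u : ℝ} (hu : 0 < u) :
    ‖(u : ℂ) ^ (s - 1) • besselKer y u‖ = u ^ (s.re - 1) * Real.exp (-y * (u + u⁻¹)) := by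
  rw [norm_smul, norm_besselKer, norm_cpow_eq_rpow_re_of_pos hu]
  simp

theorem VR_integrable {y : ℝ} (hy : 0 < y) (x : ℝ) :
    IntegrableOn (fun u : ℝ => u ^ (x - 1) * Real.exp (-y * (u + u⁻¹))) (Ioi 0) := by
  have h : IntegrableOn (fun u : ℝ => ‖(u : ℂ) ^ ((x : ℂ) - 1) • besselKer y u‖) (Ioi 0) :=
    (V_convergent hy (x : ℂ)).norm
  refine h.congr_fun (fun u hu => ?_) measurableSet_Ioi
  simp only
  rw [norm_V_integrand _ _ hu, Complex.ofReal_re]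

theorem VR_nonneg (x y : ℝ) : 0 ≤ VR x y :=
  setIntegral_nonneg measurableSet_Ioi fun u (hu : 0 < u) =>
    mul_nonneg (rpow_nonneg hu.le _) (Real.exp_pos _).le

theorem norm_V_le (s : ℂ) (y : ℝ) : ‖V s y‖ ≤ VR s.re y := by
  refine (norm_integral_le_integral_norm _).trans (le_of_eq ?_)
  exact setIntegral_congr_fun measurableSet_Ioi fun u hu => norm_V_integrand s y hu

theorem VR_le_add {y : ℝ} (hy : 0 < y) {x₁ x x₂ : ℝ} (h1 : x₁ ≤ x) (h2 : x ≤ x₂) :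
    VR x y ≤ VR x₁ y + VR x₂ y := by
  unfold VR
  rw [← integral_add (VR_integrable hy _) (VR_integrable hy _)]
  refine setIntegral_mono_on (VR_integrable hy _) ((VR_integrable hy _).add (VR_integrable hy _))
    measurableSet_Ioi fun u (hu : 0 < u) => ?_
  rw [← add_mul]
  refine mul_le_mul_of_nonneg_right ?_ (Real.exp_pos _).le
  rcases le_total u 1 with h | h
  · have := Real.rpow_le_rpow_of_exponent_ge hu h (show x₁ - 1 ≤ x - 1 by linarith)
    linarith [rpow_nonneg hu.le (x₂ - 1)]
  · have := Real.rpow_le_rpow_of_exponent_le h (show x - 1 ≤ x₂ - 1 by linarith)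
    linarith [rpow_nonneg hu.le (x₁ - 1)]

theorem VR_le_exp_mul {y₁ y₂ : ℝ} (hy : 0 < y₁) (h : y₁ ≤ y₂) (x : ℝ) :
    VR x y₂ ≤ Real.exp (-2 * (y₂ - y₁)) * VR x y₁ := by
  unfold VR
  rw [← integral_const_mul]
  refine setIntegral_mono_on (VR_integrable (hy.trans_le h) _) ((VR_integrable hy _).const_mul _)
    measurableSet_Ioi fun u (hu : 0 < u) => ?_
  rw [mul_left_comm, ← Real.exp_add]
  refine mul_le_mul_of_nonneg_left (Real.exp_le_exp.2 ?_) (rpow_nonneg hu.le _)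
  have h2 : 2 ≤ u + u⁻¹ := by
    have : 0 ≤ (u - 1) ^ 2 * u⁻¹ := by positivity
    have e : (u - 1) ^ 2 * u⁻¹ = u + u⁻¹ - 2 := by field_simp; ring
    linarith
  nlinarith

theorem V_hasDerivAt {y : ℝ} (hy : 0 < y) (s : ℂ) :
    HasDerivAt (V s) (-(V (s + 1) y + V (s - 1) y)) y := by
  have hmeas : ∀ (s : ℂ) (y : ℝ), AEStronglyMeasurable
      (fun u : ℝ => (u : ℂ) ^ (s - 1) • besselKer y u) (volume.restrict (Ioi 0)) := by
    intro s y
    refine ContinuousOn.aestronglyMeasurable (f := fun u : ℝ => (u : ℂ) ^ (s - 1) • besselKer y u)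
      (ContinuousOn.fun_smul ?_ (besselKer_continuousOn y)) measurableSet_Ioi
    exact fun u hu =>
      (Complex.continuousAt_ofReal_cpow_const _ _ (Or.inr (ne_of_gt hu))).continuousWithinAt
  have key := hasDerivAt_integral_of_dominated_loc_of_deriv_le (μ := volume.restrict (Ioi 0))
    (F := fun y u => (u : ℂ) ^ (s - 1) • besselKer y u)
    (F' := fun y u => -((u : ℂ) ^ (s + 1 - 1) • besselKer y u + (u : ℂ) ^ (s - 1 - 1) • besselKer y u))
    (bound := fun u => u ^ (s.re + 1 - 1) * Real.exp (-(y / 2) * (u + u⁻¹)) +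
      u ^ (s.re - 1 - 1) * Real.exp (-(y / 2) * (u + u⁻¹))) (x₀ := y)
    (Ioi_mem_nhds (show y / 2 < y by linarith)) (Eventually.of_forall fun y' => hmeas s y')
    (V_convergent hy s) ((hmeas _ _).add (hmeas _ _)).neg ?_
    ((VR_integrable (half_pos hy) _).add (VR_integrable (half_pos hy) _)) ?_
  · have h := key.2
    have e : ∫ u in Ioi (0 : ℝ), -((u : ℂ) ^ (s + 1 - 1) • besselKer y u +
        (u : ℂ) ^ (s - 1 - 1) • besselKer y u) = -(V (s + 1) y + V (s - 1) y) := by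
      rw [integral_neg, integral_add (V_convergent hy _) (V_convergent hy _)]
      rfl
    rw [e] at h
    exact h
  · refine (ae_restrict_iff' measurableSet_Ioi).2 (Eventually.of_forall fun u hu y' hy' => ?_)
    have hu' : (0 : ℝ) < u := hu
    have hy'' : y / 2 < y' := hy'
    rw [norm_neg]
    refine (norm_add_le _ _).trans ?_
    rw [norm_V_integrand _ _ hu', norm_V_integrand _ _ hu']
    have h3 : Real.exp (-y' * (u + u⁻¹)) ≤ Real.exp (-(y / 2) * (u + u⁻¹)) := by
      apply Real.exp_le_exp.2
      have := inv_pos.2 hu'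
      nlinarith
    simp only [add_re, sub_re, Complex.one_re]
    gcongr
  · refine (ae_restrict_iff' measurableSet_Ioi).2 (Eventually.of_forall fun u hu y' _ => ?_)
    have hu' : (u : ℂ) ≠ 0 := by exact_mod_cast ne_of_gt (show (0 : ℝ) < u from hu)
    have h1 : HasDerivAt (fun y : ℝ => besselKer y u)
        (-((u : ℂ) + (u : ℂ)⁻¹) * besselKer y' u) y' := by
      have h2 : HasDerivAt (fun y : ℝ => Real.exp (-y * (u + u⁻¹)))
          (Real.exp (-y' * (u + u⁻¹)) * (-1 * (u + u⁻¹))) y' :=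
        (((hasDerivAt_id y').fun_neg).mul_const _).exp
      have h3 := h2.ofReal_comp
      refine h3.congr_deriv ?_
      simp only [besselKer]
      push_cast
      ring
    refine (h1.const_smul ((u : ℂ) ^ (s - 1))).congr_deriv ?_
    rw [show s + 1 - 1 = (s - 1) + 1 by ring, cpow_add _ _ hu', Complex.cpow_one,
      Complex.cpow_sub (s - 1) 1 hu', Complex.cpow_one]
    simp only [smul_eq_mul]
    field_simp

theorem integral_Ioi_eq_zero_of_hasDerivAt {f f' : ℝ → ℂ}
    (hd : ∀ u ∈ Ioi (0 : ℝ), HasDerivAt f (f' u) u) (hint : IntegrableOn f' (Ioi 0))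
    (h0 : Tendsto f (𝓝[>] 0) (𝓝 0)) (htop : Tendsto f atTop (𝓝 0)) :
    ∫ u in Ioi (0 : ℝ), f' u = 0 := by
  have := integral_Ioi_deriv_mul_eq_sub (a := 0) (a' := 0) (b' := 0) (u := f) (u' := f')
    (v := fun _ => (1 : ℂ)) (v' := fun _ => 0) hd (fun x _ => hasDerivAt_const x 1)
    (by simpa [Pi.mul_def, Pi.add_def] using hint) (by simpa [Pi.mul_def] using h0)
    (by simpa [Pi.mul_def] using htop)
  simpa using this

theorem V_rec {y : ℝ} (hy : 0 < y) (s : ℂ) :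
    s * V s y = y * (V (s + 1) y - V (s - 1) y) := by
  have hd : ∀ u ∈ Ioi (0 : ℝ), HasDerivAt (fun u : ℝ => (u : ℂ) ^ s * besselKer y u)
      (s • ((u : ℂ) ^ (s - 1) • besselKer y u) - (y : ℂ) • ((u : ℂ) ^ (s + 1 - 1) • besselKer y u
        - (u : ℂ) ^ (s - 1 - 1) • besselKer y u)) u := by
    intro u hu
    have hu0 : (0 : ℝ) < u := hu
    have hu' : (u : ℂ) ≠ 0 := by exact_mod_cast hu0.ne'
    have h1 : HasDerivAt (fun u : ℝ => besselKer y u)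
        (-(y : ℂ) * (1 - ((u : ℂ) ^ 2)⁻¹) * besselKer y u) u := by
      have h2 : HasDerivAt (fun u : ℝ => Real.exp (-y * (u + u⁻¹)))
          (Real.exp (-y * (u + u⁻¹)) * (-y * (1 + -(u ^ 2)⁻¹))) u :=
        (((hasDerivAt_id u).add (hasDerivAt_inv hu0.ne')).const_mul (-y)).exp
      refine h2.ofReal_comp.congr_deriv ?_
      simp only [besselKer]
      push_cast
      ring
    have h4 : HasDerivAt (fun u : ℝ => (u : ℂ) ^ s) (s * (u : ℂ) ^ (s - 1)) u := by
      by_cases hs : s = 0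
      · subst hs; simpa using hasDerivAt_const u (1 : ℂ)
      · exact hasDerivAt_ofReal_cpow_const hu0.ne' hs
    refine (h4.mul h1).congr_deriv ?_
    rw [Complex.cpow_sub (s - 1) 1 hu', Complex.cpow_one, Complex.cpow_sub s 1 hu',
      Complex.cpow_one, show s + 1 - 1 = s by ring]
    simp only [smul_eq_mul]
    field_simp
    ring
  have hint : IntegrableOn (fun u : ℝ => s • ((u : ℂ) ^ (s - 1) • besselKer y u) -
      (y : ℂ) • ((u : ℂ) ^ (s + 1 - 1) • besselKer y u
        - (u : ℂ) ^ (s - 1 - 1) • besselKer y u)) (Ioi 0) :=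
    ((V_convergent hy s).smul s).sub
      (((V_convergent hy (s + 1)).sub (V_convergent hy (s - 1))).smul (y : ℂ))
  have hzero : Tendsto (fun u : ℝ => (u : ℂ) ^ s * besselKer y u) (𝓝[>] 0) (𝓝 0) := by
    have h1 := (besselKer_isBigO_zero hy (s.re - 1))
    refine squeeze_zero_norm' (a := fun u : ℝ => u ^ s.re * ‖besselKer y u‖) ?_ ?_
    · filter_upwards [self_mem_nhdsWithin] with u hu
      rw [norm_mul, norm_cpow_eq_rpow_re_of_pos hu]
    · have h2 : (fun u : ℝ => u ^ s.re * ‖besselKer y u‖) =O[𝓝[>] 0] fun u : ℝ => u := by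
        refine ((isBigO_refl (fun u : ℝ => u ^ s.re) _).mul h1.norm_left).congr'
          EventuallyEq.rfl ?_
        filter_upwards [self_mem_nhdsWithin] with u hu
        rw [← rpow_add hu]; simp
      exact h2.trans_tendsto (tendsto_id.mono_left nhdsWithin_le_nhds)
  have htop : Tendsto (fun u : ℝ => (u : ℂ) ^ s * besselKer y u) atTop (𝓝 0) := by
    refine squeeze_zero_norm' (a := fun u : ℝ => u ^ s.re * Real.exp (-y * u)) ?_
      (tendsto_rpow_mul_exp_neg_mul_atTop_nhds_zero s.re y hy)
    filter_upwards [eventually_gt_atTop 0] with u hu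
    rw [norm_mul, norm_cpow_eq_rpow_re_of_pos hu, norm_besselKer]
    refine mul_le_mul_of_nonneg_left (Real.exp_le_exp.2 ?_) (rpow_nonneg hu.le _)
    have := inv_pos.2 hu
    nlinarith
  have key := integral_Ioi_eq_zero_of_hasDerivAt hd hint hzero htop
  have i0 : IntegrableOn (fun u : ℝ => s • ((u : ℂ) ^ (s - 1) • besselKer y u)) (Ioi 0) :=
    (V_convergent hy s).smul s
  have i1 : IntegrableOn (fun u : ℝ => (y : ℂ) • ((u : ℂ) ^ (s + 1 - 1) • besselKer y u
        - (u : ℂ) ^ (s - 1 - 1) • besselKer y u)) (Ioi 0) :=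
    ((V_convergent hy (s + 1)).sub (V_convergent hy (s - 1))).smul (y : ℂ)
  rw [integral_sub i0 i1, integral_smul, integral_smul,
    integral_sub (V_convergent hy (s + 1)) (V_convergent hy (s - 1))] at key
  exact sub_eq_zero.1 key

theorem V_conj (s : ℂ) (y : ℝ) : conj (V s y) = V (conj s) y := by
  unfold V mellin
  rw [← integral_conj]
  refine setIntegral_congr_fun measurableSet_Ioi fun u hu => ?_
  simp only [smul_eq_mul, map_mul]
  congr 1
  · have hu0 : (0 : ℝ) < u := hu
    have h := Complex.cpow_conj (u : ℂ) (s - 1)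
      (by rw [arg_ofReal_of_nonneg hu0.le]; exact pi_pos.ne)
    rw [conj_ofReal, map_sub, map_one] at h
    exact h.symm
  · exact conj_ofReal _

/-! ### Whittaker functions as combinations of Bessel functions -/

/-- The coefficient of `X^n`, extended by zero to all `n : ℤ`. -/
def cZ (P : ℂ[X]) (n : ℤ) : ℂ := if 0 ≤ n then P.coeff n.toNat else 0

theorem cZ_mul_linear (u v : ℂ) (P : ℂ[X]) (n : ℤ) :
    cZ ((C u * X + C v) * P) n = u * cZ P (n - 1) + v * cZ P n := by
  unfold cZ
  rcases lt_trichotomy n 0 with h | h | h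
  · rw [if_neg (by omega), if_neg (by omega), if_neg (by omega)]; simp
  · subst h
    simp [Polynomial.mul_coeff_zero]
  · rw [if_pos (by omega), if_pos (by omega), if_pos (by omega)]
    obtain ⟨m, rfl⟩ : ∃ m : ℕ, n = m + 1 := ⟨(n - 1).toNat, by omega⟩
    have e1 : ((m : ℤ) + 1).toNat = m + 1 := by omega
    have e2 : ((m : ℤ) + 1 - 1).toNat = m := by omega
    rw [e1, e2, add_mul, mul_assoc, Polynomial.coeff_add, Polynomial.coeff_C_mul,
      Polynomial.coeff_X_mul, Polynomial.coeff_C_mul]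

theorem cZ_one (n : ℤ) : cZ 1 n = if n = 0 then 1 else 0 := by
  unfold cZ
  split_ifs with h1 h2 h2
  · subst h2; simp
  · rw [Polynomial.coeff_one, if_neg (by omega)]
  · omega
  · rfl

/-- The binomial coefficient, extended by zero to all `n : ℤ`. -/
def binZ (b : ℕ) (n : ℤ) : ℂ := cZ ((C 1 * X + C 1) ^ b) n

theorem binZ_zero (n : ℤ) : binZ 0 n = if n = 0 then 1 else 0 := by
  rw [binZ, pow_zero, cZ_one]

theorem binZ_succ (b : ℕ) (n : ℤ) : binZ (b + 1) n = binZ b (n - 1) + binZ b n := by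
  rw [binZ, pow_succ', cZ_mul_linear]; simp [binZ]

theorem binZ_symm (b : ℕ) (n : ℤ) : binZ b (b - n) = binZ b n := by
  induction b generalizing n with
  | zero => simp [binZ_zero]
  | succ b ih =>
    rw [binZ_succ, binZ_succ, ← ih (n - 1), ← ih n, add_comm]
    congr 2 <;> push_cast <;> ring

theorem binZ_conj (b : ℕ) (n : ℤ) : conj (binZ b n) = binZ b n := by
  induction b generalizing n with
  | zero => rw [binZ_zero]; split_ifs <;> simp
  | succ b ih => rw [binZ_succ, map_add, ih, ih]

/-- The coefficient of `X^n` in `∫ u^{s-1} exp(-y(u+1/u)) H_{a,b}(u + X/u, 1 + X; X/y) du`, with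
`H_{a,b}` the two-variable Hermite polynomials, as a combination of the functions `v (s + k) y`. -/
def Jc (v : ℂ → ℝ → ℂ) : ℕ → ℕ → ℤ → ℂ → ℝ → ℂ
  | 0, b, n, s, y => binZ b n * v s y
  | a + 1, b, n, s, y => Jc v a b n (s + 1) y + Jc v a b (n - 1) (s - 1) y -
      (b / y : ℂ) * Jc v a (b - 1) (n - 1) s y

theorem Jc_rec (v : ℂ → ℝ → ℂ) (a b : ℕ) (n : ℤ) (s : ℂ) (y : ℝ) :
    Jc v a (b + 1) n s y = Jc v a b n s y + Jc v a b (n - 1) s y -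
      (a / y : ℂ) * Jc v (a - 1) b (n - 1) s y := by
  induction a generalizing b n s with
  | zero => simp [Jc, binZ_succ]; ring
  | succ a ih =>
    have h1 : (a : ℂ) * Jc v a b (n - 1) s y = a * (Jc v (a - 1) b (n - 1) (s + 1) y +
        Jc v (a - 1) b (n - 1 - 1) (s - 1) y -
          (b / y : ℂ) * Jc v (a - 1) (b - 1) (n - 1 - 1) s y) := by
      cases a with
      | zero => simp
      | succ a => simp [Jc]
    have h2 : (b : ℂ) * Jc v a b (n - 1) s y = b * (Jc v a (b - 1) (n - 1) s y +
        Jc v a (b - 1) (n - 1 - 1) s y -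
          (a / y : ℂ) * Jc v (a - 1) (b - 1) (n - 1 - 1) s y) := by
      cases b with
      | zero => simp
      | succ b => rw [ih b (n - 1) s]; simp
    simp only [Jc, ih]
    simp only [Nat.add_sub_cancel, Nat.cast_add, Nat.cast_one]
    linear_combination (-1 / (y : ℂ)) * h2 + (1 / (y : ℂ)) * h1

/-- `(y ∂ + a)` applied to `Jc v a b n s`. -/
def T1 (v : ℂ → ℝ → ℂ) (a b : ℕ) (n : ℤ) (s : ℂ) (y : ℝ) : ℂ :=
  -y * (Jc v a b n (s + 1) y + Jc v a b n (s - 1) y) +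
    a * (Jc v (a - 1) b n (s + 1) y + Jc v (a - 1) b (n - 1) (s - 1) y)

/-- `(y ∂ + a)²` applied to `Jc v a b n s`. -/
def T2 (v : ℂ → ℝ → ℂ) (a b : ℕ) (n : ℤ) (s : ℂ) (y : ℝ) : ℂ :=
  -y * (Jc v a b n (s + 1) y + Jc v a b n (s - 1) y) -
    y * (T1 v a b n (s + 1) y + T1 v a b n (s - 1) y) +
    a * (T1 v (a - 1) b n (s + 1) y + Jc v (a - 1) b n (s + 1) y +
      (T1 v (a - 1) b (n - 1) (s - 1) y + Jc v (a - 1) b (n - 1) (s - 1) y))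

/-- The differentiation rule satisfied by `V` and its superpositions. -/
def BesselSeq (v : ℂ → ℝ → ℂ) : Prop :=
  ∀ (s : ℂ) (y : ℝ), 0 < y → HasDerivAt (v s) (-(v (s + 1) y + v (s - 1) y)) y

theorem Jc_hasDerivAt {v : ℂ → ℝ → ℂ} (hv : BesselSeq v) (a b : ℕ) (n : ℤ) (s : ℂ) {y : ℝ}
    (hy : 0 < y) :
    HasDerivAt (Jc v a b n s) ((T1 v a b n s y - a * Jc v a b n s y) / y) y := by
  have hy' : (y : ℂ) ≠ 0 := by exact_mod_cast hy.ne'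
  induction a generalizing b n s with
  | zero =>
    refine ((hv s y hy).const_mul (binZ b n)).congr_deriv ?_
    simp only [T1, Jc, Nat.cast_zero]
    field_simp
    ring
  | succ a ih =>
    have h1 : HasDerivAt (fun y : ℝ => (b / y : ℂ)) (-(b : ℂ) / y ^ 2) y := by
      have := ((hasDerivAt_id y).ofReal_comp.inv hy').const_mul (b : ℂ)
      simp only [id, Complex.ofReal_one] at this
      refine (this.congr_deriv ?_).congr_of_eventuallyEq (Eventually.of_forall fun x => ?_)
      · ring
      · simp [div_eq_mul_inv]
    refine (((ih b n (s + 1)).add (ih b (n - 1) (s - 1))).sub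
      (h1.mul (ih (b - 1) (n - 1) s))).congr_deriv ?_
    have e1 : (a : ℂ) * Jc v a b n (s + 1) y = a * (Jc v (a - 1) b n (s + 1 + 1) y +
        Jc v (a - 1) b (n - 1) (s + 1 - 1) y -
          (b / y : ℂ) * Jc v (a - 1) (b - 1) (n - 1) (s + 1) y) := by
      cases a with
      | zero => simp
      | succ a => simp [Jc]
    have e2 : (a : ℂ) * Jc v a b (n - 1) (s - 1) y = a * (Jc v (a - 1) b (n - 1) (s - 1 + 1) y +
        Jc v (a - 1) b (n - 1 - 1) (s - 1 - 1) y -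
          (b / y : ℂ) * Jc v (a - 1) (b - 1) (n - 1 - 1) (s - 1) y) := by
      cases a with
      | zero => simp
      | succ a => simp [Jc]
    simp only [T1, Jc, Nat.add_sub_cancel, Nat.cast_add, Nat.cast_one]
    have f1 : s + 1 - 1 = s := by ring
    have f2 : s - 1 + 1 = s := by ring
    rw [eq_div_iff hy']
    simp only [f1, f2] at *
    field_simp
    field_simp at e1 e2
    linear_combination (-1 : ℂ) * e1 - e2

theorem T1_hasDerivAt {v : ℂ → ℝ → ℂ} (hv : BesselSeq v) (a b : ℕ) (n : ℤ) (s : ℂ) {y : ℝ}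
    (hy : 0 < y) :
    HasDerivAt (T1 v a b n s) ((T2 v a b n s y - a * T1 v a b n s y) / y) y := by
  have hy' : (y : ℂ) ≠ 0 := by exact_mod_cast hy.ne'
  have h0 : HasDerivAt (fun y : ℝ => -(y : ℂ)) (-1) y := by
    simpa using (hasDerivAt_id y).ofReal_comp.fun_neg
  refine ((h0.mul ((Jc_hasDerivAt hv a b n (s + 1) hy).add
    (Jc_hasDerivAt hv a b n (s - 1) hy))).add
    (((Jc_hasDerivAt hv (a - 1) b n (s + 1) hy).add
      (Jc_hasDerivAt hv (a - 1) b (n - 1) (s - 1) hy)).const_mul (a : ℂ))).congr_deriv ?_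
  simp only [T2]
  rcases a with _ | a
  · simp only [T1, Nat.cast_zero, Pi.add_apply]
    field_simp
    ring
  · simp only [T1, Nat.add_sub_cancel, Nat.cast_add, Nat.cast_one, Pi.add_apply]
    field_simp
    ring

theorem V_besselSeq : BesselSeq V := fun s _ hy => V_hasDerivAt hy s

theorem Jc_V_mul (a b : ℕ) (n : ℤ) (s : ℂ) {y : ℝ} (hy : 0 < y) :
    s * Jc V a b n s y = y * (Jc V a b n (s + 1) y - Jc V a b n (s - 1) y) -
      a * (Jc V (a - 1) b n (s + 1) y - Jc V (a - 1) b (n - 1) (s - 1) y) := by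
  have hy' : (y : ℂ) ≠ 0 := by exact_mod_cast hy.ne'
  induction a generalizing b n s with
  | zero =>
    simp only [Jc, Nat.cast_zero]
    linear_combination binZ b n * V_rec hy s
  | succ a ih =>
    have e1 : (a : ℂ) * Jc V a b n (s + 1) y = a * (Jc V (a - 1) b n (s + 1 + 1) y +
        Jc V (a - 1) b (n - 1) (s + 1 - 1) y -
          (b / y : ℂ) * Jc V (a - 1) (b - 1) (n - 1) (s + 1) y) := by
      cases a with
      | zero => simp
      | succ a => simp [Jc]
    have e2 : (a : ℂ) * Jc V a b (n - 1) (s - 1) y = a * (Jc V (a - 1) b (n - 1) (s - 1 + 1) y +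
        Jc V (a - 1) b (n - 1 - 1) (s - 1 - 1) y -
          (b / y : ℂ) * Jc V (a - 1) (b - 1) (n - 1 - 1) (s - 1) y) := by
      cases a with
      | zero => simp
      | succ a => simp [Jc]
    have h1 := ih b n (s + 1)
    have h2 := ih b (n - 1) (s - 1)
    have h3 := ih (b - 1) (n - 1) s
    have f1 : s + 1 - 1 = s := by ring
    have f2 : s - 1 + 1 = s := by ring
    simp only [Jc, Nat.add_sub_cancel, Nat.cast_add, Nat.cast_one]
    simp only [f1, f2] at *
    linear_combination h1 + h2 - (b / y : ℂ) * h3 + e1 - e2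

theorem T2_V (a b : ℕ) (n : ℤ) (s : ℂ) {y : ℝ} (hy : 0 < y) :
    T2 V a b n s y = (s ^ 2 + 4 * y ^ 2) * Jc V a b n s y -
      4 * a * y * Jc V (a - 1) (b + 1) n s y := by
  have hy' : (y : ℂ) ≠ 0 := by exact_mod_cast hy.ne'
  have f1 : s + 1 - 1 = s := by ring
  have f2 : s - 1 + 1 = s := by ring
  have t1 : ∀ a b n s, T1 V a b n s y = s * Jc V a b n s y - 2 * y * Jc V a b n (s + 1) y +
      2 * a * Jc V (a - 1) b n (s + 1) y := by
    intro a b n s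
    rw [Jc_V_mul a b n s hy, T1]; ring
  have t2 : ∀ a b n s, T1 V a b n s y = -s * Jc V a b n s y - 2 * y * Jc V a b n (s - 1) y +
      2 * a * Jc V (a - 1) b (n - 1) (s - 1) y := by
    intro a b n s
    rw [neg_mul, Jc_V_mul a b n s hy, T1]; ring
  rw [T2, t2 a b n (s + 1), t1 a b n (s - 1), t2 (a - 1) b n (s + 1), t1 (a - 1) b (n - 1) (s - 1),
    Jc_rec]
  have hs := Jc_V_mul a b n s hy
  simp only [f1, f2]
  rcases a with _ | a
  · simp only [Nat.cast_zero] at hs ⊢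
    linear_combination (-s) * hs
  · simp only [Nat.add_sub_cancel, Nat.cast_add, Nat.cast_one] at hs ⊢
    field_simp
    linear_combination (-s) * hs

theorem Jc_V_neg (a b : ℕ) (n : ℤ) (s : ℂ) (y : ℝ) :
    Jc V a b (a + b - n) (-s) y = Jc V a b n s y := by
  induction a generalizing b n s with
  | zero =>
    simp only [Jc, Nat.cast_zero, zero_add, binZ_symm, V_neg]
  | succ a ih =>
    simp only [Jc]
    rw [← ih b n (s + 1), ← ih b (n - 1) (s - 1)]
    have h3 : (b : ℂ) * Jc V a (b - 1) (n - 1) s y =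
        b * Jc V a (b - 1) (((a + 1 : ℕ) : ℤ) + b - n - 1) (-s) y := by
      rcases b with _ | b
      · simp
      · rw [← ih]; congr 2; simp only [Nat.add_sub_cancel]; push_cast; ring
    have e1 : ((a + 1 : ℕ) : ℤ) + b - n = a + b - (n - 1) := by push_cast; ring
    have e2 : (a : ℤ) + b - (n - 1) - 1 = a + b - n := by ring
    have e3 : -s + 1 = -(s - 1) := by ring
    have e4 : -s - 1 = -(s + 1) := by ring
    rw [div_mul_eq_mul_div, div_mul_eq_mul_div, h3, e1, e2, e3, e4]
    ring

theorem Jc_V_swap (a b : ℕ) (n : ℤ) (s : ℂ) (y : ℝ) :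
    Jc V b a n (2 * n - (a + b) - s) y = Jc V a b n s y := by
  induction a generalizing b n s with
  | zero =>
    simp only [Jc, Nat.cast_zero, zero_add]
    induction b generalizing n with
    | zero =>
      simp only [Jc, Nat.cast_zero, binZ_zero]
      split_ifs with h
      · subst h; simp [V_neg]
      · simp
    | succ b ih =>
      simp only [Jc, Nat.cast_zero, zero_div, zero_mul, sub_zero]
      have h1 := ih n
      have h2 := ih (n - 1)
      rw [binZ_succ, add_mul, ← h1, ← h2, add_comm]
      congr 2 <;> push_cast <;> ring
  | succ a ih =>
    rw [Jc_rec]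
    simp only [Jc]
    have h3 : (b : ℂ) * Jc V a (b - 1) (n - 1) s y =
        b * Jc V (b - 1) a (n - 1) (2 * n - ((a + 1 : ℕ) + b) - s) y := by
      rcases b with _ | b
      · simp
      · rw [← ih]; congr 2; simp only [Nat.add_sub_cancel]; push_cast; ring
    rw [← ih b n (s + 1), ← ih b (n - 1) (s - 1), div_mul_eq_mul_div, div_mul_eq_mul_div, h3]
    have e1 : (2 * (n : ℂ) - (((a + 1 : ℕ) : ℂ) + b) - s) = 2 * n - (a + b) - (s + 1) := by
      push_cast; ring
    have e2 : (2 * ((n - 1 : ℤ) : ℂ) - ((a : ℂ) + b) - (s - 1)) = 2 * n - (a + b) - (s + 1) := by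
      push_cast; ring
    rw [e1, e2]

theorem Jc_V_conj (a b : ℕ) (n : ℤ) (s : ℂ) (y : ℝ) :
    conj (Jc V a b n s y) = Jc V a b n (conj s) y := by
  induction a generalizing b n s with
  | zero => simp only [Jc, map_mul, binZ_conj, V_conj]
  | succ a ih => simp [Jc, ih]

theorem Jc_V_differentiable (a b : ℕ) (n : ℤ) {y : ℝ} (hy : 0 < y) :
    Differentiable ℂ fun s => Jc V a b n s y := by
  induction a generalizing b n with
  | zero => exact (V_differentiable hy).const_mul _
  | succ a ih =>
    simp only [Jc]
    exact (((ih b n).comp (differentiable_id.add_const 1)).add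
      ((ih b (n - 1)).comp (differentiable_id.sub_const 1))).sub ((ih _ _).const_mul _)

theorem integrable_fun_add {α : Type*} [MeasurableSpace α] {μ : Measure α} {f g : α → ℂ}
    (hf : Integrable f μ) (hg : Integrable g μ) : Integrable (fun x => f x + g x) μ := hf.add hg

/-! ### Gaussian integrals over `ℂ` -/

/-- The coefficient of `X^n` in `(z̄ X + r)^a (z - r X)^b`. -/
def cf (a b : ℕ) (n : ℤ) (r : ℝ) (z : ℂ) : ℂ :=
  cZ ((C (conj z) * X + C (r : ℂ)) ^ a * (C (-r : ℂ) * X + C z) ^ b) n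

theorem cf_zero_zero (n : ℤ) (r : ℝ) (z : ℂ) : cf 0 0 n r z = if n = 0 then 1 else 0 := by
  rw [cf, pow_zero, pow_zero, one_mul, cZ_one]

theorem cf_succ_left (a b : ℕ) (n : ℤ) (r : ℝ) (z : ℂ) :
    cf (a + 1) b n r z = conj z * cf a b (n - 1) r z + r * cf a b n r z := by
  rw [cf, pow_succ', mul_assoc, cZ_mul_linear]; rfl

theorem cf_succ_right (a b : ℕ) (n : ℤ) (r : ℝ) (z : ℂ) :
    cf a (b + 1) n r z = -r * cf a b (n - 1) r z + z * cf a b n r z := by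
  rw [cf, pow_succ', mul_left_comm, cZ_mul_linear]; rfl

theorem norm_cf_le (a b : ℕ) (n : ℤ) {r : ℝ} (hr : 0 < r) (z : ℂ) :
    ‖cf a b n r z‖ ≤ (‖z‖ + r) ^ (a + b) := by
  have hr' : ‖(r : ℂ)‖ = r := by rw [norm_real, norm_of_nonneg hr.le]
  induction a generalizing n with
  | zero =>
    induction b generalizing n with
    | zero => rw [cf_zero_zero]; split_ifs <;> simp
    | succ b ih =>
      rw [cf_succ_right]
      refine (norm_add_le _ _).trans ?_
      rw [norm_mul, norm_mul, norm_neg, hr']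
      have h1 := mul_le_mul_of_nonneg_left (ih (n - 1)) hr.le
      have h2 := mul_le_mul_of_nonneg_left (ih n) (norm_nonneg z)
      rw [← add_assoc, pow_succ]
      linarith
  | succ a ih =>
    rw [cf_succ_left]
    refine (norm_add_le _ _).trans ?_
    rw [norm_mul, norm_mul, RCLike.norm_conj, hr']
    have h1 := mul_le_mul_of_nonneg_left (ih (n - 1)) (norm_nonneg z)
    have h2 := mul_le_mul_of_nonneg_left (ih n) hr.le
    rw [add_right_comm a 1 b, pow_succ]
    linarith

theorem cf_continuous (a b : ℕ) (n : ℤ) (r : ℝ) : Continuous (cf a b n r) := by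
  induction a generalizing n with
  | zero =>
    induction b generalizing n with
    | zero =>
      have : cf 0 0 n r = fun _ => if n = 0 then 1 else 0 := funext (cf_zero_zero n r)
      rw [this]; exact continuous_const
    | succ b ih =>
      have : cf 0 (b + 1) n r = fun z => -r * cf 0 b (n - 1) r z + z * cf 0 b n r z :=
        funext (cf_succ_right 0 b n r)
      rw [this]
      have h1 := ih n
      have h2 := ih (n - 1)
      fun_prop
  | succ a ih =>
    have : cf (a + 1) b n r = fun z => conj z * cf a b (n - 1) r z + r * cf a b n r z :=
      funext (cf_succ_left a b n r)
    rw [this]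
    have h1 := ih n
    have h2 := ih (n - 1)
    have h3 : Continuous (conj) := Complex.continuous_conj
    fun_prop

theorem cf_hasLineDerivAt (a b : ℕ) (n : ℤ) (r : ℝ) (z v : ℂ) :
    HasLineDerivAt ℝ (cf a b n r) (a * conj v * cf (a - 1) b (n - 1) r z +
      b * v * cf a (b - 1) n r z) z v := by
  have hz : HasDerivAt (fun t : ℝ => z + t • v) v 0 := by
    simpa using ((hasDerivAt_id (0 : ℝ)).smul_const v).const_add z
  have hzc : HasDerivAt (fun t : ℝ => conj (z + t • v)) (conj v) 0 :=
    hz.star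
  unfold HasLineDerivAt
  induction a generalizing n with
  | zero =>
    induction b generalizing n with
    | zero =>
      simp only [cf_zero_zero]
      simpa using hasDerivAt_const (0 : ℝ) _
    | succ b ih =>
      have h1 := ih n
      have h2 := ih (n - 1)
      simp only [cf_succ_right]
      refine ((h2.const_mul (-r : ℂ)).add (hz.mul h1)).congr_deriv ?_
      rcases b with _ | b
      · simp
      · simp [cf_succ_right]; ring
  | succ a ih =>
    have h1 := ih n
    have h2 := ih (n - 1)
    simp only [cf_succ_left]
    refine ((hzc.mul h2).add (h1.const_mul (r : ℂ))).congr_deriv ?_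
    rcases a with _ | a
    · simp; ring
    · simp [cf_succ_left]; ring

/-- The Gaussian times a character, `exp(-t |z|² - 2πi Re(ω z))`. -/
def gE (t : ℝ) (ω z : ℂ) : ℂ :=
  Complex.exp (-(t : ℂ) * ‖z‖ ^ 2 + (-2 * π * I) * ((ω * z).re : ℂ))

theorem gE_continuous (t : ℝ) (ω : ℂ) : Continuous (gE t ω) := by
  unfold gE
  fun_prop

theorem norm_gE (t : ℝ) (ω z : ℂ) : ‖gE t ω z‖ = Real.exp (-t * ‖z‖ ^ 2) := by
  rw [gE, Complex.norm_exp]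
  congr 1
  have : (‖z‖ : ℂ) ^ 2 = ((‖z‖ ^ 2 : ℝ) : ℂ) := by push_cast; rfl
  rw [this]
  simp [-Complex.ofReal_pow]

theorem gE_hasLineDerivAt (t : ℝ) (ω z v : ℂ) :
    HasLineDerivAt ℝ (gE t ω) ((-2 * t * (conj z * v).re -
      2 * π * I * (ω * v).re) * gE t ω z) z v := by
  unfold HasLineDerivAt gE
  have hz : HasDerivAt (fun t : ℝ => z + t • v) v 0 := by
    simpa using ((hasDerivAt_id (0 : ℝ)).smul_const v).const_add z
  have h1 : HasDerivAt (fun x : ℝ => ‖z + x • v‖ ^ 2) (2 * (conj z * v).re) 0 := by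
    refine (hz.norm_sq).congr_deriv ?_
    simp [Complex.inner]
    ring
  have h2 : HasDerivAt (fun x : ℝ => (ω * (z + x • v)).re) (ω * v).re 0 := by
    have := (hz.const_mul ω)
    exact (Complex.reCLM.hasFDerivAt.comp_hasDerivAt (0 : ℝ) this)
  have h3 := (((h1.ofReal_comp).const_mul (-(t : ℂ))).add
    ((h2.ofReal_comp).const_mul (-2 * π * I))).cexp
  refine (h3.congr_deriv ?_).congr_of_eventuallyEq (Eventually.of_forall fun x => ?_)
  · simp
    ring
  · simp

theorem integrable_poly_mul_gaussian (k : ℕ) (r : ℝ) {t : ℝ} (ht : 0 < t) :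
    Integrable fun z : ℂ => (‖z‖ + r) ^ k * Real.exp (-t * ‖z‖ ^ 2) := by
  have hg : Integrable fun z : ℂ => Real.exp (-(t / 2) * ‖z‖ ^ 2) := by
    have := (GaussianFourier.integrable_cexp_neg_mul_sq_norm_add (V := ℂ) (b := ((t / 2 : ℝ) : ℂ))
      (by simpa using ht) 0 0).norm
    refine this.congr (Eventually.of_forall fun z => ?_)
    have : (‖z‖ : ℂ) ^ 2 = ((‖z‖ ^ 2 : ℝ) : ℂ) := by push_cast; rfl
    simp only [Complex.norm_exp, this]
    congr 1
    simp [-Complex.ofReal_pow, -Complex.ofReal_div]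
  have hb : ∃ M, ∀ x : ℝ, 0 ≤ x → |(x + r) ^ k * Real.exp (-(t / 2) * x ^ 2)| ≤ M := by
    have hO : (fun x : ℝ => (x + r) ^ k * Real.exp (-(t / 2) * x ^ 2)) =O[atTop] fun _ => (1 : ℝ) := by
      have h1 : (fun x : ℝ => (x + r) ^ k) =O[atTop] fun x : ℝ => x ^ (k : ℝ) := by
        simp_rw [rpow_natCast]
        refine IsBigO.pow ?_ k
        exact (isBigO_refl _ _).add (isLittleO_const_id_atTop r).isBigO
      have h2 := (rpow_mul_exp_neg_mul_sq_isLittleO_exp_neg (half_pos ht) (k : ℝ))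
      have h3 : (fun x : ℝ => Real.exp (-(1 / 2) * x)) =O[atTop] fun _ => (1 : ℝ) := by
        refine IsBigO.of_bound 1 ?_
        filter_upwards [eventually_ge_atTop 0] with x hx
        rw [norm_of_nonneg (Real.exp_pos _).le]
        simp
        linarith
      exact (h1.mul (isBigO_refl _ _)).trans (h2.isBigO.trans h3)
    obtain ⟨c, hc⟩ := hO.bound
    obtain ⟨x₀, hx₀⟩ := eventually_atTop.1 hc
    obtain ⟨M, hM⟩ := (isCompact_Icc (a := (0 : ℝ)) (b := x₀)).exists_bound_of_continuousOn
      (f := fun x : ℝ => (x + r) ^ k * Real.exp (-(t / 2) * x ^ 2)) (by fun_prop)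
    refine ⟨max M (c * 1), fun x hx => ?_⟩
    rcases le_total x x₀ with h | h
    · exact (hM x ⟨hx, h⟩).trans (le_max_left _ _)
    · have := hx₀ x h
      simp only [Real.norm_eq_abs, abs_one] at this
      exact this.trans (le_max_right _ _)
  obtain ⟨M, hM⟩ := hb
  refine (hg.const_mul M).mono' (by fun_prop) (Eventually.of_forall fun z => ?_)
  have := hM ‖z‖ (norm_nonneg z)
  rw [Real.norm_eq_abs]
  have e : (‖z‖ + r) ^ k * Real.exp (-t * ‖z‖ ^ 2) =
      ((‖z‖ + r) ^ k * Real.exp (-(t / 2) * ‖z‖ ^ 2)) * Real.exp (-(t / 2) * ‖z‖ ^ 2) := by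
    rw [mul_assoc, ← Real.exp_add]; ring_nf
  rw [e, abs_mul, abs_of_pos (Real.exp_pos _)]
  exact mul_le_mul_of_nonneg_right this (Real.exp_pos _).le

theorem integrable_cf_mul_gE (a b : ℕ) (n : ℤ) {r : ℝ} (hr : 0 < r) {t : ℝ} (ht : 0 < t) (ω : ℂ) :
    Integrable fun z => cf a b n r z * gE t ω z := by
  refine (integrable_poly_mul_gaussian (a + b) r ht).mono'
    ((cf_continuous a b n r).mul (gE_continuous t ω)).aestronglyMeasurable
    (Eventually.of_forall fun z => ?_)
  rw [norm_mul, norm_gE]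
  exact mul_le_mul_of_nonneg_right (norm_cf_le a b n hr z) (Real.exp_pos _).le

theorem integrable_mul_cf_mul_gE (a b : ℕ) (n : ℤ) {r : ℝ} (hr : 0 < r) {t : ℝ} (ht : 0 < t)
    (ω : ℂ) {f : ℂ → ℂ} (hf : Continuous f) {A : ℝ} (hA : ∀ z, ‖f z‖ ≤ A * (‖z‖ + r)) :
    Integrable fun z => f z * (cf a b n r z * gE t ω z) := by
  refine ((integrable_poly_mul_gaussian (a + b + 1) r ht).const_mul A).mono'
    (hf.mul ((cf_continuous a b n r).mul (gE_continuous t ω))).aestronglyMeasurable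
    (Eventually.of_forall fun z => ?_)
  rw [norm_mul, norm_mul, norm_gE, pow_succ (‖z‖ + r)]
  have h1 := mul_le_mul (hA z) (norm_cf_le a b n hr z) (norm_nonneg _)
    ((norm_nonneg _).trans (hA z))
  have h2 := mul_le_mul_of_nonneg_right h1 (Real.exp_pos (-t * ‖z‖ ^ 2)).le
  nlinarith

/-- The Gaussian integral `∫ cf(z) exp(-t |z|² - 2πi Re(ω z)) dz`. -/
def Q (a b : ℕ) (n : ℤ) (r : ℝ) (ω : ℂ) (t : ℝ) : ℂ := ∫ z, cf a b n r z * gE t ω z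

theorem integrable_line_mul (a b : ℕ) (n : ℤ) {r : ℝ} (hr : 0 < r) {t : ℝ} (ht : 0 < t)
    (ω v : ℂ) :
    Integrable fun z : ℂ => (-2 * t * (conj z * v).re -
      2 * π * I * (ω * v).re : ℂ) * (cf a b n r z * gE t ω z) := by
  have hcont : Continuous (conj) := Complex.continuous_conj
  refine integrable_mul_cf_mul_gE a b n hr ht ω (by fun_prop)
    (A := 2 * t * ‖v‖ + 2 * π * ‖ω * v‖ / r) fun z => ?_
  refine (norm_sub_le _ _).trans ?_
  have e1 : ‖(-2 * t * (conj z * v).re : ℂ)‖ ≤ 2 * t * (‖z‖ * ‖v‖) := by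
    rw [norm_mul, norm_mul, norm_real, norm_real, norm_of_nonneg ht.le]
    have := abs_re_le_norm (conj z * v)
    rw [norm_mul, RCLike.norm_conj] at this
    rw [norm_neg, RCLike.norm_ofNat, Real.norm_eq_abs]
    exact mul_le_mul_of_nonneg_left this (by positivity)
  have e2 : ‖(2 * π * I * (ω * v).re : ℂ)‖ ≤ 2 * π * ‖ω * v‖ := by
    rw [norm_mul, norm_mul, norm_mul, Complex.norm_I, mul_one, norm_real,
      norm_real, norm_of_nonneg pi_pos.le, RCLike.norm_ofNat]
    exact mul_le_mul_of_nonneg_left (abs_re_le_norm _) (by positivity)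
  have e3 : 2 * π * ‖ω * v‖ ≤ 2 * π * ‖ω * v‖ / r * (‖z‖ + r) := by
    have e4 : 2 * π * ‖ω * v‖ / r * (‖z‖ + r) =
      2 * π * ‖ω * v‖ + 2 * π * ‖ω * v‖ / r * ‖z‖ := by field_simp; ring
    rw [e4]
    have : 0 ≤ 2 * π * ‖ω * v‖ / r * ‖z‖ := by positivity
    linarith
  have e5 : 0 ≤ 2 * t * ‖v‖ * r := by positivity
  nlinarith

theorem integral_by_parts_line (a b : ℕ) (n : ℤ) {r : ℝ} (hr : 0 < r) {t : ℝ} (ht : 0 < t)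
    (ω v : ℂ) :
    ∫ z, (-2 * t * (conj z * v).re - 2 * π * I * (ω * v).re : ℂ) *
      (cf a b n r z * gE t ω z) =
    -(a * conj v * Q (a - 1) b (n - 1) r ω t + b * v * Q a (b - 1) n r ω t) := by
  have i1 := (integrable_cf_mul_gE (a - 1) b (n - 1) hr ht ω).const_mul (a * conj v)
  have i2 := (integrable_cf_mul_gE a (b - 1) n hr ht ω).const_mul (b * v)
  have i3 := integrable_line_mul a b n hr ht ω v
  have key := integral_bilinear_hasLineDerivAt_right_eq_neg_left_of_integrable (μ := volume)
    (B := ContinuousLinearMap.mul ℝ ℂ) (f := cf a b n r) (g := gE t ω) (v := v)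
    (f' := fun z => a * conj v * cf (a - 1) b (n - 1) r z + b * v * cf a (b - 1) n r z)
    (g' := fun z => (-2 * t * (conj z * v).re -
      2 * π * I * (ω * v).re) * gE t ω z)
    ((i1.add i2).congr (Eventually.of_forall fun z => by simp; ring))
    (i3.congr (Eventually.of_forall fun z => by simp; ring))
    ((integrable_cf_mul_gE a b n hr ht ω).congr (Eventually.of_forall fun z => by simp))
    (fun z _ => cf_hasLineDerivAt a b n r z v) (fun z _ => gE_hasLineDerivAt t ω z v)
  simp only [ContinuousLinearMap.mul_apply'] at key
  rw [Q, Q, ← integral_const_mul, ← integral_const_mul, ← integral_add i1 i2]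
  convert key using 1
  · congr 1; ext z; ring
  · congr 2; ext z; ring

theorem integral_conj_mul_cf (a b : ℕ) (n : ℤ) {r : ℝ} (hr : 0 < r) {t : ℝ} (ht : 0 < t) (ω : ℂ) :
    ∫ z, conj z * (cf a b n r z * gE t ω z) =
      (b / t : ℂ) * Q a (b - 1) n r ω t - π * I * ω / t * Q a b n r ω t := by
  have ht' : (t : ℂ) ≠ 0 := by exact_mod_cast ht.ne'
  have h1 := integral_by_parts_line a b n hr ht ω 1
  have h2 := integral_by_parts_line a b n hr ht ω I
  have i1 := (integrable_line_mul a b n hr ht ω 1).const_mul (-1 / (2 * t : ℂ))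
  have i2 := (integrable_line_mul a b n hr ht ω I).const_mul (I / (2 * t : ℂ))
  have i3 := (integrable_cf_mul_gE a b n hr ht ω).const_mul (π * I * ω / t : ℂ)
  have e : ∀ z, conj z * (cf a b n r z * gE t ω z) =
      ((-1 / (2 * t : ℂ)) * ((-2 * t * (conj z * 1).re -
        2 * π * I * (ω * 1).re : ℂ) * (cf a b n r z * gE t ω z)) +
      (I / (2 * t : ℂ)) * ((-2 * t * (conj z * I).re -
        2 * π * I * (ω * I).re : ℂ) * (cf a b n r z * gE t ω z))) -
      (π * I * ω / t : ℂ) * (cf a b n r z * gE t ω z) := by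
    intro z
    have hz : conj z = (z.re : ℂ) - z.im * I := by
      apply Complex.ext <;> simp
    have hw : (ω.re : ℂ) + ω.im * I = ω := Complex.re_add_im ω
    simp only [mul_one, Complex.mul_I_re, Complex.conj_re, Complex.conj_im, neg_neg]
    generalize cf a b n r z * gE t ω z = F
    rw [hz]
    push_cast
    field_simp
    linear_combination (-π * I * F : ℂ) * hw
  rw [integral_congr_ae (Eventually.of_forall e), integral_sub (integrable_fun_add i1 i2) i3,
    integral_add i1 i2, integral_const_mul, integral_const_mul, integral_const_mul, h1, h2]
  simp only [Q, map_one, conj_I]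
  field_simp
  ring_nf
  simp only [I_sq]
  ring

theorem integral_mul_cf (a b : ℕ) (n : ℤ) {r : ℝ} (hr : 0 < r) {t : ℝ} (ht : 0 < t) (ω : ℂ) :
    ∫ z, z * (cf a b n r z * gE t ω z) =
      (a / t : ℂ) * Q (a - 1) b (n - 1) r ω t -
        π * I * conj ω / t * Q a b n r ω t := by
  have ht' : (t : ℂ) ≠ 0 := by exact_mod_cast ht.ne'
  have h1 := integral_by_parts_line a b n hr ht ω 1
  have h2 := integral_by_parts_line a b n hr ht ω I
  have i1 := (integrable_line_mul a b n hr ht ω 1).const_mul (-1 / (2 * t : ℂ))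
  have i2 := (integrable_line_mul a b n hr ht ω I).const_mul (-I / (2 * t : ℂ))
  have i3 := (integrable_cf_mul_gE a b n hr ht ω).const_mul
    (π * I * conj ω / t : ℂ)
  have e : ∀ z, z * (cf a b n r z * gE t ω z) =
      ((-1 / (2 * t : ℂ)) * ((-2 * t * (conj z * 1).re -
        2 * π * I * (ω * 1).re : ℂ) * (cf a b n r z * gE t ω z)) +
      (-I / (2 * t : ℂ)) * ((-2 * t * (conj z * I).re -
        2 * π * I * (ω * I).re : ℂ) * (cf a b n r z * gE t ω z))) -
      (π * I * conj ω / t : ℂ) * (cf a b n r z * gE t ω z) := by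
    intro z
    have hz : z = (z.re : ℂ) + z.im * I := (Complex.re_add_im z).symm
    have hw : conj ω = (ω.re : ℂ) - ω.im * I := by
      apply Complex.ext <;> simp
    simp only [mul_one, Complex.mul_I_re, Complex.conj_re, Complex.conj_im, neg_neg]
    generalize cf a b n r z * gE t ω z = F
    rw [hw]
    nth_rewrite 1 [hz]
    push_cast
    field_simp
    ring_nf
    try simp only [I_sq]
    try ring
  rw [integral_congr_ae (Eventually.of_forall e), integral_sub (integrable_fun_add i1 i2) i3,
    integral_add i1 i2, integral_const_mul, integral_const_mul, integral_const_mul, h1, h2]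
  simp only [Q, map_one, conj_I]
  field_simp
  ring_nf
  simp only [I_sq]
  ring

/-! ### Mellin transforms of the Gaussian integrals -/

theorem Q_succ_left (a b : ℕ) (n : ℤ) {r : ℝ} (hr : 0 < r) (ω : ℂ) {t : ℝ} (ht : 0 < t) :
    Q (a + 1) b n r ω t = r * Q a b n r ω t + (b : ℂ) * (Q a (b - 1) (n - 1) r ω t / t) +
      (-(π * I * ω)) * (Q a b (n - 1) r ω t / t) := by
  have i1 := integrable_mul_cf_mul_gE a b (n - 1) hr ht ω Complex.continuous_conj (A := 1)
    (fun z => by rw [RCLike.norm_conj]; linarith)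
  have i2 := (integrable_cf_mul_gE a b n hr ht ω).const_mul (r : ℂ)
  have : Q (a + 1) b n r ω t = ∫ z, (conj z * (cf a b (n - 1) r z * gE t ω z) +
      r * (cf a b n r z * gE t ω z)) := by
    rw [Q]; congr 1; ext z; rw [cf_succ_left]; ring
  rw [this, integral_add i1 i2, integral_const_mul, integral_conj_mul_cf a b (n - 1) hr ht ω]
  simp only [Q]
  ring

theorem Q_succ_right (a b : ℕ) (n : ℤ) {r : ℝ} (hr : 0 < r) (ω : ℂ) {t : ℝ} (ht : 0 < t) :
    Q a (b + 1) n r ω t = -r * Q a b (n - 1) r ω t + (a : ℂ) * (Q (a - 1) b (n - 1) r ω t / t) +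
      (-(π * I * conj ω)) * (Q a b n r ω t / t) := by
  have i1 := integrable_mul_cf_mul_gE a b n hr ht ω continuous_id (A := 1)
    (fun z => by simp only [id]; linarith)
  have i2 := (integrable_cf_mul_gE a b (n - 1) hr ht ω).const_mul (-r : ℂ)
  have : Q a (b + 1) n r ω t = ∫ z, (-r * (cf a b (n - 1) r z * gE t ω z) +
      z * (cf a b n r z * gE t ω z)) := by
    rw [Q]; congr 1; ext z; rw [cf_succ_right]; ring
  simp only [id] at i1
  rw [this, integral_add i2 i1, integral_const_mul]
  rw [integral_mul_cf a b n hr ht ω]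
  simp only [Q]
  ring

theorem Q_zero_zero (n : ℤ) (r : ℝ) (ω : ℂ) {t : ℝ} (ht : 0 < t) :
    Q 0 0 n r ω t = (if n = 0 then 1 else 0) *
      (π / t * Complex.exp (-((π * ‖ω‖) ^ 2 / t : ℝ))) := by
  have key := GaussianFourier.integral_cexp_neg_mul_sq_norm_add (V := ℂ) (b := (t : ℂ))
    (by simpa using ht) (-2 * π * I) (conj ω)
  simp only [Q, cf_zero_zero]
  rw [integral_const_mul]
  congr 1
  simp only [gE]
  have e : ∀ z : ℂ, inner ℝ (conj ω) z = (ω * z).re := fun z => by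
    rw [Complex.inner]; simp; try ring
  simp_rw [e] at key
  rw [key, Complex.finrank_real_complex]
  simp only [Nat.cast_ofNat, ne_eq, OfNat.ofNat_ne_zero, not_false_eq_true, div_self,
    Complex.cpow_one, RCLike.norm_conj]
  congr 2
  have ht' : (t : ℂ) ≠ 0 := by exact_mod_cast ht.ne'
  push_cast
  field_simp
  rw [I_sq]
  ring

theorem hasMellin_congr_pos {f g : ℝ → ℂ} {s m : ℂ} (h : HasMellin f s m)
    (hfg : ∀ t : ℝ, 0 < t → g t = f t) : HasMellin g s m := by
  have e : EqOn (fun t : ℝ => (t : ℂ) ^ (s - 1) • f t) (fun t : ℝ => (t : ℂ) ^ (s - 1) • g t)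
      (Ioi 0) := fun t ht => by simp only [hfg t ht]
  refine ⟨h.1.congr_fun e measurableSet_Ioi, ?_⟩
  rw [← h.2]
  exact (setIntegral_congr_fun measurableSet_Ioi e).symm

theorem hasMellin_div_self {f : ℝ → ℂ} {s m : ℂ} (h : HasMellin f (s - 1) m) :
    HasMellin (fun t => f t / t) s m := by
  have h1 : HasMellin (fun t : ℝ => (t : ℂ) ^ (-1 : ℂ) • f t) s m := by
    refine ⟨MellinConvergent.cpow_smul.2 (by simpa [sub_eq_add_neg] using h.1), ?_⟩
    rw [mellin_cpow_smul, ← h.2, sub_eq_add_neg]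
  refine hasMellin_congr_pos h1 fun t ht => ?_
  rw [Complex.cpow_neg_one, smul_eq_mul, div_eq_inv_mul]

theorem hasMellin_const_mul' {f : ℝ → ℂ} {s m : ℂ} (h : HasMellin f s m) (c : ℂ) :
    HasMellin (fun t => c * f t) s (c * m) := by
  have := hasMellin_const_smul h.1 c
  rw [h.2] at this
  simpa using this

theorem hasMellin_add' {f g : ℝ → ℂ} {s m m' : ℂ} (h : HasMellin f s m) (h' : HasMellin g s m') :
    HasMellin (fun t => f t + g t) s (m + m') := by
  have := hasMellin_add h.1 h'.1
  rwa [h.2, h'.2] at this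

theorem mellin_base {r κ : ℝ} (hr : 0 < r) (hκ : 0 < κ) (σ : ℂ) :
    HasMellin (fun t : ℝ => Complex.exp (-(t * r ^ 2 : ℝ)) *
      (π / t * Complex.exp (-(κ ^ 2 / t : ℝ)))) σ
      (π * ((κ / r : ℝ) : ℂ) ^ (σ - 1) * V (σ - 1) (κ * r)) := by
  have hq : 0 < r / κ := by positivity
  have h0 : HasMellin (fun t : ℝ => besselKer (κ * r) (r / κ * t)) (σ - 1)
      (((κ / r : ℝ) : ℂ) ^ (σ - 1) * V (σ - 1) (κ * r)) := by
    refine ⟨(MellinConvergent.comp_mul_left hq).2 (V_convergent (by positivity) _), ?_⟩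
    rw [mellin_comp_mul_left _ _ hq, smul_eq_mul, V]
    congr 1
    rw [Complex.cpow_neg, ← Complex.inv_cpow, ← Complex.ofReal_inv, inv_div]
    rw [arg_ofReal_of_nonneg hq.le]; exact pi_pos.ne
  have h1 := hasMellin_const_mul' (hasMellin_div_self h0) (π : ℂ)
  rw [← mul_assoc] at h1
  refine hasMellin_congr_pos h1 fun t ht => ?_
  rw [besselKer, mul_left_comm, ← Complex.ofReal_neg, ← Complex.ofReal_neg, ← Complex.ofReal_exp,
    ← Complex.ofReal_exp, ← Complex.ofReal_mul, ← Real.exp_add]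
  have : -(t * r ^ 2) + -(κ ^ 2 / t) = -(κ * r) * (r / κ * t + (r / κ * t)⁻¹) := by
    field_simp; ring
  rw [this]
  ring

/-- `-i ω̄/|ω|` and `-i ω/|ω|`. -/
theorem neg_I_mul_unitPart {ω : ℂ} (hω : ω ≠ 0) :
    (-I * conj (unitPart ω)) * (-I * unitPart ω) = -1 := by
  have hn : (‖ω‖ : ℂ) ≠ 0 := by exact_mod_cast norm_ne_zero_iff.2 hω
  have h1 : conj (unitPart ω) * unitPart ω = 1 := by
    rw [mul_comm, mul_conj, unitPart, Complex.normSq_div, normSq_ofReal,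
      normSq_eq_norm_sq, ← sq, div_self (pow_ne_zero _ (norm_ne_zero_iff.2 hω)),
      Complex.ofReal_one]
  linear_combination (I ^ 2) * h1 + I_sq

/-- The Mellin transform of `exp(-t r²) Q(t)` in terms of Bessel functions. -/
theorem hasMellin_Q {ω : ℂ} (hω : ω ≠ 0) {r : ℝ} (hr : 0 < r) (a b : ℕ) (n : ℤ) (σ : ℂ) :
    HasMellin (fun t : ℝ => Complex.exp (-(t * r ^ 2 : ℝ)) * Q a b n r ω t) σ
      (π * ((π * ‖ω‖ / r : ℝ) : ℂ) ^ (σ - 1) * (r : ℂ) ^ (a + b) *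
        (-I * conj (unitPart ω)) ^ b * (-I * unitPart ω) ^ n *
        Jc V a b n (σ - 1 - (a + b) + n) (π * ‖ω‖ * r)) := by
  set κ : ℝ := π * ‖ω‖ with hκdef
  have hκ : 0 < κ := mul_pos pi_pos (norm_pos_iff.2 hω)
  set B : ℂ := -I * conj (unitPart ω) with hB
  set E : ℂ := -I * unitPart ω with hE
  have hBE : B * E = -1 := neg_I_mul_unitPart hω
  have hE0 : E ≠ 0 := by rintro h; rw [h] at hBE; simp at hBE
  have hn : (‖ω‖ : ℂ) ≠ 0 := by exact_mod_cast norm_ne_zero_iff.2 hω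
  have hωE : -(π * I * ω) = κ * E := by
    rw [hE, hκdef, unitPart]; push_cast; field_simp
  have hωB : -(π * I * conj ω) = κ * B := by
    rw [hB, hκdef, unitPart, map_div₀, conj_ofReal]; push_cast; field_simp
  have hr' : (r : ℂ) ≠ 0 := by exact_mod_cast hr.ne'
  have hκ' : (κ : ℂ) ≠ 0 := by exact_mod_cast hκ.ne'
  have hq : ((κ / r : ℝ) : ℂ) ≠ 0 := by exact_mod_cast (div_pos hκ hr).ne'
  have hqpow : ∀ σ : ℂ, (r : ℂ) * ((κ / r : ℝ) : ℂ) ^ (σ - 1) = κ * ((κ / r : ℝ) : ℂ) ^ (σ - 1 - 1) := by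
    intro σ
    rw [Complex.cpow_sub (σ - 1) 1 hq, Complex.cpow_one]
    push_cast
    field_simp
  have hEn : ∀ n : ℤ, E ^ n = E ^ (n - 1) * E := fun n => by
    rw [← zpow_add_one₀ hE0, sub_add_cancel]
  induction a generalizing b n σ with
  | zero =>
    induction b generalizing n σ with
    | zero =>
      have h1 := hasMellin_const_mul' (mellin_base hr hκ σ) (if n = 0 then 1 else 0)
      have h2 := hasMellin_congr_pos h1 (g := fun t : ℝ => Complex.exp (-(t * r ^ 2 : ℝ)) * Q 0 0 n r ω t)
        (fun t ht => by rw [Q_zero_zero n r ω ht]; ring)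
      convert h2 using 1
      simp only [Jc, binZ_zero]
      split_ifs with h
      · subst h; simp
      · simp
    | succ b ih =>
      have h1 := hasMellin_const_mul' (ih (n - 1) σ) (-r : ℂ)
      have h2 := hasMellin_const_mul' (hasMellin_div_self (ih n (σ - 1))) (κ * B)
      have h3 := hasMellin_congr_pos (hasMellin_add' h1 h2)
        (g := fun t : ℝ => Complex.exp (-(t * r ^ 2 : ℝ)) * Q 0 (b + 1) n r ω t) (fun t ht => by
          rw [Q_succ_right 0 b n hr ω ht, ← hωB]; simp; ring)
      convert h3 using 1
      simp only [Jc, binZ_succ]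
      have e1 : σ - 1 - (((0 : ℕ) : ℂ) + (b : ℕ)) + ((n - 1 : ℤ) : ℂ) =
        σ - 1 - (((0 : ℕ) : ℂ) + ((b + 1 : ℕ) : ℂ)) + n := by push_cast; ring
      have e2 : σ - 1 - 1 - (((0 : ℕ) : ℂ) + (b : ℕ)) + (n : ℂ) =
        σ - 1 - (((0 : ℕ) : ℂ) + ((b + 1 : ℕ) : ℂ)) + n := by push_cast; ring
      rw [e1, e2]
      generalize V (σ - 1 - (((0 : ℕ) : ℂ) + ((b + 1 : ℕ) : ℂ)) + n) (κ * r) = W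
      have hp := hqpow σ
      rw [hEn n]
      simp only [zero_add, pow_succ]
      linear_combination (π * (r : ℂ) ^ b * B ^ b * E ^ (n - 1) * W * binZ b (n - 1) * r *
        ((κ / r : ℝ) : ℂ) ^ (σ - 1)) * hBE + (π * (r : ℂ) ^ b * B ^ b * B * E ^ (n - 1) * E *
          W * binZ b n) * hp
  | succ a ih =>
    have h1 := hasMellin_const_mul' (ih b n σ) (r : ℂ)
    have h2 := hasMellin_const_mul' (hasMellin_div_self (ih (b - 1) (n - 1) (σ - 1))) (b : ℂ)
    have h4 := hasMellin_const_mul' (hasMellin_div_self (ih b (n - 1) (σ - 1))) (κ * E)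
    have h3 := hasMellin_congr_pos (hasMellin_add' (hasMellin_add' h1 h2) h4)
      (g := fun t : ℝ => Complex.exp (-(t * r ^ 2 : ℝ)) * Q (a + 1) b n r ω t) (fun t ht => by
        rw [Q_succ_left a b n hr ω ht, ← hωE]; ring)
    convert h3 using 1
    simp only [Jc]
    have hp := hqpow σ
    have e1 : σ - 1 - (((a + 1 : ℕ) : ℂ) + (b : ℕ)) + (n : ℂ) + 1 =
      σ - 1 - (a + b) + n := by push_cast; ring
    have e3 : σ - 1 - 1 - ((a : ℂ) + b) + ((n - 1 : ℤ) : ℂ) =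
      σ - 1 - (((a + 1 : ℕ) : ℂ) + (b : ℕ)) + (n : ℂ) - 1 := by push_cast; ring
    rw [e1, e3]
    generalize Jc V a b n (σ - 1 - (a + b) + n) (κ * r) = W1
    generalize Jc V a b (n - 1) (σ - 1 - (((a + 1 : ℕ) : ℂ) + (b : ℕ)) + (n : ℂ) - 1) (κ * r) = W3
    have hp' : ((κ / r : ℝ) : ℂ) ^ (σ - 1) = κ * ((κ / r : ℝ) : ℂ) ^ (σ - 1 - 1) / r := by
      rw [← hp]; field_simp
    rcases b with _ | b
    · rw [hEn n, hp']
      simp only [Nat.cast_zero, pow_succ, pow_add]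
      field_simp
      ring
    · have e2 : σ - 1 - 1 - ((a : ℂ) + ((b + 1 - 1 : ℕ) : ℂ)) + ((n - 1 : ℤ) : ℂ) =
        σ - 1 - (((a + 1 : ℕ) : ℂ) + ((b + 1 : ℕ) : ℂ)) + (n : ℂ) := by
          simp only [Nat.add_sub_cancel]; push_cast; ring
      rw [e2]
      generalize Jc V a (b + 1 - 1) (n - 1) (σ - 1 - (((a + 1 : ℕ) : ℂ) + ((b + 1 : ℕ) : ℂ)) + (n : ℂ)) (κ * r) = W2
      rw [hEn n, hp']
      simp only [Nat.add_sub_cancel, pow_succ, pow_add]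
      push_cast
      field_simp
      generalize (((κ : ℂ) / r)) ^ (σ - 1 - 1) = Y
      linear_combination (-(Y * B ^ b * W2 * (b + 1))) * hBE

/-! ### The integral over `N` -/

/-- The integral `∫ (1 + |z|²)^{-σ} cf(z) exp(-2πi Re(ω z)) dz`. -/
def Zint (a b : ℕ) (n : ℤ) (σ ω : ℂ) : ℂ :=
  ∫ z : ℂ, ((1 + ‖z‖ ^ 2 : ℝ) : ℂ) ^ (-σ) * (cf a b n 1 z *
    Complex.exp ((-2 * π * I) * ((ω * z).re : ℂ)))

theorem one_le_one_add_norm_sq (z : ℂ) : (1 : ℝ) ≤ 1 + ‖z‖ ^ 2 := by nlinarith [sq_nonneg ‖z‖]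

theorem one_add_norm_sq_pos (z : ℂ) : (0 : ℝ) < 1 + ‖z‖ ^ 2 :=
  lt_of_lt_of_le one_pos (one_le_one_add_norm_sq z)

theorem norm_one_add_norm_sq_cpow (z σ : ℂ) :
    ‖((1 + ‖z‖ ^ 2 : ℝ) : ℂ) ^ (-σ)‖ = (1 + ‖z‖ ^ 2) ^ (-σ.re) := by
  rw [norm_cpow_eq_rpow_re_of_pos (one_add_norm_sq_pos z), neg_re]

theorem norm_cf_one_le (a b : ℕ) (n : ℤ) (z : ℂ) :
    ‖cf a b n 1 z‖ ≤ 2 ^ (((a + b : ℕ) : ℝ) / 2) * (1 + ‖z‖ ^ 2) ^ (((a + b : ℕ) : ℝ) / 2) := by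
  refine (norm_cf_le a b n one_pos z).trans ?_
  rw [← Real.mul_rpow (by norm_num) (one_add_norm_sq_pos z).le]
  have h1 : (‖z‖ + 1) ^ (a + b) = ((‖z‖ + 1) ^ 2) ^ (((a + b : ℕ) : ℝ) / 2) := by
    rw [← rpow_natCast, ← rpow_natCast, ← Real.rpow_mul (by positivity)]
    congr 1; push_cast; ring
  rw [h1]
  refine Real.rpow_le_rpow (by positivity) ?_ (by positivity)
  nlinarith [sq_nonneg (‖z‖ - 1)]

theorem integrable_one_add_norm_sq {x : ℝ} (hx : 1 < x) :
    Integrable fun z : ℂ => (1 + ‖z‖ ^ 2) ^ (-x) := by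
  have := integrable_rpow_neg_one_add_norm_sq (E := ℂ) (μ := volume) (r := 2 * x)
    (by rw [Complex.finrank_real_complex]; push_cast; linarith)
  simpa [neg_div] using this

theorem norm_cf_mul_le (a b : ℕ) (n : ℤ) (z σ : ℂ) :
    ‖((1 + ‖z‖ ^ 2 : ℝ) : ℂ) ^ (-σ) * cf a b n 1 z‖ ≤
      2 ^ (((a + b : ℕ) : ℝ) / 2) * (1 + ‖z‖ ^ 2) ^ (-(σ.re - ((a + b : ℕ) : ℝ) / 2)) := by
  rw [norm_mul, norm_one_add_norm_sq_cpow]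
  refine (mul_le_mul_of_nonneg_left (norm_cf_one_le a b n z)
    (rpow_nonneg (one_add_norm_sq_pos z).le _)).trans (le_of_eq ?_)
  rw [neg_sub, sub_eq_add_neg (((a + b : ℕ) : ℝ) / 2), rpow_add (one_add_norm_sq_pos z)]
  ring

theorem norm_exp_char (ω z : ℂ) :
    ‖Complex.exp ((-2 * π * I) * ((ω * z).re : ℂ))‖ = 1 := by
  rw [Complex.norm_exp]; simp

theorem one_add_cpow_continuous (σ : ℂ) :
    Continuous fun z : ℂ => ((1 + ‖z‖ ^ 2 : ℝ) : ℂ) ^ (-σ) := by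
  refine Continuous.cpow (by fun_prop) continuous_const fun z => ?_
  exact Complex.ofReal_mem_slitPlane.2 (one_add_norm_sq_pos z)

theorem Zint_integrand_continuous (a b : ℕ) (n : ℤ) (σ ω : ℂ) :
    Continuous fun z : ℂ => ((1 + ‖z‖ ^ 2 : ℝ) : ℂ) ^ (-σ) * (cf a b n 1 z *
    Complex.exp ((-2 * π * I) * ((ω * z).re : ℂ))) :=
  (one_add_cpow_continuous σ).mul ((cf_continuous a b n 1).mul (by fun_prop))

theorem norm_Zint_integrand (a b : ℕ) (n : ℤ) (z σ ω : ℂ) :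
    ‖((1 + ‖z‖ ^ 2 : ℝ) : ℂ) ^ (-σ) * (cf a b n 1 z *
    Complex.exp ((-2 * π * I) * ((ω * z).re : ℂ)))‖ =
    ‖((1 + ‖z‖ ^ 2 : ℝ) : ℂ) ^ (-σ) * cf a b n 1 z‖ := by
  rw [← mul_assoc, norm_mul, norm_exp_char, mul_one]

theorem Zint_integrable (a b : ℕ) (n : ℤ) {σ : ℂ} (hσ : ((a + b : ℕ) : ℝ) / 2 + 1 < σ.re)
    (ω : ℂ) : Integrable fun z : ℂ => ((1 + ‖z‖ ^ 2 : ℝ) : ℂ) ^ (-σ) * (cf a b n 1 z *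
    Complex.exp ((-2 * π * I) * ((ω * z).re : ℂ))) := by
  refine ((integrable_one_add_norm_sq (x := σ.re - ((a + b : ℕ) : ℝ) / 2)
    (by linarith)).const_mul (2 ^ (((a + b : ℕ) : ℝ) / 2))).mono'
    (Zint_integrand_continuous a b n σ ω).aestronglyMeasurable (Eventually.of_forall fun z => ?_)
  rw [norm_Zint_integrand]
  exact norm_cf_mul_le a b n z σ

theorem integral_rpow_mul_exp {x ρ : ℝ} (hx : 0 < x) (hρ : 0 < ρ) :
    ∫ t in Ioi (0 : ℝ), t ^ (x - 1) * Real.exp (-ρ * t) = Real.Gamma x * ρ ^ (-x) := by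
  have := Real.integral_rpow_mul_exp_neg_mul_Ioi hx hρ
  simp only [neg_mul]
  rw [this, one_div, Real.inv_rpow hρ.le, ← Real.rpow_neg hρ.le, mul_comm]

theorem Gamma_mul_Zint (a b : ℕ) (n : ℤ) {σ : ℂ} (hσ : ((a + b : ℕ) : ℝ) / 2 + 1 < σ.re)
    (ω : ℂ) : Gamma σ * Zint a b n σ ω =
      mellin (fun t : ℝ => Complex.exp (-(t * 1 ^ 2 : ℝ)) * Q a b n 1 ω t) σ := by
  have hσ0 : 0 < σ.re := lt_of_le_of_lt (by positivity) hσ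
  let F : ℝ → ℂ → ℂ := fun t z => (t : ℂ) ^ (σ - 1) * (Complex.exp (-(t * 1 ^ 2 : ℝ)) *
    (cf a b n 1 z * gE t ω z))
  have hFn : ∀ t z, 0 < t → ‖F t z‖ = ‖cf a b n 1 z‖ *
      (t ^ (σ.re - 1) * Real.exp (-(1 + ‖z‖ ^ 2) * t)) := by
    intro t z ht
    simp only [F, norm_mul, norm_gE]
    rw [norm_cpow_eq_rpow_re_of_pos ht, ← Complex.ofReal_neg, Complex.norm_exp_ofReal]
    have : Real.exp (-(1 + ‖z‖ ^ 2) * t) = Real.exp (-(t * 1 ^ 2)) * Real.exp (-t * ‖z‖ ^ 2) := by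
      rw [← Real.exp_add]; congr 1; ring
    rw [this, sub_re, Complex.one_re]; ring
  have hmeas : AEStronglyMeasurable (Function.uncurry F)
      ((volume.restrict (Ioi (0 : ℝ))).prod (volume : Measure ℂ)) := by
    have hc : ContinuousOn (Function.uncurry F) (Ioi (0 : ℝ) ×ˢ univ) := by
      intro p hp
      have hp1 : 0 < p.1 := hp.1
      refine ContinuousAt.continuousWithinAt ?_
      have h1 : ContinuousAt (fun p : ℝ × ℂ => (p.1 : ℂ) ^ (σ - 1)) p :=
        ContinuousAt.cpow (by fun_prop) continuousAt_const (Complex.ofReal_mem_slitPlane.2 hp1)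
      have h2 : ContinuousAt (fun p : ℝ × ℂ => cf a b n 1 p.2) p :=
        ((cf_continuous a b n 1).comp continuous_snd).continuousAt
      have h3 : ContinuousAt (fun p : ℝ × ℂ => gE p.1 ω p.2) p := by
        unfold gE; fun_prop
      have h4 : ContinuousAt (fun p : ℝ × ℂ => Complex.exp (-(p.1 * 1 ^ 2 : ℝ))) p := by fun_prop
      exact h1.mul (h4.mul (h2.mul h3))
    have := hc.aestronglyMeasurable (μ := (volume : Measure ℝ).prod (volume : Measure ℂ))
      (measurableSet_Ioi.prod MeasurableSet.univ)
    rwa [← Measure.prod_restrict, Measure.restrict_univ] at this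
  have hIt : ∀ z, IntegrableOn (fun t : ℝ => t ^ (σ.re - 1) * Real.exp (-(1 + ‖z‖ ^ 2) * t))
      (Ioi 0) := fun z => by
    have := cpow_mul_exp_integrable hσ0 (one_add_norm_sq_pos z)
    exact this
  have hIz : ∀ z, ∫ t in Ioi (0 : ℝ), ‖F t z‖ = Real.Gamma σ.re *
      ‖((1 + ‖z‖ ^ 2 : ℝ) : ℂ) ^ (-σ) * cf a b n 1 z‖ := by
    intro z
    rw [setIntegral_congr_fun measurableSet_Ioi (fun t ht => hFn t z ht), integral_const_mul,
      integral_rpow_mul_exp hσ0 (one_add_norm_sq_pos z), norm_mul, norm_one_add_norm_sq_cpow]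
    ring
  have hint : Integrable (Function.uncurry F)
      ((volume.restrict (Ioi (0 : ℝ))).prod (volume : Measure ℂ)) := by
    rw [integrable_prod_iff' hmeas]
    constructor
    · refine (ae_of_all _ fun z => ?_)
      have h1 := (hIt z).const_mul ‖cf a b n 1 z‖
      have hm : AEStronglyMeasurable (fun t => F t z) (volume.restrict (Ioi 0)) := by
        refine ContinuousOn.aestronglyMeasurable (fun t ht => ?_) measurableSet_Ioi
        refine ContinuousAt.continuousWithinAt ?_
        refine ContinuousAt.mul (ContinuousAt.cpow (by fun_prop) continuousAt_const
          (Complex.ofReal_mem_slitPlane.2 ht)) ?_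
        unfold gE
        fun_prop
      refine Integrable.mono' h1 hm ?_
      filter_upwards [self_mem_ae_restrict measurableSet_Ioi] with t ht
      exact (hFn t z ht).le
    · simp only [Function.uncurry]
      simp_rw [hIz]
      refine Integrable.const_mul ?_ _
      have := (Zint_integrable a b n hσ 0).norm
      simpa only [norm_Zint_integrand] using this
  have hswap := integral_integral_swap hint
  have hL : mellin (fun t : ℝ => Complex.exp (-(t * 1 ^ 2 : ℝ)) * Q a b n 1 ω t) σ =
      ∫ t in Ioi (0 : ℝ), ∫ z : ℂ, F t z := by
    rw [mellin]
    congr 1; ext t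
    simp only [F, smul_eq_mul]
    rw [integral_const_mul, integral_const_mul, Q]
  rw [hL, hswap, Zint, ← integral_const_mul]
  congr 1; ext z
  have hker := Complex.integral_cpow_mul_exp_neg_mul_Ioi hσ0
    (r := 1 + ‖z‖ ^ 2) (one_add_norm_sq_pos z)
  have e : ∀ t : ℝ, F t z = (cf a b n 1 z *
      Complex.exp ((-2 * π * I) * ((ω * z).re : ℂ))) *
      ((t : ℂ) ^ (σ - 1) * Complex.exp (-(((1 + ‖z‖ ^ 2 : ℝ) : ℂ) * t))) := by
    intro t
    have : Complex.exp (-(((1 + ‖z‖ ^ 2 : ℝ) : ℂ) * t)) = Complex.exp (-(t * 1 ^ 2 : ℝ)) *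
        Complex.exp (-(t : ℂ) * ‖z‖ ^ 2) := by
      rw [← Complex.exp_add]; congr 1; push_cast; ring
    simp only [F, gE, this, Complex.exp_add]
    ring
  simp_rw [e]
  rw [integral_const_mul, hker, one_div, Complex.inv_cpow, Complex.cpow_neg]
  · ring
  · rw [arg_ofReal_of_nonneg (one_add_norm_sq_pos z).le]; exact pi_pos.ne

/-- The integral over `N` in terms of Bessel functions. -/
theorem Gamma_mul_Zint_eq (a b : ℕ) (n : ℤ) {σ : ℂ} (hσ : ((a + b : ℕ) : ℝ) / 2 + 1 < σ.re)
    {ω : ℂ} (hω : ω ≠ 0) : Gamma σ * Zint a b n σ ω =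
      π * ((π * ‖ω‖ : ℝ) : ℂ) ^ (σ - 1) *
        (-I * conj (unitPart ω)) ^ b * (-I * unitPart ω) ^ n *
        Jc V a b n (σ - 1 - (a + b) + n) (π * ‖ω‖) := by
  rw [Gamma_mul_Zint a b n hσ, (hasMellin_Q hω one_pos a b n σ).2]
  simp

theorem hasMellin_Q_zero (a b : ℕ) (n : ℤ) {σ : ℂ} (hσ : 1 + a < σ.re) :
    HasMellin (fun t : ℝ => Complex.exp (-(t * 1 ^ 2 : ℝ)) * Q a b n 1 0 t) σ
      (if n = b then π * (-1) ^ b * Gamma (σ - 1 - a) *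
        ∏ i ∈ Finset.range a, (σ - 2 - b - i) else 0) := by
  induction a generalizing b n σ with
  | zero =>
    induction b generalizing n with
    | zero =>
      have h0 : HasMellin (fun t : ℝ => Complex.exp (-t)) (σ - 1) (Gamma (σ - 1)) := by
        have hre : 0 < (σ - 1).re := by simp at hσ ⊢; linarith
        have hG := Complex.Gamma_eq_integral hre
        refine ⟨?_, ?_⟩
        · refine (Complex.GammaIntegral_convergent hre).congr_fun (fun t _ => ?_) measurableSet_Ioi
          simp only [smul_eq_mul, Complex.ofReal_exp, Complex.ofReal_neg]; ring
        · rw [hG, Complex.GammaIntegral, mellin]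
          refine setIntegral_congr_fun measurableSet_Ioi fun t _ => ?_
          simp only [smul_eq_mul, Complex.ofReal_exp, Complex.ofReal_neg]; ring
      have h1 := hasMellin_const_mul' (hasMellin_div_self h0) (if n = 0 then (π : ℂ) else 0)
      have h2 := hasMellin_congr_pos h1
        (g := fun t : ℝ => Complex.exp (-(t * 1 ^ 2 : ℝ)) * Q 0 0 n 1 0 t) (fun t ht => by
          rw [Q_zero_zero n 1 0 ht]; split_ifs <;> simp; ring)
      convert h2 using 1
      split_ifs with h3 h4 h4
      · simp
      · simp at h3; exact absurd h3 h4
      · simp at h3; exact absurd h4 h3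
      · simp
    | succ b ih =>
      have h1 := hasMellin_const_mul' (ih (n - 1)) (-1)
      have h2 := hasMellin_congr_pos h1
        (g := fun t : ℝ => Complex.exp (-(t * 1 ^ 2 : ℝ)) * Q 0 (b + 1) n 1 0 t) (fun t ht => by
          rw [Q_succ_right 0 b n one_pos 0 ht]; simp)
      convert h2 using 1
      have : n = ((b + 1 : ℕ) : ℤ) ↔ n - 1 = (b : ℤ) := by push_cast; omega
      simp only [this]
      split_ifs
      · simp [pow_succ]
      · simp
  | succ a ih =>
    have hσ1 : 1 + (a : ℝ) < σ.re := by push_cast at hσ; linarith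
    have hσ2 : 1 + (a : ℝ) < (σ - 1).re := by push_cast at hσ; simp; linarith
    have h1 := ih b n hσ1
    have h2 := hasMellin_const_mul' (hasMellin_div_self (ih (b - 1) (n - 1) hσ2)) (b : ℂ)
    have h3 := hasMellin_congr_pos (hasMellin_add' h1 h2)
      (g := fun t : ℝ => Complex.exp (-(t * 1 ^ 2 : ℝ)) * Q (a + 1) b n 1 0 t) (fun t ht => by
        rw [Q_succ_left a b n one_pos 0 ht]; simp; ring)
    convert h3 using 1
    have hG : Gamma (σ - 1 - a) = (σ - 2 - a) * Gamma (σ - 2 - a) := by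
      rw [← Gamma_add_one]
      · congr 1; ring
      · intro h
        have := congrArg Complex.re h
        simp at this hσ2; linarith
    have e1 : σ - 1 - ((a + 1 : ℕ) : ℂ) = σ - 2 - a := by push_cast; ring
    have e2 : σ - 1 - 1 - (a : ℂ) = σ - 2 - a := by ring
    rw [e1, e2, hG, Finset.prod_range_succ]
    rcases b with _ | b
    · simp only [Nat.cast_zero, zero_mul, add_zero]
      split_ifs
      · simp; ring
      · rfl
    · have e3 : n - 1 = ((b + 1 - 1 : ℕ) : ℤ) ↔ n = ((b + 1 : ℕ) : ℤ) := by
        simp only [Nat.add_sub_cancel]; push_cast; omega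
      have e4 : ∀ i ∈ Finset.range a, σ - 1 - 2 - ((b + 1 - 1 : ℕ) : ℂ) - i =
          σ - 2 - ((b + 1 : ℕ) : ℂ) - i := fun i _ => by
        simp only [Nat.add_sub_cancel]; push_cast; ring
      simp only [e3, Finset.prod_congr rfl e4]
      split_ifs
      · simp only [Nat.add_sub_cancel, pow_succ]; push_cast; ring
      · simp

/-! ### Uniform bounds for the Bessel functions -/

theorem integral_one_add_norm_sq {x : ℝ} (hx : 1 < x) :
    ∫ z : ℂ, (1 + ‖z‖ ^ 2) ^ (-x) = π / (x - 1) := by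
  have h1 := Gamma_mul_Zint 0 0 0 (σ := (x : ℂ)) (by simpa using hx) 0
  rw [(hasMellin_Q_zero 0 0 0 (σ := (x : ℂ)) (by simpa using hx)).2] at h1
  have h2 : Zint 0 0 0 x 0 = ((∫ z : ℂ, (1 + ‖z‖ ^ 2) ^ (-x) : ℝ) : ℂ) := by
    rw [Zint, ← integral_complex_ofReal]
    congr 1; ext z
    rw [cf_zero_zero, Complex.ofReal_cpow (one_add_norm_sq_pos z).le]
    simp
  have hx1 : (x : ℂ) - 1 ≠ 0 := by
    rw [sub_ne_zero]; exact_mod_cast hx.ne'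
  have h3 : Gamma x = (x - 1) * Gamma (x - 1) := by
    rw [← Gamma_add_one _ hx1]; congr 1; ring
  have hG : Gamma ((x : ℂ) - 1) ≠ 0 :=
    Complex.Gamma_ne_zero_of_re_pos (by simpa using hx)
  rw [h2, h3] at h1
  simp only [Nat.cast_zero, if_true, pow_zero, mul_one, sub_zero, Finset.range_zero,
    Finset.prod_empty] at h1
  have h4 : (x - 1) * ((∫ z : ℂ, (1 + ‖z‖ ^ 2) ^ (-x) : ℝ) : ℂ) = π := by
    apply mul_right_cancel₀ hG
    linear_combination h1
  have h5 : (x - 1) * (∫ z : ℂ, (1 + ‖z‖ ^ 2) ^ (-x) : ℝ) = π := by exact_mod_cast h4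
  rw [eq_div_iff (by linarith)]
  linarith

theorem norm_Zint_le (a b : ℕ) (n : ℤ) {σ : ℂ} (hσ : ((a + b : ℕ) : ℝ) / 2 + 1 < σ.re) (ω : ℂ) :
    ‖Zint a b n σ ω‖ ≤ 2 ^ (((a + b : ℕ) : ℝ) / 2) *
      (π / (σ.re - ((a + b : ℕ) : ℝ) / 2 - 1)) := by
  rw [← integral_one_add_norm_sq (by linarith : 1 < σ.re - ((a + b : ℕ) : ℝ) / 2),
    ← integral_const_mul]
  refine norm_integral_le_of_norm_le ((integrable_one_add_norm_sq (by linarith)).const_mul _)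
    (Eventually.of_forall fun z => ?_)
  rw [norm_Zint_integrand]
  exact norm_cf_mul_le a b n z σ

theorem norm_exp_I_sub_one_le {x θ : ℝ} (h0 : 0 ≤ θ) (h1 : θ ≤ 1) :
    ‖Complex.exp (x * I) - 1‖ ≤ 2 * |x| ^ θ := by
  have hx := abs_nonneg x
  rcases le_total |x| 1 with h | h
  · have := Real.norm_exp_I_mul_ofReal_sub_one_le (x := x)
    rw [mul_comm] at this
    have h2 : |x| ≤ |x| ^ θ := by
      rcases hx.eq_or_lt with h3 | h3
      · rw [← h3]; exact rpow_nonneg le_rfl _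
      · simpa using Real.rpow_le_rpow_of_exponent_ge h3 h h1
    rw [Real.norm_eq_abs] at this
    linarith [rpow_nonneg hx θ]
  · have h2 : (1 : ℝ) ≤ |x| ^ θ := Real.one_le_rpow h h0
    have := norm_sub_le (Complex.exp (x * I)) 1
    rw [Complex.norm_exp_ofReal_mul_I, norm_one] at this
    linarith

theorem norm_Zint_sub_le (a b : ℕ) (n : ℤ) {σ : ℂ} {θ : ℝ} (h0 : 0 ≤ θ) (h1 : θ ≤ 1)
    (hσ : ((a + b : ℕ) : ℝ) / 2 + 1 + θ / 2 < σ.re) (ω : ℂ) :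
    ‖Zint a b n σ ω - Zint a b n σ 0‖ ≤ 2 * (2 * π * ‖ω‖) ^ θ *
      (2 ^ (((a + b : ℕ) : ℝ) / 2) *
      (π / (σ.re - ((a + b : ℕ) : ℝ) / 2 - θ / 2 - 1))) := by
  have hω : 0 ≤ 2 * π * ‖ω‖ := by positivity
  rw [← integral_one_add_norm_sq (by linarith : 1 < σ.re - ((a + b : ℕ) : ℝ) / 2 - θ / 2),
    ← integral_const_mul, ← integral_const_mul]
  rw [Zint, Zint, ← integral_sub (Zint_integrable a b n (by linarith) ω)
    (Zint_integrable a b n (by linarith) 0)]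
  refine norm_integral_le_of_norm_le
    (((integrable_one_add_norm_sq (by linarith)).const_mul _).const_mul _)
    (Eventually.of_forall fun z => ?_)
  have e : ((1 + ‖z‖ ^ 2 : ℝ) : ℂ) ^ (-σ) * (cf a b n 1 z *
      Complex.exp ((-2 * π * I) * ((ω * z).re : ℂ))) -
      ((1 + ‖z‖ ^ 2 : ℝ) : ℂ) ^ (-σ) * (cf a b n 1 z *
      Complex.exp ((-2 * π * I) * (((0 : ℂ) * z).re : ℂ))) =
      (((1 + ‖z‖ ^ 2 : ℝ) : ℂ) ^ (-σ) * cf a b n 1 z) *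
      (Complex.exp (((-2 * π * (ω * z).re : ℝ) : ℂ) * I) - 1) := by
    rw [zero_mul, Complex.zero_re, Complex.ofReal_zero, mul_zero, Complex.exp_zero]
    have : (-2 * π * I) * ((ω * z).re : ℂ) =
      ((-2 * π * (ω * z).re : ℝ) : ℂ) * I := by push_cast; ring
    rw [this]; ring
  rw [e, norm_mul]
  have hz := one_add_norm_sq_pos z
  have b1 : ‖Complex.exp (((-2 * π * (ω * z).re : ℝ) : ℂ) * I) - 1‖ ≤
      2 * ((2 * π * ‖ω‖) ^ θ * (1 + ‖z‖ ^ 2) ^ (θ / 2)) := by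
    refine (norm_exp_I_sub_one_le h0 h1).trans ?_
    have c1 : |-2 * π * (ω * z).re| ≤ (2 * π * ‖ω‖) * ‖z‖ := by
      rw [abs_mul, abs_mul, abs_neg, abs_two, abs_of_pos pi_pos, mul_assoc _ ‖ω‖, ← norm_mul]
      exact mul_le_mul_of_nonneg_left (abs_re_le_norm _) (by positivity)
    have c2 : ‖z‖ ^ θ ≤ (1 + ‖z‖ ^ 2) ^ (θ / 2) := by
      have : ‖z‖ ^ θ = (‖z‖ ^ 2) ^ (θ / 2) := by
        rw [← rpow_natCast, ← Real.rpow_mul (norm_nonneg z)]; congr 1; push_cast; ring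
      rw [this]
      exact Real.rpow_le_rpow (by positivity) (by linarith) (by positivity)
    have c3 := Real.rpow_le_rpow (abs_nonneg _) c1 h0
    rw [Real.mul_rpow hω (norm_nonneg z)] at c3
    have c4 := mul_le_mul_of_nonneg_left c2 (rpow_nonneg hω θ)
    linarith
  refine (mul_le_mul (norm_cf_mul_le a b n z σ) b1 (norm_nonneg _) (by positivity)).trans
    (le_of_eq ?_)
  have : (1 + ‖z‖ ^ 2) ^ (-(σ.re - ((a + b : ℕ) : ℝ) / 2 - θ / 2)) =
      (1 + ‖z‖ ^ 2) ^ (-(σ.re - ((a + b : ℕ) : ℝ) / 2)) * (1 + ‖z‖ ^ 2) ^ (θ / 2) := by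
    rw [← rpow_add hz]; congr 1; ring
  rw [this]; ring

theorem unitPart_ofReal {y : ℝ} (hy : 0 < y) : unitPart (y : ℂ) = 1 := by
  have : (y : ℂ) ≠ 0 := by exact_mod_cast hy.ne'
  rw [unitPart, norm_real, norm_of_nonneg hy.le, div_self this]

theorem Jc_V_eq_Zint (a b : ℕ) (n : ℤ) {σ : ℂ} (hσ : ((a + b : ℕ) : ℝ) / 2 + 1 < σ.re)
    {y : ℝ} (hy : 0 < y) : Jc V a b n (σ - 1 - (a + b) + n) y =
      (y : ℂ) ^ (-(σ - 1)) * (Gamma σ * Zint a b n σ ((y / π : ℝ) : ℂ)) /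
        (π * ((-I) ^ b * (-I) ^ n)) := by
  have hyp : 0 < y / π := div_pos hy pi_pos
  have h := Gamma_mul_Zint_eq a b n hσ (ω := ((y / π : ℝ) : ℂ))
    (by exact_mod_cast hyp.ne')
  have e : π * ‖((y / π : ℝ) : ℂ)‖ = y := by
    rw [norm_real, norm_of_nonneg hyp.le]; field_simp
  rw [e, unitPart_ofReal hyp, map_one, mul_one] at h
  have hy' : (y : ℂ) ≠ 0 := by exact_mod_cast hy.ne'
  have hpi : (π : ℂ) ≠ 0 := by exact_mod_cast pi_pos.ne'
  have hI : (-I) ^ b * (-I) ^ n ≠ 0 :=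
    mul_ne_zero (pow_ne_zero _ (by simp)) (zpow_ne_zero _ (by simp))
  have hyy : (y : ℂ) ^ (-(σ - 1)) * (y : ℂ) ^ (σ - 1) = 1 := by
    rw [← cpow_add _ _ hy', neg_add_cancel, Complex.cpow_zero]
  rw [h, eq_div_iff (mul_ne_zero hpi hI)]
  linear_combination (-(Jc V a b n (σ - 1 - (a + b) + n) y * (π * ((-I) ^ b * (-I) ^ n)))) * hyy

theorem norm_neg_I_pow (b : ℕ) (n : ℤ) : ‖(-I) ^ b * (-I) ^ n‖ = 1 := by
  rw [norm_mul, norm_pow, norm_zpow, norm_neg, Complex.norm_I]; simp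

theorem norm_ofReal_cpow {y : ℝ} (hy : 0 < y) (s : ℂ) : ‖(y : ℂ) ^ s‖ = y ^ s.re :=
  norm_cpow_eq_rpow_re_of_pos hy s

theorem norm_Jc_V_le (a b : ℕ) (n : ℤ) {σ : ℂ} (hσ : ((a + b : ℕ) : ℝ) / 2 + 1 < σ.re)
    {y : ℝ} (hy : 0 < y) : ‖Jc V a b n (σ - 1 - (a + b) + n) y‖ ≤
      2 ^ (((a + b : ℕ) : ℝ) / 2) / (σ.re - ((a + b : ℕ) : ℝ) / 2 - 1) * ‖Gamma σ‖ *
        y ^ (-(σ.re - 1)) := by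
  rw [Jc_V_eq_Zint a b n hσ hy, norm_div, norm_mul, norm_mul, norm_mul, norm_neg_I_pow, mul_one,
    norm_ofReal_cpow hy, norm_real, norm_of_nonneg pi_pos.le,
    div_le_iff₀ pi_pos]
  have h := norm_Zint_le a b n hσ ((y / π : ℝ) : ℂ)
  have h2 := mul_le_mul_of_nonneg_left h (mul_nonneg (rpow_nonneg hy.le (-(σ - 1)).re)
    (norm_nonneg (Gamma σ)))
  simp only [neg_re, sub_re, Complex.one_re] at h2 ⊢
  calc _ = _ := by ring
    _ ≤ _ := h2
    _ = _ := by ring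

/-- The coefficient of the leading term at `0`. -/
def leadCoef (a b : ℕ) (n : ℤ) (σ : ℂ) : ℂ :=
  if n = b then Gamma (σ - 1 - a) * ∏ i ∈ Finset.range a, (σ - 2 - b - i) else 0

theorem norm_Jc_V_sub_le (a b : ℕ) (n : ℤ) {σ : ℂ} {θ : ℝ} (h0 : 0 ≤ θ) (h1 : θ ≤ 1)
    (hσ : ((a + b : ℕ) : ℝ) / 2 + 1 + θ / 2 < σ.re) (hσa : 1 + a < σ.re)
    {y : ℝ} (hy : 0 < y) :
    ‖Jc V a b n (σ - 1 - (a + b) + n) y - leadCoef a b n σ * (y : ℂ) ^ (-(σ - 1))‖ ≤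
      4 * 2 ^ (((a + b : ℕ) : ℝ) / 2) / (σ.re - ((a + b : ℕ) : ℝ) / 2 - θ / 2 - 1) *
        ‖Gamma σ‖ * y ^ (-(σ.re - 1) + θ) := by
  have hσ1 : ((a + b : ℕ) : ℝ) / 2 + 1 < σ.re := by linarith
  have hpi : (π : ℂ) ≠ 0 := by exact_mod_cast pi_pos.ne'
  have hI : (-I) ^ b * (-I) ^ n ≠ 0 :=
    mul_ne_zero (pow_ne_zero _ (by simp)) (zpow_ne_zero _ (by simp))
  have hlead : leadCoef a b n σ = Gamma σ * Zint a b n σ 0 /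
      (π * ((-I) ^ b * (-I) ^ n)) := by
    rw [Gamma_mul_Zint a b n hσ1, (hasMellin_Q_zero a b n hσa).2, leadCoef]
    split_ifs with h
    · have e : (-I) ^ b * (-I) ^ n = (-1) ^ b := by
        rw [h, zpow_natCast, ← mul_pow]; congr 1; simp
      rw [e, eq_div_iff (mul_ne_zero hpi (pow_ne_zero _ (by norm_num)))]
      ring
    · simp
  have e : Jc V a b n (σ - 1 - (a + b) + n) y - leadCoef a b n σ * (y : ℂ) ^ (-(σ - 1)) =
      (y : ℂ) ^ (-(σ - 1)) * (Gamma σ * (Zint a b n σ ((y / π : ℝ) : ℂ) -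
        Zint a b n σ 0)) / (π * ((-I) ^ b * (-I) ^ n)) := by
    rw [Jc_V_eq_Zint a b n hσ1 hy, hlead]; ring
  rw [e, norm_div, norm_mul, norm_mul, norm_mul, norm_neg_I_pow, mul_one,
    norm_ofReal_cpow hy, norm_real, norm_of_nonneg pi_pos.le,
    div_le_iff₀ pi_pos]
  have h := norm_Zint_sub_le a b n h0 h1 hσ ((y / π : ℝ) : ℂ)
  have hyp : 2 * π * ‖((y / π : ℝ) : ℂ)‖ = 2 * y := by
    rw [norm_real, norm_of_nonneg (div_pos hy pi_pos).le]; field_simp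
  rw [hyp] at h
  set D := σ.re - ((a + b : ℕ) : ℝ) / 2 - θ / 2 - 1 with hD
  have hDpos : 0 < D := by linarith
  have h3 : (2 * y) ^ θ ≤ 2 * y ^ θ := by
    rw [Real.mul_rpow (by norm_num) hy.le]
    refine mul_le_mul_of_nonneg_right ?_ (rpow_nonneg hy.le _)
    simpa using Real.rpow_le_rpow_of_exponent_le (by norm_num : (1 : ℝ) ≤ 2) h1
  have h4 : ‖Zint a b n σ ((y / π : ℝ) : ℂ) - Zint a b n σ 0‖ ≤ 2 * (2 * y ^ θ) *
      (2 ^ (((a + b : ℕ) : ℝ) / 2) * (π / D)) := by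
    refine h.trans (mul_le_mul_of_nonneg_right (by linarith) ?_)
    have := pi_pos
    positivity
  have h2 := mul_le_mul_of_nonneg_left h4 (mul_nonneg (rpow_nonneg hy.le (-(σ - 1)).re)
    (norm_nonneg (Gamma σ)))
  simp only [neg_re, sub_re, Complex.one_re] at h2 ⊢
  rw [rpow_add hy]
  calc _ = _ := by ring
    _ ≤ _ := h2
    _ = _ := by ring

/-! ### The functions `j` -/

/-- The Bessel-type function of the component `m`. -/
def jB (l : ℕ) (p m : ℤ) (ν : ℂ) (y : ℝ) : ℂ :=
  Jc V ((l : ℤ) - m).toNat ((l : ℤ) + m).toNat ((l : ℤ) - p) (ν - p) y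

/-- The leading coefficient of `jB l p (-p) ν` at `0`. -/
def Dlead (l : ℕ) (p : ℤ) (ν : ℂ) : ℂ :=
  Gamma (ν + p.natAbs) * ∏ i ∈ Finset.Ico (p.natAbs + 1) (l + 1), (ν - i)

theorem jB_neg (l : ℕ) (p : ℤ) {m : ℤ} (hm : |m| ≤ (l : ℤ)) (ν : ℂ) (y : ℝ) :
    jB l (-p) m (-ν) y = jB l p m ν y := by
  have h := abs_le.1 hm
  unfold jB
  rw [← Jc_V_neg _ _ _ (ν - p)]
  congr 1
  · rw [Int.toNat_of_nonneg (by omega), Int.toNat_of_nonneg (by omega)]; ring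
  · push_cast; ring

theorem toNat_cast {k : ℤ} (h : 0 ≤ k) : ((k.toNat : ℕ) : ℂ) = (k : ℂ) := by
  rw [← Int.cast_natCast, Int.toNat_of_nonneg h]

theorem jB_swap (l : ℕ) (p : ℤ) {m : ℤ} (hm : |m| ≤ (l : ℤ)) (ν : ℂ) (y : ℝ) :
    jB l p (-m) (-ν) y = jB l p m ν y := by
  have h := abs_le.1 hm
  have e1 : ((((l : ℤ) - m).toNat : ℕ) : ℂ) = (l : ℂ) - m := by
    rw [toNat_cast (by omega)]; push_cast; ring
  have e2 : ((((l : ℤ) + m).toNat : ℕ) : ℂ) = (l : ℂ) + m := by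
    rw [toNat_cast (by omega)]; push_cast; ring
  unfold jB
  rw [← Jc_V_swap _ _ _ (ν - p), e1, e2, sub_neg_eq_add, ← sub_eq_add_neg]
  congr 1
  push_cast; ring

theorem jB_neg_neg (l : ℕ) (p : ℤ) {m : ℤ} (hm : |m| ≤ (l : ℤ)) (ν : ℂ) (y : ℝ) :
    jB l (-p) (-m) ν y = jB l p m ν y := by
  have := jB_swap l (-p) hm (-ν) y
  rw [neg_neg] at this
  rw [this, jB_neg l p hm]

theorem toNat_add_eq {l : ℕ} {m : ℤ} (hm : |m| ≤ (l : ℤ)) :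
    ((l : ℤ) - m).toNat + ((l : ℤ) + m).toNat = 2 * l := by
  have h := abs_le.1 hm
  omega

theorem jB_eq {l : ℕ} (p : ℤ) {m : ℤ} (hm : |m| ≤ (l : ℤ)) (ν : ℂ) (y : ℝ) :
    jB l p m ν y = Jc V ((l : ℤ) - m).toNat ((l : ℤ) + m).toNat ((l : ℤ) - p)
      ((l + 1 + ν) - 1 - ((((l : ℤ) - m).toNat : ℕ) + (((l : ℤ) + m).toNat : ℕ)) +
        (((l : ℤ) - p : ℤ) : ℂ)) y := by
  unfold jB
  congr 1
  rw [← Nat.cast_add, toNat_add_eq hm]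
  push_cast; ring

theorem half_cast {l : ℕ} {m : ℤ} (hm : |m| ≤ (l : ℤ)) :
    (((((l : ℤ) - m).toNat + ((l : ℤ) + m).toNat : ℕ)) : ℝ) / 2 = l := by
  rw [toNat_add_eq hm]; push_cast; ring

theorem norm_jB_le {l : ℕ} (p : ℤ) {m : ℤ} (hm : |m| ≤ (l : ℤ)) {ν : ℂ} (hν : 0 < ν.re)
    {y : ℝ} (hy : 0 < y) :
    ‖jB l p m ν y‖ ≤ 2 ^ (l : ℝ) / ν.re * ‖Gamma (l + 1 + ν)‖ * y ^ (-(l + ν.re)) := by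
  have hre : (l + 1 + ν : ℂ).re = l + 1 + ν.re := by simp
  have := norm_Jc_V_le ((l : ℤ) - m).toNat ((l : ℤ) + m).toNat ((l : ℤ) - p) (σ := l + 1 + ν)
    (by rw [half_cast hm, hre]; linarith) hy
  rw [← jB_eq p hm, half_cast hm, hre] at this
  convert this using 3
  · congr 1; ring
  · ring

theorem norm_jB_sub_le {l : ℕ} {p : ℤ} {m : ℤ} (hm : |m| ≤ (l : ℤ)) {ν : ℂ}
    {θ : ℝ} (h0 : 0 ≤ θ) (h1 : θ ≤ 1) (hν : θ / 2 < ν.re) {y : ℝ} (hy : 0 < y) :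
    ‖jB l p m ν y - (if m = -p then Dlead l p ν else 0) * (y : ℂ) ^ (-(l + ν))‖ ≤
      4 * 2 ^ (l : ℝ) / (ν.re - θ / 2) * ‖Gamma (l + 1 + ν)‖ *
        y ^ (-(l + ν.re) + θ) := by
  wlog hm0 : 0 ≤ m generalizing p m
  · have := this (p := -p) (m := -m) (by rwa [abs_neg]) (by omega)
    rw [jB_neg_neg l p hm] at this
    have e : (-m = - -p) ↔ (m = -p) := by omega
    simpa only [e, Dlead, Int.natAbs_neg] using this
  have hre : (l + 1 + ν : ℂ).re = l + 1 + ν.re := by simp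
  have hab := abs_le.1 hm
  have ha : ((((l : ℤ) - m).toNat : ℕ) : ℝ) ≤ l := by
    exact_mod_cast (by omega : ((l : ℤ) - m).toNat ≤ l)
  have := norm_Jc_V_sub_le ((l : ℤ) - m).toNat ((l : ℤ) + m).toNat ((l : ℤ) - p)
    (σ := l + 1 + ν) h0 h1 (by rw [half_cast hm, hre]; linarith) (by rw [hre]; linarith) hy
  rw [← jB_eq p hm, half_cast hm, hre] at this
  have e : leadCoef ((l : ℤ) - m).toNat ((l : ℤ) + m).toNat ((l : ℤ) - p) (l + 1 + ν) =
      if m = -p then Dlead l p ν else 0 := by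
    unfold leadCoef
    have hc : ((l : ℤ) - p = (((l : ℤ) + m).toNat : ℕ)) ↔ m = -p := by omega
    simp only [hc]
    split_ifs with h
    · have e1 : ((((l : ℤ) - m).toNat : ℕ) : ℂ) = (l : ℂ) - p.natAbs := by
        have : ((l : ℤ) - m).toNat = l - p.natAbs := by omega
        rw [this, Nat.cast_sub (by omega)]
      have e2 : ((((l : ℤ) + m).toNat : ℕ) : ℂ) = (l : ℂ) + p.natAbs := by
        have : ((l : ℤ) + m).toNat = l + p.natAbs := by omega
        rw [this, Nat.cast_add]
      have e3 : ((l : ℤ) - m).toNat = l + 1 - (p.natAbs + 1) := by omega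
      rw [Dlead, Finset.prod_Ico_eq_prod_range, ← e3, e1, e2]
      congr 1
      · congr 1; ring
      · refine Finset.prod_congr rfl fun i _ => ?_
        push_cast; ring
    · rfl
  rw [e] at this
  have e2 : -((l : ℂ) + 1 + ν - 1) = -(l + ν) := by ring
  have e3 : -((l : ℝ) + 1 + ν.re - 1) = -(l + ν.re) := by ring
  have e4 : (l : ℝ) + 1 + ν.re - l - θ / 2 - 1 = ν.re - θ / 2 := by ring
  rwa [e2, e3, e4] at this

/-! ### Bounds in vertical strips -/

/-- `F s y` decays like `exp(-π|Im s|/2)` in vertical strips, up to polynomial factors in `Im s` and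
`1/y`. -/
def StripBdd (F : ℂ → ℝ → ℂ) : Prop :=
  ∀ R : ℝ, ∃ C : ℝ, 0 ≤ C ∧ ∃ N : ℕ, ∀ s : ℂ, |s.re| ≤ R → ∀ y : ℝ, 0 < y →
    ‖F s y‖ ≤ C * ((1 + |s.im|) * (1 + y⁻¹)) ^ N * Real.exp (-π * |s.im| / 2)

theorem one_le_one_add_abs_mul (t : ℝ) {y : ℝ} (hy : 0 < y) :
    1 ≤ (1 + |t|) * (1 + y⁻¹) := by
  have h1 : 0 ≤ |t| := abs_nonneg t
  have h2 : 0 < y⁻¹ := inv_pos.2 hy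
  nlinarith [mul_nonneg h1 h2.le]

theorem StripBdd.add {F G : ℂ → ℝ → ℂ} (hF : StripBdd F) (hG : StripBdd G) :
    StripBdd fun s y => F s y + G s y := fun R => by
  obtain ⟨C, hC, N, h⟩ := hF R
  obtain ⟨C', hC', N', h'⟩ := hG R
  refine ⟨C + C', add_nonneg hC hC', max N N', fun s hs y hy => ?_⟩
  have h1 := one_le_one_add_abs_mul s.im hy
  have e1 := pow_le_pow_right₀ h1 (le_max_left N N')
  have e2 := pow_le_pow_right₀ h1 (le_max_right N N')
  have p1 : C * ((1 + |s.im|) * (1 + y⁻¹)) ^ N * Real.exp (-π * |s.im| / 2) ≤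
    C * ((1 + |s.im|) * (1 + y⁻¹)) ^ (max N N') * Real.exp (-π * |s.im| / 2) := by gcongr
  have p2 : C' * ((1 + |s.im|) * (1 + y⁻¹)) ^ N' * Real.exp (-π * |s.im| / 2) ≤
    C' * ((1 + |s.im|) * (1 + y⁻¹)) ^ (max N N') * Real.exp (-π * |s.im| / 2) := by gcongr
  calc _ ≤ _ := norm_add_le _ _
    _ ≤ _ := add_le_add ((h s hs y hy).trans p1) ((h' s hs y hy).trans p2)
    _ = _ := by ring

theorem StripBdd.mul_of_le {F G : ℂ → ℝ → ℂ} (hF : StripBdd F)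
    (hG : ∀ R : ℝ, ∃ A : ℝ, 0 ≤ A ∧ ∀ s : ℂ, |s.re| ≤ R → ∀ y : ℝ, 0 < y →
      ‖G s y‖ ≤ A * ((1 + |s.im|) * (1 + y⁻¹))) :
    StripBdd fun s y => G s y * F s y := fun R => by
  obtain ⟨C, hC, N, h⟩ := hF R
  obtain ⟨A, hA, h'⟩ := hG R
  refine ⟨A * C, mul_nonneg hA hC, N + 1, fun s hs y hy => ?_⟩
  have h1 := one_le_one_add_abs_mul s.im hy
  rw [norm_mul]
  refine (mul_le_mul (h' s hs y hy) (h s hs y hy) (norm_nonneg _) (by positivity)).trans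
    (le_of_eq (by ring))

theorem StripBdd.const_mul {F : ℂ → ℝ → ℂ} (hF : StripBdd F) (c : ℂ) :
    StripBdd fun s y => c * F s y :=
  hF.mul_of_le fun _ => ⟨‖c‖, norm_nonneg c, fun s _ _ hy =>
    le_mul_of_one_le_right (norm_nonneg c) (one_le_one_add_abs_mul s.im hy)⟩

theorem StripBdd.sub {F G : ℂ → ℝ → ℂ} (hF : StripBdd F) (hG : StripBdd G) :
    StripBdd fun s y => F s y - G s y := by
  have := hF.add (hG.const_mul (-1))
  simpa [sub_eq_add_neg] using this

theorem StripBdd.div_mul {F : ℂ → ℝ → ℂ} (hF : StripBdd F) (c : ℂ) :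
    StripBdd fun s y => (c / y : ℂ) * F s y :=
  hF.mul_of_le fun _ => ⟨‖c‖, norm_nonneg c, fun s _ y hy => by
    rw [norm_div, norm_real, norm_of_nonneg hy.le, div_eq_mul_inv]
    refine mul_le_mul_of_nonneg_left ?_ (norm_nonneg c)
    have h1 : 0 ≤ |s.im| := abs_nonneg _
    have h2 : 0 < y⁻¹ := inv_pos.2 hy
    nlinarith [mul_nonneg h1 h2.le]⟩

theorem StripBdd.shift {F : ℂ → ℝ → ℂ} (hF : StripBdd F) (c : ℝ) :
    StripBdd fun s y => F (s + c) y := fun R => by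
  obtain ⟨C, hC, N, h⟩ := hF (R + |c|)
  refine ⟨C, hC, N, fun s hs y hy => ?_⟩
  have := h (s + c) (by
    rw [add_re, Complex.ofReal_re]; exact (abs_add_le _ _).trans (by linarith)) y hy
  simpa using this

theorem rpow_neg_le_one_add_inv {y x : ℝ} (hy : 0 < y) {K : ℕ} (h0 : 0 ≤ x) (h : x ≤ K) :
    y ^ (-x) ≤ (1 + y⁻¹) ^ K := by
  have h2 : 0 < y⁻¹ := inv_pos.2 hy
  rw [Real.rpow_neg hy.le, ← Real.inv_rpow hy.le, ← rpow_natCast]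
  refine (Real.rpow_le_rpow h2.le (by linarith : y⁻¹ ≤ 1 + y⁻¹) h0).trans ?_
  exact Real.rpow_le_rpow_of_exponent_le (by linarith) h

theorem V_stripBdd_right (R : ℝ) : ∃ C : ℝ, 0 ≤ C ∧ ∃ N : ℕ, ∀ s : ℂ, 1 ≤ s.re → s.re ≤ R →
    ∀ y : ℝ, 0 < y →
      ‖V s y‖ ≤ C * ((1 + |s.im|) * (1 + y⁻¹)) ^ N * Real.exp (-π * |s.im| / 2) := by
  obtain ⟨C, hC, n, h⟩ := exists_norm_Gamma_le (x₁ := 2) two_pos (R + 1)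
  obtain ⟨K, hK⟩ := exists_nat_ge R
  refine ⟨C, hC, max n K, fun s h1 h2 y hy => ?_⟩
  have hJ := norm_Jc_V_le 0 0 0 (σ := s + 1) (by simp; linarith) hy
  have hre : (s + 1).re = s.re + 1 := by simp
  have him : (s + 1).im = s.im := by simp
  have e : Jc V 0 0 0 (s + 1 - 1 - (((0 : ℕ) : ℂ) + ((0 : ℕ) : ℂ)) + ((0 : ℤ) : ℂ)) y = V s y := by
    simp [Jc, binZ_zero]
  have hG := h (s + 1) (by rw [hre]; linarith) (by rw [hre]; linarith)
  rw [e, hre] at hJ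
  rw [him] at hG
  have h3 : (2 : ℝ) ^ (((0 + 0 : ℕ) : ℝ) / 2) / (s.re + 1 - ((0 + 0 : ℕ) : ℝ) / 2 - 1) ≤ 1 := by
    rw [div_le_one (by simp; linarith)]; simp; linarith
  have h4 : y ^ (-(s.re + 1 - 1)) ≤ (1 + y⁻¹) ^ K := by
    rw [add_sub_cancel_right]
    exact rpow_neg_le_one_add_inv hy (by linarith) (by linarith)
  have hi : 0 < y⁻¹ := inv_pos.2 hy
  have ha : 0 ≤ |s.im| := abs_nonneg _
  have h5 : (1 + |s.im|) ^ n ≤ (1 + |s.im|) ^ (max n K) :=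
    pow_le_pow_right₀ (by linarith) (le_max_left _ _)
  have h6 : (1 + y⁻¹) ^ K ≤ (1 + y⁻¹) ^ (max n K) :=
    pow_le_pow_right₀ (by linarith) (le_max_right _ _)
  have hexp := Real.exp_pos (-π * |s.im| / 2)
  calc ‖V s y‖ ≤ _ := hJ
    _ ≤ 1 * (C * (1 + |s.im|) ^ n * Real.exp (-π * |s.im| / 2)) * (1 + y⁻¹) ^ K := by
      gcongr
    _ ≤ 1 * (C * (1 + |s.im|) ^ (max n K) * Real.exp (-π * |s.im| / 2)) *
        (1 + y⁻¹) ^ (max n K) := by gcongr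
    _ = _ := by rw [mul_pow]; ring

theorem V_stripBdd : StripBdd V := fun R => by
  obtain ⟨C, hC, N, h⟩ := V_stripBdd_right (R + 2)
  have key : ∀ s : ℂ, 0 ≤ s.re → s.re ≤ R → ∀ y : ℝ, 0 < y →
      ‖V s y‖ ≤ (C + (|R| + 1) * C) * ((1 + |s.im|) * (1 + y⁻¹)) ^ (N + 1) *
        Real.exp (-π * |s.im| / 2) := by
    intro s h0 hR y hy
    have hy' : (y : ℂ) ≠ 0 := by exact_mod_cast hy.ne'
    have e : V s y = V (s + 2) y - (s + 1) / y * V (s + 1) y := by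
      have := V_rec hy (s + 1)
      have e1 : s + 1 + 1 = s + 2 := by ring
      rw [e1, add_sub_cancel_right] at this
      field_simp
      linear_combination this
    have b1 := h (s + 2) (by simp; linarith) (by simp; linarith) y hy
    have b2 := h (s + 1) (by simp; linarith) (by simp; linarith) y hy
    simp only [Complex.add_im, Complex.im_ofNat, Complex.one_im, add_zero] at b1 b2
    have h1 := one_le_one_add_abs_mul s.im hy
    have hi : 0 < y⁻¹ := inv_pos.2 hy
    have ha : 0 ≤ |s.im| := abs_nonneg _
    have b3 : ‖(s + 1) / (y : ℂ)‖ ≤ (|R| + 1) * ((1 + |s.im|) * (1 + y⁻¹)) := by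
      rw [norm_div, norm_real, norm_of_nonneg hy.le, div_eq_mul_inv]
      have c1 : ‖s + 1‖ ≤ (|R| + 1) * (1 + |s.im|) := by
        refine (Complex.norm_le_abs_re_add_abs_im _).trans ?_
        simp only [add_re, Complex.one_re, Complex.add_im, Complex.one_im, add_zero]
        rw [abs_of_nonneg (by linarith)]
        have := le_abs_self R
        nlinarith [mul_nonneg (abs_nonneg R) ha]
      rw [← mul_assoc]
      exact mul_le_mul c1 (by linarith) hi.le (by positivity)
    set X := (1 + |s.im|) * (1 + y⁻¹)
    set E := Real.exp (-π * |s.im| / 2)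
    have hE : 0 < E := Real.exp_pos _
    have b4 : C * X ^ N * E ≤ C * X ^ (N + 1) * E := by
      have := pow_le_pow_right₀ h1 (Nat.le_succ N)
      gcongr
    rw [e]
    calc _ ≤ ‖V (s + 2) y‖ + ‖(s + 1) / (y : ℂ) * V (s + 1) y‖ := norm_sub_le _ _
      _ ≤ C * X ^ (N + 1) * E + (|R| + 1) * X * (C * X ^ N * E) := by
        rw [norm_mul]
        refine add_le_add (b1.trans b4) (mul_le_mul b3 b2 (norm_nonneg _) (by positivity))
      _ = _ := by ring
  refine ⟨C + (|R| + 1) * C, by positivity, N + 1, fun s hs y hy => ?_⟩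
  rcases le_total 0 s.re with h0 | h0
  · exact key s h0 ((le_abs_self _).trans hs) y hy
  · have := key (-s) (by simpa using h0) (by
      rw [neg_re]; exact (neg_le_abs _).trans hs) y hy
    rwa [V_neg, Complex.neg_im, abs_neg] at this

theorem Jc_V_stripBdd (a b : ℕ) (n : ℤ) : StripBdd (Jc V a b n) := by
  induction a generalizing b n with
  | zero => exact V_stripBdd.const_mul (binZ b n)
  | succ a ih =>
    have h1 := (ih b n).shift 1
    have h2 := (ih b (n - 1)).shift (-1)
    have h3 := (ih (b - 1) (n - 1)).div_mul (b : ℂ)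
    have := (h1.add h2).sub h3
    simpa [Jc, sub_eq_add_neg] using this

theorem jB_eq_shift (l : ℕ) (p m : ℤ) : jB l p m = fun s y =>
    Jc V ((l : ℤ) - m).toNat ((l : ℤ) + m).toNat ((l : ℤ) - p) (s + ((-p : ℝ) : ℂ)) y := by
  ext s y
  rw [jB]
  congr 1
  push_cast; ring

theorem jB_stripBdd (l : ℕ) (p m : ℤ) : StripBdd (jB l p m) := by
  rw [jB_eq_shift]
  exact (Jc_V_stripBdd ((l : ℤ) - m).toNat ((l : ℤ) + m).toNat ((l : ℤ) - p)).shift (-p)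

/-- `F s y` decays exponentially in `y`, locally uniformly in `Re s`. -/
def ExpDecay (F : ℂ → ℝ → ℂ) : Prop :=
  ∀ R : ℝ, ∃ C : ℝ, 0 ≤ C ∧ ∀ s : ℂ, |s.re| ≤ R → ∀ y : ℝ, 1 ≤ y →
    ‖F s y‖ ≤ C * Real.exp (-2 * y)

theorem ExpDecay.add {F G : ℂ → ℝ → ℂ} (hF : ExpDecay F) (hG : ExpDecay G) :
    ExpDecay fun s y => F s y + G s y := fun R => by
  obtain ⟨C, hC, h⟩ := hF R
  obtain ⟨C', hC', h'⟩ := hG R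
  refine ⟨C + C', add_nonneg hC hC', fun s hs y hy => ?_⟩
  rw [add_mul]
  exact (norm_add_le _ _).trans (add_le_add (h s hs y hy) (h' s hs y hy))

theorem ExpDecay.mul_of_le {F : ℂ → ℝ → ℂ} (hF : ExpDecay F) {G : ℝ → ℂ} {A : ℝ}
    (hG : ∀ y : ℝ, 1 ≤ y → ‖G y‖ ≤ A) : ExpDecay fun s y => G y * F s y := fun R => by
  obtain ⟨C, hC, h⟩ := hF R
  have hA : 0 ≤ A := (norm_nonneg _).trans (hG 1 le_rfl)
  refine ⟨A * C, mul_nonneg hA hC, fun s hs y hy => ?_⟩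
  rw [norm_mul, mul_assoc]
  exact mul_le_mul (hG y hy) (h s hs y hy) (norm_nonneg _) hA

theorem ExpDecay.shift {F : ℂ → ℝ → ℂ} (hF : ExpDecay F) (c : ℝ) :
    ExpDecay fun s y => F (s + c) y := fun R => by
  obtain ⟨C, hC, h⟩ := hF (R + |c|)
  refine ⟨C, hC, fun s hs y hy => h (s + c) (by
    rw [add_re, Complex.ofReal_re]; exact (abs_add_le _ _).trans (by linarith)) y hy⟩

theorem V_expDecay : ExpDecay V := fun R => by
  refine ⟨Real.exp 2 * (VR (-R) 1 + VR R 1),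
    mul_nonneg (Real.exp_pos _).le (add_nonneg (VR_nonneg _ _) (VR_nonneg _ _)),
    fun s hs y hy => ?_⟩
  have hs' := abs_le.1 hs
  calc ‖V s y‖ ≤ VR s.re y := norm_V_le s y
    _ ≤ Real.exp (-2 * (y - 1)) * VR s.re 1 := VR_le_exp_mul one_pos hy _
    _ ≤ Real.exp (-2 * (y - 1)) * (VR (-R) 1 + VR R 1) :=
      mul_le_mul_of_nonneg_left (VR_le_add one_pos hs'.1 hs'.2) (Real.exp_pos _).le
    _ = _ := by
      have : Real.exp (-2 * (y - 1)) = Real.exp 2 * Real.exp (-2 * y) := by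
        rw [← Real.exp_add]; congr 1; ring
      rw [this]; ring

theorem Jc_V_expDecay (a b : ℕ) (n : ℤ) : ExpDecay (Jc V a b n) := by
  induction a generalizing b n with
  | zero => exact V_expDecay.mul_of_le (G := fun _ => binZ b n) fun _ _ => le_rfl
  | succ a ih =>
    have h1 := (ih b n).shift 1
    have h2 := (ih b (n - 1)).shift (-1)
    have h3 := (ih (b - 1) (n - 1)).mul_of_le (G := fun y : ℝ => (-(b / y) : ℂ)) (A := b)
      fun y hy => by
        rw [norm_neg, norm_div, norm_real, norm_of_nonneg (by linarith),
          Complex.norm_natCast]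
        exact div_le_self (by positivity) hy
    have := (h1.add h2).add h3
    simpa [Jc, sub_eq_add_neg] using this

theorem jB_expDecay (l : ℕ) (p m : ℤ) : ExpDecay (jB l p m) := by
  rw [jB_eq_shift]
  exact (Jc_V_expDecay ((l : ℤ) - m).toNat ((l : ℤ) + m).toNat ((l : ℤ) - p)).shift (-p)

theorem jB_differentiable (l : ℕ) (p m : ℤ) {y : ℝ} (hy : 0 < y) :
    Differentiable ℂ fun ν => jB l p m ν y :=
  (Jc_V_differentiable _ _ _ hy).comp (differentiable_id.sub_const (p : ℂ))

theorem jB_conj (l : ℕ) (p m : ℤ) (ν : ℂ) (y : ℝ) :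
    conj (jB l p m ν y) = jB l p m (conj ν) y := by
  rw [jB, Jc_V_conj, map_sub]; simp [jB]

/-! ### Contour integrals along vertical lines -/

theorem line_re (x t : ℝ) : ((x : ℂ) + t * I).re = x := by simp
theorem line_im (x t : ℝ) : ((x : ℂ) + t * I).im = t := by simp

theorem integrable_line {F : ℂ → ℂ} {x C : ℝ}
    (hF : ∀ z : ℂ, z.re = x → ContinuousAt F z)
    (hb : ∀ z : ℂ, z.re = x → ‖F z‖ ≤ C * (1 + z.im ^ 2)⁻¹) :
    Integrable fun t : ℝ => F (x + t * I) := by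
  refine (integrable_inv_one_add_sq.const_mul C).mono' ?_ (Eventually.of_forall fun t => ?_)
  · refine Continuous.aestronglyMeasurable (continuous_iff_continuousAt.2 fun t => ?_)
    exact ContinuousAt.comp (f := fun t : ℝ => (x : ℂ) + t * I) (hF _ (line_re x t))
      (by fun_prop)
  · have := hb _ (line_re x t)
    rwa [line_im] at this

theorem integral_vertical_eq {F : ℂ → ℂ} {x₁ x₂ C : ℝ} (hx : x₁ ≤ x₂)
    (hF : ∀ z : ℂ, x₁ ≤ z.re → z.re ≤ x₂ → DifferentiableAt ℂ F z)
    (hb : ∀ z : ℂ, x₁ ≤ z.re → z.re ≤ x₂ → ‖F z‖ ≤ C * (1 + z.im ^ 2)⁻¹) :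
    ∫ t : ℝ, F (x₁ + t * I) = ∫ t : ℝ, F (x₂ + t * I) := by
  have i1 := integrable_line (F := F) (x := x₁) (C := C)
    (fun z hz => (hF z hz.ge (hz.le.trans hx)).continuousAt)
    (fun z hz => hb z hz.ge (hz.le.trans hx))
  have i2 := integrable_line (F := F) (x := x₂) (C := C)
    (fun z hz => (hF z (hx.trans hz.ge) hz.le).continuousAt)
    (fun z hz => hb z (hx.trans hz.ge) hz.le)
  have t1 := intervalIntegral_tendsto_integral i1 tendsto_neg_atTop_atBot tendsto_id
  have t2 := intervalIntegral_tendsto_integral i2 tendsto_neg_atTop_atBot tendsto_id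
  have hor : ∀ ε : ℝ, ε = 1 ∨ ε = -1 → Tendsto (fun T : ℝ =>
      ∫ x in x₁..x₂, F (x + ((ε * T : ℝ) : ℂ) * I)) atTop (𝓝 0) := by
    intro ε hε
    have hε2 : ε ^ 2 = 1 := by rcases hε with h | h <;> simp [h]
    have hlim : Tendsto (fun T : ℝ => C * (1 + T ^ 2)⁻¹ * |x₂ - x₁|) atTop (𝓝 0) := by
      have h1 : Tendsto (fun T : ℝ => (1 + T ^ 2)⁻¹) atTop (𝓝 0) :=
        tendsto_inv_atTop_zero.comp (tendsto_atTop_add_const_left _ _ (tendsto_pow_atTop two_ne_zero))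
      simpa using (h1.const_mul C).mul_const |x₂ - x₁|
    refine squeeze_zero_norm (fun T => ?_) hlim
    refine intervalIntegral.norm_integral_le_of_norm_le_const fun x hx' => ?_
    rw [uIoc_of_le hx] at hx'
    have := hb (x + ((ε * T : ℝ) : ℂ) * I) (by rw [line_re]; exact hx'.1.le)
      (by rw [line_re]; exact hx'.2)
    rwa [line_im, mul_pow, hε2, one_mul] at this
  have hrect : ∀ T : ℝ, (∫ t in (-T)..T, F (x₁ + t * I)) =
      (∫ t in (-T)..T, F (x₂ + t * I)) - I *
        ((∫ x in x₁..x₂, F (x + (((-1) * T : ℝ) : ℂ) * I)) -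
          ∫ x in x₁..x₂, F (x + ((1 * T : ℝ) : ℂ) * I)) := by
    intro T
    have h := Complex.integral_boundary_rect_eq_zero_of_differentiableOn F
      (x₁ + ((-T : ℝ) : ℂ) * I) (x₂ + (T : ℂ) * I) (by
        intro z hz
        rw [Complex.mem_reProdIm, line_re, line_re, uIcc_of_le hx] at hz
        exact (hF z hz.1.1 hz.1.2).differentiableWithinAt)
    simp only [line_re, line_im, smul_eq_mul] at h
    rw [neg_one_mul, one_mul]
    linear_combination (I) * h - ((∫ t in (-T)..T, F (x₂ + t * I)) -
      (∫ t in (-T)..T, F (x₁ + t * I))) * I_sq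
  refine tendsto_nhds_unique t1 ?_
  have := t2.sub (((hor (-1) (Or.inr rfl)).sub (hor 1 (Or.inl rfl))).const_mul I)
  simp only [sub_zero, mul_zero] at this
  refine this.congr fun T => ?_
  simp only [id]
  rw [hrect T]

theorem integral_div_sq_add_sq {a : ℝ} (ha : 0 < a) :
    Integrable (fun t : ℝ => a / (a ^ 2 + t ^ 2)) ∧ ∫ t : ℝ, a / (a ^ 2 + t ^ 2) = π := by
  have e : (fun t : ℝ => a / (a ^ 2 + t ^ 2)) = fun t => a⁻¹ * (1 + (a⁻¹ * t) ^ 2)⁻¹ := by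
    ext t
    have : a ^ 2 + t ^ 2 ≠ 0 := by positivity
    field_simp
  rw [e]
  refine ⟨(integrable_inv_one_add_sq.comp_mul_left' (inv_ne_zero ha.ne')).const_mul _, ?_⟩
  rw [integral_const_mul, Measure.integral_comp_mul_left (fun t : ℝ => (1 + t ^ 2)⁻¹),
    integral_univ_inv_one_add_sq, inv_inv, abs_of_pos ha, smul_eq_mul]
  field_simp

theorem integral_odd_eq_zero {f : ℝ → ℂ} (h : ∀ t, f (-t) = -f t) : ∫ t, f t = 0 := by
  have h1 := integral_neg_eq_self f volume
  simp only [h, integral_neg] at h1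
  have : (2 : ℂ) * ∫ t, f t = 0 := by linear_combination -h1
  simpa using this

theorem integral_inv_sub_inv {a c : ℝ} (ha : a ≠ 0) (hc : 0 < c) :
    Integrable (fun t : ℝ => 1 / ((a : ℂ) + t * I) - 1 / ((c : ℂ) + t * I)) ∧
    ∫ t : ℝ, (1 / ((a : ℂ) + t * I) - 1 / ((c : ℂ) + t * I)) =
      if 0 < a then 0 else -2 * π := by
  have hq : ∀ b : ℝ, b ≠ 0 → ∀ t : ℝ, 1 / ((b : ℂ) + t * I) =
      ((b / (b ^ 2 + t ^ 2) : ℝ) : ℂ) - ((t / (b ^ 2 + t ^ 2) : ℝ) : ℂ) * I := by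
    intro b hb t
    have h1 : (b : ℂ) + t * I ≠ 0 := by
      intro h; have := congrArg Complex.re h; rw [line_re] at this; exact hb this
    have h2 : (b : ℂ) ^ 2 + t ^ 2 ≠ 0 := by
      have : b ^ 2 + t ^ 2 ≠ 0 := by positivity
      exact_mod_cast this
    rw [div_eq_iff h1]
    push_cast
    field_simp
    linear_combination ((t : ℂ) ^ 2) * I_sq
  have habs : Integrable (fun t : ℝ => a / (a ^ 2 + t ^ 2)) ∧
      ∫ t : ℝ, a / (a ^ 2 + t ^ 2) = if 0 < a then π else -π := by
    split_ifs with h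
    · exact integral_div_sq_add_sq h
    · have h' : 0 < -a := by
        rcases lt_or_gt_of_ne ha with h1 | h1
        · linarith
        · exact absurd h1 h
      have := integral_div_sq_add_sq h'
      have e : (fun t : ℝ => a / (a ^ 2 + t ^ 2)) = fun t => -(-a / ((-a) ^ 2 + t ^ 2)) := by
        ext t; rw [neg_sq]; ring
      rw [e]
      exact ⟨this.1.neg, by rw [integral_neg, this.2]⟩
  obtain ⟨ic, hcI⟩ := integral_div_sq_add_sq hc
  have e : (fun t : ℝ => 1 / ((a : ℂ) + t * I) - 1 / ((c : ℂ) + t * I)) =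
      fun t : ℝ => (((a / (a ^ 2 + t ^ 2) - c / (c ^ 2 + t ^ 2) : ℝ) : ℂ) +
        (-((t / (a ^ 2 + t ^ 2) - t / (c ^ 2 + t ^ 2) : ℝ) : ℂ) * I)) := by
    ext t
    rw [hq a ha, hq c hc.ne']
    push_cast; ring
  have i1 : Integrable fun t : ℝ => ((a / (a ^ 2 + t ^ 2) - c / (c ^ 2 + t ^ 2) : ℝ) : ℂ) :=
    (habs.1.sub ic).ofReal
  have i0 : Integrable fun t : ℝ => t / (a ^ 2 + t ^ 2) - t / (c ^ 2 + t ^ 2) := by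
    have e0 : (fun t : ℝ => t / (a ^ 2 + t ^ 2) - t / (c ^ 2 + t ^ 2)) =
        fun t : ℝ => ((c ^ 2 - a ^ 2) / a * (t / (c ^ 2 + t ^ 2))) * (a / (a ^ 2 + t ^ 2)) := by
      ext t
      have h1 : a ^ 2 + t ^ 2 ≠ 0 := by positivity
      have h2 : c ^ 2 + t ^ 2 ≠ 0 := by positivity
      field_simp
      ring
    rw [e0]
    refine habs.1.bdd_mul (c := |(c ^ 2 - a ^ 2) / a| * (1 / c)) ?_ ?_
    · refine Continuous.aestronglyMeasurable ?_
      refine continuous_const.mul (continuous_id.div (by fun_prop) fun t => ?_)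
      positivity
    · refine Eventually.of_forall fun t => ?_
      rw [norm_mul, Real.norm_eq_abs, Real.norm_eq_abs]
      refine mul_le_mul_of_nonneg_left ?_ (abs_nonneg _)
      have h2 : 0 < c ^ 2 + t ^ 2 := by positivity
      rw [abs_div, abs_of_pos h2, div_le_div_iff₀ h2 hc]
      nlinarith [sq_nonneg (c - |t|), sq_abs t, abs_nonneg t]
  have i2 : Integrable fun t : ℝ =>
      (-((t / (a ^ 2 + t ^ 2) - t / (c ^ 2 + t ^ 2) : ℝ) : ℂ) * I) :=
    (i0.ofReal.neg).mul_const _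
  have i3 := integral_odd_eq_zero (f := fun t : ℝ =>
    (-((t / (a ^ 2 + t ^ 2) - t / (c ^ 2 + t ^ 2) : ℝ) : ℂ) * I))
    (fun t => by rw [neg_sq]; push_cast; ring)
  rw [e]
  refine ⟨i1.add i2, ?_⟩
  rw [integral_add i1 i2, i3, add_zero, integral_complex_ofReal, integral_sub habs.1 ic, habs.2, hcI]
  split_ifs <;> push_cast <;> ring

theorem one_add_sq_le_mul_sub_sq (t τ : ℝ) (h : 1 ≤ |t - τ|) :
    1 + t ^ 2 ≤ (3 + 2 * τ ^ 2) * (t - τ) ^ 2 := by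
  have h1 : 1 ≤ (t - τ) ^ 2 := by rw [← sq_abs]; nlinarith
  nlinarith [sq_nonneg (t - 2 * τ), mul_nonneg (sq_nonneg τ) (sub_nonneg.2 h1)]

/-- The residue theorem for a simple pole between two vertical lines. -/
theorem integral_vertical_sub {A : ℂ → ℂ} {x₁ x₂ C : ℝ} {ν₀ : ℂ} (h1 : x₁ < ν₀.re)
    (h2 : ν₀.re < x₂) (hA : ∀ z : ℂ, x₁ ≤ z.re → z.re ≤ x₂ → DifferentiableAt ℂ A z)
    (hb : ∀ z : ℂ, x₁ ≤ z.re → z.re ≤ x₂ → ‖A z‖ ≤ C * (1 + z.im ^ 2)⁻¹) :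
    (∫ t : ℝ, A (x₂ + t * I) / (x₂ + t * I - ν₀)) -
      ∫ t : ℝ, A (x₁ + t * I) / (x₁ + t * I - ν₀) = 2 * π * A ν₀ := by
  have hC : 0 ≤ C := by
    have := (norm_nonneg _).trans (hb ν₀ h1.le h2.le)
    exact nonneg_of_mul_nonneg_left this (by positivity)
  set M : ℝ := ν₀.re - x₁ + 1 with hM
  set B : ℂ → ℂ := fun z => A z - A ν₀ * (M / (z - ν₀ + M)) with hB
  have hMne : ∀ z : ℂ, x₁ ≤ z.re → 1 ≤ ‖z - ν₀ + M‖ := fun z hz => by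
    refine le_trans ?_ (abs_re_le_norm _)
    refine le_trans ?_ (le_abs_self _)
    simp [hM]; linarith
  have hMne' : ∀ z : ℂ, x₁ ≤ z.re → z - ν₀ + M ≠ 0 := fun z hz =>
    norm_ne_zero_iff.1 (by linarith [hMne z hz])
  have hMpos : (M : ℂ) ≠ 0 := by
    have : 0 < M := by linarith
    exact_mod_cast this.ne'
  have hB0 : B ν₀ = 0 := by simp [hB, hMpos]
  have hBd : ∀ z : ℂ, x₁ ≤ z.re → z.re ≤ x₂ → DifferentiableAt ℂ B z := fun z hz1 hz2 => by
    refine (hA z hz1 hz2).sub (DifferentiableAt.const_mul ?_ _)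
    exact (differentiableAt_const _).div (by fun_prop) (hMne' z hz1)
  set H : ℂ → ℂ := dslope B ν₀ with hH
  have hHne : ∀ z, z ≠ ν₀ → H z = B z / (z - ν₀) := fun z hz => by
    rw [hH, dslope_of_ne _ hz, slope_def_field, hB0, sub_zero]
  have hHd : ∀ z : ℂ, x₁ ≤ z.re → z.re ≤ x₂ → DifferentiableAt ℂ H z := fun z hz1 hz2 => by
    by_cases hz : z = ν₀
    · subst hz
      have hs : {w : ℂ | x₁ < w.re ∧ w.re < x₂} ∈ 𝓝 z := by
        apply IsOpen.mem_nhds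
        · exact (isOpen_lt continuous_const continuous_re).inter
            (isOpen_lt continuous_re continuous_const)
        · exact ⟨h1, h2⟩
      have := (Complex.differentiableOn_dslope (f := B) hs).2
        (fun w hw => (hBd w hw.1.le hw.2.le).differentiableWithinAt)
      exact this.differentiableAt hs
    · exact (differentiableAt_dslope_of_ne hz).2 (hBd z hz1 hz2)
  set K : ℝ := 3 + 2 * ν₀.im ^ 2 with hK
  obtain ⟨D, hD⟩ : ∃ D, ∀ z ∈ Icc x₁ x₂ ×ℂ Icc (ν₀.im - 1) (ν₀.im + 1), ‖H z‖ ≤ D := by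
    refine (isCompact_Icc.reProdIm isCompact_Icc).exists_bound_of_continuousOn fun z hz => ?_
    rw [Complex.mem_reProdIm] at hz
    exact (hHd z hz.1.1 hz.1.2).continuousAt.continuousWithinAt
  have hHb : ∀ z : ℂ, x₁ ≤ z.re → z.re ≤ x₂ → ‖H z‖ ≤
      (max D 0 * (1 + (|ν₀.im| + 1) ^ 2) + (C + ‖A ν₀‖ * |M| * K)) * (1 + z.im ^ 2)⁻¹ := by
    intro z hz1 hz2
    have hpos : 0 < 1 + z.im ^ 2 := by positivity
    rw [← div_eq_mul_inv, le_div_iff₀ hpos]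
    have hKpos : 0 ≤ K := by positivity
    rcases le_total |z.im - ν₀.im| 1 with h | h
    · have h' := abs_le.1 h
      have hd := (hD z (by
        rw [Complex.mem_reProdIm]
        exact ⟨⟨hz1, hz2⟩, ⟨by linarith, by linarith⟩⟩)).trans (le_max_left D 0)
      have h3 : 1 + z.im ^ 2 ≤ 1 + (|ν₀.im| + 1) ^ 2 := by
        have : |z.im| ≤ |ν₀.im| + 1 := by
          have := abs_sub_abs_le_abs_sub z.im ν₀.im; linarith
        have h4 := abs_nonneg z.im
        rw [← sq_abs z.im]; nlinarith
      have h5 := mul_le_mul hd h3 hpos.le (le_max_right D 0)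
      have h6 : 0 ≤ C + ‖A ν₀‖ * |M| * K := by positivity
      linarith
    · have hn : |z.im - ν₀.im| ≤ ‖z - ν₀‖ := by
        have := Complex.abs_im_le_norm (z - ν₀); rwa [Complex.sub_im] at this
      have hn1 : 1 ≤ ‖z - ν₀‖ := h.trans hn
      have hz : z ≠ ν₀ := by rintro rfl; simp at hn1; linarith
      have hn2 : |z.im - ν₀.im| ≤ ‖z - ν₀ + M‖ := by
        have := Complex.abs_im_le_norm (z - ν₀ + M); simpa using this
      have hsq := one_add_sq_le_mul_sub_sq z.im ν₀.im h
      have e : H z = A z / (z - ν₀) - A ν₀ * M * (1 / ((z - ν₀) * (z - ν₀ + M))) := by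
        rw [hHne z hz, hB]
        have := hMne' z hz1
        have := sub_ne_zero.2 hz
        field_simp
      have b1 : ‖A z / (z - ν₀)‖ * (1 + z.im ^ 2) ≤ C := by
        rw [norm_div]
        have : ‖A z‖ / ‖z - ν₀‖ ≤ ‖A z‖ := div_le_self (norm_nonneg _) hn1
        have h3 := hb z hz1 hz2
        rw [← div_eq_mul_inv, le_div_iff₀ hpos] at h3
        exact (mul_le_mul_of_nonneg_right this hpos.le).trans h3
      have b2 : ‖1 / ((z - ν₀) * (z - ν₀ + M))‖ * (1 + z.im ^ 2) ≤ K := by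
        rw [norm_div, norm_one, norm_mul, div_mul_eq_mul_div, one_mul,
          div_le_iff₀ (mul_pos (by linarith) (by linarith [hMne z hz1]))]
        refine hsq.trans (mul_le_mul_of_nonneg_left ?_ hKpos)
        rw [← sq_abs, sq]
        exact mul_le_mul hn hn2 (abs_nonneg _) (norm_nonneg _)
      rw [e]
      have b3 : ‖A z / (z - ν₀) - A ν₀ * M * (1 / ((z - ν₀) * (z - ν₀ + M)))‖ ≤
          ‖A z / (z - ν₀)‖ + ‖A ν₀‖ * |M| * ‖1 / ((z - ν₀) * (z - ν₀ + M))‖ := by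
        refine (norm_sub_le _ _).trans (le_of_eq ?_)
        rw [norm_mul (A ν₀ * M), norm_mul, norm_real, Real.norm_eq_abs]
      have b4 := mul_le_mul_of_nonneg_left b2 (by positivity : 0 ≤ ‖A ν₀‖ * |M|)
      have b5 := mul_le_mul_of_nonneg_right b3 hpos.le
      have b6 : 0 ≤ max D 0 * (1 + (|ν₀.im| + 1) ^ 2) :=
        mul_nonneg (le_max_right _ _) (by positivity)
      nlinarith
  have hshift := integral_vertical_eq (h1.trans h2).le hHd hHb
  have line : ∀ x : ℝ, x₁ ≤ x → x ≤ x₂ → x ≠ ν₀.re →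
      (∫ t : ℝ, A (x + t * I) / (x + t * I - ν₀)) =
        (∫ t : ℝ, H (x + t * I)) + A ν₀ * (if 0 < x - ν₀.re then 0 else -2 * π) := by
    intro x hx1 hx2 hxne
    have hne : ∀ t : ℝ, (x : ℂ) + t * I ≠ ν₀ := fun t h => by
      have := congrArg Complex.re h; rw [line_re] at this; exact hxne this
    have hk := integral_inv_sub_inv (sub_ne_zero.2 hxne) (c := x - ν₀.re + M)
      (by rw [hM]; linarith)
    have iH := integrable_line (F := H) (x := x)
      (fun z hz => (hHd z (hx1.trans hz.ge) (hz.le.trans hx2)).continuousAt)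
      (fun z hz => hHb z (hx1.trans hz.ge) (hz.le.trans hx2))
    have hk1 := hk.1.comp_sub_right ν₀.im
    have hk2 := integral_sub_right_eq_self (fun t : ℝ => 1 / (((x - ν₀.re : ℝ) : ℂ) + t * I)
      - 1 / (((x - ν₀.re + M : ℝ) : ℂ) + t * I)) (μ := volume) ν₀.im
    rw [hk.2] at hk2
    have hk3 := hk1.const_mul (A ν₀)
    rw [← hk2, ← integral_const_mul, ← integral_add iH hk3]
    congr 1; ext t
    rw [hHne _ (hne t), hB]
    have e0 : ∀ c : ℂ, c + ((t - ν₀.im : ℝ) : ℂ) * I = c + t * I - ν₀.im * I :=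
      fun c => by push_cast; ring
    have e1 : ((x - ν₀.re : ℝ) : ℂ) + ((t - ν₀.im : ℝ) : ℂ) * I =
        x + t * I - ν₀ := by
      conv_rhs => rw [← Complex.re_add_im ν₀]
      push_cast; ring
    have e2 : ((x - ν₀.re + M : ℝ) : ℂ) + ((t - ν₀.im : ℝ) : ℂ) * I =
        x + t * I - ν₀ + M := by
      rw [← e1]; push_cast; ring
    rw [e1, e2]
    have n1 := sub_ne_zero.2 (hne t)
    have n2 := hMne' (x + t * I) (by rw [line_re]; exact hx1)
    field_simp
    ring
  rw [line x₂ (h1.trans h2).le le_rfl h2.ne', line x₁ le_rfl (h1.trans h2).le h1.ne, hshift,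
    if_pos (by linarith), if_neg (by linarith)]
  generalize (∫ t : ℝ, H (x₂ + t * I)) = W
  push_cast
  ring

/-! ### A bound that is uniform near the imaginary axis -/

theorem norm_jB_mul_re_le (l : ℕ) (p : ℤ) {m : ℤ} (hm : |m| ≤ (l : ℤ)) (ρ T : ℝ) :
    ∃ C : ℝ, 0 ≤ C ∧ ∀ ν : ℂ, |ν.re| ≤ ρ → |ν.im| ≤ T → ∀ y : ℝ, 0 < y → y ≤ 1 →
      ‖jB l p m ν y‖ * |ν.re| ≤ C * y ^ (-(l + ρ)) := by
  obtain ⟨C, hC, n, h⟩ := exists_norm_Gamma_le (x₁ := l + 1) (by positivity) (l + 1 + ρ)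
  refine ⟨2 ^ (l : ℝ) * (C * (1 + |T|) ^ n), by positivity, ?_⟩
  have key : ∀ (p : ℤ) (ν : ℂ), 0 < ν.re → ν.re ≤ ρ → |ν.im| ≤ T → ∀ y : ℝ, 0 < y → y ≤ 1 →
      ‖jB l p m ν y‖ * ν.re ≤ 2 ^ (l : ℝ) * (C * (1 + |T|) ^ n) * y ^ (-(l + ρ)) := by
    intro p ν h0 h1 h2 y hy hy1
    have hJ := norm_jB_le p hm h0 hy
    have hG := h (l + 1 + ν) (by simp; linarith) (by simp; linarith)
    have him : (l + 1 + ν : ℂ).im = ν.im := by simp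
    rw [him] at hG
    have hT : |ν.im| ≤ |T| := h2.trans (le_abs_self T)
    have hG' : ‖Gamma (l + 1 + ν)‖ ≤ C * (1 + |T|) ^ n := by
      have e1 : Real.exp (-π * |ν.im| / 2) ≤ 1 := by
        rw [Real.exp_le_one_iff]
        have := mul_nonneg pi_pos.le (abs_nonneg ν.im)
        linarith
      have e2 : (1 + |ν.im|) ^ n ≤ (1 + |T|) ^ n :=
        pow_le_pow_left₀ (by positivity) (by linarith) n
      calc _ ≤ _ := hG
        _ ≤ C * (1 + |T|) ^ n * 1 := by gcongr
        _ = _ := mul_one _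
    have hy' : y ^ (-(l + ν.re)) ≤ y ^ (-(l + ρ)) :=
      Real.rpow_le_rpow_of_exponent_ge hy hy1 (by linarith)
    calc _ ≤ (2 ^ (l : ℝ) / ν.re * ‖Gamma (l + 1 + ν)‖ * y ^ (-(l + ν.re))) * ν.re :=
          mul_le_mul_of_nonneg_right hJ h0.le
      _ = 2 ^ (l : ℝ) * ‖Gamma (l + 1 + ν)‖ * y ^ (-(l + ν.re)) := by field_simp
      _ ≤ _ := by gcongr
  intro ν h1 h2 y hy hy1
  rcases lt_trichotomy ν.re 0 with h0 | h0 | h0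
  · have := key (-p) (-ν) (by simpa using h0) (by
      rw [neg_re]; exact (neg_le_abs _).trans h1) (by simpa using h2) y hy hy1
    rwa [jB_neg l p hm, neg_re, ← abs_of_neg h0] at this
  · rw [h0, abs_zero, mul_zero]; positivity
  · rw [abs_of_pos h0]
    exact key p ν h0 ((le_abs_self _).trans h1) h2 y hy hy1

theorem jB_local_bound (l : ℕ) (p : ℤ) {m : ℤ} (hm : |m| ≤ (l : ℤ)) {ρ : ℝ} {ν₀ : ℂ}
    (hν : |ν₀.re| < ρ) : ∃ C : ℝ, 0 ≤ C ∧ ∃ δ > 0, ∀ ν ∈ Metric.ball ν₀ δ, ∀ y : ℝ, 0 < y → y ≤ 1 →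
      ‖jB l p m ν y‖ ≤ C * y ^ (-(l + ρ)) := by
  have hρ : 0 < ρ := (abs_nonneg _).trans_lt hν
  set c : ℂ := ν₀.im * I with hc
  obtain ⟨C, hC, h⟩ := norm_jB_mul_re_le l p hm ρ (|ν₀.im| + ρ)
  set ρ' := (|ν₀.re| + ρ) / 2 with hρ'
  have hρ'1 : ρ' < ρ := by linarith
  have hρ'0 : 0 < ρ' := by have := abs_nonneg ν₀.re; linarith
  have hD : 0 < ρ ^ 2 - ρ' ^ 2 := by nlinarith
  refine ⟨2 * ρ * C / (ρ ^ 2 - ρ' ^ 2), by positivity, (ρ - |ν₀.re|) / 2, by linarith, ?_⟩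
  intro ν hνb y hy hy1
  have hcν : ‖ν - c‖ ≤ ρ' := by
    have e : ν - c = (ν - ν₀) + (ν₀ - c) := by ring
    have e2 : ν₀ - c = (ν₀.re : ℂ) := by
      rw [hc, sub_eq_iff_eq_add]; exact (Complex.re_add_im ν₀).symm
    have h3 : ‖ν - ν₀‖ < (ρ - |ν₀.re|) / 2 := by simpa [dist_eq_norm] using hνb
    have h4 : ‖ν₀ - c‖ = |ν₀.re| := by rw [e2, norm_real, Real.norm_eq_abs]
    rw [e]
    have := norm_add_le (ν - ν₀) (ν₀ - c)
    linarith
  have hmax : ‖jB l p m ν y * ((ν - c) ^ 2 + (ρ : ℂ) ^ 2)‖ ≤ 2 * ρ * (C * y ^ (-(l + ρ))) := by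
    refine Complex.norm_le_of_forall_mem_frontier_norm_le (U := Metric.ball c ρ)
      (f := fun z => jB l p m z y * ((z - c) ^ 2 + (ρ : ℂ) ^ 2))
      Metric.isBounded_ball ?_ ?_ ?_
    · refine Differentiable.diffContOnCl ?_
      exact (jB_differentiable l p m hy).mul (by fun_prop)
    · intro z hz
      rw [frontier_ball c hρ.ne', mem_sphere_iff_norm] at hz
      have hre : (z - c).re = z.re := by simp [hc]
      have him : (z - c).im = z.im - ν₀.im := by simp [hc]
      have e1 : (z - c) ^ 2 + (ρ : ℂ) ^ 2 = (z - c) * ((2 * z.re : ℝ) : ℂ) := by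
        have h5 : (z - c) * conj (z - c) = (ρ : ℂ) ^ 2 := by
          rw [mul_conj, normSq_eq_norm_sq, hz]; push_cast; rfl
        have h6 := Complex.add_conj (z - c)
        rw [hre] at h6
        rw [← h5, ← h6]; ring
      have b1 : |z.re| ≤ ρ := by rw [← hre, ← hz]; exact abs_re_le_norm _
      have b2 : |z.im| ≤ |ν₀.im| + ρ := by
        have h7 : |z.im - ν₀.im| ≤ ρ := by rw [← him, ← hz]; exact Complex.abs_im_le_norm _
        have := abs_sub_abs_le_abs_sub z.im ν₀.im
        linarith
      have := h z b1 b2 y hy hy1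
      simp only [e1]
      rw [norm_mul, norm_mul, hz, norm_real, Real.norm_eq_abs, abs_mul, abs_two]
      nlinarith
    · rw [closure_ball c hρ.ne', mem_closedBall_iff_norm]
      linarith
  rw [norm_mul] at hmax
  have hlow : ρ ^ 2 - ρ' ^ 2 ≤ ‖(ν - c) ^ 2 + (ρ : ℂ) ^ 2‖ := by
    have h8 := norm_sub_norm_le ((ρ : ℂ) ^ 2) (-(ν - c) ^ 2)
    rw [sub_neg_eq_add, norm_neg, norm_pow, norm_pow, norm_real,
      norm_of_nonneg hρ.le, add_comm] at h8
    have h9 : ‖ν - c‖ ^ 2 ≤ ρ' ^ 2 := pow_le_pow_left₀ (norm_nonneg _) hcν 2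
    linarith
  have h10 := mul_le_mul_of_nonneg_left hlow (norm_nonneg (jB l p m ν y))
  rw [div_mul_eq_mul_div, le_div_iff₀ hD]
  nlinarith

/-! ### Derivative bounds -/

theorem hasDerivAt_ofReal (t : ℝ) : HasDerivAt (fun t : ℝ => (t : ℂ)) 1 t := by
  simpa using HasDerivAt.ofReal_comp (hasDerivAt_id' t)

theorem norm_deriv_le_of_second {f f1 f2 : ℝ → ℂ} {x K : ℝ}
    (h1 : ∀ t ∈ Icc x (x + 1), HasDerivAt f (f1 t) t)
    (h2 : ∀ t ∈ Icc x (x + 1), HasDerivAt f1 (f2 t) t)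
    (hK : ∀ t ∈ Icc x (x + 1), ‖f2 t‖ ≤ K) :
    ‖f1 x‖ ≤ ‖f (x + 1)‖ + ‖f x‖ + K := by
  have hx : x ∈ Icc x (x + 1) := ⟨le_rfl, by linarith⟩
  have hx1 : x + 1 ∈ Icc x (x + 1) := ⟨by linarith, le_rfl⟩
  have hK0 : 0 ≤ K := (norm_nonneg _).trans (hK x hx)
  have b1 : ∀ t ∈ Icc x (x + 1), ‖f1 t - f1 x‖ ≤ K := fun t ht => by
    have := (convex_Icc x (x + 1)).norm_image_sub_le_of_norm_hasDerivWithin_le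
      (fun s hs => (h2 s hs).hasDerivWithinAt) hK hx ht
    refine this.trans ?_
    rw [norm_of_nonneg (by linarith [ht.1])]
    nlinarith [ht.2]
  have hd : ∀ t ∈ Icc x (x + 1), HasDerivWithinAt (fun t : ℝ => f t - (t : ℂ) * f1 x)
      (f1 t - f1 x) (Icc x (x + 1)) t := fun t ht => by
    have : HasDerivAt (fun t : ℝ => f t - (t : ℂ) * f1 x) (f1 t - 1 * f1 x) t :=
      (h1 t ht).sub ((hasDerivAt_ofReal t).mul_const (f1 x))
    rw [one_mul] at this
    exact this.hasDerivWithinAt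
  have b2 := (convex_Icc x (x + 1)).norm_image_sub_le_of_norm_hasDerivWithin_le hd b1 hx hx1
  have e : f1 x = (f (x + 1) - f x) - ((f (x + 1) - ((x + 1 : ℝ) : ℂ) * f1 x) - (f x - (x : ℂ) * f1 x)) := by
    push_cast; ring
  rw [add_sub_cancel_left, norm_one, mul_one] at b2
  rw [e]
  refine (norm_sub_le _ _).trans ?_
  have := norm_sub_le (f (x + 1)) (f x)
  linarith

/-- If `f' = (t₁ - c f)/y` and `t₁' = (t₂ - c t₁)/y`, then bounds for `f` and `t₂` give a bound
for `t₁`. -/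
theorem norm_T1_le {f t₁ t₂ : ℝ → ℂ} {c : ℕ} {y C d : ℝ} (hy : 0 < y)
    (h1 : ∀ t : ℝ, 0 < t → HasDerivAt f ((t₁ t - c * f t) / t) t)
    (h2 : ∀ t : ℝ, 0 < t → HasDerivAt t₁ ((t₂ t - c * t₁ t) / t) t)
    (hf : ∀ t ∈ Icc y (y * Real.exp 1), ‖f t‖ ≤ C * t ^ d)
    (ht : ∀ t ∈ Icc y (y * Real.exp 1), ‖t₂ t‖ ≤ C * t ^ d) :
    ‖t₁ y‖ ≤ 3 * C * Real.exp (c + |d|) * y ^ d := by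
  have hE : ∀ x : ℝ, HasDerivAt Real.exp (Real.exp x) x := Real.hasDerivAt_exp
  have hcomp : ∀ {u u' : ℝ → ℂ}, (∀ t : ℝ, 0 < t → HasDerivAt u ((u' t - c * u t) / t) t) →
      ∀ x : ℝ, HasDerivAt (fun x : ℝ => Complex.exp (c * x) * u (Real.exp x))
        (Complex.exp (c * x) * u' (Real.exp x)) x := by
    intro u u' hu x
    have a1 : HasDerivAt (fun x : ℝ => u (Real.exp x))
        (Real.exp x • ((u' (Real.exp x) - c * u (Real.exp x)) / (Real.exp x : ℝ))) x :=
      (hu _ (Real.exp_pos x)).scomp x (hE x)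
    have a2 : HasDerivAt (fun x : ℝ => Complex.exp (c * x)) (Complex.exp (c * x) * c) x := by
      simpa using ((hasDerivAt_ofReal x).const_mul (c : ℂ)).cexp
    refine (a2.mul a1).congr_deriv ?_
    have : ((Real.exp x : ℝ) : ℂ) ≠ 0 := by exact_mod_cast (Real.exp_pos x).ne'
    rw [Complex.real_smul]
    field_simp
    ring
  have hn : ∀ x : ℝ, ‖Complex.exp (c * x)‖ = Real.exp (c * x) := fun x => by
    rw [Complex.norm_exp]; simp
  set x := Real.log y with hx
  have hxy : Real.exp x = y := Real.exp_log hy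
  have hC : 0 ≤ C := by
    have := (norm_nonneg _).trans (hf y ⟨le_rfl, le_mul_of_one_le_right hy.le (Real.one_le_exp zero_le_one)⟩)
    exact nonneg_of_mul_nonneg_left this (Real.rpow_pos_of_pos hy d)
  have hbd : ∀ u : ℝ → ℂ, (∀ t ∈ Icc y (y * Real.exp 1), ‖u t‖ ≤ C * t ^ d) →
      ∀ s ∈ Icc x (x + 1), ‖Complex.exp (c * s) * u (Real.exp s)‖ ≤
        Real.exp (c * x) * (C * Real.exp (c + |d|) * y ^ d) := by
    intro u hu s hs
    have hs1 : Real.exp s ∈ Icc y (y * Real.exp 1) := by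
      rw [← hxy, ← Real.exp_add]
      exact ⟨Real.exp_le_exp.2 hs.1, Real.exp_le_exp.2 hs.2⟩
    rw [norm_mul, hn]
    have e1 : (Real.exp s) ^ d ≤ y ^ d * Real.exp |d| := by
      rw [← hxy, ← Real.exp_mul, ← Real.exp_mul, ← Real.exp_add, Real.exp_le_exp]
      have h3 : (s - x) * d ≤ (s - x) * |d| :=
        mul_le_mul_of_nonneg_left (le_abs_self d) (by linarith [hs.1])
      have h4 : (s - x) * |d| ≤ 1 * |d| :=
        mul_le_mul_of_nonneg_right (by linarith [hs.2]) (abs_nonneg d)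
      linarith
    have e2 : Real.exp (c * s) ≤ Real.exp (c * x) * Real.exp c := by
      rw [← Real.exp_add, Real.exp_le_exp]
      have : (0 : ℝ) ≤ c := by positivity
      nlinarith [hs.2]
    calc _ ≤ (Real.exp (c * x) * Real.exp c) * (C * (y ^ d * Real.exp |d|)) := by
          refine mul_le_mul e2 ((hu _ hs1).trans (mul_le_mul_of_nonneg_left e1 hC))
            (norm_nonneg _) (by positivity)
      _ = _ := by rw [Real.exp_add]; ring
  have hL := norm_deriv_le_of_second (x := x) (fun t _ => hcomp h1 t) (fun t _ => hcomp h2 t)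
    (hbd t₂ ht)
  have b1 := hbd f hf x ⟨le_rfl, by linarith⟩
  have b2 := hbd f hf (x + 1) ⟨by linarith, le_rfl⟩
  rw [norm_mul, hn, hxy] at hL
  rw [hxy] at b1
  have hpos := Real.exp_pos (c * x)
  rw [← mul_le_mul_iff_right₀ hpos]
  calc _ ≤ _ := hL
    _ ≤ Real.exp (c * x) * (C * Real.exp (c + |d|) * y ^ d) +
        Real.exp (c * x) * (C * Real.exp (c + |d|) * y ^ d) +
        Real.exp (c * x) * (C * Real.exp (c + |d|) * y ^ d) := by
      refine add_le_add (add_le_add b2 b1) le_rfl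
    _ = _ := by ring

theorem norm_T1_sub_le {f t₁ t₂ : ℝ → ℂ} {c : ℕ} {y C d : ℝ} {A μ : ℂ} (hy : 0 < y)
    (h1 : ∀ t : ℝ, 0 < t → HasDerivAt f ((t₁ t - c * f t) / t) t)
    (h2 : ∀ t : ℝ, 0 < t → HasDerivAt t₁ ((t₂ t - c * t₁ t) / t) t)
    (hf : ∀ t ∈ Icc y (y * Real.exp 1), ‖f t - A * (t : ℂ) ^ μ‖ ≤ C * t ^ d)
    (ht : ∀ t ∈ Icc y (y * Real.exp 1), ‖t₂ t - A * (μ + c) ^ 2 * (t : ℂ) ^ μ‖ ≤ C * t ^ d) :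
    ‖t₁ y - A * (μ + c) * (y : ℂ) ^ μ‖ ≤ 3 * C * Real.exp (c + |d|) * y ^ d := by
  have hp : ∀ t : ℝ, 0 < t → HasDerivAt (fun t : ℝ => (t : ℂ) ^ μ) (μ * (t : ℂ) ^ μ / t) t := by
    intro t ht
    have ht' : (t : ℂ) ≠ 0 := by exact_mod_cast ht.ne'
    have := ((hasDerivAt_id' (t : ℂ)).cpow_const (c := μ)
      (Complex.ofReal_mem_slitPlane.2 ht)).comp_ofReal
    rwa [mul_one, Complex.cpow_sub _ _ ht', Complex.cpow_one, ← mul_div_assoc] at this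
  refine norm_T1_le (f := fun t => f t - A * (t : ℂ) ^ μ)
    (t₁ := fun t => t₁ t - A * (μ + c) * (t : ℂ) ^ μ)
    (t₂ := fun t => t₂ t - A * (μ + c) ^ 2 * (t : ℂ) ^ μ) hy (fun t ht => ?_) (fun t ht => ?_) hf ht
  · exact ((h1 t ht).sub ((hp t ht).const_mul A)).congr_deriv (by ring)
  · exact ((h2 t ht).sub ((hp t ht).const_mul (A * (μ + c)))).congr_deriv (by ring)

/-! ### Holomorphic parametric integrals -/

theorem differentiableAt_integral {X : Type*} [MeasurableSpace X] {μ : Measure X}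
    {F : X → ℂ → ℂ} {ν₀ : ℂ} {δ : ℝ} {bound : X → ℝ} (hδ : 0 < δ)
    (hm : ∀ ν ∈ Metric.ball ν₀ δ, AEStronglyMeasurable (fun x => F x ν) μ)
    (hd : ∀ᵐ x ∂μ, DifferentiableOn ℂ (F x) (Metric.ball ν₀ δ))
    (hb : ∀ᵐ x ∂μ, ∀ ν ∈ Metric.ball ν₀ δ, ‖F x ν‖ ≤ bound x) (hbi : Integrable bound μ) :
    DifferentiableAt ℂ (fun ν => ∫ x, F x ν ∂μ) ν₀ := by
  have hδ2 : 0 < δ / 2 := by linarith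
  have h0 : ν₀ ∈ Metric.ball ν₀ δ := Metric.mem_ball_self hδ
  have hF' : AEStronglyMeasurable (fun x => deriv (F x) ν₀) μ := by
    set u : ℕ → ℂ := fun n => ν₀ + ((δ / (n + 2) : ℝ) : ℂ) with hu
    have hub : ∀ n, u n ∈ Metric.ball ν₀ δ := fun n => by
      rw [Metric.mem_ball, dist_eq_norm, hu]
      simp only [add_sub_cancel_left]
      rw [norm_real, norm_of_nonneg (by positivity), div_lt_iff₀ (by positivity)]
      have : (0 : ℝ) ≤ n := by positivity
      nlinarith
    have hune : ∀ n, u n ≠ ν₀ := fun n => by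
      simp only [hu, ne_eq, add_eq_left]
      have : δ / (n + 2) ≠ 0 := by positivity
      exact_mod_cast this
    have hlim : Tendsto u atTop (𝓝[≠] ν₀) := by
      refine tendsto_nhdsWithin_iff.2 ⟨?_, Eventually.of_forall hune⟩
      have h1 : Tendsto (fun n : ℕ => δ / ((n : ℝ) + 2)) atTop (𝓝 0) :=
        tendsto_const_nhds.div_atTop (tendsto_atTop_add_const_right _ _ tendsto_natCast_atTop_atTop)
      have h2 := (Complex.continuous_ofReal.tendsto 0).comp h1
      simpa [hu, Function.comp_def] using h2.const_add ν₀
    refine aestronglyMeasurable_of_tendsto_ae (u := atTop)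
      (f := fun n x => slope (F x) ν₀ (u n)) (fun n => ?_) ?_
    · simp only [slope_def_field]
      exact ((hm _ (hub n)).sub (hm _ h0)).mul_const _
    · filter_upwards [hd] with x hx
      have : HasDerivAt (F x) (deriv (F x) ν₀) ν₀ :=
        (hx.differentiableAt (Metric.isOpen_ball.mem_nhds h0)).hasDerivAt
      exact (hasDerivAt_iff_tendsto_slope.1 this).comp hlim
  have hint : Integrable (F · ν₀) μ := hbi.mono' (hm _ h0) (by
    filter_upwards [hb] with x hx using hx _ h0)
  have := hasDerivAt_integral_of_dominated_loc_of_deriv_le (μ := μ) (F := fun ν x => F x ν)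
    (F' := fun ν x => deriv (F x) ν) (x₀ := ν₀) (bound := fun x => bound x / (δ / 2))
    (s := Metric.ball ν₀ (δ / 2)) (Metric.ball_mem_nhds _ hδ2)
    (by filter_upwards [Metric.ball_mem_nhds ν₀ hδ] with ν hν using hm ν hν) hint hF'
    (by
      filter_upwards [hd, hb] with x hx hbx ν hν
      have hsub : Metric.closedBall ν (δ / 2) ⊆ Metric.ball ν₀ δ := fun z hz => by
        rw [Metric.mem_ball] at hν ⊢
        rw [Metric.mem_closedBall] at hz
        linarith [dist_triangle z ν ν₀]
      refine Complex.norm_deriv_le_of_forall_mem_sphere_norm_le hδ2 ?_ fun z hz =>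
        hbx z (hsub (Metric.sphere_subset_closedBall hz))
      exact (hx.mono hsub).diffContOnCl_ball subset_rfl)
    (hbi.div_const _)
    (by
      filter_upwards [hd] with x hx ν hν
      exact (hx.differentiableAt (Metric.isOpen_ball.mem_nhds
        (Metric.ball_subset_ball (by linarith) hν))).hasDerivAt)
  exact this.2.differentiableAt

/-! ### Superpositions of Bessel functions -/

theorem StripBdd.shift_complex {F : ℂ → ℝ → ℂ} (hF : StripBdd F) (s : ℂ) :
    StripBdd fun z y => F (s + z) y := fun R => by
  obtain ⟨C, hC, N, h⟩ := hF (R + |s.re|)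
  refine ⟨C * (1 + |s.im|) ^ N * Real.exp (π * |s.im| / 2), by positivity, N,
    fun z hz y hy => ?_⟩
  have h1 := h (s + z) (by
    rw [add_re]; exact (abs_add_le _ _).trans (by linarith)) y hy
  rw [Complex.add_im] at h1
  have hi : 0 < y⁻¹ := inv_pos.2 hy
  have a1 := abs_nonneg s.im
  have a2 := abs_nonneg z.im
  have b1 : 1 + |s.im + z.im| ≤ (1 + |s.im|) * (1 + |z.im|) := by
    have := abs_add_le s.im z.im
    nlinarith [mul_nonneg a1 a2]
  have b2 : -π * |s.im + z.im| / 2 ≤ π * |s.im| / 2 + -π * |z.im| / 2 := by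
    have h3 := abs_sub_abs_le_abs_sub (s.im + z.im) s.im
    have h4 : |z.im| ≤ |s.im + z.im| + |s.im| := by
      have := abs_sub (s.im + z.im) s.im
      simpa using this
    nlinarith [pi_pos]
  have b3 := Real.exp_le_exp.2 b2
  rw [Real.exp_add] at b3
  have b4 : ((1 + |s.im + z.im|) * (1 + y⁻¹)) ^ N ≤
      (1 + |s.im|) ^ N * ((1 + |z.im|) * (1 + y⁻¹)) ^ N := by
    rw [← mul_pow, ← mul_assoc]
    gcongr
  calc _ ≤ _ := h1
    _ ≤ C * ((1 + |s.im|) ^ N * ((1 + |z.im|) * (1 + y⁻¹)) ^ N) *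
        (Real.exp (π * |s.im| / 2) * Real.exp (-π * |z.im| / 2)) := by gcongr
    _ = _ := by ring

/-- Weights on a vertical line for which superpositions of Bessel functions converge. -/
def PacketWeight (G : ℝ → ℂ) : Prop :=
  Continuous G ∧ ∀ N : ℕ, ∃ C : ℝ, 0 ≤ C ∧ ∀ t : ℝ,
    ‖G t‖ * (1 + |t|) ^ N ≤ C * Real.exp (π * |t| / 2)

theorem packet_bound {G : ℝ → ℂ} (hG : PacketWeight G) {F : ℂ → ℝ → ℂ} (hF : StripBdd F)
    (c : ℝ) (s : ℂ) : ∃ C : ℝ, 0 ≤ C ∧ ∃ N : ℕ, ∀ t y : ℝ, 0 < y →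
      ‖G t * F (s + (c + t * I)) y‖ ≤ C * (1 + y⁻¹) ^ N * (1 + t ^ 2)⁻¹ := by
  obtain ⟨C, hC, N, h⟩ := hF.shift_complex s |c|
  obtain ⟨C', hC', h'⟩ := hG.2 (N + 2)
  refine ⟨C * C', mul_nonneg hC hC', N, fun t y hy => ?_⟩
  have h1 := h (c + t * I) (by rw [line_re]) y hy
  simp only [line_im] at h1
  have h2 := h' t
  have ht := abs_nonneg t
  have hi : 0 < y⁻¹ := inv_pos.2 hy
  have e1 : 1 + t ^ 2 ≤ (1 + |t|) ^ 2 := by rw [← sq_abs]; nlinarith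
  have hexp : Real.exp (π * |t| / 2) * Real.exp (-π * |t| / 2) = 1 := by
    rw [← Real.exp_add, ← Real.exp_zero]; congr 1; ring
  rw [← div_eq_mul_inv, le_div_iff₀ (by positivity), norm_mul]
  calc _ ≤ ‖G t‖ * (C * ((1 + |t|) * (1 + y⁻¹)) ^ N * Real.exp (-π * |t| / 2)) *
        (1 + |t|) ^ 2 := by gcongr
    _ = (‖G t‖ * (1 + |t|) ^ (N + 2)) * (C * (1 + y⁻¹) ^ N * Real.exp (-π * |t| / 2)) := by
        rw [mul_pow, pow_add]; ring
    _ ≤ (C' * Real.exp (π * |t| / 2)) *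
        (C * (1 + y⁻¹) ^ N * Real.exp (-π * |t| / 2)) := by gcongr
    _ = C * C' * (1 + y⁻¹) ^ N * (Real.exp (π * |t| / 2) *
        Real.exp (-π * |t| / 2)) := by ring
    _ = _ := by rw [hexp, mul_one]

theorem packet_integrable {G : ℝ → ℂ} (hG : PacketWeight G) {F : ℂ → ℝ → ℂ} (hF : StripBdd F)
    {y : ℝ} (hy : 0 < y) (hc : Continuous fun s => F s y) (c : ℝ) (s : ℂ) :
    Integrable fun t : ℝ => G t * F (s + (c + t * I)) y := by
  obtain ⟨C, hC, N, h⟩ := packet_bound hG hF c s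
  refine (integrable_inv_one_add_sq.const_mul (C * (1 + y⁻¹) ^ N)).mono' ?_
    (Eventually.of_forall fun t => h t y hy)
  exact (hG.1.mul (hc.comp (by fun_prop))).aestronglyMeasurable

/-- The superposition of the functions `V (s + c + it)` with weight `G`. -/
def pk (G : ℝ → ℂ) (c : ℝ) (s : ℂ) (y : ℝ) : ℂ := ∫ t : ℝ, G t * V (s + (c + t * I)) y

theorem Jc_packet_integrable {G : ℝ → ℂ} (hG : PacketWeight G) (c : ℝ) (a b : ℕ) (n : ℤ) (s : ℂ)
    {y : ℝ} (hy : 0 < y) :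
    Integrable fun t : ℝ => G t * Jc V a b n (s + (c + t * I)) y :=
  packet_integrable hG (Jc_V_stripBdd a b n) hy (Jc_V_differentiable a b n hy).continuous c s

theorem Jc_pk {G : ℝ → ℂ} (hG : PacketWeight G) (c : ℝ) (a b : ℕ) (n : ℤ) (s : ℂ)
    {y : ℝ} (hy : 0 < y) :
    Jc (pk G c) a b n s y = ∫ t : ℝ, G t * Jc V a b n (s + (c + t * I)) y := by
  induction a generalizing b n s with
  | zero =>
    simp only [Jc, pk]
    rw [← integral_const_mul]
    congr 1; ext t; ring
  | succ a ih =>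
    simp only [Jc]
    have i1 := Jc_packet_integrable hG c a b n (s + 1) hy
    have i2 := Jc_packet_integrable hG c a b (n - 1) (s - 1) hy
    have i3 := (Jc_packet_integrable hG c a (b - 1) (n - 1) s hy).const_mul (b / y : ℂ)
    rw [ih, ih, ih, ← integral_const_mul, ← integral_add i1 i2,
      ← integral_sub (integrable_fun_add i1 i2) i3]
    congr 1; ext t
    have e1 : s + 1 + (c + t * I) = s + (c + t * I) + 1 := by ring
    have e2 : s - 1 + (c + t * I) = s + (c + t * I) - 1 := by ring
    rw [e1, e2]; ring

theorem T1_packet {G : ℝ → ℂ} (hG : PacketWeight G) (c : ℝ) (a b : ℕ) (n : ℤ) (s : ℂ)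
    {y : ℝ} (hy : 0 < y) :
    Integrable (fun t : ℝ => G t * T1 V a b n (s + (c + t * I)) y) ∧
    T1 (pk G c) a b n s y = ∫ t : ℝ, G t * T1 V a b n (s + (c + t * I)) y := by
  have i1 := Jc_packet_integrable hG c a b n (s + 1) hy
  have i2 := Jc_packet_integrable hG c a b n (s - 1) hy
  have i3 := Jc_packet_integrable hG c (a - 1) b n (s + 1) hy
  have i4 := Jc_packet_integrable hG c (a - 1) b (n - 1) (s - 1) hy
  have j1 := (integrable_fun_add i1 i2).const_mul (-y : ℂ)
  have j2 := (integrable_fun_add i3 i4).const_mul (a : ℂ)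
  have e : (fun t : ℝ => G t * T1 V a b n (s + (c + t * I)) y) = fun t : ℝ =>
      -y * (G t * Jc V a b n (s + 1 + (c + t * I)) y +
        G t * Jc V a b n (s - 1 + (c + t * I)) y) +
      a * (G t * Jc V (a - 1) b n (s + 1 + (c + t * I)) y +
        G t * Jc V (a - 1) b (n - 1) (s - 1 + (c + t * I)) y) := by
    ext t
    have e1 : s + 1 + (c + t * I) = s + (c + t * I) + 1 := by ring
    have e2 : s - 1 + (c + t * I) = s + (c + t * I) - 1 := by ring
    rw [e1, e2, T1]; ring
  rw [e]
  refine ⟨integrable_fun_add j1 j2, ?_⟩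
  rw [integral_add j1 j2, integral_const_mul, integral_const_mul, integral_add i1 i2,
    integral_add i3 i4, T1]
  simp only [Jc_pk hG c _ _ _ _ hy]

theorem T2_packet {G : ℝ → ℂ} (hG : PacketWeight G) (c : ℝ) (a b : ℕ) (n : ℤ) (s : ℂ)
    {y : ℝ} (hy : 0 < y) :
    T2 (pk G c) a b n s y = ∫ t : ℝ, G t * T2 V a b n (s + (c + t * I)) y := by
  have i1 := Jc_packet_integrable hG c a b n (s + 1) hy
  have i2 := Jc_packet_integrable hG c a b n (s - 1) hy
  have i3 := Jc_packet_integrable hG c (a - 1) b n (s + 1) hy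
  have i4 := Jc_packet_integrable hG c (a - 1) b (n - 1) (s - 1) hy
  obtain ⟨k1, q1⟩ := T1_packet hG c a b n (s + 1) hy
  obtain ⟨k2, q2⟩ := T1_packet hG c a b n (s - 1) hy
  obtain ⟨k3, q3⟩ := T1_packet hG c (a - 1) b n (s + 1) hy
  obtain ⟨k4, q4⟩ := T1_packet hG c (a - 1) b (n - 1) (s - 1) hy
  have j1 := (integrable_fun_add i1 i2).const_mul (-y : ℂ)
  have j2 := (integrable_fun_add k1 k2).const_mul (-y : ℂ)
  have j3 := (integrable_fun_add (integrable_fun_add k3 i3)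
    (integrable_fun_add k4 i4)).const_mul (a : ℂ)
  have e : (fun t : ℝ => G t * T2 V a b n (s + (c + t * I)) y) = fun t : ℝ =>
      (-y * (G t * Jc V a b n (s + 1 + (c + t * I)) y +
        G t * Jc V a b n (s - 1 + (c + t * I)) y) +
      -y * (G t * T1 V a b n (s + 1 + (c + t * I)) y +
        G t * T1 V a b n (s - 1 + (c + t * I)) y)) +
      a * ((G t * T1 V (a - 1) b n (s + 1 + (c + t * I)) y +
        G t * Jc V (a - 1) b n (s + 1 + (c + t * I)) y) +
        (G t * T1 V (a - 1) b (n - 1) (s - 1 + (c + t * I)) y +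
        G t * Jc V (a - 1) b (n - 1) (s - 1 + (c + t * I)) y)) := by
    ext t
    have e1 : s + 1 + (c + t * I) = s + (c + t * I) + 1 := by ring
    have e2 : s - 1 + (c + t * I) = s + (c + t * I) - 1 := by ring
    rw [e1, e2, T2]; ring
  rw [e, integral_add (integrable_fun_add j1 j2) j3, integral_add j1 j2, integral_const_mul,
    integral_const_mul, integral_const_mul, integral_add i1 i2, integral_add k1 k2,
    integral_add (integrable_fun_add k3 i3) (integrable_fun_add k4 i4), integral_add k3 i3,
    integral_add k4 i4, T2, q1, q2, q3, q4]
  simp only [Jc_pk hG c _ _ _ _ hy]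
  ring

theorem pk_besselSeq {G : ℝ → ℂ} (hG : PacketWeight G) (c : ℝ) : BesselSeq (pk G c) := by
  intro s y hy
  have hF : StripBdd fun s y => -(V (s + 1) y + V (s - 1) y) := by
    have := ((V_stripBdd.shift 1).add (V_stripBdd.shift (-1))).const_mul (-1)
    simpa [sub_eq_add_neg] using this
  have hFc : ∀ y : ℝ, 0 < y → Continuous fun s => -(V (s + 1) y + V (s - 1) y) := fun y hy => by
    have := (V_differentiable hy).continuous
    exact ((this.comp (continuous_add_const 1)).add (this.comp (continuous_sub_right 1))).neg
  obtain ⟨C, hC, N, hb⟩ := packet_bound hG hF c s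
  have hy2 : 0 < y / 2 := by linarith
  have hball : ∀ x ∈ Metric.ball y (y / 2), y / 2 < x := fun x hx => by
    rw [Metric.mem_ball, Real.dist_eq] at hx
    have := (abs_lt.1 hx).1; linarith
  have key := hasDerivAt_integral_of_dominated_loc_of_deriv_le (μ := volume)
    (F := fun (x : ℝ) (t : ℝ) => G t * V (s + (c + t * I)) x)
    (F' := fun (x : ℝ) (t : ℝ) => G t * (-(V (s + (c + t * I) + 1) x +
      V (s + (c + t * I) - 1) x)))
    (x₀ := y) (s := Metric.ball y (y / 2))
    (bound := fun t => C * (1 + (y / 2)⁻¹) ^ N * (1 + t ^ 2)⁻¹) (Metric.ball_mem_nhds _ hy2)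
    (by
      filter_upwards [Metric.ball_mem_nhds y hy2] with x hx
      exact (packet_integrable hG V_stripBdd (hy2.trans (hball x hx))
        (V_differentiable (hy2.trans (hball x hx))).continuous c s).aestronglyMeasurable)
    (packet_integrable hG V_stripBdd hy (V_differentiable hy).continuous c s)
    (packet_integrable hG hF hy (hFc y hy) c s).aestronglyMeasurable
    (Eventually.of_forall fun t x hx => by
      have hx2 := hball x hx
      have hx0 := hy2.trans hx2
      refine (hb t x hx0).trans ?_
      have : x⁻¹ ≤ (y / 2)⁻¹ := inv_anti₀ hy2 hx2.le
      have hxi : 0 < x⁻¹ := inv_pos.2 hx0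
      gcongr)
    (integrable_inv_one_add_sq.const_mul _)
    (Eventually.of_forall fun t x hx => (V_hasDerivAt (hy2.trans (hball x hx)) _).const_mul _)
  refine key.2.congr_deriv ?_
  have i1 := packet_integrable hG V_stripBdd hy (V_differentiable hy).continuous c (s + 1)
  have i2 := packet_integrable hG V_stripBdd hy (V_differentiable hy).continuous c (s - 1)
  rw [pk, pk, ← integral_add i1 i2, ← integral_neg]
  congr 1; ext t
  have e1 : s + 1 + (c + t * I) = s + (c + t * I) + 1 := by ring
  have e2 : s - 1 + (c + t * I) = s + (c + t * I) - 1 := by ring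
  rw [e1, e2]; ring

theorem BesselSeq.contDiffOn {v : ℂ → ℝ → ℂ} (hv : BesselSeq v) (k : ℕ) (s : ℂ) :
    ContDiffOn ℝ k (v s) (Ioi 0) := by
  induction k generalizing s with
  | zero =>
    rw [Nat.cast_zero, contDiffOn_zero]
    exact fun y hy => (hv s y hy).continuousAt.continuousWithinAt
  | succ k ih =>
    rw [Nat.cast_add, Nat.cast_one, contDiffOn_succ_iff_deriv_of_isOpen isOpen_Ioi]
    refine ⟨fun y hy => (hv s y hy).differentiableAt.differentiableWithinAt, by simp, ?_⟩
    exact (((ih (s + 1)).add (ih (s - 1))).neg).congr fun y hy => (hv s y hy).deriv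

theorem Jc_contDiffOn {v : ℂ → ℝ → ℂ} (hv : BesselSeq v) (k : ℕ) (a b : ℕ) (n : ℤ) (s : ℂ) :
    ContDiffOn ℝ k (Jc v a b n s) (Ioi 0) := by
  induction a generalizing b n s with
  | zero => exact contDiffOn_const.mul (hv.contDiffOn k s)
  | succ a ih =>
    refine ((ih b n (s + 1)).add (ih b (n - 1) (s - 1))).sub
      (ContDiffOn.mul ?_ (ih (b - 1) (n - 1) s))
    simp only [div_eq_mul_inv]
    refine contDiffOn_const.mul (ContDiffOn.inv (Complex.ofRealCLM.contDiff.contDiffOn) fun y hy => ?_)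
    have : (y : ℂ) ≠ 0 := by exact_mod_cast (ne_of_gt hy : y ≠ 0)
    exact this

/-! ### The functions `jB` and their superpositions -/

/-- `(y ∂ + l - m) jB`. -/
def jB1 (l : ℕ) (p m : ℤ) (ν : ℂ) (y : ℝ) : ℂ :=
  T1 V ((l : ℤ) - m).toNat ((l : ℤ) + m).toNat ((l : ℤ) - p) (ν - p) y

/-- `(y ∂ + l - m)² jB`. -/
def jB2 (l : ℕ) (p m : ℤ) (ν : ℂ) (y : ℝ) : ℂ :=
  ((ν - p) ^ 2 + 4 * y ^ 2) * jB l p m ν y -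
    4 * (((l : ℤ) - m).toNat : ℕ) * y * jB l p (m + 1) ν y

theorem T2_eq_jB2 (l : ℕ) (p : ℤ) {m : ℤ} (hm : |m| ≤ (l : ℤ)) (ν : ℂ) {y : ℝ} (hy : 0 < y) :
    T2 V ((l : ℤ) - m).toNat ((l : ℤ) + m).toNat ((l : ℤ) - p) (ν - p) y = jB2 l p m ν y := by
  have h := abs_le.1 hm
  rw [T2_V _ _ _ _ hy, jB2]
  congr 1
  by_cases h0 : ((l : ℤ) - m).toNat = 0
  · rw [h0]; simp
  · have e1 : ((l : ℤ) - m).toNat - 1 = ((l : ℤ) - (m + 1)).toNat := by omega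
    have e2 : ((l : ℤ) + m).toNat + 1 = ((l : ℤ) + (m + 1)).toNat := by omega
    rw [e1, e2, jB]

theorem jB_hasDerivAt (l : ℕ) (p m : ℤ) (ν : ℂ) {y : ℝ} (hy : 0 < y) :
    HasDerivAt (jB l p m ν)
      ((jB1 l p m ν y - (((l : ℤ) - m).toNat : ℕ) * jB l p m ν y) / y) y :=
  Jc_hasDerivAt V_besselSeq _ _ _ _ hy

theorem jB1_hasDerivAt (l : ℕ) (p : ℤ) {m : ℤ} (hm : |m| ≤ (l : ℤ)) (ν : ℂ) {y : ℝ} (hy : 0 < y) :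
    HasDerivAt (jB1 l p m ν)
      ((jB2 l p m ν y - (((l : ℤ) - m).toNat : ℕ) * jB1 l p m ν y) / y) y := by
  rw [← T2_eq_jB2 l p hm ν hy]
  exact T1_hasDerivAt V_besselSeq _ _ _ _ hy

/-- The superposition of the functions `jB` on the line `Re ν = c` with weight `G`. -/
def jP (G : ℝ → ℂ) (c : ℝ) (l : ℕ) (p m : ℤ) (y : ℝ) : ℂ :=
  ∫ t : ℝ, G t * jB l p m (c + t * I) y

/-- `(y ∂ + l - m) jP`. -/
def jP1 (G : ℝ → ℂ) (c : ℝ) (l : ℕ) (p m : ℤ) (y : ℝ) : ℂ :=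
  ∫ t : ℝ, G t * jB1 l p m (c + t * I) y

/-- `(y ∂ + l - m)² jP`. -/
def jP2 (G : ℝ → ℂ) (c : ℝ) (l : ℕ) (p m : ℤ) (y : ℝ) : ℂ :=
  ∫ t : ℝ, G t * jB2 l p m (c + t * I) y

theorem jB_integrable {G : ℝ → ℂ} (hG : PacketWeight G) (c : ℝ) (l : ℕ) (p m : ℤ)
    {y : ℝ} (hy : 0 < y) : Integrable fun t : ℝ => G t * jB l p m (c + t * I) y := by
  simpa using packet_integrable hG (jB_stripBdd l p m) hy (jB_differentiable l p m hy).continuous c 0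

theorem jP_eq {G : ℝ → ℂ} (hG : PacketWeight G) (c : ℝ) (l : ℕ) (p m : ℤ) {y : ℝ} (hy : 0 < y) :
    jP G c l p m y = Jc (pk G c) ((l : ℤ) - m).toNat ((l : ℤ) + m).toNat ((l : ℤ) - p) (-p) y := by
  rw [Jc_pk hG c _ _ _ _ hy, jP]
  congr 1; ext t
  rw [jB, sub_eq_neg_add (c + t * I : ℂ)]

theorem jP1_eq {G : ℝ → ℂ} (hG : PacketWeight G) (c : ℝ) (l : ℕ) (p m : ℤ) {y : ℝ} (hy : 0 < y) :
    jP1 G c l p m y = T1 (pk G c) ((l : ℤ) - m).toNat ((l : ℤ) + m).toNat ((l : ℤ) - p) (-p) y := by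
  rw [(T1_packet hG c _ _ _ _ hy).2, jP1]
  congr 1; ext t
  rw [jB1, sub_eq_neg_add (c + t * I : ℂ)]

theorem jP2_eq {G : ℝ → ℂ} (hG : PacketWeight G) (c : ℝ) (l : ℕ) (p : ℤ) {m : ℤ}
    (hm : |m| ≤ (l : ℤ)) {y : ℝ} (hy : 0 < y) :
    jP2 G c l p m y = T2 (pk G c) ((l : ℤ) - m).toNat ((l : ℤ) + m).toNat ((l : ℤ) - p) (-p) y := by
  rw [T2_packet hG c _ _ _ _ hy, jP2]
  congr 1; ext t
  rw [← T2_eq_jB2 l p hm _ hy, sub_eq_neg_add (c + t * I : ℂ)]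

theorem jP_hasDerivAt {G : ℝ → ℂ} (hG : PacketWeight G) (c : ℝ) (l : ℕ) (p m : ℤ)
    {y : ℝ} (hy : 0 < y) : HasDerivAt (jP G c l p m)
      ((jP1 G c l p m y - (((l : ℤ) - m).toNat : ℕ) * jP G c l p m y) / y) y := by
  rw [jP1_eq hG c l p m hy, jP_eq hG c l p m hy]
  refine (Jc_hasDerivAt (pk_besselSeq hG c) _ _ _ _ hy).congr_of_eventuallyEq ?_
  filter_upwards [Ioi_mem_nhds hy] with x hx using jP_eq hG c l p m hx

theorem jP1_hasDerivAt {G : ℝ → ℂ} (hG : PacketWeight G) (c : ℝ) (l : ℕ) (p : ℤ) {m : ℤ}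
    (hm : |m| ≤ (l : ℤ)) {y : ℝ} (hy : 0 < y) : HasDerivAt (jP1 G c l p m)
      ((jP2 G c l p m y - (((l : ℤ) - m).toNat : ℕ) * jP1 G c l p m y) / y) y := by
  rw [jP2_eq hG c l p hm hy, jP1_eq hG c l p m hy]
  refine (T1_hasDerivAt (pk_besselSeq hG c) _ _ _ _ hy).congr_of_eventuallyEq ?_
  filter_upwards [Ioi_mem_nhds hy] with x hx using jP1_eq hG c l p m hx

theorem jP_contDiffOn {G : ℝ → ℂ} (hG : PacketWeight G) (c : ℝ) (l : ℕ) (p m : ℤ) :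
    ContDiffOn ℝ ((⊤ : ℕ∞) : WithTop ℕ∞) (jP G c l p m) (Ioi 0) :=
  contDiffOn_infty.2 fun k => (Jc_contDiffOn (pk_besselSeq hG c) k _ _ _ _).congr
    fun _ hy => jP_eq hG c l p m hy

theorem PacketWeight.div {G D : ℝ → ℂ} (hG : PacketWeight G) (hD : Continuous D) {d : ℝ}
    (hd : 0 < d) (h : ∀ t, d ≤ ‖D t‖) : PacketWeight fun t => G t / D t := by
  refine ⟨hG.1.div hD fun t h0 => ?_, fun N => ?_⟩
  · have := h t; rw [h0, norm_zero] at this; linarith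
  · obtain ⟨C, hC, hb⟩ := hG.2 N
    refine ⟨C / d, by positivity, fun t => ?_⟩
    rw [norm_div, div_mul_eq_mul_div, div_mul_eq_mul_div]
    exact div_le_div₀ (by positivity) (hb t) hd (h t)

/-- The differential equation inverts division of the weight by `(ν - p)² - κ²`. -/
theorem jP2_div {G : ℝ → ℂ} (hG : PacketWeight G) (c : ℝ) (l : ℕ) (p m : ℤ) (κ : ℂ) {d : ℝ}
    (hd : 0 < d) (h : ∀ t : ℝ, d ≤ ‖(c + t * I - p : ℂ) ^ 2 - κ ^ 2‖) {y : ℝ} (hy : 0 < y) :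
    jP2 (fun t => G t / ((c + t * I - p : ℂ) ^ 2 - κ ^ 2)) c l p m y =
      jP G c l p m y +
      (κ ^ 2 + 4 * y ^ 2) *
        jP (fun t => G t / ((c + t * I - p : ℂ) ^ 2 - κ ^ 2)) c l p m y -
      4 * (((l : ℤ) - m).toNat : ℕ) * y *
        jP (fun t => G t / ((c + t * I - p : ℂ) ^ 2 - κ ^ 2)) c l p (m + 1) y := by
  have hG' := hG.div (D := fun t : ℝ => (c + t * I - p : ℂ) ^ 2 - κ ^ 2) (by fun_prop) hd h
  have i1 := jB_integrable hG c l p m hy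
  have i2 := (jB_integrable hG' c l p m hy).const_mul (κ ^ 2 + 4 * y ^ 2 : ℂ)
  have i3 := (jB_integrable hG' c l p (m + 1) hy).const_mul
    (4 * (((l : ℤ) - m).toNat : ℕ) * y : ℂ)
  simp only [jP, jP2]
  rw [← integral_const_mul, ← integral_const_mul, ← integral_add i1 i2,
    ← integral_sub (integrable_fun_add i1 i2) i3]
  congr 1; ext t
  have h0 : (c + t * I - p : ℂ) ^ 2 - κ ^ 2 ≠ 0 := norm_ne_zero_iff.1 (by linarith [h t])
  rw [jB2]
  field_simp
  ring

/-! ### Polynomials depending on parameters -/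

/-- Coefficientwise differentiability of a curve of polynomials. -/
def PolyDeriv (A : ℝ → ℂ[X]) (A' : ℂ[X]) (t : ℝ) : Prop :=
  ∀ k, HasDerivAt (fun t => (A t).coeff k) (A'.coeff k) t

theorem PolyDeriv.mul {A B : ℝ → ℂ[X]} {A' B' : ℂ[X]} {t : ℝ} (hA : PolyDeriv A A' t)
    (hB : PolyDeriv B B' t) : PolyDeriv (fun t => A t * B t) (A' * B t + A t * B') t := by
  intro k
  simp only [coeff_mul, coeff_add, ← Finset.sum_add_distrib]
  exact HasDerivAt.fun_sum fun x _ => (hA x.1).mul (hB x.2)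

theorem PolyDeriv.pow {A : ℝ → ℂ[X]} {A' : ℂ[X]} {t : ℝ} (hA : PolyDeriv A A' t) (n : ℕ) :
    PolyDeriv (fun t => A t ^ n) (n * A t ^ (n - 1) * A') t := by
  induction n with
  | zero =>
    intro k
    simpa using hasDerivAt_const t ((1 : ℂ[X]).coeff k)
  | succ n ih =>
    have := ih.mul hA
    simp only [← pow_succ] at this
    convert this using 1
    rcases n with _ | n
    · simp
    · simp only [Nat.add_sub_cancel, Nat.cast_add, Nat.cast_one, pow_succ]; ring

theorem PolyDeriv.linear {f g : ℝ → ℂ} {f' g' : ℂ} {t : ℝ} (hf : HasDerivAt f f' t)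
    (hg : HasDerivAt g g' t) (U W : ℂ[X]) :
    PolyDeriv (fun t => C (f t) * U + C (g t) * W) (C f' * U + C g' * W) t := by
  intro k
  simp only [coeff_add, coeff_C_mul]
  exact (hf.mul_const _).add (hg.mul_const _)

/-- Coefficientwise smoothness of a family of polynomials. -/
def PolySmooth {E : Type*} [NormedAddCommGroup E] [NormedSpace ℝ E] (A : E → ℂ[X]) : Prop :=
  ∀ k, ContDiff ℝ ((⊤ : ℕ∞) : WithTop ℕ∞) fun x => (A x).coeff k

theorem PolySmooth.mul {E : Type*} [NormedAddCommGroup E] [NormedSpace ℝ E] {A B : E → ℂ[X]}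
    (hA : PolySmooth A) (hB : PolySmooth B) : PolySmooth fun x => A x * B x := by
  intro k
  simp only [coeff_mul]
  exact ContDiff.sum fun x _ => (hA x.1).mul (hB x.2)

theorem PolySmooth.pow {E : Type*} [NormedAddCommGroup E] [NormedSpace ℝ E] {A : E → ℂ[X]}
    (hA : PolySmooth A) (n : ℕ) : PolySmooth fun x => A x ^ n := by
  induction n with
  | zero => intro k; simp only [pow_zero]; exact contDiff_const
  | succ n ih => simp only [pow_succ]; exact ih.mul hA

theorem PolySmooth.linear {E : Type*} [NormedAddCommGroup E] [NormedSpace ℝ E] {f g : E → ℂ}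
    (hf : ContDiff ℝ ((⊤ : ℕ∞) : WithTop ℕ∞) f) (hg : ContDiff ℝ ((⊤ : ℕ∞) : WithTop ℕ∞) g) :
    PolySmooth fun x => C (f x) * X + C (g x) := by
  intro k
  simp only [coeff_add, coeff_C_mul, coeff_C]
  refine (hf.mul contDiff_const).add ?_
  split_ifs
  · exact hg
  · exact contDiff_const

/-- Homogenization of a product of powers of linear polynomials. -/
theorem linear_pow_mul_linear_pow (a b c d : ℂ) (i j : ℕ) (U W : ℂ[X]) :
    ((C a * X + C b) ^ i * (C c * X + C d) ^ j : ℂ[X]).natDegree ≤ i + j ∧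
    (C a * U + C b * W) ^ i * (C c * U + C d * W) ^ j =
      ∑ k ∈ Finset.range (i + j + 1),
        C (((C a * X + C b) ^ i * (C c * X + C d) ^ j : ℂ[X]).coeff k) * U ^ k * W ^ (i + j - k) := by
  have step : ∀ (P : ℂ[X]) (N : ℕ) (a b : ℂ), P.natDegree ≤ N →
      ((C a * X + C b) * P).natDegree ≤ N + 1 ∧
      (C a * U + C b * W) * (∑ k ∈ Finset.range (N + 1), C (P.coeff k) * U ^ k * W ^ (N - k)) =
      ∑ k ∈ Finset.range (N + 1 + 1),
        C (((C a * X + C b) * P).coeff k) * U ^ k * W ^ (N + 1 - k) := by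
    intro P N a b hP
    refine ⟨?_, ?_⟩
    · refine natDegree_mul_le.trans ?_
      have : (C a * X + C b).natDegree ≤ 1 := natDegree_linear_le
      omega
    · have h1 : ∀ k, ((C a * X + C b) * P).coeff (k + 1) = a * P.coeff k + b * P.coeff (k + 1) := by
        intro k
        rw [add_mul, mul_assoc, coeff_add, coeff_C_mul, coeff_C_mul, coeff_X_mul]
      have h0 : ((C a * X + C b) * P).coeff 0 = b * P.coeff 0 := by
        rw [add_mul, mul_assoc, coeff_add, coeff_C_mul, coeff_C_mul, coeff_X_mul_zero]; simp
      have hN : P.coeff (N + 1) = 0 := coeff_eq_zero_of_natDegree_lt (by omega)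
      rw [Finset.sum_range_succ' _ (N + 1), h0]
      simp only [h1]
      simp only [C_add, C_mul, add_mul, Finset.sum_add_distrib]
      have e1 : ∀ k ∈ Finset.range (N + 1), C a * C (P.coeff k) * U ^ (k + 1) * W ^ (N + 1 - (k + 1))
          = C a * U * (C (P.coeff k) * U ^ k * W ^ (N - k)) := fun k _ => by
        rw [Nat.add_sub_add_right]; ring
      have e2 : (∑ k ∈ Finset.range (N + 1), C b * C (P.coeff (k + 1)) * U ^ (k + 1) *
          W ^ (N + 1 - (k + 1))) + C b * C (P.coeff 0) * U ^ 0 * W ^ (N + 1 - 0) =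
          C b * W * ∑ k ∈ Finset.range (N + 1), C (P.coeff k) * U ^ k * W ^ (N - k) := by
        have := Finset.sum_range_succ' (fun k => C b * C (P.coeff k) * U ^ k * W ^ (N + 1 - k))
          (N + 1)
        rw [← this, Finset.sum_range_succ, hN, Finset.mul_sum]
        simp only [C_0, mul_zero, zero_mul, add_zero]
        refine Finset.sum_congr rfl fun k hk => ?_
        have : N + 1 - k = (N - k) + 1 := by have := Finset.mem_range.1 hk; omega
        rw [this, pow_succ]; ring
      rw [Finset.sum_congr rfl e1, ← Finset.mul_sum, add_assoc, e2]
  induction i with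
  | zero =>
    induction j with
    | zero => simp
    | succ j ih =>
      simp only [pow_zero, one_mul, zero_add] at ih ⊢
      obtain ⟨h1, h2⟩ := step _ j c d ih.1
      rw [← pow_succ'] at h1 h2
      refine ⟨h1, ?_⟩
      rw [← h2, pow_succ', ih.2]
  | succ i ih =>
    obtain ⟨h1, h2⟩ := step _ (i + j) a b ih.1
    rw [← mul_assoc, ← pow_succ'] at h1 h2
    have e : i + 1 + j = i + j + 1 := by ring
    rw [e]
    refine ⟨h1, ?_⟩
    rw [← h2, ← ih.2, pow_succ']; ring

/-! ### The matrix coefficients -/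

/-- The generating polynomial of the matrix coefficients. -/
def PhiP (l : ℕ) (q : ℤ) (α β : ℂ) : ℂ[X] :=
  (C α * X - C (conj β)) ^ ((l : ℤ) - q).toNat *
    (C β * X + C (conj α)) ^ ((l : ℤ) + q).toNat

theorem Phi_eq_coeff {l : ℕ} {p q : ℤ} (hp : |p| ≤ (l : ℤ)) (hq : |q| ≤ (l : ℤ)) (α β : ℂ) :
    Phi l p q α β = (PhiP l q α β).coeff ((l : ℤ) - p).toNat := by
  rw [Phi, if_pos ⟨hp, hq⟩, PhiP]

theorem sum_Icc_eq_sum_range {M : Type*} [AddCommMonoid M] (l : ℕ) (f : ℤ → M) :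
    ∑ m ∈ Finset.Icc (-(l : ℤ)) l, f m = ∑ k ∈ Finset.range (2 * l + 1), f (l - k) := by
  refine Finset.sum_nbij' (fun m => (l - m).toNat) (fun k => (l : ℤ) - k) ?_ ?_ ?_ ?_ ?_
  · intro m hm; rw [Finset.mem_Icc] at hm; rw [Finset.mem_range]; omega
  · intro k hk; rw [Finset.mem_range] at hk; rw [Finset.mem_Icc]; omega
  · intro m hm; rw [Finset.mem_Icc] at hm; omega
  · intro k hk; omega
  · intro m hm; rw [Finset.mem_Icc] at hm; congr 1; omega

theorem mem_Icc_iff_abs {l : ℕ} {m : ℤ} : m ∈ Finset.Icc (-(l : ℤ)) l ↔ |m| ≤ (l : ℤ) := by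
  rw [Finset.mem_Icc, abs_le]

/-- The addition theorem. -/
theorem Phi_mul {l : ℕ} {p q : ℤ} (hp : |p| ≤ (l : ℤ)) (hq : |q| ≤ (l : ℤ)) (α β α' β' : ℂ) :
    Phi l p q (α * α' - β * conj β') (α * β' + β * conj α') =
      ∑ m ∈ Finset.Icc (-(l : ℤ)) l, Phi l p m α β * Phi l m q α' β' := by
  have hq' := abs_le.1 hq
  have hij : ((l : ℤ) - q).toNat + ((l : ℤ) + q).toNat = 2 * l := toNat_add_eq hq
  rw [sum_Icc_eq_sum_range, Phi_eq_coeff hp hq]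
  have h := (linear_pow_mul_linear_pow α' (-conj β') β' (conj α')
    ((l : ℤ) - q).toNat ((l : ℤ) + q).toNat (C α * X - C (conj β))
    (C β * X + C (conj α))).2
  have e1 : C α' * (C α * X - C (conj β)) +
      C (-conj β') * (C β * X + C (conj α)) =
      C (α * α' - β * conj β') * X -
        C (conj (α * β' + β * conj α')) := by
    simp only [map_add, map_mul, map_sub, map_neg, Complex.conj_conj]; ring
  have e2 : C β' * (C α * X - C (conj β)) +
      C (conj α') * (C β * X + C (conj α)) =
      C (α * β' + β * conj α') * X +
        C (conj (α * α' - β * conj β')) := by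
    simp only [map_add, map_mul, map_sub, Complex.conj_conj]; ring
  rw [e1, e2, hij] at h
  rw [PhiP, h, finsetSum_coeff]
  refine Finset.sum_congr rfl fun k hk => ?_
  rw [Finset.mem_range] at hk
  have hm : |(l : ℤ) - k| ≤ l := by rw [abs_le]; omega
  rw [Phi_eq_coeff hp hm, Phi_eq_coeff hm hq, PhiP, PhiP, mul_assoc, coeff_C_mul, mul_comm]
  have f1 : ((l : ℤ) - (l - k)).toNat = k := by omega
  have f2 : ((l : ℤ) + (l - k)).toNat = 2 * l - k := by omega
  rw [f1, f2, C_neg, ← sub_eq_add_neg]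

theorem Phi_smooth (l : ℕ) (p q : ℤ) :
    ContDiff ℝ ((⊤ : ℕ∞) : WithTop ℕ∞) fun x : ℂ × ℂ => Phi l p q x.1 x.2 := by
  by_cases h : |p| ≤ (l : ℤ) ∧ |q| ≤ (l : ℤ)
  · have hc : ContDiff ℝ ((⊤ : ℕ∞) : WithTop ℕ∞) (conj : ℂ → ℂ) := Complex.conjCLE.contDiff
    have h1 : PolySmooth fun x : ℂ × ℂ => C x.1 * X - C (conj x.2) := by
      have := PolySmooth.linear (f := fun x : ℂ × ℂ => x.1) (g := fun x => -conj x.2)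
        contDiff_fst (hc.comp contDiff_snd).neg
      simpa [sub_eq_add_neg] using this
    have h2 : PolySmooth fun x : ℂ × ℂ => C x.2 * X + C (conj x.1) :=
      PolySmooth.linear contDiff_snd (hc.comp contDiff_fst)
    simp only [Phi_eq_coeff h.1 h.2]
    exact ((h1.pow _).mul (h2.pow _)) _
  · have : (fun x : ℂ × ℂ => Phi l p q x.1 x.2) = fun _ => 0 := by ext x; rw [Phi, if_neg h]
    rw [this]; exact contDiff_const

theorem Phi_bounded (l : ℕ) (p q : ℤ) : ∃ C : ℝ, 0 ≤ C ∧ ∀ α β : ℂ,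
    normSq α + normSq β = 1 → ‖Phi l p q α β‖ ≤ C := by
  obtain ⟨C, hC⟩ := ((isCompact_closedBall (0 : ℂ) 1).prod
    (isCompact_closedBall (0 : ℂ) 1)).exists_bound_of_continuousOn
    (Phi_smooth l p q).continuous.continuousOn
  refine ⟨max C 0, le_max_right _ _, fun α β h => (hC (α, β) ?_).trans (le_max_left _ _)⟩
  simp only [normSq_eq_norm_sq] at h
  refine ⟨?_, ?_⟩
  · rw [mem_closedBall_zero_iff]; nlinarith [norm_nonneg α, sq_nonneg ‖β‖]
  · rw [mem_closedBall_zero_iff]; nlinarith [norm_nonneg β, sq_nonneg ‖α‖]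

theorem Phi_neg (l : ℕ) (p q : ℤ) (α β : ℂ) : Phi l p q (-α) (-β) = Phi l p q α β := by
  by_cases h : |p| ≤ (l : ℤ) ∧ |q| ≤ (l : ℤ)
  · rw [Phi_eq_coeff h.1 h.2, Phi_eq_coeff h.1 h.2]
    congr 1
    have e1 : C (-α) * X - C (conj (-β)) = (-1) * (C α * X - C (conj β)) := by
      simp only [map_neg]; ring
    have e2 : C (-β) * X + C (conj (-α)) = (-1) * (C β * X + C (conj α)) := by
      simp only [map_neg]; ring
    rw [PhiP, PhiP, e1, e2, mul_pow, mul_pow]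
    have e3 : ((-1 : ℂ[X]) ^ ((l : ℤ) - q).toNat) * (-1) ^ ((l : ℤ) + q).toNat = 1 := by
      rw [← pow_add, toNat_add_eq h.2, pow_mul]; simp
    calc _ = ((-1 : ℂ[X]) ^ ((l : ℤ) - q).toNat * (-1) ^ ((l : ℤ) + q).toNat) *
        ((C α * X - C (conj β)) ^ ((l : ℤ) - q).toNat *
        (C β * X + C (conj α)) ^ ((l : ℤ) + q).toNat) := by ring
      _ = _ := by rw [e3, one_mul]
  · rw [Phi, if_neg h, Phi, if_neg h]

theorem PolyDeriv.pow_mul_pow {u v : ℝ → ℂ[X]} {u' v' : ℂ[X]} {t : ℝ} (hu : PolyDeriv u u' t)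
    (hv : PolyDeriv v v' t) (a b : ℕ) : PolyDeriv (fun t => u t ^ a * v t ^ b)
      (a * u t ^ (a - 1) * u' * v t ^ b + u t ^ a * (b * v t ^ (b - 1) * v')) t :=
  (hu.pow a).mul (hv.pow b)

/-- `(l - q) P_{q+1}` in terms of the factors of `P_q`. -/
theorem PhiP_raise {l : ℕ} {q : ℤ} (hq : |q| ≤ (l : ℤ)) (α β : ℂ) (p : ℤ) (hp : |p| ≤ (l : ℤ)) :
    (((((l : ℤ) - q).toNat : ℕ) : ℂ[X]) * (C α * X - C (conj β)) ^ (((l : ℤ) - q).toNat - 1) *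
      (C β * X + C (conj α)) * (C β * X + C (conj α)) ^ ((l : ℤ) + q).toNat).coeff
        ((l : ℤ) - p).toNat = ((l : ℂ) - q) * Phi l p (q + 1) α β := by
  have h := abs_le.1 hq
  by_cases h0 : q = l
  · subst h0; simp
  · have hq1 : |q + 1| ≤ (l : ℤ) := by rw [abs_le]; omega
    have e1 : ((l : ℤ) - q).toNat - 1 = ((l : ℤ) - (q + 1)).toNat := by omega
    have e2 : ((l : ℤ) + (q + 1)).toNat = ((l : ℤ) + q).toNat + 1 := by omega
    have e3 : (((((l : ℤ) - q).toNat : ℕ) : ℂ[X])) = C ((l : ℂ) - q) := by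
      rw [← C_eq_natCast, toNat_cast (by omega)]; push_cast; rfl
    rw [Phi_eq_coeff hp hq1, ← coeff_C_mul, PhiP, e1, e2, e3, pow_succ]
    exact congrArg (fun P : ℂ[X] => P.coeff _) (by ring)

theorem PhiP_lower {l : ℕ} {q : ℤ} (hq : |q| ≤ (l : ℤ)) (α β : ℂ) (p : ℤ) (hp : |p| ≤ (l : ℤ)) :
    ((C α * X - C (conj β)) ^ ((l : ℤ) - q).toNat * (((((l : ℤ) + q).toNat : ℕ) : ℂ[X]) *
      (C β * X + C (conj α)) ^ (((l : ℤ) + q).toNat - 1) *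
      (C α * X - C (conj β)))).coeff
        ((l : ℤ) - p).toNat = ((l : ℂ) + q) * Phi l p (q - 1) α β := by
  have h := abs_le.1 hq
  by_cases h0 : q = -l
  · subst h0; simp
  · have hq1 : |q - 1| ≤ (l : ℤ) := by rw [abs_le]; omega
    have e1 : ((l : ℤ) + q).toNat - 1 = ((l : ℤ) + (q - 1)).toNat := by omega
    have e2 : ((l : ℤ) - (q - 1)).toNat = ((l : ℤ) - q).toNat + 1 := by omega
    have e3 : (((((l : ℤ) + q).toNat : ℕ) : ℂ[X])) = C ((l : ℂ) + q) := by
      rw [← C_eq_natCast, toNat_cast (by omega)]; push_cast; rfl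
    rw [Phi_eq_coeff hp hq1, ← coeff_C_mul, PhiP, e1, e2, e3, pow_succ]
    exact congrArg (fun P : ℂ[X] => P.coeff _) (by ring)

theorem hasDerivAt_cos_half : HasDerivAt (fun t : ℝ => ((Real.cos (t / 2) : ℝ) : ℂ)) 0 0 := by
  have := ((Real.hasDerivAt_cos (0 / 2)).comp (0 : ℝ) ((hasDerivAt_id (0 : ℝ)).div_const 2)).ofReal_comp
  simpa [Function.comp_def] using this

theorem hasDerivAt_sin_half : HasDerivAt (fun t : ℝ => ((Real.sin (t / 2) : ℝ) : ℂ)) (1 / 2) 0 := by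
  have := ((Real.hasDerivAt_sin (0 / 2)).comp (0 : ℝ) ((hasDerivAt_id (0 : ℝ)).div_const 2)).ofReal_comp
  simpa [Function.comp_def] using this

/-- A curve `α(t) u + ...` acting on the generating polynomial. -/
theorem Phi_hasDerivAt_of {l : ℕ} {p q : ℤ} (hp : |p| ≤ (l : ℤ)) (hq : |q| ≤ (l : ℤ))
    {A B : ℝ → ℂ} {f g f₁ g₁ : ℝ → ℂ} {f' g' f₁' g₁' : ℂ} {α β : ℂ}
    (hf : HasDerivAt f f' 0) (hg : HasDerivAt g g' 0) (hf₁ : HasDerivAt f₁ f₁' 0)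
    (hg₁ : HasDerivAt g₁ g₁' 0) (f0 : f 0 = 1) (g0 : g 0 = 0) (f10 : f₁ 0 = 0) (g10 : g₁ 0 = 1)
    (hu : ∀ t, C (A t) * X - C (conj (B t)) =
      C (f t) * (C α * X - C (conj β)) + C (g t) * (C β * X + C (conj α)))
    (hv : ∀ t, C (B t) * X + C (conj (A t)) =
      C (f₁ t) * (C α * X - C (conj β)) + C (g₁ t) * (C β * X + C (conj α))) :
    HasDerivAt (fun t => Phi l p q (A t) (B t))
      ((((l : ℂ) - q) * f' + ((l : ℂ) + q) * g₁') * Phi l p q α β +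
        g' * (((l : ℂ) - q) * Phi l p (q + 1) α β) +
        f₁' * (((l : ℂ) + q) * Phi l p (q - 1) α β)) 0 := by
  have h := abs_le.1 hq
  have hP := (PolyDeriv.pow_mul_pow (PolyDeriv.linear hf hg (C α * X - C (conj β))
    (C β * X + C (conj α))) (PolyDeriv.linear hf₁ hg₁ (C α * X - C (conj β))
    (C β * X + C (conj α))) ((l : ℤ) - q).toNat ((l : ℤ) + q).toNat) ((l : ℤ) - p).toNat
  have e : (fun t => Phi l p q (A t) (B t)) = fun t =>
      ((C (f t) * (C α * X - C (conj β)) + C (g t) * (C β * X + C (conj α))) ^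
        ((l : ℤ) - q).toNat * (C (f₁ t) * (C α * X - C (conj β)) +
          C (g₁ t) * (C β * X + C (conj α))) ^ ((l : ℤ) + q).toNat).coeff
          ((l : ℤ) - p).toNat := by
    ext t
    rw [Phi_eq_coeff hp hq, PhiP, hu, hv]
  rw [e]
  refine hP.congr_deriv ?_
  simp only [f0, g0, f10, g10, C_1, C_0, one_mul, zero_mul, add_zero, zero_add]
  rw [← PhiP_raise hq α β p hp, ← PhiP_lower hq α β p hp, Phi_eq_coeff hp hq, PhiP]
  set u := C α * X - C (conj β)
  set v := C β * X + C (conj α)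
  have ea : ((((l : ℤ) - q).toNat : ℕ) : ℂ[X]) * u ^ (((l : ℤ) - q).toNat - 1) * u =
      C ((l : ℂ) - q) * u ^ ((l : ℤ) - q).toNat := by
    rw [← C_eq_natCast, toNat_cast (by omega)]
    by_cases h0 : q = l
    · subst h0; simp
    · have : ((l : ℤ) - q).toNat = ((l : ℤ) - q).toNat - 1 + 1 := by omega
      conv_rhs => rw [this, pow_succ]
      push_cast; ring
  have eb : ((((l : ℤ) + q).toNat : ℕ) : ℂ[X]) * v ^ (((l : ℤ) + q).toNat - 1) * v =
      C ((l : ℂ) + q) * v ^ ((l : ℤ) + q).toNat := by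
    rw [← C_eq_natCast, toNat_cast (by omega)]
    by_cases h0 : q = -l
    · subst h0; simp
    · have : ((l : ℤ) + q).toNat = ((l : ℤ) + q).toNat - 1 + 1 := by omega
      conv_rhs => rw [this, pow_succ]
      push_cast; ring
  simp only [← coeff_C_mul, ← coeff_add]
  refine congrArg (fun P : ℂ[X] => P.coeff _) ?_
  simp only [C_add, C_mul, C_sub] at ea eb ⊢
  linear_combination (C f' * v ^ ((l : ℤ) + q).toNat) * ea + (C g₁' * u ^ ((l : ℤ) - q).toNat) * eb

theorem Phi_hasDerivAt_W1 {l : ℕ} {p q : ℤ} (hp : |p| ≤ (l : ℤ)) (hq : |q| ≤ (l : ℤ)) (α β : ℂ) :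
    HasDerivAt (fun t : ℝ => Phi l p q
      (α * (Real.cos (t / 2) : ℝ) - β * conj ((Real.sin (t / 2) : ℝ) : ℂ))
      (α * (Real.sin (t / 2) : ℝ) + β * conj ((Real.cos (t / 2) : ℝ) : ℂ)))
      (1 / 2 * (-(((l : ℂ) - q) * Phi l p (q + 1) α β) + ((l : ℂ) + q) * Phi l p (q - 1) α β)) 0 := by
  refine (Phi_hasDerivAt_of hp hq (α := α) (β := β) hasDerivAt_cos_half hasDerivAt_sin_half.neg
    hasDerivAt_sin_half hasDerivAt_cos_half (by simp) (by simp) (by simp) (by simp) (fun t => ?_)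
    (fun t => ?_)).congr_deriv (by ring)
  · simp only [map_add, map_mul, conj_ofReal, map_sub, map_neg, Pi.neg_apply]; ring
  · simp only [map_add, map_mul, conj_ofReal, map_sub]; ring

theorem Phi_hasDerivAt_W2 {l : ℕ} {p q : ℤ} (hp : |p| ≤ (l : ℤ)) (hq : |q| ≤ (l : ℤ)) (α β : ℂ) :
    HasDerivAt (fun t : ℝ => Phi l p q
      (α * (Real.cos (t / 2) : ℝ) - β * conj (I * (Real.sin (t / 2) : ℝ)))
      (α * (I * (Real.sin (t / 2) : ℝ)) + β * conj ((Real.cos (t / 2) : ℝ) : ℂ)))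
      (I / 2 * (((l : ℂ) - q) * Phi l p (q + 1) α β +
        ((l : ℂ) + q) * Phi l p (q - 1) α β)) 0 := by
  refine (Phi_hasDerivAt_of hp hq (α := α) (β := β) hasDerivAt_cos_half
    (hasDerivAt_sin_half.const_mul I)
    (hasDerivAt_sin_half.const_mul I) hasDerivAt_cos_half
    (by simp) (by simp) (by simp) (by simp) (fun t => ?_)
    (fun t => ?_)).congr_deriv (by ring)
  · simp only [map_add, map_mul, conj_ofReal, map_sub, map_neg, conj_I]; ring
  · simp only [map_add, map_mul, conj_ofReal, map_sub, conj_I, map_neg]; ring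

theorem Phi_hasDerivAt_H2 {l : ℕ} {p q : ℤ} (hp : |p| ≤ (l : ℤ)) (hq : |q| ≤ (l : ℤ)) (α β : ℂ) :
    HasDerivAt (fun t : ℝ => Phi l p q
      (α * Complex.exp (I * t / 2) - β * conj 0)
      (α * 0 + β * conj (Complex.exp (I * t / 2))))
      (-(I * q) * Phi l p q α β) 0 := by
  have h1 : HasDerivAt (fun t : ℝ => Complex.exp (I * t / 2)) (I / 2) 0 := by
    simpa using (((hasDerivAt_ofReal 0).const_mul I).div_const 2).cexp
  have h2 : HasDerivAt (fun t : ℝ => Complex.exp (-(I * t / 2))) (-(I / 2)) 0 := by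
    simpa using (((hasDerivAt_ofReal 0).const_mul I).div_const 2).neg.cexp
  have hconj : ∀ t : ℝ, conj (Complex.exp (I * t / 2)) =
      Complex.exp (-(I * t / 2)) := fun t => by
    rw [← Complex.exp_conj, map_div₀, map_mul, conj_I, conj_ofReal, map_ofNat]
    congr 1; ring
  have hconj' : ∀ t : ℝ, conj (Complex.exp (-(I * t / 2))) =
      Complex.exp (I * t / 2) := fun t => by
    rw [← hconj, Complex.conj_conj]
  refine (Phi_hasDerivAt_of hp hq (α := α) (β := β) h1 (hasDerivAt_const 0 0)
    (hasDerivAt_const 0 0) h2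
    (by simp) (by simp) (by simp) (by simp) (fun t => ?_)
    (fun t => ?_)).congr_deriv (by ring)
  · simp only [hconj, hconj', map_zero, mul_zero, zero_add, sub_zero, map_mul, zero_mul, add_zero]
    ring
  · simp only [hconj, map_zero, mul_zero, zero_add, sub_zero, map_mul, zero_mul]
    ring

/-! ### Integrals over `K` -/

/-- `Φ^l_{m,q}(k[cos(θ/2), i sin(θ/2)])`. -/
def dB (l : ℕ) (q m : ℤ) (θ : ℝ) : ℂ :=
  Phi l m q ((Real.cos (θ / 2) : ℝ) : ℂ) (I * ((Real.sin (θ / 2) : ℝ) : ℂ))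

theorem kElt_00 {α β : ℂ} (h : normSq α + normSq β = 1) :
    (kElt α β) 0 0 = α ∧ (kElt α β) 0 1 = β ∧ (kElt α β) 1 0 = -conj β ∧
      (kElt α β) 1 1 = conj α := by
  simp [kElt, h]

theorem normSq_exp_I (x : ℝ) : normSq (Complex.exp (I * x / 2)) = 1 := by
  rw [normSq_eq_norm_sq, Complex.norm_exp]
  simp

theorem normSq_cos_sin (x : ℝ) : normSq ((Real.cos x : ℝ) : ℂ) +
    normSq (I * ((Real.sin x : ℝ) : ℂ)) = 1 := by
  rw [Complex.normSq_mul, Complex.normSq_I, normSq_ofReal, normSq_ofReal]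
  have := Real.cos_sq_add_sin_sq x
  nlinarith

theorem conj_exp_I (x : ℝ) : conj (Complex.exp (I * x / 2)) =
    (Complex.exp (I * x / 2))⁻¹ := by
  rw [← Complex.exp_conj, map_div₀, map_mul, conj_I, conj_ofReal, map_ofNat,
    ← Complex.exp_neg]
  congr 1; ring

theorem hElt_exp_eq (x : ℝ) : hElt (Complex.exp (I * x / 2)) =
    kElt (Complex.exp (I * x / 2)) 0 := by
  have h : normSq (Complex.exp (I * x / 2)) + normSq 0 = 1 := by
    rw [normSq_exp_I]; simp
  obtain ⟨a1, a2, a3, a4⟩ := kElt_00 h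
  ext i j
  fin_cases i <;> fin_cases j <;>
    simp [hElt, a1, a2, a3, a4, Complex.exp_ne_zero, conj_exp_I]

theorem kElt_mul {α β α' β' : ℂ} (h : normSq α + normSq β = 1)
    (h' : normSq α' + normSq β' = 1) :
    normSq (α * α' - β * conj β') +
      normSq (α * β' + β * conj α') = 1 ∧
    kElt α β * kElt α' β' =
      kElt (α * α' - β * conj β') (α * β' + β * conj α') := by
  have h1 : normSq (α * α' - β * conj β') +
      normSq (α * β' + β * conj α') = 1 := by
    have : (normSq α + normSq β) * (normSq α' + normSq β') = 1 := by
      rw [h, h', one_mul]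
    rw [← this]
    simp only [Complex.normSq_apply, sub_re, Complex.sub_im, Complex.mul_re, Complex.mul_im,
      add_re, Complex.add_im, Complex.conj_re, Complex.conj_im]
    ring
  refine ⟨h1, ?_⟩
  obtain ⟨a1, a2, a3, a4⟩ := kElt_00 h
  obtain ⟨b1, b2, b3, b4⟩ := kElt_00 h'
  obtain ⟨c1, c2, c3, c4⟩ := kElt_00 h1
  ext i j
  fin_cases i <;> fin_cases j <;>
    simp [Matrix.SpecialLinearGroup.coe_mul, Matrix.mul_apply, Fin.sum_univ_two, a1, a2, a3, a4,
      b1, b2, b3, b4, c1, c2, c3, c4] <;> ring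

theorem eulerElt_eq (x : ℝ × ℝ × ℝ) :
    normSq (Complex.exp (I * x.1 / 2) * (Real.cos (x.2.1 / 2) : ℝ) *
      Complex.exp (I * x.2.2 / 2)) +
      normSq (Complex.exp (I * x.1 / 2) * (I * (Real.sin (x.2.1 / 2) : ℝ)) *
      conj (Complex.exp (I * x.2.2 / 2))) = 1 ∧
    eulerElt x = kElt (Complex.exp (I * x.1 / 2) * (Real.cos (x.2.1 / 2) : ℝ) *
      Complex.exp (I * x.2.2 / 2))
      (Complex.exp (I * x.1 / 2) * (I * (Real.sin (x.2.1 / 2) : ℝ)) *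
      conj (Complex.exp (I * x.2.2 / 2))) := by
  have h1 : ∀ x : ℝ, normSq (Complex.exp (I * x / 2)) + normSq 0 = 1 :=
    fun x => by rw [normSq_exp_I]; simp
  have k1 := kElt_mul (h1 x.1) (normSq_cos_sin (x.2.1 / 2))
  have k2 := kElt_mul k1.1 (h1 x.2.2)
  simp only [zero_mul, sub_zero, add_zero, mul_zero, map_zero, zero_add] at k1 k2
  refine ⟨k2.1, ?_⟩
  rw [eulerElt, hElt_exp_eq, hElt_exp_eq, k1.2, k2.2]

theorem Phi_left_diag {l : ℕ} {p q : ℤ} (hp : |p| ≤ (l : ℤ)) (hq : |q| ≤ (l : ℤ)) {u : ℂ}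
    (hu : u ≠ 0) (huc : conj u = u⁻¹) (α β : ℂ) :
    Phi l p q (u * α) (u * β) = u ^ (-(2 * p)) * Phi l p q α β := by
  rw [Phi_eq_coeff hp hq, Phi_eq_coeff hp hq]
  have e1 : C (u * α) * X - C (conj (u * β)) =
      C u⁻¹ * ((C α * X - C (conj β)).comp (C (u ^ 2) * X)) := by
    simp only [sub_comp, mul_comp, C_comp, X_comp, map_mul, huc, C_pow]
    have : C u⁻¹ * C u = (1 : ℂ[X]) := by rw [← C_mul, inv_mul_cancel₀ hu, C_1]
    linear_combination (-(C u * C α * X)) * this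
  have e2 : C (u * β) * X + C (conj (u * α)) =
      C u⁻¹ * ((C β * X + C (conj α)).comp (C (u ^ 2) * X)) := by
    simp only [add_comp, mul_comp, C_comp, X_comp, map_mul, huc, C_pow]
    have : C u⁻¹ * C u = (1 : ℂ[X]) := by rw [← C_mul, inv_mul_cancel₀ hu, C_1]
    linear_combination (-(C u * C β * X)) * this
  have e3 : PhiP l q (u * α) (u * β) = C (u⁻¹ ^ (2 * l)) * (PhiP l q α β).comp (C (u ^ 2) * X) := by
    rw [PhiP, e1, e2, mul_pow, mul_pow, PhiP, mul_comp, pow_comp, pow_comp, ← toNat_add_eq hq,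
      pow_add, C_mul, C_pow (n := ((l : ℤ) - q).toNat), C_pow (n := ((l : ℤ) + q).toNat)]
    ring
  rw [e3, coeff_C_mul, comp_C_mul_X_coeff, mul_comm ((PhiP l q α β).coeff _), ← mul_assoc]
  congr 1
  have hp' := abs_le.1 hp
  have : (u ^ 2) ^ ((l : ℤ) - p).toNat = u ^ (2 * ((l : ℤ) - p)) := by
    rw [← pow_mul, ← zpow_natCast]; congr 1; push_cast
    rw [Int.toNat_of_nonneg (by omega)]
  rw [this, inv_pow, ← zpow_natCast, ← zpow_neg, ← zpow_add₀ hu]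
  congr 1; push_cast; ring

theorem Phi_right_diag {l : ℕ} {p q : ℤ} (hp : |p| ≤ (l : ℤ)) (hq : |q| ≤ (l : ℤ)) {u : ℂ}
    (hu : u ≠ 0) (huc : conj u = u⁻¹) (α β : ℂ) :
    Phi l p q (α * u) (β * conj u) = u ^ (-(2 * q)) * Phi l p q α β := by
  rw [Phi_eq_coeff hp hq, Phi_eq_coeff hp hq, ← coeff_C_mul]
  refine congrArg (fun P : ℂ[X] => P.coeff _) ?_
  have e1 : C (α * u) * X - C (conj (β * conj u)) =
      C u * (C α * X - C (conj β)) := by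
    simp only [map_mul, Complex.conj_conj]; ring
  have e2 : C (β * conj u) * X + C (conj (α * u)) =
      C u⁻¹ * (C β * X + C (conj α)) := by
    simp only [map_mul, huc]; ring
  have hq' := abs_le.1 hq
  have e3 : C (u ^ (-(2 * q))) = C u ^ ((l : ℤ) - q).toNat * C u⁻¹ ^ ((l : ℤ) + q).toNat := by
    rw [← C_pow, ← C_pow, ← C_mul, inv_pow, ← zpow_natCast, ← zpow_natCast, ← zpow_neg,
      ← zpow_add₀ hu, Int.toNat_of_nonneg (by omega), Int.toNat_of_nonneg (by omega)]
    congr 2; ring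
  rw [PhiP, PhiP, e1, e2, e3, mul_pow, mul_pow]
  ring

theorem Phi_eulerElt {l : ℕ} {m q : ℤ} (hm : |m| ≤ (l : ℤ)) (hq : |q| ≤ (l : ℤ))
    (x : ℝ × ℝ × ℝ) : Phi l m q (eulerElt x 0 0) (eulerElt x 0 1) =
      Complex.exp (-(I * m * x.1)) * (dB l q m x.2.1 * Complex.exp (-(I * q * x.2.2))) := by
  obtain ⟨h1, h2⟩ := eulerElt_eq x
  obtain ⟨k1, k2, -, -⟩ := kElt_00 h1
  rw [h2, k1, k2, Phi_right_diag hm hq (Complex.exp_ne_zero _) (conj_exp_I _),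
    Phi_left_diag hm hq (Complex.exp_ne_zero _) (conj_exp_I _), ← Complex.exp_int_mul,
    ← Complex.exp_int_mul, dB]
  have e1 : ((-(2 * m) : ℤ) : ℂ) * (I * x.1 / 2) = -(I * m * x.1) := by
    push_cast; ring
  have e2 : ((-(2 * q) : ℤ) : ℂ) * (I * x.2.2 / 2) = -(I * q * x.2.2) := by
    push_cast; ring
  rw [e1, e2]; ring

instance : IsFiniteMeasure haarK := by
  unfold haarK
  have hfin : volume (Set.Ioc 0 (2 * π) ×ˢ Set.Icc 0 π ×ˢ
    Set.Ioc 0 (2 * π)) < ⊤ := by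
    rw [Measure.volume_eq_prod, Measure.prod_prod, Measure.volume_eq_prod, Measure.prod_prod]
    simp only [Real.volume_Ioc, Real.volume_Icc]
    exact ENNReal.mul_lt_top ENNReal.ofReal_lt_top
      (ENNReal.mul_lt_top ENNReal.ofReal_lt_top ENNReal.ofReal_lt_top)
  refine isFiniteMeasure_withDensity_ofReal ?_
  have : IsFiniteMeasure (volume.restrict (Set.Ioc 0 (2 * π) ×ˢ Set.Icc 0 π ×ˢ
    Set.Ioc 0 (2 * π))) := ⟨by rwa [Measure.restrict_apply_univ]⟩
  refine (Integrable.of_bound (C := 1 / (8 * π ^ 2)) ?_ (Eventually.of_forall fun x => ?_)).2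
  · refine Continuous.aestronglyMeasurable ?_
    fun_prop
  · rw [Real.norm_eq_abs, abs_div, abs_of_pos (by positivity : 0 < 8 * π ^ 2)]
    gcongr
    exact Real.abs_sin_le_one _

theorem integral_haarK_mul (f g h : ℝ → ℂ) :
    ∫ x, f x.1 * (g x.2.1 * h x.2.2) ∂haarK =
      (∫ x in Ioc 0 (2 * π), f x) *
        ((∫ θ in Icc 0 π, ((Real.sin θ / (8 * π ^ 2) : ℝ) : ℂ) * g θ) *
          ∫ x in Ioc 0 (2 * π), h x) := by
  rw [haarK, integral_withDensity_eq_integral_toReal_smul (by fun_prop)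
    (Eventually.of_forall fun _ => ENNReal.ofReal_lt_top)]
  rw [Measure.volume_eq_prod, ← Measure.prod_restrict, Measure.volume_eq_prod,
    ← Measure.prod_restrict, ← integral_prod_mul, ← integral_prod_mul]
  rw [Measure.prod_restrict, Measure.prod_restrict]
  refine setIntegral_congr_fun (measurableSet_Ioc.prod (measurableSet_Icc.prod measurableSet_Ioc))
    fun x hx => ?_
  have hs : 0 ≤ Real.sin x.2.1 / (8 * π ^ 2) :=
    div_nonneg (Real.sin_nonneg_of_mem_Icc hx.2.1) (by positivity)
  simp only [ENNReal.toReal_ofReal hs, Complex.real_smul]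
  ring

/-- The squared norm `‖Φ^l_{m,q}‖²_K`. -/
def nK (l : ℕ) (q m : ℤ) : ℝ := ∫ θ in Icc 0 π, Real.sin θ / 2 * ‖dB l q m θ‖ ^ 2

theorem integral_exp_int {k : ℤ} : ∫ x in Ioc 0 (2 * π), Complex.exp (I * k * x) =
    if k = 0 then 2 * π else 0 := by
  rw [← intervalIntegral.integral_of_le (by positivity)]
  split_ifs with h
  · subst h; simp
  · have hk : (I * k : ℂ) ≠ 0 := mul_ne_zero Complex.I_ne_zero (by exact_mod_cast h)
    rw [integral_exp_mul_complex hk]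
    have : I * k * ((2 * π : ℝ) : ℂ) = k * (2 * π * I) := by
      push_cast; ring
    rw [this, Complex.exp_int_mul_two_pi_mul_I]; simp

theorem integral_Phi_mul_conj {l : ℕ} {m m' q : ℤ} (hm : |m| ≤ (l : ℤ)) (hm' : |m'| ≤ (l : ℤ))
    (hq : |q| ≤ (l : ℤ)) :
    ∫ x, Phi l m q (eulerElt x 0 0) (eulerElt x 0 1) *
      conj (Phi l m' q (eulerElt x 0 0) (eulerElt x 0 1)) ∂haarK =
      if m = m' then (nK l q m : ℂ) else 0 := by
  have e : ∀ x : ℝ × ℝ × ℝ, Phi l m q (eulerElt x 0 0) (eulerElt x 0 1) *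
      conj (Phi l m' q (eulerElt x 0 0) (eulerElt x 0 1)) =
      Complex.exp (I * ((m' - m : ℤ) : ℂ) * x.1) *
        ((dB l q m x.2.1 * conj (dB l q m' x.2.1)) * (fun _ : ℝ => (1 : ℂ)) x.2.2) := by
    intro x
    rw [Phi_eulerElt hm hq, Phi_eulerElt hm' hq]
    simp only [map_mul, ← Complex.exp_conj, map_neg, conj_I, conj_ofReal, map_intCast]
    have e1 : Complex.exp (I * ((m' - m : ℤ) : ℂ) * x.1) =
        Complex.exp (-(I * m * x.1)) * Complex.exp (-(-I * m' * x.1)) := by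
      rw [← Complex.exp_add]; congr 1; push_cast; ring
    have e2 : Complex.exp (-(I * q * x.2.2)) * Complex.exp (-(-I * q * x.2.2)) = 1 := by
      rw [← Complex.exp_add, ← Complex.exp_zero]; congr 1; ring
    rw [e1]
    linear_combination (Complex.exp (-(I * m * x.1)) * Complex.exp (-(-I * m' * x.1)) *
      dB l q m x.2.1 * conj (dB l q m' x.2.1)) * e2
  simp_rw [e]
  rw [integral_haarK_mul (fun x => Complex.exp (I * ((m' - m : ℤ) : ℂ) * x))
    (fun θ => dB l q m θ * conj (dB l q m' θ)) (fun _ => 1), integral_exp_int]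
  by_cases h : m = m'
  · subst h
    rw [if_pos (sub_self m), if_pos rfl, setIntegral_const, nK]
    rw [← integral_complex_ofReal]
    have hv : (volume : Measure ℝ).real (Ioc 0 (2 * π)) = 2 * π := by
      rw [Measure.real, Real.volume_Ioc, ENNReal.toReal_ofReal (by linarith [Real.two_pi_pos])]; ring
    rw [hv, Complex.real_smul, mul_one, mul_comm (∫ θ in Icc 0 π, _), ← mul_assoc,
      ← integral_const_mul]
    refine integral_congr_ae (Eventually.of_forall fun θ => ?_)
    simp only
    rw [mul_conj, normSq_eq_norm_sq]
    have : (π : ℂ) ≠ 0 := by exact_mod_cast pi_pos.ne'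
    push_cast
    field_simp
    ring
  · rw [if_neg (fun h' => h (by omega)), if_neg h]; simp

theorem normPhi_sq {l : ℕ} {m q : ℤ} (hm : |m| ≤ (l : ℤ)) (hq : |q| ≤ (l : ℤ)) :
    normPhi l m q = Real.sqrt (nK l q m) := by
  rw [normPhi]
  congr 1
  have := integral_Phi_mul_conj hm hm hq
  rw [if_pos rfl] at this
  have h2 : ((∫ x, ‖Phi l m q (eulerElt x 0 0) (eulerElt x 0 1)‖ ^ 2 ∂haarK : ℝ) : ℂ) = nK l q m := by
    rw [← this, ← integral_complex_ofReal]
    congr 1; ext x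
    rw [mul_conj, normSq_eq_norm_sq]
  exact_mod_cast h2

/-! ### The norms of the matrix coefficients -/

theorem cZ_add (P Q : ℂ[X]) (n : ℤ) : cZ (P + Q) n = cZ P n + cZ Q n := by
  unfold cZ; split_ifs <;> simp

theorem cZ_sub (P Q : ℂ[X]) (n : ℤ) : cZ (P - Q) n = cZ P n - cZ Q n := by
  unfold cZ; split_ifs <;> simp

theorem cZ_C_mul (c : ℂ) (P : ℂ[X]) (n : ℤ) : cZ (C c * P) n = c * cZ P n := by
  unfold cZ; split_ifs <;> simp

theorem cZ_X_mul (P : ℂ[X]) (n : ℤ) : cZ (X * P) n = cZ P (n - 1) := by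
  have := cZ_mul_linear 1 0 P n
  simpa using this

theorem cZ_derivative (P : ℂ[X]) (n : ℤ) : cZ (derivative P) n = (n + 1) * cZ P (n + 1) := by
  unfold cZ
  rcases lt_trichotomy n (-1) with h | h | h
  · rw [if_neg (by omega), if_neg (by omega)]; simp
  · subst h; simp
  · rw [if_pos (by omega), if_pos (by omega), coeff_derivative]
    have h1 : (n + 1).toNat = n.toNat + 1 := by omega
    have h2 : ((n.toNat : ℕ) : ℂ) = n := by
      have : ((n.toNat : ℕ) : ℤ) = n := by omega
      exact_mod_cast congrArg (fun z : ℤ => (z : ℂ)) this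
    rw [h1, h2]; ring

theorem PhiP_natDegree {l : ℕ} {q : ℤ} (hq : |q| ≤ (l : ℤ)) (α β : ℂ) :
    (PhiP l q α β).natDegree ≤ 2 * l := by
  have h := (linear_pow_mul_linear_pow α (-conj β) β (conj α)
    ((l : ℤ) - q).toNat ((l : ℤ) + q).toNat 1 1).1
  rw [toNat_add_eq hq, C_neg, ← sub_eq_add_neg] at h
  exact h

theorem Phi_eq_cZ {l : ℕ} {q : ℤ} (hq : |q| ≤ (l : ℤ)) (p : ℤ) (α β : ℂ) :
    Phi l p q α β = cZ (PhiP l q α β) (l - p) := by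
  by_cases hp : |p| ≤ (l : ℤ)
  · rw [Phi_eq_coeff hp hq, cZ, if_pos (by have := abs_le.1 hp; omega)]
  · rw [Phi, if_neg (fun h => hp h.1), cZ]
    split_ifs with h
    · rw [coeff_eq_zero_of_natDegree_lt]
      refine (PhiP_natDegree hq α β).trans_lt ?_
      rw [abs_le] at hp
      omega
    · rfl

theorem derivative_linear_pow_mul (c s : ℂ) (a b : ℕ) :
    let u : ℂ[X] := C c * X + C s
    let v : ℂ[X] := C s * X + C c
    (1 - X ^ 2) * derivative (u ^ a * v ^ b) + ((a + b : ℕ) : ℂ[X]) * X * (u ^ a * v ^ b) =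
        (a : ℂ[X]) * u ^ (a - 1) * v * v ^ b + u ^ a * ((b : ℂ[X]) * v ^ (b - 1) * u) ∧
      (C (c * s) * (1 + X ^ 2) + C (c ^ 2 + s ^ 2) * X) * derivative (u ^ a * v ^ b) =
        (C c * (a : ℂ[X]) * v + C s * (b : ℂ[X]) * u) * (u ^ a * v ^ b) := by
  intro u v
  have hu : v - X * u = C c * (1 - X ^ 2) := by simp only [u, v]; ring
  have hv : u - X * v = C s * (1 - X ^ 2) := by simp only [u, v]; ring
  have huv : u * v = C (c * s) * (1 + X ^ 2) + C (c ^ 2 + s ^ 2) * X := by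
    simp only [u, v, C_mul, C_add, C_pow]; ring
  have h1 : (a : ℂ[X]) * u ^ (a - 1) * u = a * u ^ a := by
    cases a with
    | zero => simp
    | succ a => simp only [Nat.add_sub_cancel]; ring
  have h2 : (b : ℂ[X]) * v ^ (b - 1) * v = b * v ^ b := by
    cases b with
    | zero => simp
    | succ b => simp only [Nat.add_sub_cancel]; ring
  have hd : derivative (u ^ a * v ^ b) =
      (a : ℂ[X]) * u ^ (a - 1) * C c * v ^ b + u ^ a * ((b : ℂ[X]) * v ^ (b - 1) * C s) := by
    have d1 : derivative u = C c := by simp [u]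
    have d2 : derivative v = C s := by simp [v]
    rw [derivative_mul, derivative_pow, derivative_pow, d1, d2]; simp
  rw [hd, ← huv]
  constructor
  · push_cast
    linear_combination (-(a : ℂ[X]) * u ^ (a - 1) * v ^ b) * hu - (u ^ a * b * v ^ (b - 1)) * hv -
      (X * v ^ b) * h1 - X * u ^ a * h2
  · linear_combination (C c * v * v ^ b) * h1 + (u * u ^ a * C s) * h2

theorem dB_eq_cZ {l : ℕ} {q : ℤ} (hq : |q| ≤ (l : ℤ)) (m : ℤ) (θ : ℝ) :
    dB l q m θ = cZ ((C ((Real.cos (θ / 2) : ℝ) : ℂ) * X +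
      C (I * ((Real.sin (θ / 2) : ℝ) : ℂ))) ^ ((l : ℤ) - q).toNat *
      (C (I * ((Real.sin (θ / 2) : ℝ) : ℂ)) * X + C ((Real.cos (θ / 2) : ℝ) : ℂ)) ^
        ((l : ℤ) + q).toNat) (l - m) := by
  rw [dB, Phi_eq_cZ hq, PhiP]
  simp only [map_mul, conj_ofReal, conj_I, C_neg, neg_mul, sub_neg_eq_add]

theorem dB_hasDerivAt {l : ℕ} {q : ℤ} (hq : |q| ≤ (l : ℤ)) (m : ℤ) (θ : ℝ) :
    HasDerivAt (dB l q m) (I / 2 * (((l : ℂ) - m + 1) * dB l q (m - 1) θ +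
      ((l : ℂ) + m + 1) * dB l q (m + 1) θ)) θ ∧
    -2 * m * (Real.cos θ : ℝ) * dB l q m θ + I * (Real.sin θ : ℝ) *
      (((l : ℂ) - m + 1) * dB l q (m - 1) θ - ((l : ℂ) + m + 1) * dB l q (m + 1) θ) =
        -2 * q * dB l q m θ := by
  set a := ((l : ℤ) - q).toNat with ha
  set b := ((l : ℤ) + q).toNat with hb
  have hab : a + b = 2 * l := toNat_add_eq hq
  have hq' := abs_le.1 hq
  have haC : (a : ℂ) = l - q := by
    have : (a : ℤ) = l - q := by omega
    exact_mod_cast congrArg (fun z : ℤ => (z : ℂ)) this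
  have hbC : (b : ℂ) = l + q := by
    have : (b : ℤ) = l + q := by omega
    exact_mod_cast congrArg (fun z : ℤ => (z : ℂ)) this
  set c : ℂ := ((Real.cos (θ / 2) : ℝ) : ℂ) with hc
  set s : ℂ := I * ((Real.sin (θ / 2) : ℝ) : ℂ) with hs
  have hI : I ^ 2 = -1 := I_sq
  have r1 : ((Real.cos (θ / 2) : ℝ) : ℂ) ^ 2 + ((Real.sin (θ / 2) : ℝ) : ℂ) ^ 2 = 1 := by
    exact_mod_cast Real.cos_sq_add_sin_sq _
  have hcs : c ^ 2 - s ^ 2 = 1 := by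
    rw [hs, mul_pow, hI, hc]; linear_combination r1
  have hcos : ((Real.cos θ : ℝ) : ℂ) = c ^ 2 + s ^ 2 := by
    have : Real.cos θ = Real.cos (θ / 2) ^ 2 - Real.sin (θ / 2) ^ 2 := by
      rw [← Real.cos_two_mul']; congr 1; ring
    rw [this, hs, mul_pow, hI, hc]; push_cast; ring
  have hsin : I * ((Real.sin θ : ℝ) : ℂ) = 2 * (c * s) := by
    have : Real.sin θ = 2 * Real.sin (θ / 2) * Real.cos (θ / 2) := by
      rw [← Real.sin_two_mul]; congr 1; ring
    rw [this, hs, hc]; push_cast; ring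
  obtain ⟨h1, h2⟩ := derivative_linear_pow_mul c s a b
  set P : ℂ[X] := (C c * X + C s) ^ a * (C s * X + C c) ^ b with hP
  have hdB : ∀ m : ℤ, dB l q m θ = cZ P (l - m) := fun m => dB_eq_cZ hq m θ
  have em : ((l : ℤ) - m - 1 : ℤ) = l - (m + 1) := by ring
  have ep : ((l : ℤ) - m + 1 : ℤ) = l - (m - 1) := by ring
  have em2 : ((l : ℤ) - m - 1 + 1 - 1 : ℤ) = l - (m + 1) := by ring
  constructor
  · have hd1 : HasDerivAt (fun θ : ℝ => ((Real.cos (θ / 2) : ℝ) : ℂ)) (I / 2 * s) θ := by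
      have := ((Real.hasDerivAt_cos (θ / 2)).comp θ ((hasDerivAt_id θ).div_const 2)).ofReal_comp
      refine this.congr_deriv ?_
      rw [hs]; push_cast; linear_combination (-(Complex.sin (θ / 2)) / 2) * hI
    have hd2 : HasDerivAt (fun θ : ℝ => I * ((Real.sin (θ / 2) : ℝ) : ℂ))
        (I / 2 * c) θ := by
      have := (((Real.hasDerivAt_sin (θ / 2)).comp θ
        ((hasDerivAt_id θ).div_const 2)).ofReal_comp).const_mul I
      refine this.congr_deriv ?_
      rw [hc]; push_cast; ring
    have k1 := PolyDeriv.linear hd1 hd2 X 1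
    have k2 := PolyDeriv.linear hd2 hd1 X 1
    have k3 := PolyDeriv.pow_mul_pow k1 k2 a b
    have key : cZ (C (I / 2) * ((1 - X ^ 2) * derivative P + ((a + b : ℕ) : ℂ[X]) * X * P))
        (l - m) = I / 2 * (((l : ℂ) - m + 1) * dB l q (m - 1) θ +
      ((l : ℂ) + m + 1) * dB l q (m + 1) θ) := by
      have e : ((1 - X ^ 2) * derivative P + ((a + b : ℕ) : ℂ[X]) * X * P) =
          derivative P - X * (X * derivative P) + C (2 * l : ℂ) * (X * P) := by
        rw [hab]; push_cast; simp only [C_mul, map_ofNat, map_natCast]; ring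
      rw [e, cZ_C_mul, cZ_add, cZ_sub, cZ_C_mul, cZ_X_mul, cZ_X_mul, cZ_X_mul, cZ_derivative,
        cZ_derivative, hdB, hdB, ← em, ← ep]
      have : ((l : ℤ) - m - 1 - 1 + 1) = l - m - 1 := by ring
      rw [this]
      push_cast; ring
    rw [← key, h1]
    have hfun : dB l q m = fun θ : ℝ => cZ ((C ((Real.cos (θ / 2) : ℝ) : ℂ) * X +
      C (I * ((Real.sin (θ / 2) : ℝ) : ℂ)) * 1) ^ a *
      (C (I * ((Real.sin (θ / 2) : ℝ) : ℂ)) * X + C ((Real.cos (θ / 2) : ℝ) : ℂ) * 1) ^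
        b) (l - m) := by
      ext θ; rw [dB_eq_cZ hq]; simp only [mul_one]; rfl
    rw [hfun]
    unfold cZ
    split_ifs
    · refine (k3 _).congr_deriv ?_
      refine congrArg (fun P : ℂ[X] => P.coeff _) ?_
      simp only [← hs, ← hc, mul_one]
      simp only [C_mul]
      ring
    · exact hasDerivAt_const _ _
  · have key := congrArg (fun Q => cZ Q ((l : ℤ) - m)) h2
    have e1 : (C (c * s) * (1 + X ^ 2) + C (c ^ 2 + s ^ 2) * X) * derivative P =
        C (c * s) * derivative P + C (c * s) * (X * (X * derivative P)) +
          C (c ^ 2 + s ^ 2) * (X * derivative P) := by ring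
    have e2 : (C c * (a : ℂ[X]) * (C s * X + C c) + C s * (b : ℂ[X]) * (C c * X + C s)) * P =
        C (2 * l * (c * s)) * (X * P) + C (a * c ^ 2 + b * s ^ 2) * P := by
      have : ((a : ℂ[X]) + b) = 2 * l := by exact_mod_cast congrArg (fun n : ℕ => (n : ℂ[X])) hab
      simp only [C_mul, C_add, C_pow, map_natCast, map_ofNat]
      linear_combination (C c * C s * X * P) * this
    simp only [e1, e2, cZ_add, cZ_C_mul, cZ_X_mul, cZ_derivative] at key
    have f1 : ((l : ℤ) - m - 1 - 1 + 1) = l - m - 1 := by ring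
    have f2 : ((l : ℤ) - m - 1 + 1) = l - m := by ring
    rw [f1, f2, ep, em, ← hdB, ← hdB, ← hdB, haC, hbC] at key
    push_cast at key
    rw [hsin, hcos]
    linear_combination 2 * key - 2 * q * dB l q m θ * hcs

theorem dB_continuous {l : ℕ} {q : ℤ} (hq : |q| ≤ (l : ℤ)) (m : ℤ) : Continuous (dB l q m) :=
  continuous_iff_continuousAt.2 fun θ => (dB_hasDerivAt hq m θ).1.continuousAt

theorem nK_succ {l : ℕ} {q : ℤ} (hq : |q| ≤ (l : ℤ)) (m : ℤ) :
    ((l : ℝ) - m) * nK l q m = ((l : ℝ) + m + 1) * nK l q (m + 1) := by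
  have hd : ∀ θ : ℝ, HasDerivAt (fun θ : ℝ => ((Real.sin θ : ℝ) : ℂ) * dB l q (m + 1) θ *
      conj (dB l q m θ)) (I * (Real.sin θ : ℝ) * (((l : ℂ) - m) *
        (‖dB l q m θ‖ ^ 2 : ℝ) - ((l : ℂ) + m + 1) * (‖dB l q (m + 1) θ‖ ^ 2 : ℝ))) θ := by
    intro θ
    obtain ⟨d1, r1⟩ := dB_hasDerivAt hq (m + 1) θ
    obtain ⟨d2, r2⟩ := dB_hasDerivAt hq m θ
    have ds := (Real.hasDerivAt_sin θ).ofReal_comp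
    have hm : m + 1 - 1 = m := by ring
    rw [hm] at d1 r1
    refine ((ds.mul d1).mul (d2.star)).congr_deriv ?_
    rw [← normSq_eq_norm_sq, ← normSq_eq_norm_sq, Complex.normSq_eq_conj_mul_self,
      Complex.normSq_eq_conj_mul_self]
    have r2' := congrArg (conj) r2
    simp only [map_add, map_mul, map_sub, map_neg, conj_ofReal, conj_I, map_ofNat,
      map_intCast, map_natCast, map_one] at r2'
    simp only [Pi.mul_apply, RCLike.star_def, map_add, map_mul, map_sub, conj_I,
      map_ofNat, map_intCast, map_natCast, map_one, map_div₀]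
    push_cast at r1 r2' ⊢
    linear_combination (-(1 / 2 : ℂ)) * conj (dB l q m θ) * r1 +
      (1 / 2 : ℂ) * dB l q (m + 1) θ * r2'
  have hc := dB_continuous hq
  have hcont : Continuous fun θ : ℝ => I * (Real.sin θ : ℝ) * (((l : ℂ) - m) *
        (‖dB l q m θ‖ ^ 2 : ℝ) - ((l : ℂ) + m + 1) * (‖dB l q (m + 1) θ‖ ^ 2 : ℝ)) := by
    have := hc m
    have := hc (m + 1)
    fun_prop
  have hi := intervalIntegral.integral_eq_sub_of_hasDerivAt (a := 0) (b := π)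
    (fun θ _ => hd θ) (hcont.intervalIntegrable _ _)
  simp only [Real.sin_pi, Real.sin_zero, Complex.ofReal_zero, zero_mul, sub_zero] at hi
  have hN : ∀ m : ℤ, nK l q m = ∫ θ in (0 : ℝ)..π, Real.sin θ / 2 * ‖dB l q m θ‖ ^ 2 := by
    intro m
    rw [nK, integral_Icc_eq_integral_Ioc, intervalIntegral.integral_of_le pi_pos.le]
  have hcN : ∀ m : ℤ, Continuous fun θ : ℝ => Real.sin θ / 2 * ‖dB l q m θ‖ ^ 2 := by
    intro m; have := hc m; fun_prop
  rw [hN, hN, ← sub_eq_zero, ← intervalIntegral.integral_const_mul,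
    ← intervalIntegral.integral_const_mul, ← intervalIntegral.integral_sub
      (((hcN m).const_mul _).intervalIntegrable _ _)
      (((hcN (m + 1)).const_mul _).intervalIntegrable _ _)]
  have h2 : ∀ θ : ℝ, I * (Real.sin θ : ℝ) * (((l : ℂ) - m) *
        (‖dB l q m θ‖ ^ 2 : ℝ) - ((l : ℂ) + m + 1) * (‖dB l q (m + 1) θ‖ ^ 2 : ℝ)) =
      (2 * I) * ((((l : ℝ) - m) * (Real.sin θ / 2 * ‖dB l q m θ‖ ^ 2) -
        ((l : ℝ) + m + 1) * (Real.sin θ / 2 * ‖dB l q (m + 1) θ‖ ^ 2) : ℝ) : ℂ) := by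
    intro θ; push_cast; ring
  simp_rw [h2] at hi
  rw [intervalIntegral.integral_const_mul, intervalIntegral.integral_ofReal] at hi
  simpa using hi

theorem nK_pos {l : ℕ} {q : ℤ} (hq : |q| ≤ (l : ℤ)) {m : ℤ} (hm : |m| ≤ (l : ℤ)) :
    0 < nK l q m := by
  have hq' := abs_le.1 hq
  have top : 0 < nK l q l := by
    rw [nK, integral_Icc_eq_integral_Ioc, ← intervalIntegral.integral_of_le pi_pos.le]
    have hc := dB_continuous hq l
    refine intervalIntegral.intervalIntegral_pos_of_pos_on
      (Continuous.intervalIntegrable (by fun_prop) _ _) (fun θ hθ => ?_) pi_pos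
    have hs : 0 < Real.sin θ := Real.sin_pos_of_mem_Ioo hθ
    have hs2 : 0 < Real.sin (θ / 2) :=
      Real.sin_pos_of_pos_of_lt_pi (by linarith [hθ.1]) (by linarith [hθ.2, pi_pos])
    have hc2 : 0 < Real.cos (θ / 2) :=
      Real.cos_pos_of_mem_Ioo ⟨by linarith [hθ.1, pi_pos], by linarith [hθ.2]⟩
    have : dB l q l θ ≠ 0 := by
      rw [dB_eq_cZ hq, sub_self, cZ, if_pos le_rfl, Int.toNat_zero, coeff_zero_eq_eval_zero]
      simp only [eval_mul, eval_pow, eval_add, eval_C, eval_X, mul_zero, zero_add]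
      refine mul_ne_zero (pow_ne_zero _ (mul_ne_zero Complex.I_ne_zero ?_)) (pow_ne_zero _ ?_)
      · exact_mod_cast hs2.ne'
      · exact_mod_cast hc2.ne'
    positivity
  have hstep : ∀ k : ℕ, k ≤ 2 * l → 0 < nK l q (l - k) := by
    intro k
    induction k with
    | zero => intro _; simpa using top
    | succ k ih =>
      intro hk
      have h := nK_succ hq (l - (k + 1 : ℕ))
      have e : (l : ℤ) - (k + 1 : ℕ) + 1 = l - k := by push_cast; ring
      rw [e] at h
      push_cast at h ⊢
      have hkl : (k : ℝ) + 1 ≤ 2 * l := by exact_mod_cast hk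
      have hk0 : (0 : ℝ) ≤ k := Nat.cast_nonneg k
      have h3 : 0 < ((l : ℝ) + (l - (k + 1)) + 1) * nK l q (l - k) :=
        mul_pos (by linarith) (ih (by omega))
      rw [← h] at h3
      exact pos_of_mul_pos_right h3 (by linarith)
  have hm' := abs_le.1 hm
  have := hstep (l - m).toNat (by omega)
  have e : (l : ℤ) - ((l - m).toNat : ℕ) = m := by omega
  rwa [e] at this

theorem nK_neg {l : ℕ} {q : ℤ} (hq : |q| ≤ (l : ℤ)) (m : ℤ) : nK l q (-m) = nK l q m := by
  have : ∀ n : ℕ, nK l q (-n) = nK l q n := by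
    intro n
    induction n with
    | zero => simp
    | succ n ih =>
      have h1 := nK_succ hq n
      have h2 := nK_succ hq (-(n + 1 : ℕ))
      have e : -((n + 1 : ℕ) : ℤ) + 1 = -n := by push_cast; ring
      rw [e, ih] at h2
      have hne : (l : ℝ) + n + 1 ≠ 0 := by positivity
      push_cast at h1 h2 ⊢
      apply mul_left_cancel₀ hne
      linarith
  rcases Int.eq_nat_or_neg m with ⟨n, rfl | rfl⟩
  · exact this n
  · rw [neg_neg, this]

theorem normPhi_pos {l : ℕ} {m q : ℤ} (hm : |m| ≤ (l : ℤ)) (hq : |q| ≤ (l : ℤ)) :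
    0 < normPhi l m q := by
  rw [normPhi_sq hm hq]; exact Real.sqrt_pos.2 (nK_pos hq hm)

theorem normPhi_neg {l : ℕ} {m q : ℤ} (hm : |m| ≤ (l : ℤ)) (hq : |q| ≤ (l : ℤ)) :
    normPhi l (-m) q = normPhi l m q := by
  rw [normPhi_sq hm hq, normPhi_sq (by rwa [abs_neg]) hq, nK_neg hq]

/-! ### Iwasawa coordinates -/

/-- The `N`-coordinate of `g = n[z] a[r] k`. -/
def zc (g : SL2) : ℂ :=
  (height g : ℂ) * (g 0 0 * conj (g 1 0) + g 0 1 * conj (g 1 1))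

/-- The first coordinate of the `K`-component `k[α, β]` of `g`. -/
def kA (g : SL2) : ℂ := (Real.sqrt (height g) : ℂ) * conj (g 1 1)

/-- The second coordinate of the `K`-component `k[α, β]` of `g`. -/
def kB (g : SL2) : ℂ := -((Real.sqrt (height g) : ℂ) * conj (g 1 0))

theorem det_eq (g : SL2) : g 0 0 * g 1 1 - g 0 1 * g 1 0 = 1 := by
  have := g.2
  rwa [Matrix.det_fin_two] at this

theorem bottom_pos (g : SL2) : 0 < normSq (g 1 0) + normSq (g 1 1) := by
  have h1 := Complex.normSq_nonneg (g 1 0)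
  have h2 := Complex.normSq_nonneg (g 1 1)
  rcases eq_or_lt_of_le h1 with h | h
  · rcases eq_or_lt_of_le h2 with h' | h'
    · have d := det_eq g
      rw [Complex.normSq_eq_zero.1 h.symm, Complex.normSq_eq_zero.1 h'.symm] at d
      simp at d
    · linarith
  · linarith

theorem height_pos (g : SL2) : 0 < height g := one_div_pos.2 (bottom_pos g)

theorem height_mul_bottom (g : SL2) :
    height g * (normSq (g 1 0) + normSq (g 1 1)) = 1 :=
  one_div_mul_cancel (bottom_pos g).ne'

theorem normSq_kA_kB (g : SL2) : normSq (kA g) + normSq (kB g) = 1 := by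
  rw [kA, kB, Complex.normSq_neg, Complex.normSq_mul, Complex.normSq_mul, Complex.normSq_conj,
    Complex.normSq_conj, normSq_ofReal, Real.mul_self_sqrt (height_pos g).le,
    ← height_mul_bottom g]
  ring

theorem sqrt_height_sq (g : SL2) :
    ((Real.sqrt (height g) : ℝ) : ℂ) * ((Real.sqrt (height g) : ℝ) : ℂ) = height g := by
  rw [← Complex.ofReal_mul, Real.mul_self_sqrt (height_pos g).le]

theorem entries_eq (g : SL2) :
    g 0 0 = zc g * g 1 0 + (Real.sqrt (height g) : ℂ) * kA g ∧
    g 0 1 = zc g * g 1 1 + (Real.sqrt (height g) : ℂ) * kB g ∧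
    (height g : ℂ) * g 1 0 = -((Real.sqrt (height g) : ℂ) * conj (kB g)) ∧
    (height g : ℂ) * g 1 1 = (Real.sqrt (height g) : ℂ) * conj (kA g) := by
  have hs := sqrt_height_sq g
  have hb : (height g : ℂ) * (g 1 0 * conj (g 1 0) + g 1 1 * conj (g 1 1)) = 1 := by
    rw [mul_conj, mul_conj]
    exact_mod_cast height_mul_bottom g
  have d := det_eq g
  refine ⟨?_, ?_, ?_, ?_⟩
  · rw [zc, kA]
    linear_combination (-(g 0 0)) * hb - conj (g 1 1) * hs +
      (height g : ℂ) * conj (g 1 1) * d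
  · rw [zc, kB]
    linear_combination (-(g 0 1)) * hb + conj (g 1 0) * hs -
      (height g : ℂ) * conj (g 1 0) * d
  · rw [kB]; simp only [map_neg, map_mul, Complex.conj_conj, conj_ofReal]
    linear_combination (-(g 1 0)) * hs
  · rw [kA]; simp only [map_mul, Complex.conj_conj, conj_ofReal]
    linear_combination (-(g 1 1)) * hs

theorem phi_eq (l : ℕ) (q : ℤ) (ν : ℂ) (p : ℤ) (g : SL2) :
    phi l q ν p g = (height g : ℂ) ^ (1 + ν) * Phi l p q (kA g) (kB g) := rfl

theorem wElt_nElt_mul (z : ℂ) (g : SL2) :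
    (wElt * nElt z * g) 1 0 = g 0 0 + z * g 1 0 ∧ (wElt * nElt z * g) 1 1 = g 0 1 + z * g 1 1 := by
  constructor <;>
  · rw [Matrix.SpecialLinearGroup.coe_mul, Matrix.SpecialLinearGroup.coe_mul]
    simp [wElt, nElt, Matrix.mul_apply, Fin.sum_univ_two]

theorem coords_wElt (ζ : ℂ) (g : SL2) :
    height (wElt * nElt ((height g : ℂ) * ζ - zc g) * g) =
      (height g)⁻¹ * (1 + ‖ζ‖ ^ 2)⁻¹ ∧
    kA (wElt * nElt ((height g : ℂ) * ζ - zc g) * g) =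
      (Real.sqrt (1 + ‖ζ‖ ^ 2)⁻¹ : ℂ) * conj ζ * kA g -
        -(Real.sqrt (1 + ‖ζ‖ ^ 2)⁻¹ : ℂ) * conj (kB g) ∧
    kB (wElt * nElt ((height g : ℂ) * ζ - zc g) * g) =
      (Real.sqrt (1 + ‖ζ‖ ^ 2)⁻¹ : ℂ) * conj ζ * kB g +
        -(Real.sqrt (1 + ‖ζ‖ ^ 2)⁻¹ : ℂ) * conj (kA g) := by
  obtain ⟨h1, h2⟩ := wElt_nElt_mul ((height g : ℂ) * ζ - zc g) g
  set g' := wElt * nElt ((height g : ℂ) * ζ - zc g) * g with hg'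
  obtain ⟨e1, e2, e3, e4⟩ := entries_eq g
  have b0 : g' 1 0 = (Real.sqrt (height g) : ℂ) * (kA g - ζ * conj (kB g)) := by
    rw [h1]; linear_combination e1 + ζ * e3
  have b1 : g' 1 1 = (Real.sqrt (height g) : ℂ) * (kB g + ζ * conj (kA g)) := by
    rw [h2]; linear_combination e2 + ζ * e4
  have hk := normSq_kA_kB g
  have hh : height g' = (height g)⁻¹ * (1 + ‖ζ‖ ^ 2)⁻¹ := by
    rw [height, b0, b1, Complex.normSq_mul, Complex.normSq_mul, normSq_ofReal,
      Real.mul_self_sqrt (height_pos g).le, ← mul_add]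
    have : normSq (kA g - ζ * conj (kB g)) +
        normSq (kB g + ζ * conj (kA g)) = 1 + ‖ζ‖ ^ 2 := by
      rw [← normSq_eq_norm_sq]
      have : (1 : ℝ) + normSq ζ =
          (normSq (kA g) + normSq (kB g)) * (1 + normSq ζ) := by
        rw [hk, one_mul]
      rw [this]
      simp only [Complex.normSq_apply, sub_re, Complex.sub_im, Complex.mul_re,
        Complex.mul_im, add_re, Complex.add_im, Complex.conj_re, Complex.conj_im]
      ring
    rw [this, one_div, mul_inv]
  have hs0 : ((Real.sqrt (height g) : ℝ) : ℂ) ≠ 0 := by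
    exact_mod_cast (Real.sqrt_pos.2 (height_pos g)).ne'
  have hsq : (Real.sqrt (height g') : ℂ) * (Real.sqrt (height g) : ℂ) =
      (Real.sqrt (1 + ‖ζ‖ ^ 2)⁻¹ : ℂ) := by
    rw [← Complex.ofReal_mul, ← Real.sqrt_mul (height_pos g').le, hh]
    congr 2
    have := (height_pos g).ne'
    field_simp
  refine ⟨hh, ?_, ?_⟩
  · rw [kA, b1, ← hsq]
    simp only [map_mul, map_add, Complex.conj_conj, conj_ofReal]
    ring
  · rw [kB, b0, ← hsq]
    simp only [map_mul, map_sub, Complex.conj_conj, conj_ofReal]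
    ring

theorem Phi_eq_cf {l : ℕ} {m : ℤ} (hm : |m| ≤ (l : ℤ)) (p : ℤ) (ζ : ℂ) {ρ : ℝ} (hρ : 0 ≤ ρ) :
    Phi l p m ((Real.sqrt ρ : ℂ) * conj ζ) (-(Real.sqrt ρ : ℂ)) =
      (ρ : ℂ) ^ l * cf ((l : ℤ) - m).toNat ((l : ℤ) + m).toNat (l - p) 1 ζ := by
  rw [Phi_eq_cZ hm, cf, ← cZ_C_mul]
  refine congrArg (fun P => cZ P _) ?_
  have hs : (ρ : ℂ) ^ l = (Real.sqrt ρ : ℂ) ^ ((l : ℤ) - m).toNat *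
      (Real.sqrt ρ : ℂ) ^ ((l : ℤ) + m).toNat := by
    rw [← pow_add, toNat_add_eq hm, pow_mul, sq, ← Complex.ofReal_mul, Real.mul_self_sqrt hρ]
  have e1 : C ((Real.sqrt ρ : ℂ) * conj ζ) * X -
      C (conj (-(Real.sqrt ρ : ℂ))) =
      C (Real.sqrt ρ : ℂ) * (C (conj ζ) * X + C ((1 : ℝ) : ℂ)) := by
    simp only [map_neg, conj_ofReal, Complex.ofReal_one, C_1, C_mul]; ring
  have e2 : C (-(Real.sqrt ρ : ℂ)) * X + C (conj ((Real.sqrt ρ : ℂ) * conj ζ)) =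
      C (Real.sqrt ρ : ℂ) * (C (-(1 : ℝ) : ℂ) * X + C ζ) := by
    simp only [map_mul, Complex.conj_conj, conj_ofReal, Complex.ofReal_one, C_1, C_neg]; ring
  rw [PhiP, e1, e2, mul_pow, mul_pow, hs, C_mul, C_pow, C_pow]
  ring

theorem jacquetIntegral_eq {l : ℕ} {p q : ℤ} (hp : |p| ≤ (l : ℤ)) (hq : |q| ≤ (l : ℤ)) (ω : ℂ)
    {ν : ℂ} (hν : 0 < ν.re) (g : SL2) :
    jacquetIntegral ω (phi l q ν p) g = psi ω (zc g) * ((height g : ℂ) ^ (1 - ν) *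
      ∑ m ∈ Finset.Icc (-(l : ℤ)) l, Zint ((l : ℤ) - m).toNat ((l : ℤ) + m).toNat (l - p)
        (l + 1 + ν) (ω * height g) * Phi l m q (kA g) (kB g)) := by
  have hh := height_pos g
  have hhC : (height g : ℂ) ≠ 0 := by exact_mod_cast hh.ne'
  set f : ℂ → ℂ := fun z => (psi ω z)⁻¹ * phi l q ν p (wElt * nElt z * g) with hf
  have hcv : ∫ ζ : ℂ, f ((height g : ℂ) * ζ - zc g) =
      ((height g : ℂ) ^ 2)⁻¹ * jacquetIntegral ω (phi l q ν p) g := by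
    have h1 := Measure.integral_comp_smul (volume : Measure ℂ) (fun z => f (z - zc g)) (height g)
    rw [integral_sub_right_eq_self (fun z => f z), Complex.finrank_real_complex,
      abs_of_pos (by positivity)] at h1
    simp only [Complex.real_smul] at h1
    rw [h1, jacquetIntegral]; push_cast; rfl
  have hpt : ∀ ζ : ℂ, f ((height g : ℂ) * ζ - zc g) = psi ω (zc g) *
      ((height g : ℂ) ^ (-(1 + ν)) * ∑ m ∈ Finset.Icc (-(l : ℤ)) l,
        (((1 + ‖ζ‖ ^ 2 : ℝ) : ℂ) ^ (-((l : ℂ) + 1 + ν)) *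
          (cf ((l : ℤ) - m).toNat ((l : ℤ) + m).toNat (l - p) 1 ζ *
          Complex.exp ((-2 * π * I) * ((ω * height g * ζ).re : ℂ)))) *
          Phi l m q (kA g) (kB g)) := by
    intro ζ
    obtain ⟨c1, c2, c3⟩ := coords_wElt ζ g
    have hpos := one_add_norm_sq_pos ζ
    have h0 : ((1 + ‖ζ‖ ^ 2 : ℝ) : ℂ) ≠ 0 := by exact_mod_cast hpos.ne'
    simp only [hf]
    rw [phi_eq, c1, c2, c3, Phi_mul hp hq]
    have hpsi : (psi ω ((height g : ℂ) * ζ - zc g))⁻¹ = psi ω (zc g) *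
        Complex.exp ((-2 * π * I) * ((ω * height g * ζ).re : ℂ)) := by
      rw [psi, psi, ← Complex.exp_neg, ← Complex.exp_add]
      congr 1
      have : ω * ((height g : ℂ) * ζ - zc g) = ω * height g * ζ - ω * zc g := by ring
      rw [this, sub_re]
      push_cast; ring
    have hpow : (((height g)⁻¹ * (1 + ‖ζ‖ ^ 2)⁻¹ : ℝ) : ℂ) ^ (1 + ν) =
        (height g : ℂ) ^ (-(1 + ν)) * ((1 + ‖ζ‖ ^ 2 : ℝ) : ℂ) ^ (-(1 + ν)) := by
      rw [Complex.ofReal_mul, Complex.mul_cpow_ofReal_nonneg (by positivity) (by positivity),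
        Complex.ofReal_inv, Complex.ofReal_inv, Complex.inv_cpow _ _ (by
          rw [arg_ofReal_of_nonneg hh.le]; exact pi_pos.ne),
        Complex.inv_cpow _ _ (by rw [arg_ofReal_of_nonneg hpos.le]; exact pi_pos.ne),
        Complex.cpow_neg, Complex.cpow_neg]
    rw [hpsi, hpow]
    simp only [Finset.mul_sum]
    refine Finset.sum_congr rfl fun m hm => ?_
    rw [Phi_eq_cf (mem_Icc_iff_abs.1 hm) p ζ (by positivity : 0 ≤ (1 + ‖ζ‖ ^ 2)⁻¹)]
    have : (((1 + ‖ζ‖ ^ 2 : ℝ) : ℂ)) ^ (-((l : ℂ) + 1 + ν)) =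
        ((1 + ‖ζ‖ ^ 2 : ℝ) : ℂ) ^ (-(1 + ν)) * (((1 + ‖ζ‖ ^ 2)⁻¹ : ℝ) : ℂ) ^ l := by
      rw [show -((l : ℂ) + 1 + ν) = -(1 + ν) - (l : ℂ) by ring, Complex.cpow_sub _ _ h0,
        Complex.cpow_natCast, Complex.ofReal_inv, inv_pow, div_eq_mul_inv]
    rw [this]; ring
  have hint : ∫ ζ : ℂ, f ((height g : ℂ) * ζ - zc g) = psi ω (zc g) *
      ((height g : ℂ) ^ (-(1 + ν)) * ∑ m ∈ Finset.Icc (-(l : ℤ)) l,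
        Zint ((l : ℤ) - m).toNat ((l : ℤ) + m).toNat (l - p) (l + 1 + ν) (ω * height g) *
          Phi l m q (kA g) (kB g)) := by
    simp_rw [hpt]
    rw [integral_const_mul, integral_const_mul, integral_finsetSum]
    · simp only [integral_mul_const, Zint]
    · intro m hm
      refine (Zint_integrable _ _ _ ?_ _).mul_const _
      rw [toNat_add_eq (mem_Icc_iff_abs.1 hm)]
      simp; linarith
  rw [hint] at hcv
  have e : (height g : ℂ) ^ (1 - ν) = (height g : ℂ) ^ 2 * (height g : ℂ) ^ (-(1 + ν)) := by
    rw [show (1 : ℂ) - ν = (2 : ℕ) + -(1 + ν) by push_cast; ring, cpow_add _ _ hhC,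
      Complex.cpow_natCast]
  rw [e]
  have h2 : ((height g : ℂ) ^ 2) ≠ 0 := pow_ne_zero _ hhC
  field_simp at hcv ⊢
  linear_combination -hcv

/-- The component of `A_ω φ(ν, p)` along `Φ^l_{m,q}`. -/
def jacW (l : ℕ) (p m : ℤ) (ω ν : ℂ) (h : ℝ) : ℂ :=
  (Gamma (l + 1 + ν))⁻¹ * (π * ((π * ‖ω‖ : ℝ) : ℂ) ^ (l + ν) * (h : ℂ) ^ (l + 1) *
    (-I * conj (unitPart ω)) ^ (l + m) * (-I * unitPart ω) ^ (l - p) *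
      jB l p m ν (π * ‖ω‖ * h))

theorem unitPart_mul_pos (ω : ℂ) {h : ℝ} (hh : 0 < h) : unitPart (ω * h) = unitPart ω := by
  have : (h : ℂ) ≠ 0 := by exact_mod_cast hh.ne'
  rw [unitPart, unitPart, norm_mul, norm_real, norm_of_nonneg hh.le]
  push_cast
  rw [mul_div_mul_right _ _ this]

theorem Zint_eq_jacW {l : ℕ} {p m : ℤ} (hm : |m| ≤ (l : ℤ)) {ω : ℂ} (hω : ω ≠ 0) {ν : ℂ}
    (hν : 0 < ν.re) {h : ℝ} (hh : 0 < h) :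
    (h : ℂ) ^ (1 - ν) * Zint ((l : ℤ) - m).toNat ((l : ℤ) + m).toNat (l - p) (l + 1 + ν) (ω * h) =
      jacW l p m ω ν h := by
  have hhC : (h : ℂ) ≠ 0 := by exact_mod_cast hh.ne'
  have hm' := abs_le.1 hm
  have hG : Gamma (l + 1 + ν) ≠ 0 := by
    refine Complex.Gamma_ne_zero_of_re_pos ?_
    simp only [add_re, Complex.natCast_re, Complex.one_re]; positivity
  have key := Gamma_mul_Zint_eq ((l : ℤ) - m).toNat ((l : ℤ) + m).toNat (l - p) (σ := l + 1 + ν)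
    (by rw [toNat_add_eq hm]; simp; linarith) (mul_ne_zero hω hhC)
  rw [← jB_eq p hm, unitPart_mul_pos ω hh, norm_mul, norm_real, norm_of_nonneg hh.le,
    ← mul_assoc π, Complex.ofReal_mul (π * ‖ω‖) h,
    Complex.mul_cpow_ofReal_nonneg (by positivity) hh.le] at key
  have e1 : (l : ℂ) + 1 + ν - 1 = l + ν := by ring
  rw [e1] at key
  have e2 : (h : ℂ) ^ (1 - ν) * (h : ℂ) ^ (l + ν) = (h : ℂ) ^ (l + 1) := by
    rw [← cpow_add _ _ hhC, ← Complex.cpow_natCast]; congr 1; push_cast; ring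
  have e3 : (-I * conj (unitPart ω)) ^ ((l : ℤ) + m) =
      (-I * conj (unitPart ω)) ^ ((l : ℤ) + m).toNat := by
    rw [← zpow_natCast, Int.toNat_of_nonneg (by omega)]
  rw [jacW, eq_inv_mul_iff_mul_eq₀ hG, e3, ← e2, mul_left_comm, key]
  ring

theorem jacquet_unique {F₁ F₂ : ℂ → ℂ} (h₁ : Differentiable ℂ F₁) (h₂ : Differentiable ℂ F₂)
    (h : ∀ s : ℂ, 0 < s.re → F₁ s = F₂ s) : F₁ = F₂ := by
  refine AnalyticOnNhd.eq_of_eventuallyEq (z₀ := 1) (fun z _ => h₁.analyticAt z)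
    (fun z _ => h₂.analyticAt z) ?_
  filter_upwards [(isOpen_lt continuous_const continuous_re).mem_nhds
    (by simp : (1 : ℂ) ∈ {s : ℂ | 0 < s.re})] with s hs using h s hs

theorem jacquet_eq {l : ℕ} {p q : ℤ} (hp : |p| ≤ (l : ℤ)) (hq : |q| ≤ (l : ℤ)) {ω : ℂ}
    (hω : ω ≠ 0) (ν : ℂ) (g : SL2) : jacquet ω l q ν p g = psi ω (zc g) *
      ∑ m ∈ Finset.Icc (-(l : ℤ)) l, jacW l p m ω ν (height g) * Phi l m q (kA g) (kB g) := by
  have hκ : 0 < π * ‖ω‖ := by positivity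
  set F : ℂ → ℂ := fun ν => psi ω (zc g) *
      ∑ m ∈ Finset.Icc (-(l : ℤ)) l, jacW l p m ω ν (height g) * Phi l m q (kA g) (kB g) with hF
  have hd : Differentiable ℂ F := by
    have hW : ∀ m, Differentiable ℂ fun ν => jacW l p m ω ν (height g) := by
      intro m
      have h1 := jB_differentiable l p m (mul_pos hκ (height_pos g))
      have h2 : Differentiable ℂ fun ν : ℂ => (Gamma (l + 1 + ν))⁻¹ :=
        Complex.differentiable_one_div_Gamma.comp (differentiable_id.const_add _)
      have h3 : Differentiable ℂ fun ν : ℂ => ((π * ‖ω‖ : ℝ) : ℂ) ^ ((l : ℂ) + ν) :=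
        (differentiable_id.const_add _).const_cpow (Or.inl (by exact_mod_cast hκ.ne'))
      unfold jacW
      fun_prop
    exact (Differentiable.fun_sum fun m _ => (hW m).mul_const _).const_mul _
  have hF' : ∀ s : ℂ, 0 < s.re → F s = jacquetIntegral ω (phi l q s p) g := by
    intro s hs
    rw [jacquetIntegral_eq hp hq ω hs, hF, Finset.mul_sum]
    simp only
    congr 1
    refine Finset.sum_congr rfl fun m hm => ?_
    rw [← mul_assoc, Zint_eq_jacW (mem_Icc_iff_abs.1 hm) hω hs (height_pos g)]
  have hsp := Classical.epsilon_spec (p := fun F : ℂ → ℂ => Differentiable ℂ F ∧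
    ∀ s : ℂ, 0 < s.re → F s = jacquetIntegral ω (phi l q s p) g) ⟨F, hd, hF'⟩
  exact congrFun (jacquet_unique hsp.1 hd fun s hs => by rw [hsp.2 s hs, hF' s hs]) ν

/-! ### Functions given by their `K`-components -/

theorem coords_nElt_mul (z : ℂ) (g : SL2) : height (nElt z * g) = height g ∧
    zc (nElt z * g) = z + zc g ∧ kA (nElt z * g) = kA g ∧ kB (nElt z * g) = kB g := by
  have b0 : (nElt z * g) 1 0 = g 1 0 := by
    rw [Matrix.SpecialLinearGroup.coe_mul]
    simp [nElt, Matrix.mul_apply, Fin.sum_univ_two]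
  have b1 : (nElt z * g) 1 1 = g 1 1 := by
    rw [Matrix.SpecialLinearGroup.coe_mul]
    simp [nElt, Matrix.mul_apply, Fin.sum_univ_two]
  have a0 : (nElt z * g) 0 0 = g 0 0 + z * g 1 0 := by
    rw [Matrix.SpecialLinearGroup.coe_mul]
    simp [nElt, Matrix.mul_apply, Fin.sum_univ_two]
  have a1 : (nElt z * g) 0 1 = g 0 1 + z * g 1 1 := by
    rw [Matrix.SpecialLinearGroup.coe_mul]
    simp [nElt, Matrix.mul_apply, Fin.sum_univ_two]
  have hh : height (nElt z * g) = height g := by rw [height, height, b0, b1]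
  refine ⟨hh, ?_, ?_, ?_⟩
  · have hb : (height g : ℂ) * (g 1 0 * conj (g 1 0) + g 1 1 * conj (g 1 1)) =
        1 := by
      rw [mul_conj, mul_conj]
      exact_mod_cast height_mul_bottom g
    rw [zc, zc, hh, a0, a1, b0, b1]
    linear_combination z * hb
  · rw [kA, kA, hh, b1]
  · rw [kB, kB, hh, b0]

theorem coords_neg (g : SL2) : height (-g) = height g ∧ zc (-g) = zc g ∧ kA (-g) = -kA g ∧
    kB (-g) = -kB g := by
  have e : ∀ i j, (-g) i j = -(g i j) := fun i j => by
    rw [Matrix.SpecialLinearGroup.coe_neg]; rfl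
  have hh : height (-g) = height g := by
    rw [height, height, e, e, Complex.normSq_neg, Complex.normSq_neg]
  refine ⟨hh, ?_, ?_, ?_⟩
  · rw [zc, zc, hh, e, e, e, e]; simp only [map_neg]; ring
  · rw [kA, kA, hh, e]; simp
  · rw [kB, kB, hh, e]; simp

theorem coords_mul_kElt (g : SL2) {α β : ℂ} (h : normSq α + normSq β = 1) :
    height (g * kElt α β) = height g ∧ zc (g * kElt α β) = zc g ∧
    kA (g * kElt α β) = kA g * α - kB g * conj β ∧
    kB (g * kElt α β) = kA g * β + kB g * conj α := by
  obtain ⟨k1, k2, k3, k4⟩ := kElt_00 h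
  have e : ∀ i, (g * kElt α β) i 0 = g i 0 * α - g i 1 * conj β ∧
      (g * kElt α β) i 1 = g i 0 * β + g i 1 * conj α := fun i => by
    rw [Matrix.SpecialLinearGroup.coe_mul]
    simp [Matrix.mul_apply, Fin.sum_univ_two, k1, k2, k3, k4, sub_eq_add_neg]
  have hC : α * conj α + β * conj β = 1 := by
    rw [mul_conj, mul_conj]; exact_mod_cast h
  have hh : height (g * kElt α β) = height g := by
    rw [height, height, (e 1).1, (e 1).2]
    congr 1
    have : normSq (g 1 0) + normSq (g 1 1) =
        (normSq (g 1 0) + normSq (g 1 1)) *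
          (normSq α + normSq β) := by rw [h, mul_one]
    rw [this]
    simp only [Complex.normSq_apply, sub_re, Complex.sub_im, Complex.mul_re,
      Complex.mul_im, add_re, Complex.add_im, Complex.conj_re, Complex.conj_im]
    ring
  refine ⟨hh, ?_, ?_, ?_⟩
  · rw [zc, zc, hh, (e 0).1, (e 0).2, (e 1).1, (e 1).2]
    simp only [map_sub, map_add, map_mul, Complex.conj_conj]
    linear_combination (height g : ℂ) * (g 0 0 * conj (g 1 0) +
      g 0 1 * conj (g 1 1)) * hC
  · rw [kA, kA, kB, hh, (e 1).2]
    simp only [map_add, map_mul, Complex.conj_conj]; ring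
  · rw [kB, kA, kB, hh, (e 1).1]
    simp only [map_sub, map_mul, Complex.conj_conj]; ring

theorem coords_aElt {r : ℝ} (hr : 0 < r) : height (aElt r) = r ∧ zc (aElt r) = 0 ∧
    kA (aElt r) = 1 ∧ kB (aElt r) = 0 := by
  have hs : ((Real.sqrt r : ℝ) : ℂ) ≠ 0 := by exact_mod_cast (Real.sqrt_pos.2 hr).ne'
  have a0 : (aElt r) 0 0 = (Real.sqrt r : ℂ) := by simp [aElt, hElt, hs]
  have a1 : (aElt r) 0 1 = 0 := by simp [aElt, hElt, hs]
  have b0 : (aElt r) 1 0 = 0 := by simp [aElt, hElt, hs]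
  have b1 : (aElt r) 1 1 = ((Real.sqrt r : ℝ) : ℂ)⁻¹ := by simp [aElt, hElt, hs]
  have hh : height (aElt r) = r := by
    rw [height, b0, b1, Complex.normSq_inv, normSq_ofReal, Real.mul_self_sqrt hr.le]
    simp
  refine ⟨hh, ?_, ?_, ?_⟩
  · rw [zc, a1, b0]; simp
  · rw [kA, hh, b1]; simp [hs]
  · rw [kB, b0]; simp

theorem coords_aElt_mul_kElt {r : ℝ} (hr : 0 < r) {α β : ℂ}
    (h : normSq α + normSq β = 1) :
    height (aElt r * kElt α β) = r ∧ zc (aElt r * kElt α β) = 0 ∧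
    kA (aElt r * kElt α β) = α ∧ kB (aElt r * kElt α β) = β := by
  obtain ⟨h1, h2, h3, h4⟩ := coords_mul_kElt (aElt r) h
  obtain ⟨a1, a2, a3, a4⟩ := coords_aElt hr
  rw [h1, h2, h3, h4, a1, a2, a3, a4]
  simp

/-- The function on `G` with `K`-components `F_m`. -/
def fK (ω : ℂ) (F : ℤ → ℝ → ℂ) (l : ℕ) (q : ℤ) (g : SL2) : ℂ :=
  psi ω (zc g) * ∑ m ∈ Finset.Icc (-(l : ℤ)) l, F m (height g) * Phi l m q (kA g) (kB g)

theorem fK_aElt_mul_kElt (ω : ℂ) (F : ℤ → ℝ → ℂ) (l : ℕ) (q : ℤ) {r : ℝ} (hr : 0 < r) {α β : ℂ}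
    (h : normSq α + normSq β = 1) :
    fK ω F l q (aElt r * kElt α β) = ∑ m ∈ Finset.Icc (-(l : ℤ)) l, F m r * Phi l m q α β := by
  obtain ⟨h1, h2, h3, h4⟩ := coords_aElt_mul_kElt hr h
  rw [fK, h1, h2, h3, h4]
  simp [psi]

theorem fK_neg (ω : ℂ) (F : ℤ → ℝ → ℂ) (l : ℕ) (q : ℤ) (g : SL2) :
    fK ω F l q (-g) = fK ω F l q g := by
  obtain ⟨h1, h2, h3, h4⟩ := coords_neg g
  rw [fK, fK, h1, h2, h3, h4]
  simp only [Phi_neg]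

theorem fK_nElt_mul (ω : ℂ) (F : ℤ → ℝ → ℂ) (l : ℕ) (q : ℤ) (z : ℂ) (g : SL2) :
    fK ω F l q (nElt z * g) = psi ω z * fK ω F l q g := by
  obtain ⟨h1, h2, h3, h4⟩ := coords_nElt_mul z g
  rw [fK, fK, h1, h2, h3, h4, ← mul_assoc]
  congr 1
  rw [psi, psi, psi, ← Complex.exp_add, mul_add, add_re]
  congr 1; push_cast; ring

theorem contDiff_conj : ContDiff ℝ ((⊤ : ℕ∞) : WithTop ℕ∞) (conj : ℂ → ℂ) :=
  Complex.conjCLE.contDiff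

theorem contDiff_psi (ω : ℂ) : ContDiff ℝ ((⊤ : ℕ∞) : WithTop ℕ∞) (psi ω) := by
  have h1 : ContDiff ℝ ((⊤ : ℕ∞) : WithTop ℕ∞) fun z : ℂ => ω * z := contDiff_const.mul contDiff_id
  have h2 : ContDiff ℝ ((⊤ : ℕ∞) : WithTop ℕ∞) fun z : ℂ => (((ω * z).re : ℝ) : ℂ) :=
    Complex.ofRealCLM.contDiff.comp (Complex.reCLM.contDiff.comp h1)
  exact (contDiff_const.mul h2).cexp

theorem contDiff_normSq : ContDiff ℝ ((⊤ : ℕ∞) : WithTop ℕ∞) normSq := by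
  have : (normSq : ℂ → ℝ) = fun z => ‖z‖ ^ 2 := by
    ext z; exact normSq_eq_norm_sq z
  rw [this]; exact contDiff_norm_sq ℝ

/-- The quantity `|c|² + |d|²` of a matrix with bottom row `(c, d)`. -/
def bottomSq (x : Fin 2 → Fin 2 → ℂ) : ℝ := normSq (x 1 0) + normSq (x 1 1)

theorem contDiff_bottomSq : ContDiff ℝ ((⊤ : ℕ∞) : WithTop ℕ∞) bottomSq :=
  (contDiff_normSq.comp (contDiff_apply_apply ℝ ℂ 1 0)).add
    (contDiff_normSq.comp (contDiff_apply_apply ℝ ℂ 1 1))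

theorem contDiffOn_inv_bottomSq : ContDiffOn ℝ ((⊤ : ℕ∞) : WithTop ℕ∞) (fun x => 1 / bottomSq x)
    {x | 0 < bottomSq x} :=
  contDiffOn_const.div contDiff_bottomSq.contDiffOn fun _ hx => ne_of_gt hx

theorem contDiffOn_sqrt_mul_conj (j : Fin 2) : ContDiffOn ℝ ((⊤ : ℕ∞) : WithTop ℕ∞)
    (fun x : Fin 2 → Fin 2 → ℂ => ((Real.sqrt (1 / bottomSq x) : ℝ) : ℂ) * conj (x 1 j))
    {x | 0 < bottomSq x} := by
  have h1 : ContDiffOn ℝ ((⊤ : ℕ∞) : WithTop ℕ∞)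
      (fun x => ((Real.sqrt (1 / bottomSq x) : ℝ) : ℂ)) {x | 0 < bottomSq x} :=
    Complex.ofRealCLM.contDiff.comp_contDiffOn
      (contDiffOn_inv_bottomSq.sqrt fun x hx => (one_div_pos.2 hx).ne')
  exact h1.mul (contDiff_conj.comp (contDiff_apply_apply ℝ ℂ 1 j)).contDiffOn

theorem contDiffOn_zc : ContDiffOn ℝ ((⊤ : ℕ∞) : WithTop ℕ∞)
    (fun x : Fin 2 → Fin 2 → ℂ => ((1 / bottomSq x : ℝ) : ℂ) *
      (x 0 0 * conj (x 1 0) + x 0 1 * conj (x 1 1))) {x | 0 < bottomSq x} := by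
  have h1 : ContDiffOn ℝ ((⊤ : ℕ∞) : WithTop ℕ∞)
      (fun x => ((1 / bottomSq x : ℝ) : ℂ)) {x | 0 < bottomSq x} :=
    Complex.ofRealCLM.contDiff.comp_contDiffOn contDiffOn_inv_bottomSq
  have h2 : ContDiff ℝ ((⊤ : ℕ∞) : WithTop ℕ∞) fun x : Fin 2 → Fin 2 → ℂ =>
      x 0 0 * conj (x 1 0) + x 0 1 * conj (x 1 1) :=
    ((contDiff_apply_apply ℝ ℂ 0 0).mul (contDiff_conj.comp (contDiff_apply_apply ℝ ℂ 1 0))).add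
      ((contDiff_apply_apply ℝ ℂ 0 1).mul (contDiff_conj.comp (contDiff_apply_apply ℝ ℂ 1 1)))
  exact h1.mul h2.contDiffOn

theorem contDiffOn_Phi_coords (l : ℕ) (m q : ℤ) : ContDiffOn ℝ ((⊤ : ℕ∞) : WithTop ℕ∞)
    (fun x : Fin 2 → Fin 2 → ℂ =>
      Phi l m q (((Real.sqrt (1 / bottomSq x) : ℝ) : ℂ) * conj (x 1 1))
        (-(((Real.sqrt (1 / bottomSq x) : ℝ) : ℂ) * conj (x 1 0))))
    {x | 0 < bottomSq x} := by
  have h : ContDiffOn ℝ ((⊤ : ℕ∞) : WithTop ℕ∞) (fun x : Fin 2 → Fin 2 → ℂ =>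
      (((Real.sqrt (1 / bottomSq x) : ℝ) : ℂ) * conj (x 1 1),
        -(((Real.sqrt (1 / bottomSq x) : ℝ) : ℂ) * conj (x 1 0)))) {x | 0 < bottomSq x} :=
    ContDiffOn.prodMk (contDiffOn_sqrt_mul_conj 1) (contDiffOn_sqrt_mul_conj 0).neg
  have := (Phi_smooth l m q).comp_contDiffOn h
  simpa only [Function.comp_def] using this

theorem contDiffOn_comp_inv_bottomSq {f : ℝ → ℂ}
    (hf : ContDiffOn ℝ ((⊤ : ℕ∞) : WithTop ℕ∞) f (Ioi 0)) :
    ContDiffOn ℝ ((⊤ : ℕ∞) : WithTop ℕ∞) (fun x => f (1 / bottomSq x)) {x | 0 < bottomSq x} :=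
  hf.comp contDiffOn_inv_bottomSq fun x (hx : 0 < bottomSq x) => mem_Ioi.2 (one_div_pos.2 hx)

theorem contDiffOn_psi_coords (ω : ℂ) : ContDiffOn ℝ ((⊤ : ℕ∞) : WithTop ℕ∞)
    (fun x : Fin 2 → Fin 2 → ℂ => psi ω (((1 / bottomSq x : ℝ) : ℂ) *
      (x 0 0 * conj (x 1 0) + x 0 1 * conj (x 1 1)))) {x | 0 < bottomSq x} :=
  (contDiff_psi ω).comp_contDiffOn contDiffOn_zc

theorem fK_smooth (ω : ℂ) {F : ℤ → ℝ → ℂ} {l : ℕ} {q : ℤ} (hF : ∀ m : ℤ, |m| ≤ (l : ℤ) →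
    ContDiffOn ℝ ((⊤ : ℕ∞) : WithTop ℕ∞) (F m) (Ioi 0)) : IsSmooth (fK ω F l q) := by
  refine ⟨{x | 0 < bottomSq x}, fun x => psi ω (((1 / bottomSq x : ℝ) : ℂ) *
    (x 0 0 * conj (x 1 0) + x 0 1 * conj (x 1 1))) *
    ∑ m ∈ Finset.Icc (-(l : ℤ)) l, F m (1 / bottomSq x) *
      Phi l m q (((Real.sqrt (1 / bottomSq x) : ℝ) : ℂ) * conj (x 1 1))
        (-(((Real.sqrt (1 / bottomSq x) : ℝ) : ℂ) * conj (x 1 0))),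
    isOpen_lt continuous_const contDiff_bottomSq.continuous, fun g => bottom_pos g, ?_,
    fun g => by simp only [fK, kA, kB, zc, height, bottomSq]⟩
  exact (contDiffOn_psi_coords ω).mul (ContDiffOn.sum fun m hm =>
    (contDiffOn_comp_inv_bottomSq (hF m (mem_Icc_iff_abs.1 hm))).mul (contDiffOn_Phi_coords l m q))

theorem fK_hasDerivAt_of (ω : ℂ) (F : ℤ → ℝ → ℂ) {l : ℕ} {q : ℤ} {A B : ℝ → ℂ}
    (hAB : ∀ t, normSq (A t) + normSq (B t) = 1) {c d e : ℂ}
    (hPhi : ∀ p : ℤ, |p| ≤ (l : ℤ) → ∀ α β : ℂ, HasDerivAt (fun t : ℝ => Phi l p q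
      (α * A t - β * conj (B t)) (α * B t + β * conj (A t)))
      (c * Phi l p (q + 1) α β + d * Phi l p (q - 1) α β + e * Phi l p q α β) 0) (g : SL2) :
    HasDerivAt (fun t => fK ω F l q (g * kElt (A t) (B t)))
      (c * fK ω F l (q + 1) g + d * fK ω F l (q - 1) g + e * fK ω F l q g) 0 := by
  have h1 : ∀ t, fK ω F l q (g * kElt (A t) (B t)) = psi ω (zc g) *
      ∑ m ∈ Finset.Icc (-(l : ℤ)) l, F m (height g) * Phi l m q
        (kA g * A t - kB g * conj (B t)) (kA g * B t + kB g * conj (A t)) := by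
    intro t
    obtain ⟨h1, h2, h3, h4⟩ := coords_mul_kElt g (hAB t)
    rw [fK, h1, h2, h3, h4]
  simp_rw [h1]
  refine ((HasDerivAt.fun_sum fun m hm =>
    (hPhi m (mem_Icc_iff_abs.1 hm) (kA g) (kB g)).const_mul (F m (height g))).const_mul
      (psi ω (zc g))).congr_deriv ?_
  simp only [fK, mul_add, Finset.sum_add_distrib, Finset.mul_sum]
  congr 1
  · congr 1 <;> exact Finset.sum_congr rfl fun m _ => by ring
  · exact Finset.sum_congr rfl fun m _ => by ring

theorem fK_hasDerivAt_W1 (ω : ℂ) (F : ℤ → ℝ → ℂ) {l : ℕ} {q : ℤ} (hq : |q| ≤ (l : ℤ)) (g : SL2) :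
    HasDerivAt (fun t => fK ω F l q (g * expW1 t))
      (1 / 2 * (-(((l : ℂ) - q) * fK ω F l (q + 1) g) + ((l : ℂ) + q) * fK ω F l (q - 1) g)) 0 := by
  have := fK_hasDerivAt_of ω F (q := q) (l := l) (A := fun t => ((Real.cos (t / 2) : ℝ) : ℂ))
    (B := fun t => ((Real.sin (t / 2) : ℝ) : ℂ)) (c := -(1 / 2 * ((l : ℂ) - q)))
    (d := 1 / 2 * ((l : ℂ) + q)) (e := 0)
    (fun t => by
      rw [normSq_ofReal, normSq_ofReal]
      have := Real.cos_sq_add_sin_sq (t / 2); nlinarith)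
    (fun p hp α β => (Phi_hasDerivAt_W1 hp hq α β).congr_deriv (by ring)) g
  exact this.congr_deriv (by ring)

theorem fK_hasDerivAt_W2 (ω : ℂ) (F : ℤ → ℝ → ℂ) {l : ℕ} {q : ℤ} (hq : |q| ≤ (l : ℤ)) (g : SL2) :
    HasDerivAt (fun t => fK ω F l q (g * expW2 t))
      (I / 2 * (((l : ℂ) - q) * fK ω F l (q + 1) g + ((l : ℂ) + q) * fK ω F l (q - 1) g))
      0 := by
  have := fK_hasDerivAt_of ω F (q := q) (l := l) (A := fun t => ((Real.cos (t / 2) : ℝ) : ℂ))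
    (B := fun t => I * ((Real.sin (t / 2) : ℝ) : ℂ)) (c := I / 2 * ((l : ℂ) - q))
    (d := I / 2 * ((l : ℂ) + q)) (e := 0) (fun t => normSq_cos_sin (t / 2))
    (fun p hp α β => (Phi_hasDerivAt_W2 hp hq α β).congr_deriv (by ring)) g
  exact this.congr_deriv (by ring)

theorem fK_hasDerivAt_H2 (ω : ℂ) (F : ℤ → ℝ → ℂ) {l : ℕ} {q : ℤ} (hq : |q| ≤ (l : ℤ)) (g : SL2) :
    HasDerivAt (fun t => fK ω F l q (g * expH2 t)) (-(I * q) * fK ω F l q g) 0 := by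
  have := fK_hasDerivAt_of ω F (q := q) (l := l) (A := fun t => Complex.exp (I * t / 2))
    (B := fun _ => 0) (c := 0) (d := 0) (e := -(I * q))
    (fun t => by rw [normSq_exp_I]; simp)
    (fun p hp α β => (Phi_hasDerivAt_H2 hp hq α β).congr_deriv (by ring)) g
  simp only [← hElt_exp_eq] at this
  exact this.congr_deriv (by ring)

theorem fK_hasDerivAt_raise (ω : ℂ) (F : ℤ → ℝ → ℂ) {l : ℕ} {q : ℤ} (hq : |q| ≤ (l : ℤ))
    {γ : ℝ → SL2} {c d : ℂ} (h : ∀ q : ℤ, |q| ≤ (l : ℤ) → ∀ g, HasDerivAt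
      (fun t => fK ω F l q (g * γ t)) (c * (((l : ℂ) - q) * fK ω F l (q + 1) g) +
        d * (((l : ℂ) + q) * fK ω F l (q - 1) g)) 0) (g : SL2) :
    rightDeriv γ (rightDeriv γ (fK ω F l q)) g =
      c * (((l : ℂ) - q) * (c * (((l : ℂ) - (q + 1)) * fK ω F l (q + 1 + 1) g) +
        d * (((l : ℂ) + (q + 1)) * fK ω F l q g))) +
      d * (((l : ℂ) + q) * (c * (((l : ℂ) - (q - 1)) * fK ω F l q g) +
        d * (((l : ℂ) + (q - 1)) * fK ω F l (q - 1 - 1) g))) := by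
  have h1 : rightDeriv γ (fK ω F l q) = fun g => c * (((l : ℂ) - q) * fK ω F l (q + 1) g) +
        d * (((l : ℂ) + q) * fK ω F l (q - 1) g) := by
    ext g; exact (h q hq g).deriv
  have hq' := abs_le.1 hq
  have up : HasDerivAt (fun t => ((l : ℂ) - q) * fK ω F l (q + 1) (g * γ t)) (((l : ℂ) - q) *
      (c * (((l : ℂ) - (q + 1)) * fK ω F l (q + 1 + 1) g) +
        d * (((l : ℂ) + (q + 1)) * fK ω F l q g))) 0 := by
    by_cases hl : q = l
    · subst hl; simpa using hasDerivAt_const (0 : ℝ) (0 : ℂ)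
    · have := (h (q + 1) (abs_le.2 (by omega)) g).const_mul ((l : ℂ) - q)
      rw [add_sub_cancel_right] at this
      push_cast at this; exact this
  have down : HasDerivAt (fun t => ((l : ℂ) + q) * fK ω F l (q - 1) (g * γ t)) (((l : ℂ) + q) *
      (c * (((l : ℂ) - (q - 1)) * fK ω F l q g) +
        d * (((l : ℂ) + (q - 1)) * fK ω F l (q - 1 - 1) g))) 0 := by
    by_cases hl : q = -l
    · subst hl; simpa using hasDerivAt_const (0 : ℝ) (0 : ℂ)
    · have := (h (q - 1) (abs_le.2 (by omega)) g).const_mul ((l : ℂ) + q)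
      rw [sub_add_cancel] at this
      push_cast at this; exact this
  rw [h1, rightDeriv]
  exact ((up.const_mul c).add (down.const_mul d)).deriv

theorem fK_hasKType (ω : ℂ) (F : ℤ → ℝ → ℂ) {l : ℕ} {q : ℤ} (hq : |q| ≤ (l : ℤ)) :
    HasKType l q (fK ω F l q) := by
  have hH : rightDeriv expH2 (fK ω F l q) = fun g => -(I * q) * fK ω F l q g := by
    ext g; exact (fK_hasDerivAt_H2 ω F hq g).deriv
  intro g
  refine ⟨?_, congrFun hH g⟩
  have hHH : rightDeriv expH2 (rightDeriv expH2 (fK ω F l q)) g =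
      -(I * q) * (-(I * q) * fK ω F l q g) := by
    rw [hH, rightDeriv]
    exact ((fK_hasDerivAt_H2 ω F hq g).const_mul _).deriv
  have h1 := fK_hasDerivAt_raise ω F hq (γ := expW1) (c := -(1 / 2)) (d := 1 / 2)
    (fun q hq g => (fK_hasDerivAt_W1 ω F hq g).congr_deriv (by ring)) g
  have h2 := fK_hasDerivAt_raise ω F hq (γ := expW2) (c := I / 2) (d := I / 2)
    (fun q hq g => (fK_hasDerivAt_W2 ω F hq g).congr_deriv (by ring)) g
  rw [casimirK, hHH, h1, h2]
  have hI := I_sq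
  linear_combination (1 / 2 * ((q : ℂ) ^ 2 * fK ω F l q g + 1 / 4 * (((l : ℂ) - q) *
    (((l : ℂ) - (q + 1)) * fK ω F l (q + 1 + 1) g + ((l : ℂ) + (q + 1)) * fK ω F l q g) +
    ((l : ℂ) + q) * (((l : ℂ) - (q - 1)) * fK ω F l q g +
      ((l : ℂ) + (q - 1)) * fK ω F l (q - 1 - 1) g)))) * hI

theorem fK_bound (ω : ℂ) {F : ℤ → ℝ → ℂ} {l : ℕ} (q : ℤ) {S : Set ℝ} (hS : S ⊆ Ioi 0) {s : ℝ}
    (hF : ∀ m : ℤ, |m| ≤ (l : ℤ) → ∃ C, ∀ r ∈ S, ‖F m r‖ ≤ C * r ^ s) :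
    ∃ C : ℝ, ∀ r ∈ S, ∀ α β : ℂ, normSq α + normSq β = 1 →
      ‖fK ω F l q (aElt r * kElt α β)‖ ≤ C * r ^ s := by
  choose! C hC using hF
  choose K hK0 hK using fun m => Phi_bounded l m q
  refine ⟨∑ m ∈ Finset.Icc (-(l : ℤ)) l, C m * K m, fun r hr α β h => ?_⟩
  rw [fK_aElt_mul_kElt ω F l q (hS hr) h, Finset.sum_mul]
  refine norm_sum_le_of_le _ fun m hm => ?_
  rw [norm_mul, mul_right_comm]
  have h1 := hC m (mem_Icc_iff_abs.1 hm) r hr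
  exact mul_le_mul h1 (hK m α β h) (norm_nonneg _) ((norm_nonneg _).trans h1)

theorem fK_memP (ω : ℂ) {F : ℤ → ℝ → ℂ} {l : ℕ} {q : ℤ} (hq : |q| ≤ (l : ℤ))
    (hF : ∀ m : ℤ, |m| ≤ (l : ℤ) → ContDiffOn ℝ ((⊤ : ℕ∞) : WithTop ℕ∞) (F m) (Ioi 0))
    {s t r₀ r₁ : ℝ} (hs : 0 < s) (ht : 0 < t) (hr₀ : 0 < r₀) (hr₁ : 0 < r₁)
    (h0 : ∀ m : ℤ, |m| ≤ (l : ℤ) → ∃ C, ∀ r ∈ Ioo 0 r₀, ‖F m r‖ ≤ C * r ^ (1 + s))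
    (h1 : ∀ m : ℤ, |m| ≤ (l : ℤ) → ∃ C, ∀ r ∈ Ioi r₁, ‖F m r‖ ≤ C * r ^ (1 - t)) :
    MemP l q ω (fK ω F l q) where
  even := fK_neg ω F l q
  smooth := fK_smooth ω hF
  equivariant := fK_nElt_mul ω F l q
  kType := fK_hasKType ω F hq
  growthZero := by
    obtain ⟨C, hC⟩ := fK_bound ω q (fun r (hr : r ∈ Ioo 0 r₀) => hr.1) h0
    exact ⟨s, hs, C, r₀, hr₀, fun r hr0 hr => hC r ⟨hr0, hr⟩⟩
  growthInfty := by
    obtain ⟨C, hC⟩ := fK_bound ω q (fun r (hr : r ∈ Ioi r₁) => hr₁.trans hr) h1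
    exact ⟨t, ht, C, r₁, hr₁, fun r hr => hC r hr⟩

/-! ### Holomorphic functions on vertical strips -/

/-- Holomorphic functions on the strip `x₁ ≤ Re z ≤ x₂` of size `O((1 + |Im z|)^N e^{c |Im z|})`. -/
def Tempered (x₁ x₂ c : ℝ) (A : ℂ → ℂ) : Prop :=
  (∀ z : ℂ, x₁ ≤ z.re → z.re ≤ x₂ → DifferentiableAt ℂ A z) ∧ ∃ C : ℝ, 0 ≤ C ∧ ∃ N : ℕ,
    ∀ z : ℂ, x₁ ≤ z.re → z.re ≤ x₂ → ‖A z‖ ≤ C * (1 + |z.im|) ^ N * Real.exp (c * |z.im|)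

/-- Holomorphic functions on the strip `x₁ ≤ Re z ≤ x₂` of size `O((1 + |Im z|)^{-N} e^{c |Im z|})`
for all `N`. -/
def Rapid (x₁ x₂ c : ℝ) (A : ℂ → ℂ) : Prop :=
  (∀ z : ℂ, x₁ ≤ z.re → z.re ≤ x₂ → DifferentiableAt ℂ A z) ∧ ∀ N : ℕ, ∃ C : ℝ, 0 ≤ C ∧
    ∀ z : ℂ, x₁ ≤ z.re → z.re ≤ x₂ → ‖A z‖ * (1 + |z.im|) ^ N ≤ C * Real.exp (c * |z.im|)

/-- Families of holomorphic functions on `|Re ν| ≤ σ` of size `O((1 + |Im ν|)^{-N} e^{-π |Im ν| / 2})`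
for all `N`. -/
abbrev RapidFamily (l : ℕ) (σ : ℝ) (η : ℂ → ℤ → ℂ) : Prop :=
  ∀ p : ℤ, |p| ≤ (l : ℤ) → Rapid (-σ) σ (-π / 2) fun ν => η ν p

/-- Invariance under `(ν, p) ↦ (-ν, -p)`. -/
abbrev EvenFamily (l : ℕ) (σ : ℝ) (η : ℂ → ℤ → ℂ) : Prop :=
  ∀ p : ℤ, |p| ≤ (l : ℤ) → ∀ ν : ℂ, |ν.re| ≤ σ → η ν p = η (-ν) (-p)

section Strips

variable {x₁ x₂ c c' : ℝ} {A B : ℂ → ℂ}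

theorem Rapid.mul (hA : Rapid x₁ x₂ c A) (hB : Tempered x₁ x₂ c' B) :
    Rapid x₁ x₂ (c + c') fun z => A z * B z := by
  obtain ⟨dA, hA⟩ := hA
  obtain ⟨dB, C', hC', M, hB⟩ := hB
  refine ⟨fun z h1 h2 => (dA z h1 h2).mul (dB z h1 h2), fun N => ?_⟩
  obtain ⟨C, hC, hA⟩ := hA (N + M)
  refine ⟨C * C', mul_nonneg hC hC', fun z h1 h2 => ?_⟩
  have := abs_nonneg z.im
  calc ‖A z * B z‖ * (1 + |z.im|) ^ N
      ≤ ‖A z‖ * (C' * (1 + |z.im|) ^ M * Real.exp (c' * |z.im|)) * (1 + |z.im|) ^ N := by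
        rw [norm_mul]; gcongr; exact hB z h1 h2
    _ = (‖A z‖ * (1 + |z.im|) ^ (N + M)) * (C' * Real.exp (c' * |z.im|)) := by rw [pow_add]; ring
    _ ≤ (C * Real.exp (c * |z.im|)) * (C' * Real.exp (c' * |z.im|)) := by
        exact mul_le_mul_of_nonneg_right (hA z h1 h2) (by positivity)
    _ = _ := by rw [add_mul, Real.exp_add]; ring

theorem Tempered.mul (hA : Tempered x₁ x₂ c A) (hB : Tempered x₁ x₂ c' B) :
    Tempered x₁ x₂ (c + c') fun z => A z * B z := by
  obtain ⟨dA, C, hC, N, hA⟩ := hA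
  obtain ⟨dB, C', hC', M, hB⟩ := hB
  refine ⟨fun z h1 h2 => (dA z h1 h2).mul (dB z h1 h2), C * C', mul_nonneg hC hC', N + M,
    fun z h1 h2 => ?_⟩
  have := abs_nonneg z.im
  calc ‖A z * B z‖ ≤ (C * (1 + |z.im|) ^ N * Real.exp (c * |z.im|)) *
        (C' * (1 + |z.im|) ^ M * Real.exp (c' * |z.im|)) := by
        rw [norm_mul]; exact mul_le_mul (hA z h1 h2) (hB z h1 h2) (norm_nonneg _) (by positivity)
    _ = _ := by rw [add_mul, Real.exp_add, pow_add]; ring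

theorem Rapid.mono {y₁ y₂ : ℝ} (hA : Rapid x₁ x₂ c A) (h₁ : x₁ ≤ y₁) (h₂ : y₂ ≤ x₂) :
    Rapid y₁ y₂ c A := by
  refine ⟨fun z k1 k2 => hA.1 z (h₁.trans k1) (k2.trans h₂), fun N => ?_⟩
  obtain ⟨C, hC, h⟩ := hA.2 N
  exact ⟨C, hC, fun z k1 k2 => h z (h₁.trans k1) (k2.trans h₂)⟩

theorem Rapid.bound (hA : Rapid x₁ x₂ 0 A) : ∃ C : ℝ, 0 ≤ C ∧ ∀ z : ℂ, x₁ ≤ z.re → z.re ≤ x₂ →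
    ‖A z‖ ≤ C * (1 + z.im ^ 2)⁻¹ := by
  obtain ⟨C, hC, h⟩ := hA.2 2
  refine ⟨C, hC, fun z h1 h2 => ?_⟩
  have := h z h1 h2
  rw [zero_mul, Real.exp_zero, mul_one] at this
  rw [← div_eq_mul_inv, le_div_iff₀ (by positivity)]
  refine le_trans (mul_le_mul_of_nonneg_left ?_ (norm_nonneg _)) this
  rw [← sq_abs]; nlinarith [abs_nonneg z.im]

theorem Rapid.integrable (hA : Rapid x₁ x₂ 0 A) {x : ℝ} (h1 : x₁ ≤ x) (h2 : x ≤ x₂) :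
    Integrable fun t : ℝ => A (x + t * I) := by
  obtain ⟨C, -, h⟩ := hA.bound
  exact integrable_line (fun z hz => (hA.1 z (hz ▸ h1) (hz ▸ h2)).continuousAt)
    fun z hz => h z (hz ▸ h1) (hz ▸ h2)

theorem Rapid.integral_eq (hA : Rapid x₁ x₂ 0 A) (hx : x₁ ≤ x₂) :
    ∫ t : ℝ, A (x₁ + t * I) = ∫ t : ℝ, A (x₂ + t * I) := by
  obtain ⟨C, -, h⟩ := hA.bound
  exact integral_vertical_eq hx hA.1 h

theorem Rapid.integral_sub (hA : Rapid x₁ x₂ 0 A) {ν₀ : ℂ} (h1 : x₁ < ν₀.re) (h2 : ν₀.re < x₂) :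
    (∫ t : ℝ, A (x₂ + t * I) / (x₂ + t * I - ν₀)) -
      ∫ t : ℝ, A (x₁ + t * I) / (x₁ + t * I - ν₀) = 2 * π * A ν₀ := by
  obtain ⟨C, -, h⟩ := hA.bound
  exact integral_vertical_sub h1 h2 hA.1 h

theorem Rapid.packet (hA : Rapid x₁ x₂ (π / 2) A) {x : ℝ} (h1 : x₁ ≤ x) (h2 : x ≤ x₂) :
    PacketWeight fun t : ℝ => A (x + t * I) := by
  refine ⟨continuous_iff_continuousAt.2 fun t => ContinuousAt.comp (g := A)
    (hA.1 _ (by rwa [line_re]) (by rwa [line_re])).continuousAt (by fun_prop), fun N => ?_⟩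
  obtain ⟨C, hC, h⟩ := hA.2 N
  refine ⟨C, hC, fun t => ?_⟩
  have := h (x + t * I) (by rwa [line_re]) (by rwa [line_re])
  rw [line_im] at this
  rwa [div_mul_eq_mul_div] at this

theorem tempered_of_bound {C : ℝ} (hd : ∀ z : ℂ, x₁ ≤ z.re → z.re ≤ x₂ → DifferentiableAt ℂ A z)
    (hC : 0 ≤ C) (h : ∀ z : ℂ, x₁ ≤ z.re → z.re ≤ x₂ → ‖A z‖ ≤ C) : Tempered x₁ x₂ 0 A :=
  ⟨hd, C, hC, 0, fun z h1 h2 => by simpa using h z h1 h2⟩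

theorem norm_le_strip {z : ℂ} (h1 : x₁ ≤ z.re) (h2 : z.re ≤ x₂) :
    ‖z‖ ≤ (1 + |x₁| + |x₂|) * (1 + |z.im|) := by
  have h3 := Complex.norm_le_abs_re_add_abs_im z
  have h4 : |z.re| ≤ |x₁| + |x₂| := by
    rw [abs_le]
    exact ⟨by linarith [neg_abs_le x₁, abs_nonneg x₂], by linarith [le_abs_self x₂, abs_nonneg x₁]⟩
  nlinarith [abs_nonneg z.im, abs_nonneg x₁, abs_nonneg x₂]

theorem tempered_linear (x₁ x₂ : ℝ) (a b : ℂ) : Tempered x₁ x₂ 0 fun z => a * z + b := by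
  refine ⟨fun z _ _ => by fun_prop, ‖a‖ * (1 + |x₁| + |x₂|) + ‖b‖, by positivity, 1,
    fun z h1 h2 => ?_⟩
  have := norm_le_strip h1 h2
  have h3 := abs_nonneg z.im
  rw [zero_mul, Real.exp_zero, mul_one, pow_one]
  calc ‖a * z + b‖ ≤ ‖a‖ * ‖z‖ + ‖b‖ := (norm_add_le _ _).trans (by rw [norm_mul])
    _ ≤ ‖a‖ * ((1 + |x₁| + |x₂|) * (1 + |z.im|)) + ‖b‖ * (1 + |z.im|) := by
        gcongr; nlinarith [norm_nonneg b]
    _ = _ := by ring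

theorem tempered_prod (x₁ x₂ : ℝ) (s : Finset ℕ) : Tempered x₁ x₂ 0 fun z => ∏ i ∈ s, (z - i) := by
  induction s using Finset.induction_on with
  | empty => simpa using tempered_linear x₁ x₂ 0 1
  | insert a s ha ih =>
    have := (tempered_linear x₁ x₂ 1 (-a)).mul ih
    simpa [Finset.prod_insert ha, sub_eq_add_neg] using this

theorem norm_sin_le (z : ℂ) : ‖Complex.sin z‖ ≤ Real.exp |z.im| := by
  rw [Complex.sin, norm_div, norm_mul, Complex.norm_I, mul_one, Complex.norm_ofNat]
  have h1 : ‖Complex.exp (-z * I)‖ ≤ Real.exp |z.im| := by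
    rw [Complex.norm_exp]; exact Real.exp_le_exp.2 (by simpa using le_abs_self z.im)
  have h2 : ‖Complex.exp (z * I)‖ ≤ Real.exp |z.im| := by
    rw [Complex.norm_exp]; exact Real.exp_le_exp.2 (by simpa using neg_le_abs z.im)
  have := norm_sub_le (Complex.exp (-z * I)) (Complex.exp (z * I))
  linarith

theorem norm_sin_pi_le (z : ℂ) : ‖Complex.sin (π * z)‖ ≤ Real.exp (π * |z.im|) := by
  refine (norm_sin_le _).trans_eq ?_
  rw [Complex.im_ofReal_mul, abs_mul,
    abs_of_pos pi_pos]

theorem tempered_sin (x₁ x₂ : ℝ) : Tempered x₁ x₂ π fun z => Complex.sin (π * z) :=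
  ⟨fun z _ _ => by fun_prop, 1, zero_le_one, 0, fun z _ _ => by simpa using norm_sin_pi_le z⟩

theorem tempered_gamma {n : ℕ} (h : 0 < x₁ + n) (x₂ : ℝ) :
    Tempered x₁ x₂ (-π / 2) fun z => Gamma (z + n) := by
  obtain ⟨C, hC, N, hb⟩ := exists_norm_Gamma_le h (x₂ + n)
  refine ⟨fun z h1 h2 => ?_, C, hC, N, fun z h1 h2 => ?_⟩
  · refine DifferentiableAt.comp z (Complex.differentiableAt_Gamma _ fun m hm => ?_) (by fun_prop)
    have := congrArg Complex.re hm
    simp only [add_re, Complex.natCast_re, neg_re] at this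
    have : (0 : ℝ) ≤ m := m.cast_nonneg
    linarith
  · have := hb (z + n) (by simpa using h1) (by simpa using h2)
    simp only [Complex.add_im, Complex.natCast_im, add_zero] at this
    rwa [div_mul_eq_mul_div]

theorem tempered_inv {w : ℂ} {d : ℝ} (hd : 0 < d)
    (h : ∀ x : ℝ, x₁ ≤ x → x ≤ x₂ → d ≤ |x - w.re|) : Tempered x₁ x₂ 0 fun z => (z - w)⁻¹ := by
  have key : ∀ z : ℂ, x₁ ≤ z.re → z.re ≤ x₂ → d ≤ ‖z - w‖ := fun z h1 h2 =>
    (h z.re h1 h2).trans (by rw [← sub_re]; exact abs_re_le_norm _)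
  refine tempered_of_bound (C := d⁻¹) (fun z h1 h2 => ?_) (by positivity) fun z h1 h2 => ?_
  · have : z - w ≠ 0 := fun h0 => by
      have := key z h1 h2; rw [h0, norm_zero] at this; linarith
    exact (differentiableAt_id.sub_const w).inv this
  · rw [norm_inv]; exact inv_anti₀ hd (key z h1 h2)

theorem tempered_cpow (x₁ x₂ : ℝ) {y : ℝ} (hy : 0 < y) (a : ℂ) :
    Tempered x₁ x₂ 0 fun z => (y : ℂ) ^ (-(a + z)) := by
  have hyC : (y : ℂ) ≠ 0 := by exact_mod_cast hy.ne'
  refine tempered_of_bound (C := y ^ (-(a.re + x₁)) + y ^ (-(a.re + x₂)))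
    (fun z h1 h2 => (by fun_prop : DifferentiableAt ℂ (fun z => -(a + z)) z).const_cpow (Or.inl hyC))
    (by positivity) fun z h1 h2 => ?_
  rw [norm_ofReal_cpow hy, neg_re, add_re]
  rcases le_total y 1 with h | h
  · exact (Real.rpow_le_rpow_of_exponent_ge hy h (by linarith)).trans
      (le_add_of_nonneg_left (by positivity))
  · exact (Real.rpow_le_rpow_of_exponent_le h (by linarith)).trans
      (le_add_of_nonneg_right (by positivity))

theorem tempered_jB (x₁ x₂ : ℝ) (l : ℕ) (p m : ℤ) {y : ℝ} (hy : 0 < y) :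
    Tempered x₁ x₂ (-π / 2) fun z => jB l p m z y := by
  obtain ⟨C, hC, N, h⟩ := jB_stripBdd l p m (|x₁| + |x₂|)
  refine ⟨fun z _ _ => jB_differentiable l p m hy z, C * (1 + y⁻¹) ^ N, by positivity, N,
    fun z h1 h2 => ?_⟩
  have h4 : |z.re| ≤ |x₁| + |x₂| := by
    rw [abs_le]
    exact ⟨by linarith [neg_abs_le x₁, abs_nonneg x₂], by linarith [le_abs_self x₂, abs_nonneg x₁]⟩
  refine (h z h4 y hy).trans_eq ?_
  rw [mul_pow, div_mul_eq_mul_div]; ring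

/-! ### The weight `ν^{ε(p)} sin(πν)` -/

/-- The entire function equal to `ν^{ε(p)} sin(πν)` for `ν ≠ 0`. -/
def sinW (p : ℤ) (ν : ℂ) : ℂ :=
  if p = 0 then ν * Complex.sin (π * ν) else dslope (fun z => Complex.sin (π * z)) 0 ν

theorem sinW_eq (p : ℤ) {ν : ℂ} (h : ν ≠ 0) :
    sinW p ν = ν ^ eps p * Complex.sin (π * ν) := by
  unfold sinW eps
  split_ifs with hp
  · simp
  · rw [dslope_of_ne _ h, slope_def_field]
    simp [div_eq_inv_mul]

theorem sinW_neg (p : ℤ) (ν : ℂ) : sinW (-p) (-ν) = sinW p ν := by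
  by_cases h : ν = 0
  · subst h; unfold sinW; simp
  · rw [sinW_eq _ (neg_ne_zero.2 h), sinW_eq _ h]
    unfold eps
    split_ifs with h1 h2 h2
    · simp
    · exact absurd (neg_eq_zero.1 h1) h2
    · exact absurd (neg_eq_zero.2 h2) h1
    · simp [inv_neg]

theorem sinW_differentiable (p : ℤ) : Differentiable ℂ (sinW p) := by
  have hs : Differentiable ℂ fun z : ℂ => Complex.sin (π * z) := by fun_prop
  unfold sinW
  by_cases hp : p = 0
  · simp only [hp, if_true]; fun_prop
  · simp only [hp, if_false]
    exact differentiableOn_univ.1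
      ((Complex.differentiableOn_dslope univ_mem).2 hs.differentiableOn)

theorem tempered_sinW (x₁ x₂ : ℝ) (p : ℤ) : Tempered x₁ x₂ π (sinW p) := by
  refine ⟨fun z _ _ => sinW_differentiable p z, ?_⟩
  by_cases hp : p = 0
  · have := (tempered_linear x₁ x₂ 1 0).mul (tempered_sin x₁ x₂)
    simpa [sinW, hp] using this.2
  · obtain ⟨C, hC⟩ := (isCompact_closedBall (0 : ℂ) 1).exists_bound_of_continuousOn
      (sinW_differentiable p).continuous.continuousOn
    refine ⟨max C 1, by positivity, 0, fun z _ _ => ?_⟩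
    rw [pow_zero, mul_one]
    have he : 1 ≤ Real.exp (π * |z.im|) := Real.one_le_exp (by positivity)
    rcases le_total ‖z‖ 1 with h | h
    · have := hC z (mem_closedBall_zero_iff.2 h)
      nlinarith [le_max_left C 1, le_max_right C 1]
    · have hz : z ≠ 0 := by rintro rfl; simp at h; linarith
      rw [sinW_eq p hz, eps, if_neg hp, norm_mul, zpow_neg_one, norm_inv]
      have h1 := norm_sin_pi_le z
      have h2 : ‖z‖⁻¹ ≤ 1 := inv_le_one_of_one_le₀ h
      calc _ ≤ 1 * Real.exp (π * |z.im|) := by gcongr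
        _ ≤ _ := by gcongr; exact le_max_right _ _

/-- The function `ν^{ε(p)} sin(πν) Dlead l p ν`, holomorphic for `Re ν > -1`. -/
def sinD (l : ℕ) (p : ℤ) (ν : ℂ) : ℂ :=
  (if p = 0 then Complex.sin (π * ν) * Gamma (ν + (1 : ℕ))
    else sinW p ν * Gamma (ν + p.natAbs)) *
    ∏ i ∈ Finset.Ico (p.natAbs + 1) (l + 1), (ν - i)

theorem sinD_eq (l : ℕ) (p : ℤ) {ν : ℂ} (h : ν ≠ 0) : sinD l p ν = sinW p ν * Dlead l p ν := by
  unfold sinD Dlead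
  by_cases hp : p = 0
  · subst hp
    simp only [if_true, sinW_eq 0 h, eps, Int.natAbs_zero, Nat.cast_zero, add_zero, Nat.cast_one,
      Gamma_add_one _ h, zpow_one]
    ring
  · simp only [hp, if_false]; ring

theorem tempered_sinD (l : ℕ) (p : ℤ) (hx : -1 < x₁) (x₂ : ℝ) :
    Tempered x₁ x₂ (π / 2) (sinD l p) := by
  have e : π + -π / 2 + 0 = π / 2 := by ring
  rw [← e]
  refine Tempered.mul ?_ (tempered_prod x₁ x₂ _)
  by_cases hp : p = 0
  · simp only [hp, if_true]
    exact (tempered_sin x₁ x₂).mul (tempered_gamma (by simp; linarith) x₂)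
  · simp only [hp, if_false]
    have : 1 ≤ p.natAbs := by omega
    have h1 : (1 : ℝ) ≤ p.natAbs := by exact_mod_cast this
    exact (tempered_sinW x₁ x₂ p).mul (tempered_gamma (by linarith) x₂)

end Strips

/-- The product `ν^{ε(p)} sin(πν) Dlead l p ν Dlead l p (-ν)`. -/
theorem sinD_mul_Dlead (l : ℕ) {p : ℤ} (hp : |p| ≤ (l : ℤ)) {ν : ℂ} (h : ν ≠ 0)
    (hs : Complex.sin (π * ν) ≠ 0) :
    sinD l p ν * Dlead l p (-ν) = (π : ℂ) ^ 2 / 2 * factor l p ν := by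
  have hpi : (π : ℂ) ≠ 0 := by exact_mod_cast pi_pos.ne'
  have hprod : ∀ s : Finset ℕ, (∏ i ∈ s, (ν - i)) * ∏ i ∈ s, (-ν - i) =
      ∏ i ∈ s, ((i : ℂ) ^ 2 - ν ^ 2) := fun s => by
    rw [← Finset.prod_mul_distrib]; exact Finset.prod_congr rfl fun i _ => by ring
  have hG : ∀ n : ℕ, Gamma (ν + (n + 1 : ℕ)) * Gamma (-ν + (n + 1 : ℕ)) =
      (∏ j ∈ Finset.Ico 1 (n + 1), ((j : ℂ) ^ 2 - ν ^ 2)) *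
        (π * ν / Complex.sin (π * ν)) := by
    intro n
    have hne : ∀ k : ℕ, ν ≠ k ∧ ν ≠ -k := fun k => by
      constructor <;> intro hk <;> apply hs
      · rw [hk, mul_comm]; exact Complex.sin_nat_mul_pi k
      · rw [hk, mul_neg, Complex.sin_neg, mul_comm, Complex.sin_nat_mul_pi, neg_zero]
    induction n with
    | zero =>
      have h1 := Complex.Gamma_mul_Gamma_one_sub ν
      rw [zero_add, Nat.cast_one, Gamma_add_one ν h, mul_assoc,
        show -ν + 1 = 1 - ν by ring, h1]
      simp; ring
    | succ n ih =>
      have e1 : ν + ((n + 1 + 1 : ℕ) : ℂ) = (ν + (n + 1 : ℕ)) + 1 := by push_cast; ring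
      have e2 : -ν + ((n + 1 + 1 : ℕ) : ℂ) = (-ν + (n + 1 : ℕ)) + 1 := by push_cast; ring
      rw [e1, e2, Gamma_add_one _ (fun h0 => (hne (n + 1)).2 (eq_neg_of_add_eq_zero_left h0)),
        Gamma_add_one _ (fun h0 => (hne (n + 1)).1 (by linear_combination -h0)),
        Finset.prod_Ico_succ_top (by omega)]
      linear_combination (((n + 1 : ℕ) : ℂ) ^ 2 - ν ^ 2) * ih
  have hIcc : Finset.Icc 1 l = Finset.Ico 1 (l + 1) := by ext; simp
  unfold sinD Dlead factor
  by_cases h0 : p = 0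
  · subst h0
    simp only [if_true]
    have h1 := hG 0
    have e : -ν * Gamma (-ν) = Gamma (-ν + ((0 + 1 : ℕ) : ℂ)) := by
      rw [zero_add, Nat.cast_one, Gamma_add_one _ (neg_ne_zero.2 h)]
    rw [zero_add] at h1 e
    have h2 := hprod (Finset.Ico 1 (l + 1))
    rw [hIcc, ← h2]
    rw [← e] at h1
    simp only [Finset.Ico_self, Finset.prod_empty, one_mul, eq_div_iff hs] at h1
    have h3 : Complex.sin (π * ν) * Gamma (ν + (1 : ℕ)) * Gamma (-ν) =
        -π := by
      have h4 : ν * (Complex.sin (π * ν) * Gamma (ν + (1 : ℕ)) * Gamma (-ν)) =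
        ν * -π := by linear_combination -h1
      exact mul_left_cancel₀ h h4
    have h5 : (π : ℂ) ^ 2 / 2 * (-(2 / π)) = -π := by field_simp
    rw [← mul_assoc ((π : ℂ) ^ 2 / 2), h5, ← h3]
    simp only [Int.natAbs_zero, Nat.cast_zero, add_zero, zero_add]
    ring
  · simp only [h0, if_false]
    obtain ⟨n, hn⟩ : ∃ n, p.natAbs = n + 1 := ⟨p.natAbs - 1, by omega⟩
    have hnl : n + 1 ≤ l := by have := abs_le.1 hp; omega
    have e3 : (Finset.Icc 1 l).erase (n + 1) = Finset.Ico 1 (n + 1) ∪ Finset.Ico (n + 1 + 1) (l + 1) := by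
      ext j; simp; omega
    have hdis : Disjoint (Finset.Ico 1 (n + 1)) (Finset.Ico (n + 1 + 1) (l + 1)) := by
      rw [Finset.disjoint_left]; intro j; simp; omega
    change (sinW p ν * Gamma (ν + p.natAbs) *
      ∏ i ∈ Finset.Ico (p.natAbs + 1) (l + 1), (ν - i)) * (Gamma (-ν + p.natAbs) *
      ∏ i ∈ Finset.Ico (p.natAbs + 1) (l + 1), (-ν - i)) = (π : ℂ) ^ 2 / 2 * ((2 / π) *
        ∏ j ∈ (Finset.Icc 1 l).erase p.natAbs, ((j : ℂ) ^ 2 - ν ^ 2))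
    rw [hn, e3, Finset.prod_union hdis, ← hprod (Finset.Ico (n + 1 + 1) (l + 1)), sinW_eq p h, eps,
      if_neg h0, zpow_neg_one]
    have hGn := hG n
    have h4 : ν⁻¹ * Complex.sin (π * ν) * (π * ν / Complex.sin (π * ν)) =
        π := by rw [mul_assoc, mul_div_cancel₀ _ hs]; field_simp
    have h5 : (π : ℂ) ^ 2 / 2 * (2 / π) = π := by field_simp
    rw [← mul_assoc ((π : ℂ) ^ 2 / 2), h5]
    linear_combination (ν⁻¹ * Complex.sin (π * ν) *
      (∏ i ∈ Finset.Ico (n + 1 + 1) (l + 1), (ν - i)) *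
        ∏ i ∈ Finset.Ico (n + 1 + 1) (l + 1), (-ν - i)) * hGn +
      ((∏ j ∈ Finset.Ico 1 (n + 1), ((j : ℂ) ^ 2 - ν ^ 2)) *
        ((∏ i ∈ Finset.Ico (n + 1 + 1) (l + 1), (ν - i)) *
        ∏ i ∈ Finset.Ico (n + 1 + 1) (l + 1), (-ν - i))) * h4

/-! ### Asymptotics of packets -/

theorem PacketWeight.mul_Gamma {G : ℝ → ℂ} (hG : PacketWeight G) (l : ℕ) {c : ℝ} (hc : 0 < c) :
    ∃ C : ℝ, 0 ≤ C ∧ ∀ t : ℝ,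
      ‖G t‖ * ‖Gamma (l + 1 + (c + t * I))‖ ≤ C * (1 + t ^ 2)⁻¹ := by
  obtain ⟨C, hC, N, h⟩ := exists_norm_Gamma_le (x₁ := l + 1 + c) (by positivity) (l + 1 + c)
  obtain ⟨C', hC', h'⟩ := hG.2 (N + 2)
  refine ⟨C * C', mul_nonneg hC hC', fun t => ?_⟩
  have e : (l + 1 + (c + t * I) : ℂ) = ((l + 1 + c : ℝ) : ℂ) + t * I := by
    push_cast; ring
  have h1 := h (l + 1 + (c + t * I)) (by rw [e, line_re]) (by rw [e, line_re])
  rw [e, line_im, ← e] at h1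
  have ht := abs_nonneg t
  have e1 : 1 + t ^ 2 ≤ (1 + |t|) ^ 2 := by rw [← sq_abs]; nlinarith
  have hexp : Real.exp (π * |t| / 2) * Real.exp (-π * |t| / 2) = 1 := by
    rw [← Real.exp_add, ← Real.exp_zero]; congr 1; ring
  rw [← div_eq_mul_inv, le_div_iff₀ (by positivity)]
  calc _ ≤ ‖G t‖ * (C * (1 + |t|) ^ N * Real.exp (-π * |t| / 2)) * (1 + |t|) ^ 2 := by
        gcongr
    _ = (‖G t‖ * (1 + |t|) ^ (N + 2)) * (C * Real.exp (-π * |t| / 2)) := by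
        rw [pow_add]; ring
    _ ≤ (C' * Real.exp (π * |t| / 2)) * (C * Real.exp (-π * |t| / 2)) :=
        mul_le_mul_of_nonneg_right (h' t) (by positivity)
    _ = C * C' * (Real.exp (π * |t| / 2) * Real.exp (-π * |t| / 2)) := by ring
    _ = _ := by rw [hexp, mul_one]

theorem jP_norm_le {G : ℝ → ℂ} (hG : PacketWeight G) {c : ℝ} (hc : 0 < c) (l : ℕ) (p : ℤ) {m : ℤ}
    (hm : |m| ≤ (l : ℤ)) : ∃ C : ℝ, 0 ≤ C ∧ ∀ y : ℝ, 0 < y →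
      ‖jP G c l p m y‖ ≤ C * y ^ (-(l + c)) := by
  obtain ⟨C, hC, h⟩ := hG.mul_Gamma l hc
  refine ⟨∫ t : ℝ, 2 ^ (l : ℝ) / c * C * (1 + t ^ 2)⁻¹, integral_nonneg fun t => by positivity,
    fun y hy => ?_⟩
  rw [← integral_mul_const]
  refine norm_integral_le_of_norm_le ((integrable_inv_one_add_sq.const_mul _).mul_const _)
    (Eventually.of_forall fun t => ?_)
  have h1 := norm_jB_le p hm (ν := c + t * I) (by rwa [line_re]) hy
  rw [line_re] at h1
  have hyp : 0 ≤ y ^ (-(l + c)) := by positivity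
  calc _ ≤ ‖G t‖ * (2 ^ (l : ℝ) / c * ‖Gamma (l + 1 + (c + t * I))‖ *
        y ^ (-(l + c))) := by rw [norm_mul]; gcongr
    _ = 2 ^ (l : ℝ) / c * (‖G t‖ * ‖Gamma (l + 1 + (c + t * I))‖) *
        y ^ (-(l + c)) := by ring
    _ ≤ 2 ^ (l : ℝ) / c * (C * (1 + t ^ 2)⁻¹) * y ^ (-(l + c)) :=
        mul_le_mul_of_nonneg_right (mul_le_mul_of_nonneg_left (h t) (by positivity)) hyp
    _ = _ := by ring

theorem jP_sub_le {G : ℝ → ℂ} (hG : PacketWeight G) {c θ : ℝ} (h0 : 0 ≤ θ) (h1 : θ ≤ 1)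
    (hc : θ / 2 < c) (l : ℕ) (p : ℤ) {m : ℤ} (hm : |m| ≤ (l : ℤ))
    (hi : ∀ y : ℝ, 0 < y → Integrable fun t : ℝ => G t * Dlead l p (c + t * I) *
      (y : ℂ) ^ (-(l + (c + t * I)) : ℂ)) :
    ∃ C : ℝ, 0 ≤ C ∧ ∀ y : ℝ, 0 < y → ‖jP G c l p m y - (if m = -p then
      ∫ t : ℝ, G t * Dlead l p (c + t * I) * (y : ℂ) ^ (-(l + (c + t * I)) : ℂ)
        else 0)‖ ≤ C * y ^ (-(l + c) + θ) := by
  obtain ⟨C, hC, h⟩ := hG.mul_Gamma l (by linarith : 0 < c)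
  have hcθ : 0 < c - θ / 2 := by linarith
  refine ⟨∫ t : ℝ, 4 * 2 ^ (l : ℝ) / (c - θ / 2) * C * (1 + t ^ 2)⁻¹,
    integral_nonneg fun t => by positivity, fun y hy => ?_⟩
  have e : jP G c l p m y - (if m = -p then
      ∫ t : ℝ, G t * Dlead l p (c + t * I) * (y : ℂ) ^ (-(l + (c + t * I)) : ℂ)
        else 0) = ∫ t : ℝ, G t * (jB l p m (c + t * I) y -
          (if m = -p then Dlead l p (c + t * I) else 0) *
            (y : ℂ) ^ (-(l + (c + t * I)) : ℂ)) := by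
    split_ifs with hmp
    · rw [jP, ← integral_sub (jB_integrable hG c l p m hy) (hi y hy)]
      congr 1; ext t; ring
    · simp [jP]
  rw [e, ← integral_mul_const]
  refine norm_integral_le_of_norm_le ((integrable_inv_one_add_sq.const_mul _).mul_const _)
    (Eventually.of_forall fun t => ?_)
  have h2 := norm_jB_sub_le (p := p) hm (ν := c + t * I) h0 h1 (by rwa [line_re]) hy
  rw [line_re] at h2
  have hyp : 0 ≤ y ^ (-(l + c) + θ) := by positivity
  calc _ ≤ ‖G t‖ * (4 * 2 ^ (l : ℝ) / (c - θ / 2) *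
        ‖Gamma (l + 1 + (c + t * I))‖ * y ^ (-(l + c) + θ)) := by
          rw [norm_mul]; gcongr
    _ = 4 * 2 ^ (l : ℝ) / (c - θ / 2) * (‖G t‖ *
        ‖Gamma (l + 1 + (c + t * I))‖) * y ^ (-(l + c) + θ) := by ring
    _ ≤ 4 * 2 ^ (l : ℝ) / (c - θ / 2) * (C * (1 + t ^ 2)⁻¹) * y ^ (-(l + c) + θ) :=
        mul_le_mul_of_nonneg_right (mul_le_mul_of_nonneg_left (h t) (by positivity)) hyp
    _ = _ := by ring

theorem half_line_ne_zero (t : ℝ) {w : ℂ} (hw : w.re < 1 / 2) :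
    (((1 / 2 : ℝ) : ℂ) + t * I) - w ≠ 0 := by
  intro h
  have := congrArg Complex.re h
  rw [sub_re, line_re] at this
  simp only [Complex.zero_re] at this
  linarith

/-- The asymptotics at `0` of a packet whose weight has a simple pole at `ν₀`. -/
theorem jP_pole_asymptotics {a : ℂ → ℂ} (ha : Rapid (-1 / 4) (1 / 2) (-π / 2) a) {ν₀ : ℂ}
    (h1 : -1 / 4 < ν₀.re) (h2 : ν₀.re < 0) (l : ℕ) (p : ℤ) {m : ℤ} (hm : |m| ≤ (l : ℤ)) :
    PacketWeight (fun t : ℝ => a (((1 / 2 : ℝ) : ℂ) + t * I) *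
      sinW p (((1 / 2 : ℝ) : ℂ) + t * I) / (((1 / 2 : ℝ) : ℂ) + t * I - ν₀)) ∧
    ∃ C : ℝ, 0 ≤ C ∧ ∀ y : ℝ, 0 < y →
      ‖jP (fun t : ℝ => a (((1 / 2 : ℝ) : ℂ) + t * I) *
        sinW p (((1 / 2 : ℝ) : ℂ) + t * I) / (((1 / 2 : ℝ) : ℂ) + t * I - ν₀))
          (1 / 2) l p m y - (if m = -p then 2 * π * (a ν₀ * sinD l p ν₀) else 0) *
            (y : ℂ) ^ (-(l + ν₀))‖ ≤ C * y ^ (-(l : ℝ) + 1 / 4) := by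
  have hw := (ha.mono le_rfl le_rfl).mul (tempered_sinW (-1 / 4) (1 / 2) p)
  rw [show -π / 2 + π = π / 2 by ring] at hw
  have hL := ha.mul (tempered_sinD l p (by norm_num : (-1 : ℝ) < -1 / 4) (1 / 2))
  rw [show -π / 2 + π / 2 = 0 by ring] at hL
  have hLy : ∀ y : ℝ, 0 < y → Rapid (-1 / 4) (1 / 2) 0
      fun z => (a z * sinD l p z) * (y : ℂ) ^ (-((l : ℂ) + z)) := fun y hy => by
    have := hL.mul (tempered_cpow (-1 / 4) (1 / 2) hy l)
    rwa [add_zero] at this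
  have hν₀ : ν₀.re < 1 / 2 := by linarith
  have hG := (hw.packet (x := 1 / 2) (by norm_num) le_rfl).div
    (D := fun t : ℝ => ((1 / 2 : ℝ) : ℂ) + t * I - ν₀) (by fun_prop)
    (d := 1 / 2) (by norm_num) (fun t => by
      refine le_trans ?_ (abs_re_le_norm _)
      rw [sub_re, line_re, abs_of_pos (by linarith)]; linarith)
  refine ⟨hG, ?_⟩
  set G := fun t : ℝ => a (((1 / 2 : ℝ) : ℂ) + t * I) *
    sinW p (((1 / 2 : ℝ) : ℂ) + t * I) / (((1 / 2 : ℝ) : ℂ) + t * I - ν₀) with hGdef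
  have hne : ∀ t : ℝ, ((1 / 2 : ℝ) : ℂ) + t * I ≠ 0 := fun t => by
    simpa using half_line_ne_zero t (w := 0) (by simp)
  have eG : ∀ y t : ℝ, G t * Dlead l p (((1 / 2 : ℝ) : ℂ) + t * I) *
      (y : ℂ) ^ (-(l + (((1 / 2 : ℝ) : ℂ) + t * I)) : ℂ) =
      (a (((1 / 2 : ℝ) : ℂ) + t * I) * sinD l p (((1 / 2 : ℝ) : ℂ) + t * I)) *
        (y : ℂ) ^ (-(l + (((1 / 2 : ℝ) : ℂ) + t * I)) : ℂ) /
          (((1 / 2 : ℝ) : ℂ) + t * I - ν₀) := by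
    intro y t
    rw [sinD_eq l p (hne t)]; simp only [hGdef]; ring
  have hint : ∀ x : ℝ, (x = -1 / 4 ∨ x = 1 / 2) → ∀ y : ℝ, 0 < y → Integrable fun t : ℝ =>
      (a (x + t * I) * sinD l p (x + t * I)) *
        (y : ℂ) ^ (-(l + (x + t * I)) : ℂ) / (x + t * I - ν₀) := by
    intro x hx y hy
    have hx' : -1 / 4 ≤ x ∧ x ≤ 1 / 2 ∧ x ≠ ν₀.re := by
      rcases hx with rfl | rfl
      · exact ⟨le_rfl, by norm_num, by linarith [h1] |> fun h : (-1 / 4 : ℝ) < ν₀.re => h.ne⟩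
      · exact ⟨by norm_num, le_rfl, hν₀.ne'⟩
    have := (((hLy y hy).mono hx'.1 hx'.2.1).mul (tempered_inv (w := ν₀) (d := |x - ν₀.re|)
      (abs_pos.2 (sub_ne_zero.2 hx'.2.2)) (fun x' k1 k2 => by rw [le_antisymm k2 k1])))
    rw [add_zero] at this
    exact this.integrable le_rfl le_rfl
  obtain ⟨C, hC, hb⟩ := jP_sub_le hG (c := 1 / 2) (θ := 3 / 4) (by norm_num) (by norm_num)
    (by norm_num) l p hm (fun y hy => by
      simp_rw [eG]; exact hint (1 / 2) (Or.inr rfl) y hy)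
  obtain ⟨C', hC', hb'⟩ := hL.bound
  set d := ν₀.re + 1 / 4 with hd
  have hd0 : 0 < d := by linarith
  refine ⟨C + ∫ t : ℝ, C' * (1 + t ^ 2)⁻¹ / d,
    add_nonneg hC (integral_nonneg fun t => by positivity), fun y hy => ?_⟩
  have hleft : ‖∫ t : ℝ, (a (((-1 / 4 : ℝ) : ℂ) + t * I) *
      sinD l p (((-1 / 4 : ℝ) : ℂ) + t * I)) *
        (y : ℂ) ^ (-(l + (((-1 / 4 : ℝ) : ℂ) + t * I)) : ℂ) /
          (((-1 / 4 : ℝ) : ℂ) + t * I - ν₀)‖ ≤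
      (∫ t : ℝ, C' * (1 + t ^ 2)⁻¹ / d) * y ^ (-(l : ℝ) + 1 / 4) := by
    rw [← integral_mul_const]
    refine norm_integral_le_of_norm_le
      (((integrable_inv_one_add_sq.const_mul _).div_const _).mul_const _)
      (Eventually.of_forall fun t => ?_)
    have k1 := hb' (((-1 / 4 : ℝ) : ℂ) + t * I) (by rw [line_re])
      (by rw [line_re]; norm_num)
    rw [line_im] at k1
    have k2 : d ≤ ‖((-1 / 4 : ℝ) : ℂ) + t * I - ν₀‖ := by
      refine le_trans ?_ (abs_re_le_norm _)
      rw [sub_re, line_re, abs_of_neg (by linarith)]; linarith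
    have k3 : ‖(y : ℂ) ^ (-(l + (((-1 / 4 : ℝ) : ℂ) + t * I)) : ℂ)‖ =
        y ^ (-(l : ℝ) + 1 / 4) := by
      rw [norm_ofReal_cpow hy, neg_re, add_re, line_re, Complex.natCast_re]
      congr 1; ring
    rw [norm_div, norm_mul, k3, div_mul_eq_mul_div]
    exact div_le_div₀ (by positivity) (mul_le_mul_of_nonneg_right k1 (by positivity)) hd0 k2
  have hres := (hLy y hy).integral_sub h1 hν₀
  have hmain := hb y hy
  simp_rw [eG] at hmain
  have hexp : -((l : ℝ) + 1 / 2) + 3 / 4 = -(l : ℝ) + 1 / 4 := by ring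
  rw [hexp] at hmain
  rw [add_mul]
  by_cases hmp : m = -p
  · simp only [hmp, if_true] at hmain ⊢
    rw [sub_eq_iff_eq_add] at hres
    rw [hres] at hmain
    have e4 : jP G (1 / 2) l p (-p) y -
        2 * π * (a ν₀ * sinD l p ν₀) * (y : ℂ) ^ (-(l + ν₀)) =
        (jP G (1 / 2) l p (-p) y - (2 * π * (a ν₀ * sinD l p ν₀ * (y : ℂ) ^ (-(l + ν₀))) +
          ∫ t : ℝ, (a (((-1 / 4 : ℝ) : ℂ) + t * I) *
      sinD l p (((-1 / 4 : ℝ) : ℂ) + t * I)) *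
        (y : ℂ) ^ (-(l + (((-1 / 4 : ℝ) : ℂ) + t * I)) : ℂ) /
          (((-1 / 4 : ℝ) : ℂ) + t * I - ν₀))) +
        ∫ t : ℝ, (a (((-1 / 4 : ℝ) : ℂ) + t * I) *
      sinD l p (((-1 / 4 : ℝ) : ℂ) + t * I)) *
        (y : ℂ) ^ (-(l + (((-1 / 4 : ℝ) : ℂ) + t * I)) : ℂ) /
          (((-1 / 4 : ℝ) : ℂ) + t * I - ν₀) := by ring
    rw [e4]
    exact (norm_add_le _ _).trans (add_le_add hmain hleft)
  · simp only [hmp, if_false, zero_mul] at hmain ⊢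
    exact hmain.trans (le_add_of_nonneg_right (by
      have : 0 ≤ ∫ t : ℝ, C' * (1 + t ^ 2)⁻¹ / d := integral_nonneg fun t => by positivity
      positivity))

/-- Packets with holomorphic weight are small at `0`. -/
theorem jP_asymptotics {a : ℂ → ℂ} (ha : Rapid (-1 / 4) (1 / 2) (-π / 2) a) (l : ℕ) (p : ℤ)
    {m : ℤ} (hm : |m| ≤ (l : ℤ)) : ∃ C : ℝ, 0 ≤ C ∧ ∀ y : ℝ, 0 < y →
      ‖jP (fun t : ℝ => a (((1 / 2 : ℝ) : ℂ) + t * I) *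
        sinW p (((1 / 2 : ℝ) : ℂ) + t * I)) (1 / 2) l p m y‖ ≤
          C * y ^ (-(l : ℝ) + 1 / 4) := by
  have ha' := ha.mul (tempered_linear (-1 / 4) (1 / 2) 1 (1 / 8))
  rw [add_zero] at ha'
  obtain ⟨-, C, hC, h⟩ := jP_pole_asymptotics ha' (ν₀ := -1 / 8) (by norm_num) (by norm_num) l p hm
  refine ⟨C, hC, fun y hy => ?_⟩
  have := h y hy
  have e1 : (1 * (-1 / 8 : ℂ) + 1 / 8) = 0 := by norm_num
  rw [e1] at this
  simp only [mul_zero, zero_mul, ite_self, sub_zero] at this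
  convert this using 4 with t
  have hne := half_line_ne_zero t (w := -1 / 8) (by norm_num)
  rw [eq_div_iff hne]; ring

/-! ### The components of the inverse transform -/

/-- The radial components of the inverse transform, up to normalization. -/
def gM (l : ℕ) (q : ℤ) (η : ℂ → ℤ → ℂ) (m : ℤ) (y : ℝ) : ℂ :=
  ∑ p ∈ Finset.Icc (-(l : ℤ)) l, (normPhi l p q : ℂ)⁻¹ * (I *
    jP (fun t : ℝ => η (((0 : ℝ) : ℂ) + t * I) p *
      sinW p (((0 : ℝ) : ℂ) + t * I)) 0 l p m y)

/-- The components of the inverse transform. -/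
def cM (l : ℕ) (q : ℤ) (ω : ℂ) (η : ℂ → ℤ → ℂ) (m : ℤ) (h : ℝ) : ℂ :=
  1 / (2 * (π : ℂ) ^ 3 * I) * (π * ((π * ‖ω‖ : ℝ) : ℂ) ^ l *
    (h : ℂ) ^ (l + 1) * (-I * conj (unitPart ω)) ^ ((l : ℤ) + m) *
      (-I * unitPart ω) ^ l) * gM l q η m (π * ‖ω‖ * h)

theorem Rapid.packet_sinW {x₁ x₂ x : ℝ} {a : ℂ → ℂ} (ha : Rapid x₁ x₂ (-π / 2) a) (p : ℤ)
    (h1 : x₁ ≤ x) (h2 : x ≤ x₂) :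
    PacketWeight fun t : ℝ => a (x + t * I) * sinW p (x + t * I) := by
  have hw := ha.mul (tempered_sinW x₁ x₂ p)
  rw [show -π / 2 + π = π / 2 by ring] at hw
  exact hw.packet h1 h2

theorem jP_shift {x₁ x₂ : ℝ} {a : ℂ → ℂ} (ha : Rapid x₁ x₂ (-π / 2) a) (hx : x₁ ≤ x₂) (l : ℕ)
    (p m : ℤ) {y : ℝ} (hy : 0 < y) :
    jP (fun t : ℝ => a (x₁ + t * I) * sinW p (x₁ + t * I)) x₁ l p m y =
      jP (fun t : ℝ => a (x₂ + t * I) * sinW p (x₂ + t * I)) x₂ l p m y := by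
  have hw := (ha.mul (tempered_sinW x₁ x₂ p)).mul (tempered_jB x₁ x₂ l p m hy)
  rw [show -π / 2 + π + -π / 2 = 0 by ring] at hw
  exact hw.integral_eq hx

section

variable {l : ℕ} {q : ℤ} {η : ℂ → ℤ → ℂ} {σ : ℝ}

/-- By the functional equation, an odd factor does not contribute. -/
theorem sum_odd_eq_zero (hq : |q| ≤ (l : ℤ)) (hσ : 0 < σ)
    (h₃ : EvenFamily l σ η)
    {m : ℤ} (hm : |m| ≤ (l : ℤ)) (y : ℝ) :
    ∑ p ∈ Finset.Icc (-(l : ℤ)) l, (normPhi l p q : ℂ)⁻¹ * (I *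
      jP (fun t : ℝ => η (((0 : ℝ) : ℂ) + t * I) p * (((0 : ℝ) : ℂ) + t * I) *
        sinW p (((0 : ℝ) : ℂ) + t * I)) 0 l p m y) = 0 := by
  set f : ℤ → ℂ := fun p => (normPhi l p q : ℂ)⁻¹ * (I *
      jP (fun t : ℝ => η (((0 : ℝ) : ℂ) + t * I) p * (((0 : ℝ) : ℂ) + t * I) *
        sinW p (((0 : ℝ) : ℂ) + t * I)) 0 l p m y) with hf
  have hneg : ∀ p ∈ Finset.Icc (-(l : ℤ)) l, f (-p) = -f p := by
    intro p hp
    have hp' := mem_Icc_iff_abs.1 hp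
    simp only [hf]
    rw [normPhi_neg hp' hq, ← mul_neg, ← mul_neg]
    congr 2
    rw [jP, jP, ← integral_neg_eq_self, ← integral_neg]
    congr 1; ext t
    have e : ((0 : ℝ) : ℂ) + ((-t : ℝ) : ℂ) * I = -(((0 : ℝ) : ℂ) + t * I) := by
      push_cast; ring
    rw [e, sinW_neg, jB_neg l p hm, ← h₃ p hp' _ (by rw [line_re]; simpa using hσ.le)]
    ring
  have h2 : ∑ p ∈ Finset.Icc (-(l : ℤ)) l, f p = ∑ p ∈ Finset.Icc (-(l : ℤ)) l, f (-p) := by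
    refine Finset.sum_nbij' (fun p => -p) (fun p => -p) ?_ ?_ ?_ ?_ ?_
    · intro p hp; rw [Finset.mem_Icc] at hp ⊢; omega
    · intro p hp; rw [Finset.mem_Icc] at hp ⊢; omega
    · intro p _; exact neg_neg p
    · intro p _; exact neg_neg p
    · intro p _; rw [neg_neg]
  rw [Finset.sum_congr rfl hneg, Finset.sum_neg_distrib] at h2
  exact self_eq_neg.1 h2

theorem Rapid.mul_linear {a : ℂ → ℂ} {x₁ x₂ c : ℝ} (ha : Rapid x₁ x₂ c a) (u v : ℂ) :
    Rapid x₁ x₂ c fun z => a z * (u * z + v) := by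
  have := ha.mul (tempered_linear x₁ x₂ u v)
  rwa [add_zero] at this

theorem gM_eq (hq : |q| ≤ (l : ℤ)) (hσ : 1 / 2 ≤ σ)
    (hη : RapidFamily l σ η)
    (h₃ : EvenFamily l σ η)
    {m : ℤ} (hm : |m| ≤ (l : ℤ)) (u : ℂ) {y : ℝ} (hy : 0 < y) :
    gM l q η m y = ∑ p ∈ Finset.Icc (-(l : ℤ)) l, (normPhi l p q : ℂ)⁻¹ * (I *
      jP (fun t : ℝ => η (((1 / 2 : ℝ) : ℂ) + t * I) p *
        (u * (((1 / 2 : ℝ) : ℂ) + t * I) + 1) *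
        sinW p (((1 / 2 : ℝ) : ℂ) + t * I)) (1 / 2) l p m y) := by
  have h0 := sum_odd_eq_zero hq (by linarith) h₃ hm y
  have e : gM l q η m y = gM l q η m y + u * 0 := by ring
  rw [e, ← h0, gM, Finset.mul_sum, ← Finset.sum_add_distrib]
  refine Finset.sum_congr rfl fun p hp => ?_
  have ha := hη p (mem_Icc_iff_abs.1 hp)
  have ha' := (ha.mul_linear u 1).mono (y₁ := 0) (y₂ := 1 / 2) (by linarith) hσ
  rw [← jP_shift ha' (by norm_num) l p m hy]
  have i1 := jB_integrable (ha.packet_sinW p (x := 0) (by linarith) (by linarith)) 0 l p m hy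
  have ha2 := ha.mul_linear 1 0
  simp only [one_mul, add_zero] at ha2
  have i2 := jB_integrable (ha2.packet_sinW p (x := 0) (by linarith) (by linarith)) 0 l p m hy
  have key : jP (fun t : ℝ => η (((0 : ℝ) : ℂ) + t * I) p *
        (u * (((0 : ℝ) : ℂ) + t * I) + 1) *
        sinW p (((0 : ℝ) : ℂ) + t * I)) 0 l p m y =
      jP (fun t : ℝ => η (((0 : ℝ) : ℂ) + t * I) p *
        sinW p (((0 : ℝ) : ℂ) + t * I)) 0 l p m y +
      u * jP (fun t : ℝ => η (((0 : ℝ) : ℂ) + t * I) p * (((0 : ℝ) : ℂ) + t * I) *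
        sinW p (((0 : ℝ) : ℂ) + t * I)) 0 l p m y := by
    rw [jP, jP, jP, ← integral_const_mul, ← integral_add i1 (i2.const_mul u)]
    congr 1; ext t; ring
  rw [key]; ring

theorem exists_sum_bound {ι : Type*} (s : Finset ι) {f : ι → ℝ → ℂ} {S : Set ℝ} {d : ℝ}
    (h : ∀ i ∈ s, ∃ C : ℝ, 0 ≤ C ∧ ∀ y ∈ S, ‖f i y‖ ≤ C * y ^ d) (c : ι → ℂ) :
    ∃ C : ℝ, 0 ≤ C ∧ ∀ y ∈ S, ‖∑ i ∈ s, c i * f i y‖ ≤ C * y ^ d := by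
  choose! C hC hb using h
  refine ⟨∑ i ∈ s, ‖c i‖ * C i, Finset.sum_nonneg fun i hi => mul_nonneg (norm_nonneg _) (hC i hi),
    fun y hy => ?_⟩
  rw [Finset.sum_mul]
  refine norm_sum_le_of_le _ fun i hi => ?_
  rw [norm_mul, mul_assoc]
  exact mul_le_mul_of_nonneg_left (hb i hi y hy) (norm_nonneg _)

theorem gM_bounds (hq : |q| ≤ (l : ℤ)) (hσ : 1 / 2 ≤ σ)
    (hη : RapidFamily l σ η)
    (h₃ : EvenFamily l σ η)
    {m : ℤ} (hm : |m| ≤ (l : ℤ)) :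
    (∃ C : ℝ, 0 ≤ C ∧ ∀ y ∈ Ioi (0 : ℝ), ‖gM l q η m y‖ ≤ C * y ^ (-(l : ℝ) + 1 / 4)) ∧
    ∃ C : ℝ, 0 ≤ C ∧ ∀ y ∈ Ioi (0 : ℝ), ‖gM l q η m y‖ ≤ C * y ^ (-((l : ℝ) + 1 / 2)) := by
  have ha : ∀ p : ℤ, |p| ≤ (l : ℤ) →
      Rapid (-1 / 4) (1 / 2) (-π / 2) fun z => η z p * (0 * z + 1) := fun p hp =>
    ((hη p hp).mul_linear 0 1).mono (by linarith) hσ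
  have e : ∀ y ∈ Ioi (0 : ℝ), gM l q η m y = _ := fun y hy => gM_eq hq hσ hη h₃ hm 0 hy
  simp only [← mul_assoc (_ : ℂ)⁻¹ I] at e
  constructor
  · obtain ⟨C, hC, h⟩ := exists_sum_bound (Finset.Icc (-(l : ℤ)) l) (S := Ioi 0)
      (d := -(l : ℝ) + 1 / 4) (fun p hp => jP_asymptotics (ha p (mem_Icc_iff_abs.1 hp)) l p hm)
      fun p => (normPhi l p q : ℂ)⁻¹ * I
    exact ⟨C, hC, fun y hy => by rw [e y hy]; exact h y hy⟩
  · obtain ⟨C, hC, h⟩ := exists_sum_bound (Finset.Icc (-(l : ℤ)) l) (S := Ioi 0)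
      (d := -((l : ℝ) + 1 / 2)) (fun p hp => jP_norm_le ((ha p (mem_Icc_iff_abs.1 hp)).packet_sinW p
        (x := 1 / 2) (by norm_num) le_rfl) (by norm_num) l p hm)
      fun p => (normPhi l p q : ℂ)⁻¹ * I
    exact ⟨C, hC, fun y hy => by rw [e y hy]; exact h y hy⟩

theorem gM_contDiffOn (hσ : 0 ≤ σ)
    (hη : RapidFamily l σ η) (m : ℤ) :
    ContDiffOn ℝ ((⊤ : ℕ∞) : WithTop ℕ∞) (gM l q η m) (Ioi 0) := by
  unfold gM
  exact ContDiffOn.sum fun p hp => contDiffOn_const.mul (contDiffOn_const.mul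
    (jP_contDiffOn ((hη p (mem_Icc_iff_abs.1 hp)).packet_sinW p (x := 0) (by linarith) hσ) 0 l p m))

theorem norm_unitPart {ω : ℂ} (hω : ω ≠ 0) : ‖unitPart ω‖ = 1 := by
  rw [unitPart, norm_div, norm_real, norm_norm, div_self (norm_ne_zero_iff.2 hω)]

theorem neg_I_mul_unitPart_ne_zero {ω : ℂ} (hω : ω ≠ 0) : -I * unitPart ω ≠ 0 := by
  rw [← norm_ne_zero_iff, norm_mul, norm_unitPart hω]; simp

theorem norm_cM {ω : ℂ} (hω : ω ≠ 0) (m : ℤ) {h : ℝ} (hh : 0 < h) :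
    ‖cM l q ω η m h‖ = (2 * π ^ 2)⁻¹ * (π * ‖ω‖) ^ l * h ^ (l + 1) *
      ‖gM l q η m (π * ‖ω‖ * h)‖ := by
  have hp := pi_pos
  rw [cM]
  simp only [norm_mul, norm_div, norm_pow, norm_zpow, norm_neg, Complex.norm_I, RCLike.norm_conj,
    norm_unitPart hω, norm_real, one_zpow, one_pow, mul_one, norm_one, Complex.norm_ofNat,
    norm_of_nonneg hp.le, norm_of_nonneg hh.le, norm_norm]
  field_simp

theorem cM_contDiffOn {ω : ℂ} (hω : ω ≠ 0) (hσ : 0 ≤ σ)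
    (hη : RapidFamily l σ η) (m : ℤ) :
    ContDiffOn ℝ ((⊤ : ℕ∞) : WithTop ℕ∞) (cM l q ω η m) (Ioi 0) := by
  have hκ : 0 < π * ‖ω‖ := by positivity
  have ho : ContDiff ℝ ((⊤ : ℕ∞) : WithTop ℕ∞) ((↑) : ℝ → ℂ) := Complex.ofRealCLM.contDiff
  have h1 : ContDiffOn ℝ ((⊤ : ℕ∞) : WithTop ℕ∞) (fun h : ℝ => gM l q η m (π * ‖ω‖ * h))
      (Ioi 0) :=
    (gM_contDiffOn hσ hη m).comp (contDiff_const.mul contDiff_id).contDiffOn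
      fun h hh => mul_pos hκ hh
  have h2 : ContDiff ℝ ((⊤ : ℕ∞) : WithTop ℕ∞) fun h : ℝ => (h : ℂ) ^ (l + 1) := ho.pow _
  unfold cM
  exact (contDiff_const.mul (((contDiff_const.mul h2).mul contDiff_const).mul
    contDiff_const)).contDiffOn.mul h1

theorem cM_bound {ω : ℂ} (hω : ω ≠ 0) {m : ℤ} {C d : ℝ}
    (h : ∀ y ∈ Ioi (0 : ℝ), ‖gM l q η m y‖ ≤ C * y ^ (-(l : ℝ) + d)) :
    ∃ C : ℝ, ∀ r ∈ Ioi (0 : ℝ), ‖cM l q ω η m r‖ ≤ C * r ^ (1 + d) := by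
  have hκ : 0 < π * ‖ω‖ := by positivity
  refine ⟨(2 * π ^ 2)⁻¹ * (π * ‖ω‖) ^ l * (C * (π * ‖ω‖) ^ (-(l : ℝ) + d)),
    fun r (hr : 0 < r) => ?_⟩
  rw [norm_cM hω m hr]
  have h1 := h _ (mul_pos hκ hr)
  rw [Real.mul_rpow hκ.le hr.le] at h1
  have e : r ^ (1 + d) = r ^ (l + 1) * r ^ (-(l : ℝ) + d) := by
    rw [← rpow_natCast, ← rpow_add hr]; congr 1; push_cast; ring
  rw [e]
  calc _ ≤ (2 * π ^ 2)⁻¹ * (π * ‖ω‖) ^ l * r ^ (l + 1) *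
        (C * ((π * ‖ω‖) ^ (-(l : ℝ) + d) * r ^ (-(l : ℝ) + d))) := by gcongr
    _ = _ := by ring

theorem inverseIntegrand_eq (hq : |q| ≤ (l : ℤ)) {ω : ℂ} (hω : ω ≠ 0) (g : SL2) {p : ℤ}
    (hp : |p| ≤ (l : ℤ)) {t : ℝ} (ht : t ≠ 0) :
    inverseIntegrand l q ω η g p (t * I) =
      ∑ m ∈ Finset.Icc (-(l : ℤ)) l, (psi ω (zc g) * (π * ((π * ‖ω‖ : ℝ) : ℂ) ^ l *
        (height g : ℂ) ^ (l + 1) * (-I * conj (unitPart ω)) ^ ((l : ℤ) + m) *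
        (-I * unitPart ω) ^ l) * (-I * unitPart ω) ^ (-p) *
          Phi l m q (kA g) (kB g)) *
        (η (((0 : ℝ) : ℂ) + t * I) p * sinW p (((0 : ℝ) : ℂ) + t * I) *
          jB l p m (((0 : ℝ) : ℂ) + t * I) (π * ‖ω‖ * height g)) := by
  have hκ : ((π * ‖ω‖ : ℝ) : ℂ) ≠ 0 := by
    exact_mod_cast (by positivity : (0 : ℝ) < π * ‖ω‖).ne'
  have h0 : (t * I : ℂ) ≠ 0 := mul_ne_zero (by exact_mod_cast ht) Complex.I_ne_zero
  have hE := neg_I_mul_unitPart_ne_zero hω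
  have hG : Gamma (l + 1 + t * I) ≠ 0 := by
    refine Complex.Gamma_ne_zero_of_re_pos ?_
    simp only [add_re, Complex.natCast_re, Complex.one_re, Complex.mul_re,
      Complex.ofReal_re, Complex.I_re, Complex.ofReal_im, Complex.I_im]
    norm_num; positivity
  have hz : ((0 : ℝ) : ℂ) + t * I = t * I := by simp
  have hpow : ((π * ‖ω‖ : ℝ) : ℂ) ^ (-(t * I)) *
      ((π * ‖ω‖ : ℝ) : ℂ) ^ (l + t * I : ℂ) = ((π * ‖ω‖ : ℝ) : ℂ) ^ l := by
    rw [← cpow_add _ _ hκ, ← Complex.cpow_natCast]; congr 1; ring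
  rw [inverseIntegrand, jacquet_eq hp hq hω, hz, sinW_eq p h0, Finset.mul_sum, Finset.mul_sum,
    Finset.sum_mul, Finset.sum_mul]
  refine Finset.sum_congr rfl fun m _ => ?_
  have hE' : (-I * unitPart ω) ^ ((l : ℤ) - p) =
      (-I * unitPart ω) ^ l * (-I * unitPart ω) ^ (-p) := by
    rw [sub_eq_add_neg, zpow_add₀ hE, zpow_natCast]
  rw [jacW, hE', ← hpow]
  have hGG := mul_inv_cancel₀ hG
  generalize (Gamma (l + 1 + t * I))⁻¹ = G' at hGG ⊢
  generalize Gamma (l + 1 + t * I) = G at hGG ⊢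
  generalize jB l p m (t * I) (π * ‖ω‖ * height g) = J
  generalize (-I * conj (unitPart ω)) ^ ((l : ℤ) + m) = b
  generalize (-I * unitPart ω) ^ l = e₁
  generalize (-I * unitPart ω) ^ (-p) = e₂
  generalize ((π * ‖ω‖ : ℝ) : ℂ) ^ (-(t * I)) = k₁
  generalize ((π * ‖ω‖ : ℝ) : ℂ) ^ (l + t * I : ℂ) = k₂
  generalize (t * I : ℂ) ^ eps p = x
  generalize Complex.sin (π * (t * I)) = s
  generalize η (t * I) p = n
  linear_combination (n * k₁ * psi ω (zc g) * (π * k₂ * (height g : ℂ) ^ (l + 1) * b * e₁ *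
    e₂ * J) * Phi l m q (kA g) (kB g) * x * s) * hGG

theorem inverseIntegrand_integrable (hq : |q| ≤ (l : ℤ)) {ω : ℂ} (hω : ω ≠ 0) (hσ : 0 ≤ σ)
    (hη : RapidFamily l σ η) (g : SL2) {p : ℤ}
    (hp : |p| ≤ (l : ℤ)) :
    Integrable (fun t : ℝ => inverseIntegrand l q ω η g p (t * I)) ∧
    ∫ t : ℝ, inverseIntegrand l q ω η g p (t * I) * I =
      ∑ m ∈ Finset.Icc (-(l : ℤ)) l, (psi ω (zc g) * (π * ((π * ‖ω‖ : ℝ) : ℂ) ^ l *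
        (height g : ℂ) ^ (l + 1) * (-I * conj (unitPart ω)) ^ ((l : ℤ) + m) *
        (-I * unitPart ω) ^ l) * (-I * unitPart ω) ^ (-p) *
          Phi l m q (kA g) (kB g)) * (I *
        jP (fun t : ℝ => η (((0 : ℝ) : ℂ) + t * I) p *
          sinW p (((0 : ℝ) : ℂ) + t * I)) 0 l p m (π * ‖ω‖ * height g)) := by
  have hy : 0 < π * ‖ω‖ * height g := by have := height_pos g; positivity
  have hae : ∀ᵐ t : ℝ, t ≠ 0 := by simp [ae_iff]
  have hint := fun m => jB_integrable ((hη p hp).packet_sinW p (x := 0) (by linarith) hσ) 0 l p m hy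
  have hcongr := hae.mono fun t ht => inverseIntegrand_eq (η := η) hq hω g hp ht
  have hI := integrable_finsetSum (Finset.Icc (-(l : ℤ)) l) fun m _ =>
    (hint m).const_mul (psi ω (zc g) * (π * ((π * ‖ω‖ : ℝ) : ℂ) ^ l *
        (height g : ℂ) ^ (l + 1) * (-I * conj (unitPart ω)) ^ ((l : ℤ) + m) *
        (-I * unitPart ω) ^ l) * (-I * unitPart ω) ^ (-p) *
          Phi l m q (kA g) (kB g))
  refine ⟨hI.congr (hcongr.mono fun t ht => ht.symm), ?_⟩
  rw [integral_mul_const, integral_congr_ae hcongr,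
    integral_finsetSum _ fun m _ => (hint m).const_mul _, Finset.sum_mul]
  refine Finset.sum_congr rfl fun m _ => ?_
  rw [integral_const_mul, jP]; ring

theorem inverseTransform_eq (hq : |q| ≤ (l : ℤ)) {ω : ℂ} (hω : ω ≠ 0) (hσ : 0 ≤ σ)
    (hη : RapidFamily l σ η) :
    inverseTransform l q ω η = fK ω (cM l q ω η) l q := by
  ext g
  have hE := neg_I_mul_unitPart_ne_zero hω
  rw [inverseTransform, fK, Finset.sum_congr rfl fun p hp => by
    rw [(inverseIntegrand_integrable hq hω hσ hη g (mem_Icc_iff_abs.1 hp)).2]]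
  simp only [cM, gM, Finset.mul_sum, Finset.sum_mul]
  rw [Finset.sum_comm]
  refine Finset.sum_congr rfl fun m _ => Finset.sum_congr rfl fun p _ => ?_
  have : (-I * unitPart ω) ^ p * (-I * unitPart ω) ^ (-p) = 1 := by
    rw [← zpow_add₀ hE, add_neg_cancel, zpow_zero]
  linear_combination (1 / (2 * (π : ℂ) ^ 3 * I) * (normPhi l p q : ℂ)⁻¹ *
    (psi ω (zc g) * (π * ((π * ‖ω‖ : ℝ) : ℂ) ^ l *
        (height g : ℂ) ^ (l + 1) * (-I * conj (unitPart ω)) ^ ((l : ℤ) + m) *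
        (-I * unitPart ω) ^ l) * Phi l m q (kA g) (kB g)) * (I *
        jP (fun t : ℝ => η (((0 : ℝ) : ℂ) + t * I) p *
          sinW p (((0 : ℝ) : ℂ) + t * I)) 0 l p m (π * ‖ω‖ * height g))) * this

theorem inverseTransform_memP (hq : |q| ≤ (l : ℤ)) {ω : ℂ} (hω : ω ≠ 0) (hσ : 1 / 2 ≤ σ)
    (hη : RapidFamily l σ η)
    (h₃ : EvenFamily l σ η) :
    MemP l q ω (inverseTransform l q ω η) := by
  rw [inverseTransform_eq hq hω (by linarith) hη]
  refine fK_memP ω hq (fun m _ => cM_contDiffOn hω (by linarith) hη m) (s := 1 / 4) (t := 1 / 2)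
    (r₀ := 1) (r₁ := 1) (by norm_num) (by norm_num) one_pos one_pos (fun m hm => ?_) fun m hm => ?_
  · obtain ⟨⟨C, -, h⟩, -⟩ := gM_bounds hq hσ hη h₃ hm
    obtain ⟨C', h'⟩ := cM_bound (l := l) (q := q) (η := η) hω h
    exact ⟨C', fun r hr => h' r hr.1⟩
  · obtain ⟨-, C, -, h⟩ := gM_bounds hq hσ hη h₃ hm
    obtain ⟨C', h'⟩ := cM_bound (l := l) (q := q) (η := η) (d := -(1 / 2)) hω
      (fun y hy => by have := h y hy; rwa [neg_add] at this)
    refine ⟨C', fun r hr => ?_⟩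
    have := h' r (one_pos.trans (mem_Ioi.1 hr))
    rwa [← sub_eq_add_neg] at this

end

/-! ### Differential equations and Green's formula -/

section Landau

variable {f t₁ t₂ G fn : ℝ → ℂ} {c : ℕ} {κ : ℂ}

/-- Asymptotics at `0` of the derivative of a solution of an inhomogeneous equation. -/
theorem T1_asymptotics_zero {A μ : ℂ} {d : ℝ}
    (h1 : ∀ t : ℝ, 0 < t → HasDerivAt f ((t₁ t - c * f t) / t) t)
    (h2 : ∀ t : ℝ, 0 < t → HasDerivAt t₁ ((t₂ t - c * t₁ t) / t) t)
    (ht : ∀ t : ℝ, 0 < t → t₂ t = G t + (κ ^ 2 + 4 * t ^ 2) * f t - 4 * c * t * fn t)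
    (hf : ∃ C : ℝ, 0 ≤ C ∧ ∀ t ∈ Ioc (0 : ℝ) 3, ‖f t - A * (t : ℂ) ^ μ‖ ≤ C * t ^ d)
    (hfc : ∃ C : ℝ, 0 ≤ C ∧ ∀ t ∈ Ioc (0 : ℝ) 3, ‖f t‖ ≤ C * t ^ (d - 3 / 4))
    (hfn : ∃ C : ℝ, 0 ≤ C ∧ ∀ t ∈ Ioc (0 : ℝ) 3, ‖(c : ℂ) * fn t‖ ≤ C * t ^ (d - 3 / 4))
    (hG : ∃ C : ℝ, 0 ≤ C ∧ ∀ t ∈ Ioc (0 : ℝ) 3, ‖G t‖ ≤ C * t ^ d)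
    (hA : A * (μ + c) ^ 2 = κ ^ 2 * A) :
    ∃ C : ℝ, 0 ≤ C ∧ ∀ t ∈ Ioc (0 : ℝ) 1, ‖t₁ t - A * (μ + c) * (t : ℂ) ^ μ‖ ≤ C * t ^ d := by
  obtain ⟨C₁, hC₁, hf⟩ := hf
  obtain ⟨C₂, hC₂, hfc⟩ := hfc
  obtain ⟨C₃, hC₃, hfn⟩ := hfn
  obtain ⟨C₄, hC₄, hG⟩ := hG
  set K : ℝ := C₄ + ‖κ ^ 2‖ * C₁ + 4 * 27 * C₂ + 4 * 3 * C₃ with hK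
  have hK0 : 0 ≤ K := by positivity
  refine ⟨3 * (C₁ + K) * Real.exp (c + |d|), by positivity, fun y hy => ?_⟩
  have hsub : ∀ t ∈ Icc y (y * Real.exp 1), t ∈ Ioc (0 : ℝ) 3 := fun t ht =>
    ⟨hy.1.trans_le ht.1, ht.2.trans (by
      have := Real.exp_one_lt_d9; nlinarith [hy.2, hy.1, Real.exp_pos 1])⟩
  refine norm_T1_sub_le hy.1 h1 h2 (fun t hty => ?_) (fun t hty => ?_)
  · have h0 := hsub t hty
    have := rpow_nonneg h0.1.le d
    exact (hf t h0).trans (mul_le_mul_of_nonneg_right (le_add_of_nonneg_right hK0) this)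
  · have h0 := hsub t hty
    have h0p := h0.1
    have e1 : t₂ t - A * (μ + c) ^ 2 * (t : ℂ) ^ μ = G t + κ ^ 2 * (f t - A * (t : ℂ) ^ μ) +
        4 * (t : ℂ) ^ 2 * f t - 4 * t * (c * fn t) := by
      rw [ht t h0p, hA]; ring
    have hpow : t ^ (d - 3 / 4) * t ≤ 3 * t ^ d := by
      have e : t ^ (d - 3 / 4) * t = t ^ d * t ^ (1 / 4 : ℝ) := by
        nth_rewrite 2 [← Real.rpow_one t]
        rw [← rpow_add h0p, ← rpow_add h0p]; congr 1; ring
      have : t ^ (1 / 4 : ℝ) ≤ 3 := by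
        calc t ^ (1 / 4 : ℝ) ≤ 3 ^ (1 / 4 : ℝ) := Real.rpow_le_rpow h0p.le h0.2 (by norm_num)
          _ ≤ 3 ^ (1 : ℝ) := Real.rpow_le_rpow_of_exponent_le (by norm_num) (by norm_num)
          _ = 3 := Real.rpow_one 3
      rw [e]; nlinarith [rpow_nonneg h0p.le d]
    have hd0 := rpow_nonneg h0p.le d
    have n1 : ‖κ ^ 2 * (f t - A * (t : ℂ) ^ μ)‖ ≤ ‖κ ^ 2‖ * C₁ * t ^ d := by
      rw [norm_mul, mul_assoc]; exact mul_le_mul_of_nonneg_left (hf t h0) (norm_nonneg _)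
    have n2 : ‖4 * (t : ℂ) ^ 2 * f t‖ ≤ 4 * 27 * C₂ * t ^ d := by
      rw [norm_mul, norm_mul, norm_pow, norm_real, norm_of_nonneg h0p.le,
        Complex.norm_ofNat]
      calc 4 * t ^ 2 * ‖f t‖ ≤ 4 * t ^ 2 * (C₂ * t ^ (d - 3 / 4)) :=
            mul_le_mul_of_nonneg_left (hfc t h0) (by positivity)
        _ = 4 * C₂ * t * (t ^ (d - 3 / 4) * t) := by ring
        _ ≤ 4 * C₂ * 3 * (3 * t ^ d) := by gcongr; exact h0.2
        _ ≤ _ := by nlinarith [mul_nonneg hC₂ hd0]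
    have n3 : ‖4 * (t : ℂ) * (c * fn t)‖ ≤ 4 * 3 * C₃ * t ^ d := by
      rw [norm_mul, norm_mul, norm_real, norm_of_nonneg h0p.le, Complex.norm_ofNat]
      calc 4 * t * ‖(c : ℂ) * fn t‖ ≤ 4 * t * (C₃ * t ^ (d - 3 / 4)) :=
            mul_le_mul_of_nonneg_left (hfn t h0) (by positivity)
        _ = 4 * C₃ * (t ^ (d - 3 / 4) * t) := by ring
        _ ≤ 4 * C₃ * (3 * t ^ d) := by gcongr
        _ = _ := by ring
    rw [e1]
    have nG := hG t h0
    calc _ ≤ ‖G t‖ + ‖κ ^ 2 * (f t - A * (t : ℂ) ^ μ)‖ + ‖4 * (t : ℂ) ^ 2 * f t‖ +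
          ‖4 * (t : ℂ) * (c * fn t)‖ := (norm_sub_le _ _).trans (add_le_add
            ((norm_add_le _ _).trans (add_le_add (norm_add_le _ _) le_rfl)) le_rfl)
      _ ≤ C₁ * t ^ d + (C₄ * t ^ d + ‖κ ^ 2‖ * C₁ * t ^ d + 4 * 27 * C₂ * t ^ d +
          4 * 3 * C₃ * t ^ d) := by linarith [mul_nonneg hC₁ hd0]
      _ = _ := by rw [hK]; ring

/-- Polynomial bounds at `∞` for the derivative of a solution of an inhomogeneous equation. -/
theorem T1_bound_infty {d : ℝ}
    (h1 : ∀ t : ℝ, 0 < t → HasDerivAt f ((t₁ t - c * f t) / t) t)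
    (h2 : ∀ t : ℝ, 0 < t → HasDerivAt t₁ ((t₂ t - c * t₁ t) / t) t)
    (ht : ∀ t : ℝ, 0 < t → t₂ t = G t + (κ ^ 2 + 4 * t ^ 2) * f t - 4 * c * t * fn t)
    (hf : ∃ C : ℝ, 0 ≤ C ∧ ∀ t ∈ Ici (1 : ℝ), ‖f t‖ ≤ C * t ^ (d - 2))
    (hfn : ∃ C : ℝ, 0 ≤ C ∧ ∀ t ∈ Ici (1 : ℝ), ‖(c : ℂ) * fn t‖ ≤ C * t ^ (d - 2))
    (hG : ∃ C : ℝ, 0 ≤ C ∧ ∀ t ∈ Ici (1 : ℝ), ‖G t‖ ≤ C * t ^ d) :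
    ∃ C : ℝ, 0 ≤ C ∧ ∀ t ∈ Ici (1 : ℝ), ‖t₁ t‖ ≤ C * t ^ d := by
  obtain ⟨C₁, hC₁, hf⟩ := hf
  obtain ⟨C₃, hC₃, hfn⟩ := hfn
  obtain ⟨C₄, hC₄, hG⟩ := hG
  set K : ℝ := C₄ + ‖κ ^ 2‖ * C₁ + 4 * C₁ + 4 * C₃ with hK
  have hK0 : 0 ≤ K := by positivity
  refine ⟨3 * (C₁ + K) * Real.exp (c + |d|), by positivity, fun y (hy : 1 ≤ y) => ?_⟩
  have key : ∀ t : ℝ, 1 ≤ t → t ^ (d - 2) * t ^ 2 = t ^ d ∧ t ^ (d - 2) ≤ t ^ d ∧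
      t * t ^ (d - 2) ≤ t ^ d := fun t h => by
    have hpos : 0 < t := by linarith
    have e : t ^ (d - 2) * t ^ 2 = t ^ d := by
      rw [← rpow_natCast, ← rpow_add hpos]; congr 1; push_cast; ring
    have h0 := rpow_nonneg hpos.le (d - 2)
    refine ⟨e, ?_, ?_⟩
    · exact Real.rpow_le_rpow_of_exponent_le h (by linarith)
    · rw [← e, mul_comm]; exact mul_le_mul_of_nonneg_left (by nlinarith : t ≤ t ^ 2) h0
  refine norm_T1_le (by linarith) h1 h2 (fun t hty => ?_) (fun t hty => ?_)
  · have h0 : 1 ≤ t := hy.trans hty.1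
    obtain ⟨-, k2, -⟩ := key t h0
    have := rpow_nonneg (by linarith : 0 ≤ t) d
    calc ‖f t‖ ≤ C₁ * t ^ (d - 2) := hf t h0
      _ ≤ C₁ * t ^ d := by gcongr
      _ ≤ _ := mul_le_mul_of_nonneg_right (le_add_of_nonneg_right hK0) this
  · have h0 : 1 ≤ t := hy.trans hty.1
    have hpos : 0 < t := by linarith
    obtain ⟨k1, k2, k3⟩ := key t h0
    have hd0 := rpow_nonneg hpos.le d
    have e1 : t₂ t = G t + κ ^ 2 * f t + 4 * (t : ℂ) ^ 2 * f t - 4 * t * (c * fn t) := by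
      rw [ht t hpos]; ring
    have n1 : ‖κ ^ 2 * f t‖ ≤ ‖κ ^ 2‖ * C₁ * t ^ d := by
      rw [norm_mul, mul_assoc]
      exact mul_le_mul_of_nonneg_left ((hf t h0).trans (by gcongr)) (norm_nonneg _)
    have n2 : ‖4 * (t : ℂ) ^ 2 * f t‖ ≤ 4 * C₁ * t ^ d := by
      rw [norm_mul, norm_mul, norm_pow, norm_real, norm_of_nonneg hpos.le,
        Complex.norm_ofNat, ← k1]
      calc 4 * t ^ 2 * ‖f t‖ ≤ 4 * t ^ 2 * (C₁ * t ^ (d - 2)) :=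
            mul_le_mul_of_nonneg_left (hf t h0) (by positivity)
        _ = _ := by ring
    have n3 : ‖4 * (t : ℂ) * (c * fn t)‖ ≤ 4 * C₃ * t ^ d := by
      rw [norm_mul, norm_mul, norm_real, norm_of_nonneg hpos.le, Complex.norm_ofNat]
      calc 4 * t * ‖(c : ℂ) * fn t‖ ≤ 4 * t * (C₃ * t ^ (d - 2)) :=
            mul_le_mul_of_nonneg_left (hfn t h0) (by positivity)
        _ = 4 * C₃ * (t * t ^ (d - 2)) := by ring
        _ ≤ _ := by gcongr
    have nG := hG t h0
    rw [e1]
    calc _ ≤ ‖G t‖ + ‖κ ^ 2 * f t‖ + ‖4 * (t : ℂ) ^ 2 * f t‖ + ‖4 * (t : ℂ) * (c * fn t)‖ :=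
          (norm_sub_le _ _).trans (add_le_add
            ((norm_add_le _ _).trans (add_le_add (norm_add_le _ _) le_rfl)) le_rfl)
      _ ≤ C₁ * t ^ d + (C₄ * t ^ d + ‖κ ^ 2‖ * C₁ * t ^ d + 4 * C₁ * t ^ d +
          4 * C₃ * t ^ d) := by linarith [mul_nonneg hC₁ hd0]
      _ = _ := by rw [hK]; ring

end Landau

theorem tendsto_mul_rpow_nhdsGT (C : ℝ) {e : ℝ} (he : 0 < e) :
    Tendsto (fun y : ℝ => C * y ^ e) (𝓝[>] 0) (𝓝 0) := by
  have := ((Real.continuousAt_rpow_const 0 e (Or.inr he.le)).tendsto.mono_left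
    (nhdsWithin_le_nhds (s := Ioi 0))).const_mul C
  rwa [Real.zero_rpow he.ne', mul_zero] at this

/-- The constant term of a product of two functions of opposite leading exponents. -/
theorem tendsto_mul_zero {l : ℕ} {f a : ℝ → ℂ} {A D μ μ' : ℂ} {τ C C' : ℝ} (hτ : 0 < τ)
    (hτ' : τ < 1 / 4) (hμ : μ.re = -(l : ℝ) + τ) (hμ' : μ'.re = -(l : ℝ) - τ)
    (hsum : μ + μ' = -((2 * l : ℕ) : ℂ))
    (hf : ∀ t ∈ Ioc (0 : ℝ) 1, ‖f t - A * (t : ℂ) ^ μ‖ ≤ C * t ^ (-(l : ℝ) + 1 / 4))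
    (ha : ∀ t ∈ Ioc (0 : ℝ) 1, ‖a t - D * (t : ℂ) ^ μ'‖ ≤ C' * t ^ (-(l : ℝ))) :
    Tendsto (fun y : ℝ => (y : ℂ) ^ (2 * l) * (f y * a y)) (𝓝[>] 0) (𝓝 (A * D)) := by
  rw [tendsto_iff_norm_sub_tendsto_zero]
  have hlim := (tendsto_mul_rpow_nhdsGT (C * (|C'| + ‖D‖)) (by linarith : 0 < 1 / 4 - τ)).add
    (tendsto_mul_rpow_nhdsGT (‖A‖ * C') hτ)
  rw [add_zero] at hlim
  refine squeeze_zero' (Eventually.of_forall fun y => norm_nonneg _) ?_ hlim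
  filter_upwards [Ioc_mem_nhdsGT one_pos] with y hy
  have hy0 := hy.1
  have hyC : (y : ℂ) ≠ 0 := by exact_mod_cast hy0.ne'
  have e1 : (y : ℂ) ^ μ * (y : ℂ) ^ μ' * (y : ℂ) ^ (2 * l) = 1 := by
    rw [← cpow_add _ _ hyC, hsum, Complex.cpow_neg, Complex.cpow_natCast,
      inv_mul_cancel₀ (pow_ne_zero _ hyC)]
  have e : (y : ℂ) ^ (2 * l) * (f y * a y) - A * D = (y : ℂ) ^ (2 * l) *
      ((f y - A * (y : ℂ) ^ μ) * a y) + (y : ℂ) ^ (2 * l) * (A * (y : ℂ) ^ μ *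
        (a y - D * (y : ℂ) ^ μ')) := by
    linear_combination (A * D) * e1
  have hna : ‖a y‖ ≤ (|C'| + ‖D‖) * y ^ (-(l : ℝ) - τ) := by
    have h1 : ‖a y‖ ≤ ‖a y - D * (y : ℂ) ^ μ'‖ + ‖D * (y : ℂ) ^ μ'‖ := by
      simpa using norm_add_le (a y - D * (y : ℂ) ^ μ') (D * (y : ℂ) ^ μ')
    rw [norm_mul, norm_ofReal_cpow hy0, hμ'] at h1
    have h2 : y ^ (-(l : ℝ)) ≤ y ^ (-(l : ℝ) - τ) :=
      Real.rpow_le_rpow_of_exponent_ge hy0 hy.2 (by linarith)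
    have h3 : C' * y ^ (-(l : ℝ)) ≤ |C'| * y ^ (-(l : ℝ) - τ) := by
      have := rpow_nonneg hy0.le (-(l : ℝ))
      exact mul_le_mul (le_abs_self _) h2 this (abs_nonneg _)
    rw [add_mul]
    linarith [ha y hy]
  have hp : ∀ u v : ℝ, y ^ (2 * l) * (y ^ u * y ^ v) = y ^ (2 * l + u + v) := fun u v => by
    rw [← rpow_natCast, ← rpow_add hy0, ← rpow_add hy0]; congr 1; push_cast; ring
  rw [e]
  refine (norm_add_le _ _).trans (add_le_add ?_ ?_)
  · rw [norm_mul, norm_mul, norm_pow, norm_real, norm_of_nonneg hy0.le]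
    calc _ ≤ y ^ (2 * l) * ((C * y ^ (-(l : ℝ) + 1 / 4)) *
          ((|C'| + ‖D‖) * y ^ (-(l : ℝ) - τ))) := by
          refine mul_le_mul_of_nonneg_left (mul_le_mul (hf y hy) hna (norm_nonneg _)
            ((norm_nonneg _).trans (hf y hy))) (by positivity)
      _ = C * (|C'| + ‖D‖) * (y ^ (2 * l) * (y ^ (-(l : ℝ) + 1 / 4) * y ^ (-(l : ℝ) - τ))) := by ring
      _ = _ := by rw [hp]; congr 2; ring
  · rw [norm_mul, norm_mul, norm_mul, norm_pow, norm_real, norm_of_nonneg hy0.le,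
      norm_ofReal_cpow hy0, hμ]
    calc _ ≤ y ^ (2 * l) * (‖A‖ * y ^ (-(l : ℝ) + τ) * (C' * y ^ (-(l : ℝ)))) :=
          mul_le_mul_of_nonneg_left (mul_le_mul_of_nonneg_left (ha y hy) (by positivity))
            (by positivity)
      _ = ‖A‖ * C' * (y ^ (2 * l) * (y ^ (-(l : ℝ) + τ) * y ^ (-(l : ℝ)))) := by ring
      _ = _ := by rw [hp]; congr 2; ring

theorem tendsto_mul_infty {l : ℕ} {f a : ℝ → ℂ} {C C' : ℝ}
    (hf : ∀ t ∈ Ici (1 : ℝ), ‖f t‖ ≤ C * t ^ (-(l : ℝ) + 3 / 2))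
    (ha : ∀ t ∈ Ici (1 : ℝ), ‖a t‖ ≤ C' * t ^ (-((l : ℝ) + 3))) :
    Tendsto (fun y : ℝ => (y : ℂ) ^ (2 * l) * (f y * a y)) atTop (𝓝 0) := by
  rw [tendsto_zero_iff_norm_tendsto_zero]
  have hlim := (tendsto_rpow_neg_atTop (by norm_num : (0 : ℝ) < 3 / 2)).const_mul (C * C')
  rw [mul_zero] at hlim
  refine squeeze_zero' (Eventually.of_forall fun y => norm_nonneg _) ?_ hlim
  filter_upwards [eventually_ge_atTop (1 : ℝ)] with y hy
  have hy0 : 0 < y := by linarith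
  rw [norm_mul, norm_mul, norm_pow, norm_real, norm_of_nonneg hy0.le]
  calc _ ≤ y ^ (2 * l) * ((C * y ^ (-(l : ℝ) + 3 / 2)) * (C' * y ^ (-((l : ℝ) + 3)))) :=
        mul_le_mul_of_nonneg_left (mul_le_mul (hf y hy) (ha y hy) (norm_nonneg _)
          ((norm_nonneg _).trans (hf y hy))) (by positivity)
    _ = C * C' * (y ^ (2 * l) * (y ^ (-(l : ℝ) + 3 / 2) * y ^ (-((l : ℝ) + 3)))) := by ring
    _ = _ := by
        rw [← rpow_natCast, ← rpow_add hy0, ← rpow_add hy0]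
        congr 2; push_cast; ring

/-- Shifting the summation index in the coupling terms. -/
theorem sum_coupling {l : ℕ} {T U : ℤ → ℂ} (h : ∀ m : ℤ, T m = U (m + 1)) (h1 : U (l + 1) = 0)
    (h2 : U (-l) = 0) : ∑ m ∈ Finset.Icc (-(l : ℤ)) l, T m = ∑ m ∈ Finset.Icc (-(l : ℤ)) l, U m := by
  rw [sum_Icc_eq_sum_range, sum_Icc_eq_sum_range, Finset.sum_range_succ', Finset.sum_range_succ]
  have e : (l : ℤ) - (2 * l : ℕ) = -l := by push_cast; ring
  rw [e, h2, h, Nat.cast_zero, sub_zero, h1, add_zero, add_zero]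
  refine Finset.sum_congr rfl fun k _ => ?_
  rw [h]; congr 1; push_cast; ring

/-- Green's formula on `(0, ∞)`. -/
theorem green {l : ℕ} {N : ℤ → ℝ} (hN : ∀ m : ℤ, ((l : ℝ) - m) * N m = ((l : ℝ) + m + 1) * N (m + 1))
    {f f₁ f₂ a a₁ a₂ G : ℤ → ℝ → ℂ} {κ : ℂ} {L : ℂ}
    (hf : ∀ m : ℤ, |m| ≤ (l : ℤ) → ∀ t : ℝ, 0 < t →
      HasDerivAt (f m) ((f₁ m t - ((l : ℂ) - m) * f m t) / t) t)
    (hf₁ : ∀ m : ℤ, |m| ≤ (l : ℤ) → ∀ t : ℝ, 0 < t →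
      HasDerivAt (f₁ m) ((f₂ m t - ((l : ℂ) - m) * f₁ m t) / t) t)
    (hf₂ : ∀ m : ℤ, |m| ≤ (l : ℤ) → ∀ t : ℝ, 0 < t →
      f₂ m t = G m t + (κ ^ 2 + 4 * t ^ 2) * f m t - 4 * ((l : ℂ) - m) * t * f (m + 1) t)
    (ha : ∀ m : ℤ, |m| ≤ (l : ℤ) → ∀ t : ℝ, 0 < t →
      HasDerivAt (a m) ((a₁ m t - ((l : ℂ) + m) * a m t) / t) t)
    (ha₁ : ∀ m : ℤ, |m| ≤ (l : ℤ) → ∀ t : ℝ, 0 < t →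
      HasDerivAt (a₁ m) ((a₂ m t - ((l : ℂ) + m) * a₁ m t) / t) t)
    (ha₂ : ∀ m : ℤ, |m| ≤ (l : ℤ) → ∀ t : ℝ, 0 < t →
      a₂ m t = (κ ^ 2 + 4 * t ^ 2) * a m t - 4 * ((l : ℂ) + m) * t * a (m - 1) t)
    (hint : ∀ m : ℤ, |m| ≤ (l : ℤ) →
      IntegrableOn (fun t : ℝ => (t : ℂ) ^ (2 * l) / t * (G m t * a m t)) (Ioi 0))
    (h0 : Tendsto (fun t : ℝ => ∑ m ∈ Finset.Icc (-(l : ℤ)) l, (N m : ℂ) *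
      ((t : ℂ) ^ (2 * l) * (f₁ m t * a m t) - (t : ℂ) ^ (2 * l) * (f m t * a₁ m t)))
        (𝓝[>] 0) (𝓝 L))
    (htop : Tendsto (fun t : ℝ => ∑ m ∈ Finset.Icc (-(l : ℤ)) l, (N m : ℂ) *
      ((t : ℂ) ^ (2 * l) * (f₁ m t * a m t) - (t : ℂ) ^ (2 * l) * (f m t * a₁ m t)))
        atTop (𝓝 0)) :
    ∑ m ∈ Finset.Icc (-(l : ℤ)) l, (N m : ℂ) *
      ∫ t in Ioi (0 : ℝ), (t : ℂ) ^ (2 * l) / t * (G m t * a m t) = -L := by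
  set Bf : ℝ → ℂ := fun t => ∑ m ∈ Finset.Icc (-(l : ℤ)) l, (N m : ℂ) *
      ((t : ℂ) ^ (2 * l) * (f₁ m t * a m t) - (t : ℂ) ^ (2 * l) * (f m t * a₁ m t)) with hB
  have hd : ∀ t ∈ Ioi (0 : ℝ), HasDerivAt Bf (∑ m ∈ Finset.Icc (-(l : ℤ)) l, (N m : ℂ) *
      ((t : ℂ) ^ (2 * l) / t * (G m t * a m t))) t := by
    intro t (ht : 0 < t)
    have htC : (t : ℂ) ≠ 0 := by exact_mod_cast ht.ne'
    have hp : HasDerivAt (fun t : ℝ => (t : ℂ) ^ (2 * l)) (2 * l * ((t : ℂ) ^ (2 * l) / t)) t := by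
      refine ((hasDerivAt_ofReal t).fun_pow (2 * l)).congr_deriv ?_
      rcases Nat.eq_zero_or_pos l with rfl | hl
      · simp
      · have : (t : ℂ) ^ (2 * l) / t = (t : ℂ) ^ (2 * l - 1) := by
          rw [div_eq_iff htC, ← pow_succ]; congr 1; omega
        rw [this]; push_cast; ring
    have hterm : ∀ m ∈ Finset.Icc (-(l : ℤ)) l, HasDerivAt (fun t : ℝ => (N m : ℂ) *
        ((t : ℂ) ^ (2 * l) * (f₁ m t * a m t) - (t : ℂ) ^ (2 * l) * (f m t * a₁ m t)))
        ((N m : ℂ) * ((t : ℂ) ^ (2 * l) / t * (G m t * a m t)) - 4 * (t : ℂ) ^ (2 * l) *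
          ((N m : ℂ) * ((l : ℂ) - m) * (f (m + 1) t * a m t) -
            (N m : ℂ) * ((l : ℂ) + m) * (f m t * a (m - 1) t))) t := by
      intro m hm
      have hm' := mem_Icc_iff_abs.1 hm
      refine (((hp.mul ((hf₁ m hm' t ht).mul (ha m hm' t ht))).sub
        (hp.mul ((hf m hm' t ht).mul (ha₁ m hm' t ht)))).const_mul (N m : ℂ)).congr_deriv ?_
      simp only [Pi.mul_apply]
      rw [hf₂ m hm' t ht, ha₂ m hm' t ht]
      field_simp
      ring
    refine (HasDerivAt.fun_sum hterm).congr_deriv ?_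
    rw [Finset.sum_sub_distrib, ← Finset.mul_sum, Finset.sum_sub_distrib,
      sum_coupling (T := fun m => (N m : ℂ) * ((l : ℂ) - m) * (f (m + 1) t * a m t))
        (U := fun m => (N m : ℂ) * ((l : ℂ) + m) * (f m t * a (m - 1) t)), sub_self, mul_zero,
      sub_zero]
    · intro m
      have := congrArg (fun x : ℝ => (x : ℂ)) (hN m)
      push_cast at this ⊢
      rw [add_sub_cancel_right]
      linear_combination (f (m + 1) t * a m t) * this
    · have := congrArg (fun x : ℝ => (x : ℂ)) (hN l)
      push_cast at this ⊢
      rw [sub_self, zero_mul] at this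
      linear_combination (-(f (l + 1) t * a (l + 1 - 1) t)) * this
    · push_cast; ring
  have hcont : ContinuousWithinAt (Function.update Bf 0 L) (Ici 0) 0 := by
    rw [continuousWithinAt_update_same]
    have : Ici (0 : ℝ) \ {0} = Ioi 0 := by ext x; simp [lt_iff_le_and_ne, eq_comm]
    rwa [this]
  have hI : IntegrableOn (fun t : ℝ => ∑ m ∈ Finset.Icc (-(l : ℤ)) l, (N m : ℂ) *
      ((t : ℂ) ^ (2 * l) / t * (G m t * a m t))) (Ioi 0) :=
    integrable_finsetSum _ fun m hm => (hint m (mem_Icc_iff_abs.1 hm)).const_mul _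
  have key := integral_Ioi_of_hasDerivAt_of_tendsto hcont (fun t (ht : 0 < t) =>
    (hd t ht).congr_of_eventuallyEq (by
      filter_upwards [lt_mem_nhds ht] with s hs
      rw [Function.update_of_ne (ne_of_gt hs)])) hI
    (htop.congr' (by
      filter_upwards [eventually_gt_atTop 0] with s hs
      rw [Function.update_of_ne (ne_of_gt hs)]))
  rw [Function.update_self, zero_sub, integral_finsetSum _ fun m hm =>
    (hint m (mem_Icc_iff_abs.1 hm)).const_mul _] at key
  rw [← key]
  exact Finset.sum_congr rfl fun m _ => (integral_const_mul _ _).symm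

/-- Integrability of the pairing of a function of order `y^{-l+s}` with one of order `y^{-l-ρ}`. -/
theorem pairing_bound {l : ℕ} {s ρ C₁ C₂ C₃ C₄ : ℝ} (hρ : ρ < s) (hC₁ : 0 ≤ C₁) (hC₂ : 0 ≤ C₂)
    {g : ℝ → ℂ} (hg : ∀ t ∈ Ioc (0 : ℝ) 1, ‖g t‖ ≤ C₁ * t ^ (-(l : ℝ) + s))
    (hg' : ∀ t ∈ Ioi (1 : ℝ), ‖g t‖ ≤ C₂ * t ^ (-(l : ℝ) + 1 / 4)) :
    IntegrableOn (fun t : ℝ => if t ≤ 1 then C₁ * C₃ * t ^ (-1 + (s - ρ)) else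
      C₂ * C₄ * t ^ (-15 / 4 : ℝ)) (Ioi 0) ∧
    ∀ a : ℝ → ℂ, (∀ t ∈ Ioc (0 : ℝ) 1, ‖a t‖ ≤ C₃ * t ^ (-((l : ℝ) + ρ))) →
      (∀ t ∈ Ioi (1 : ℝ), ‖a t‖ ≤ C₄ * t ^ (-((l : ℝ) + 3))) → ∀ t ∈ Ioi (0 : ℝ),
      ‖(t : ℂ) ^ (2 * l) / t * (g t * a t)‖ ≤ if t ≤ 1 then C₁ * C₃ * t ^ (-1 + (s - ρ)) else
        C₂ * C₄ * t ^ (-15 / 4 : ℝ) := by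
  constructor
  · rw [← Ioc_union_Ioi_eq_Ioi zero_le_one]
    refine IntegrableOn.union ?_ ?_
    · have h1 : IntegrableOn (fun t : ℝ => C₁ * C₃ * t ^ (-1 + (s - ρ))) (Ioc 0 1) :=
        ((intervalIntegrable_iff_integrableOn_Ioc_of_le zero_le_one).1
          (intervalIntegral.intervalIntegrable_rpow' (by linarith))).const_mul _
      exact h1.congr_fun (fun t ht => by simp only [if_pos ht.2]) measurableSet_Ioc
    · have h1 : IntegrableOn (fun t : ℝ => C₂ * C₄ * t ^ (-15 / 4 : ℝ)) (Ioi 1) :=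
        (integrableOn_Ioi_rpow_of_lt (by norm_num) one_pos).const_mul _
      exact h1.congr_fun (fun t (ht : 1 < t) => by simp only [if_neg (not_le.2 ht)])
        measurableSet_Ioi
  · intro a ha ha' t (ht : 0 < t)
    have hp : ∀ u v : ℝ, t ^ (2 * l) / t * (t ^ u * t ^ v) = t ^ (2 * l - 1 + u + v) :=
      fun u v => by
        have : t ^ (2 * l) / t = t ^ ((2 * l : ℝ) - 1) := by
          rw [Real.rpow_sub ht, Real.rpow_one, ← rpow_natCast]; push_cast; rfl
        rw [this, ← rpow_add ht, ← rpow_add ht]; congr 1; ring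
    rw [norm_mul, norm_div, norm_pow, norm_real, norm_of_nonneg ht.le, norm_mul]
    split_ifs with h
    · calc _ ≤ t ^ (2 * l) / t * ((C₁ * t ^ (-(l : ℝ) + s)) * (C₃ * t ^ (-((l : ℝ) + ρ)))) :=
            mul_le_mul_of_nonneg_left (mul_le_mul (hg t ⟨ht, h⟩) (ha t ⟨ht, h⟩) (norm_nonneg _)
              (by positivity)) (by positivity)
        _ = C₁ * C₃ * (t ^ (2 * l) / t * (t ^ (-(l : ℝ) + s) * t ^ (-((l : ℝ) + ρ)))) := by ring
        _ = _ := by rw [hp]; congr 2; ring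
    · have h' : t ∈ Ioi (1 : ℝ) := not_le.1 h
      calc _ ≤ t ^ (2 * l) / t * ((C₂ * t ^ (-(l : ℝ) + 1 / 4)) *
              (C₄ * t ^ (-((l : ℝ) + 3)))) :=
            mul_le_mul_of_nonneg_left (mul_le_mul (hg' t h') (ha' t h') (norm_nonneg _)
              (by positivity)) (by positivity)
        _ = C₂ * C₄ * (t ^ (2 * l) / t * (t ^ (-(l : ℝ) + 1 / 4) * t ^ (-((l : ℝ) + 3)))) := by
            ring
        _ = _ := by rw [hp]; congr 2; ring

/-- Exponential decay beats every power. -/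
theorem exp_neg_le_rpow (k : ℕ) : ∃ C : ℝ, 0 ≤ C ∧ ∀ t : ℝ, 1 ≤ t →
    Real.exp (-2 * t) ≤ C * t ^ (-(k : ℝ)) := by
  refine ⟨k.factorial, by positivity, fun t ht => ?_⟩
  have h0 : 0 < t := by linarith
  have h1 := Real.pow_div_factorial_le_exp t h0.le k
  rw [div_le_iff₀ (by positivity)] at h1
  rw [Real.rpow_neg h0.le, rpow_natCast, ← div_eq_mul_inv, le_div_iff₀ (by positivity)]
  have h2 : Real.exp (-2 * t) * Real.exp t ≤ 1 := by
    rw [← Real.exp_add]; exact Real.exp_le_one_iff.2 (by linarith)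
  calc Real.exp (-2 * t) * t ^ k ≤ Real.exp (-2 * t) * (Real.exp t * k.factorial) := by gcongr
    _ = (Real.exp (-2 * t) * Real.exp t) * k.factorial := by ring
    _ ≤ 1 * k.factorial := by gcongr
    _ = _ := one_mul _

/-- `(z - w) / (z - w - k)`, read as `1` for `k = 0`. -/
def ratioInt (w : ℂ) (k : ℤ) (z : ℂ) : ℂ := if k = 0 then 1 else (1 * z + -w) * (z - (w + k))⁻¹

theorem quarter_le_of_int {x u : ℝ} (k : ℤ) (hk : k ≠ 0) (h0 : -1 / 4 ≤ x) (h1 : x ≤ 1 / 2)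
    (hu : |u| ≤ 1 / 4) : 1 / 4 ≤ |x - (u + k)| := by
  have hu := abs_le.1 hu
  rcases lt_or_gt_of_ne hk with h | h
  · have : (k : ℝ) ≤ -1 := by exact_mod_cast Int.le_sub_one_of_lt h
    exact le_abs.2 (Or.inl (by linarith))
  · have : (1 : ℝ) ≤ k := by exact_mod_cast h
    exact le_abs.2 (Or.inr (by linarith))

theorem tempered_ratioInt {w : ℂ} (hw : |w.re| ≤ 1 / 4) (k : ℤ) :
    Tempered (-1 / 4) (1 / 2) 0 (ratioInt w k) := by
  by_cases hk : k = 0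
  · have e : ratioInt w k = fun z => 0 * z + 1 := by ext z; simp [ratioInt, hk]
    rw [e]; exact tempered_linear (-1 / 4) (1 / 2) 0 1
  · have h := (tempered_linear (-1 / 4) (1 / 2) 1 (-w)).mul (tempered_inv (w := w + k)
      (by norm_num : (0 : ℝ) < 1 / 4) fun x h0 h1 => by simpa using quarter_le_of_int k hk h0 h1 hw)
    have e : ratioInt w k = fun z => (1 * z + -w) * (z - (w + k))⁻¹ := by ext z; simp [ratioInt, hk]
    rw [e]; rwa [add_zero] at h

theorem ratioInt_eq {w z : ℂ} {k : ℤ} (h : z ≠ w) : ratioInt w k z = (z - w) / (z - (w + k)) := by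
  by_cases hk : k = 0
  · simp [ratioInt, hk, sub_ne_zero.2 h]
  · simp only [ratioInt, hk, if_false]; rw [one_mul, ← sub_eq_add_neg, div_eq_mul_inv]

theorem quarter_le_half_line {u : ℝ} (h4 : |u| ≤ 1 / 4) (k : ℤ) :
    1 / 4 ≤ |1 / 2 - (u + k)| := by
  by_cases hk : k = 0
  · subst hk
    have := abs_le.1 h4
    exact le_abs.2 (Or.inl (by push_cast; linarith))
  · exact quarter_le_of_int k hk (by norm_num) le_rfl h4

theorem norm_sq_sub_sq_ge {ν₀ : ℂ} (h4 : |ν₀.re| ≤ 1 / 4) (p p' : ℤ) (t : ℝ) :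
    1 / 16 ≤ ‖(((1 / 2 : ℝ) : ℂ) + t * I - p' : ℂ) ^ 2 - (ν₀ - p) ^ 2‖ := by
  have e : (((1 / 2 : ℝ) : ℂ) + t * I - p' : ℂ) ^ 2 - (ν₀ - p) ^ 2 =
      ((((1 / 2 : ℝ) : ℂ) + t * I) - (ν₀ + ((p' - p : ℤ) : ℂ))) *
      ((((1 / 2 : ℝ) : ℂ) + t * I) - (-ν₀ + ((p' + p : ℤ) : ℂ))) := by
    push_cast; ring
  have key : ∀ (w : ℂ) (k : ℤ), |w.re| ≤ 1 / 4 →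
      1 / 4 ≤ ‖(((1 / 2 : ℝ) : ℂ) + t * I) - (w + (k : ℂ))‖ := fun w k hw => by
    refine le_trans ?_ (abs_re_le_norm _)
    rw [sub_re, line_re, add_re, Complex.intCast_re]
    exact quarter_le_half_line hw k
  rw [e, norm_mul]
  have h1 := key ν₀ (p' - p) h4
  have h2 := key (-ν₀) (p' + p) (by rwa [neg_re, abs_neg])
  nlinarith

section

variable {l : ℕ} {q : ℤ} {σ : ℝ} {η : ℂ → ℤ → ℂ}

/-- A particular solution of the differential system with right hand side `gM`, and its
asymptotics. -/
theorem exists_resolvent (hq : |q| ≤ (l : ℤ)) (hσ : 1 / 2 ≤ σ)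
    (hη : RapidFamily l σ η)
    (h₃ : EvenFamily l σ η)
    {p : ℤ} (hp : |p| ≤ (l : ℤ)) {ν₀ : ℂ} (h1 : -1 / 4 < ν₀.re) (h2 : ν₀.re < 0) :
    ∃ f f₁ f₂ : ℤ → ℝ → ℂ,
      (∀ m : ℤ, ∀ t : ℝ, 0 < t →
        HasDerivAt (f m) ((f₁ m t - (((l : ℤ) - m).toNat : ℕ) * f m t) / t) t) ∧
      (∀ m : ℤ, |m| ≤ (l : ℤ) → ∀ t : ℝ, 0 < t →
        HasDerivAt (f₁ m) ((f₂ m t - (((l : ℤ) - m).toNat : ℕ) * f₁ m t) / t) t) ∧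
      (∀ m : ℤ, |m| ≤ (l : ℤ) → ∀ t : ℝ, 0 < t → f₂ m t = gM l q η m t +
        ((ν₀ - p) ^ 2 + 4 * t ^ 2) * f m t - 4 * (((l : ℤ) - m).toNat : ℕ) * t * f (m + 1) t) ∧
      (∀ m : ℤ, |m| ≤ (l : ℤ) → ∃ C : ℝ, 0 ≤ C ∧ ∀ y ∈ Ioi (0 : ℝ),
        ‖f m y - (if m = -p then (normPhi l p q : ℂ)⁻¹ * I * (2 * π *
          (η ν₀ p / (ν₀ - p) * sinD l p ν₀)) else 0) * (y : ℂ) ^ (-(l + ν₀))‖ ≤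
          C * y ^ (-(l : ℝ) + 1 / 4)) ∧
      (∀ m : ℤ, |m| ≤ (l : ℤ) → ∃ C : ℝ, 0 ≤ C ∧ ∀ y ∈ Ioi (0 : ℝ),
        ‖f m y‖ ≤ C * y ^ (-((l : ℝ) + 1 / 2))) := by
  have h4 : |ν₀.re| ≤ 1 / 4 := abs_le.2 ⟨by linarith, by linarith⟩
  have h4' : |(-ν₀).re| ≤ 1 / 4 := by rwa [neg_re, abs_neg]
  have hν0 : ν₀ ≠ 0 := by rintro rfl; simp at h2
  set num : ℤ → ℝ → ℂ := fun p' t => η (((1 / 2 : ℝ) : ℂ) + t * I) p' *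
    (ν₀⁻¹ * (((1 / 2 : ℝ) : ℂ) + t * I) + 1) * sinW p' (((1 / 2 : ℝ) : ℂ) + t * I)
    with hnum
  set G : ℤ → ℝ → ℂ := fun p' t => num p' t /
    ((((1 / 2 : ℝ) : ℂ) + t * I - p' : ℂ) ^ 2 - (ν₀ - p) ^ 2) with hG
  set a : ℤ → ℂ → ℂ := fun p' z => η z p' * (0 * z + ν₀⁻¹) * ratioInt (-ν₀) (p' + p) z *
    ratioInt ν₀ (p' - p) z with ha
  have hη' : ∀ p' : ℤ, |p'| ≤ (l : ℤ) → Rapid (-1 / 4) (1 / 2) (-π / 2) fun z => η z p' :=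
    fun p' hp' => (hη p' hp').mono (by linarith) hσ
  have hnumP : ∀ p' : ℤ, |p'| ≤ (l : ℤ) → PacketWeight (num p') := fun p' hp' =>
    ((hη' p' hp').mul_linear ν₀⁻¹ 1).packet_sinW p' (by norm_num) le_rfl
  have hGP : ∀ p' : ℤ, |p'| ≤ (l : ℤ) → PacketWeight (G p') := fun p' hp' =>
    (hnumP p' hp').div (by fun_prop) (by norm_num : (0 : ℝ) < 1 / 16) (norm_sq_sub_sq_ge h4 p p')
  have haR : ∀ p' : ℤ, |p'| ≤ (l : ℤ) → Rapid (-1 / 4) (1 / 2) (-π / 2) (a p') :=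
    fun p' hp' => by
      have := (((hη' p' hp').mul_linear 0 ν₀⁻¹).mul (tempered_ratioInt h4' (p' + p))).mul
        (tempered_ratioInt h4 (p' - p))
      rwa [add_zero, add_zero] at this
  have hGa : ∀ p' : ℤ, G p' = fun t : ℝ => a p' (((1 / 2 : ℝ) : ℂ) + t * I) *
      sinW p' (((1 / 2 : ℝ) : ℂ) + t * I) / (((1 / 2 : ℝ) : ℂ) + t * I - ν₀) :=
    fun p' => by
      ext t
      have n1 := half_line_ne_zero t (w := ν₀) (by linarith)
      have n2 := half_line_ne_zero t (w := -ν₀) (by simp; linarith)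
      have n3 : (((1 / 2 : ℝ) : ℂ) + t * I - p' : ℂ) ^ 2 - (ν₀ - p) ^ 2 ≠ 0 := fun h0 => by
        have := norm_sq_sub_sq_ge h4 p p' t; rw [h0, norm_zero] at this; linarith
      simp only [hG, ha, hnum]
      rw [ratioInt_eq (sub_ne_zero.1 n2), ratioInt_eq (sub_ne_zero.1 n1)]
      generalize ((1 / 2 : ℝ) : ℂ) + t * I = z at *
      have e : (z - p') ^ 2 - (ν₀ - p) ^ 2 =
        (z - (ν₀ + ((p' - p : ℤ) : ℂ))) * (z - (-ν₀ + ((p' + p : ℤ) : ℂ))) := by push_cast; ring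
      rw [e] at n3 ⊢
      obtain ⟨n4, n5⟩ := mul_ne_zero_iff.1 n3
      field_simp
      ring
  have ha0 : ∀ p' : ℤ, a p' ν₀ = if p' = p then η ν₀ p / (ν₀ - p) else 0 := fun p' => by
    have n0 : ν₀ ≠ -ν₀ := fun h => hν0 (by linear_combination h / 2)
    simp only [ha]
    rw [ratioInt_eq n0]
    split_ifs with hpp
    · subst hpp
      have n1 : ν₀ - p' ≠ 0 := fun h => by
        have h' := congrArg Complex.re h
        simp only [sub_re, Complex.intCast_re, Complex.zero_re] at h'
        have k1 : -1 < p' := by exact_mod_cast (by linarith : (-1 : ℝ) < p')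
        have k2 : p' < 0 := by exact_mod_cast (by linarith : (p' : ℝ) < 0)
        omega
      have n2 : ν₀ - (-ν₀ + ((p' + p' : ℤ) : ℂ)) ≠ 0 := fun h => n1 (by
        push_cast at h; linear_combination h / 2)
      have e2 : ν₀ - (-ν₀ + ((p' + p' : ℤ) : ℂ)) = 2 * (ν₀ - p') := by push_cast; ring
      simp only [ratioInt, sub_self, if_true]
      rw [e2]
      field_simp
      ring
    · simp [ratioInt, sub_ne_zero.2 hpp]
  set cf : ℤ → ℂ := fun p' => (normPhi l p' q : ℂ)⁻¹ * I with hcf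
  have hmem : ∀ p' ∈ Finset.Icc (-(l : ℤ)) l, |p'| ≤ (l : ℤ) := fun p' h => mem_Icc_iff_abs.1 h
  refine ⟨fun m y => ∑ p' ∈ Finset.Icc (-(l : ℤ)) l, cf p' * jP (G p') (1 / 2) l p' m y,
    fun m y => ∑ p' ∈ Finset.Icc (-(l : ℤ)) l, cf p' * jP1 (G p') (1 / 2) l p' m y,
    fun m y => ∑ p' ∈ Finset.Icc (-(l : ℤ)) l, cf p' * jP2 (G p') (1 / 2) l p' m y,
    fun m t ht => ?_, fun m hm t ht => ?_, fun m hm t ht => ?_, fun m hm => ?_, fun m hm => ?_⟩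
  · refine (HasDerivAt.fun_sum fun p' hp' =>
      (jP_hasDerivAt (hGP p' (hmem p' hp')) (1 / 2) l p' m ht).const_mul (cf p')).congr_deriv ?_
    rw [Finset.mul_sum, ← Finset.sum_sub_distrib, Finset.sum_div]
    exact Finset.sum_congr rfl fun p' _ => by ring
  · refine (HasDerivAt.fun_sum fun p' hp' =>
      (jP1_hasDerivAt (hGP p' (hmem p' hp')) (1 / 2) l p' hm ht).const_mul (cf p')).congr_deriv ?_
    rw [Finset.mul_sum, ← Finset.sum_sub_distrib, Finset.sum_div]
    exact Finset.sum_congr rfl fun p' _ => by ring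
  · rw [gM_eq hq hσ hη h₃ hm ν₀⁻¹ ht, Finset.mul_sum, Finset.mul_sum, ← Finset.sum_add_distrib,
      ← Finset.sum_sub_distrib]
    refine Finset.sum_congr rfl fun p' hp' => ?_
    have := jP2_div (hnumP p' (hmem p' hp')) (1 / 2) l p' m (ν₀ - p)
      (by norm_num : (0 : ℝ) < 1 / 16) (norm_sq_sub_sq_ge h4 p p') ht
    simp only [hG, hcf]
    rw [this]
    simp only [hnum]
    ring
  · have key : ∀ p' ∈ Finset.Icc (-(l : ℤ)) l, ∃ C : ℝ, 0 ≤ C ∧ ∀ y ∈ Ioi (0 : ℝ),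
        ‖jP (G p') (1 / 2) l p' m y - (if m = -p' then 2 * π * (a p' ν₀ * sinD l p' ν₀) else 0) *
          (y : ℂ) ^ (-(l + ν₀))‖ ≤ C * y ^ (-(l : ℝ) + 1 / 4) := fun p' hp' => by
      rw [hGa p']
      exact (jP_pole_asymptotics (haR p' (hmem p' hp')) h1 h2 l p' hm).2
    obtain ⟨C, hC, h⟩ := exists_sum_bound _ key cf
    refine ⟨C, hC, fun y hy => ?_⟩
    convert h y hy using 2
    simp only [mul_sub, Finset.sum_sub_distrib]
    congr 1
    rw [Finset.sum_eq_single_of_mem p (mem_Icc_iff_abs.2 hp)]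
    · rw [ha0, if_pos rfl]
      split_ifs
      · simp only [hcf]; ring
      · simp
    · intro p' _ hpp
      rw [ha0, if_neg hpp]; simp
  · exact exists_sum_bound _ (fun p' hp' => by
      obtain ⟨C, hC, h⟩ := jP_norm_le (hGP p' (hmem p' hp')) (by norm_num : (0 : ℝ) < 1 / 2) l p' hm
      exact ⟨C, hC, fun y hy => h y hy⟩) cf

end

theorem toNat_sub_cast {l : ℕ} {m : ℤ} (hm : |m| ≤ (l : ℤ)) :
    ((((l : ℤ) - m).toNat : ℕ) : ℂ) = (l : ℂ) - m := by
  rw [toNat_cast (by have := abs_le.1 hm; omega)]; push_cast; ring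

theorem rpow_le_mul_rpow_of_le {x a b : ℝ} {n : ℕ} (hx : 0 < x) (h : x ≤ 3) (hab : a ≤ b)
    (hn : b - a ≤ n) : x ^ b ≤ 3 ^ n * x ^ a := by
  have e : x ^ b = x ^ (b - a) * x ^ a := by rw [← rpow_add hx]; congr 1; ring
  rw [e]
  refine mul_le_mul_of_nonneg_right ?_ (by positivity)
  calc x ^ (b - a) ≤ (3 : ℝ) ^ (b - a) := Real.rpow_le_rpow hx.le h (by linarith)
    _ ≤ (3 : ℝ) ^ (n : ℝ) := Real.rpow_le_rpow_of_exponent_le (by norm_num) hn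
    _ = _ := rpow_natCast _ _

theorem jB_le_rpow_infty (l : ℕ) (p m : ℤ) (ν : ℂ) (k : ℕ) : ∃ C : ℝ, 0 ≤ C ∧
    ∀ t ∈ Ici (1 : ℝ), ‖jB l p m ν t‖ ≤ C * t ^ (-(k : ℝ)) := by
  obtain ⟨C, hC, h⟩ := jB_expDecay l p m |ν.re|
  obtain ⟨C', hC', h'⟩ := exp_neg_le_rpow k
  refine ⟨C * C', mul_nonneg hC hC', fun t ht => (h ν le_rfl t ht).trans ?_⟩
  rw [mul_assoc]
  exact mul_le_mul_of_nonneg_left (h' t ht) hC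

/-- The leading terms of `jB` and `jB1` at `0`, and their decay at `∞`. -/
theorem jB_jB1_asymptotics {l : ℕ} {p m : ℤ} (hm : |m| ≤ (l : ℤ)) {ν : ℂ} (h0 : 0 < ν.re)
    (h1 : ν.re < 1 / 4) :
    (∃ C : ℝ, 0 ≤ C ∧ ∀ t ∈ Ioc (0 : ℝ) 1, ‖jB l p m ν t -
      (if m = -p then Dlead l p ν else 0) * (t : ℂ) ^ (-(l + ν))‖ ≤ C * t ^ (-(l : ℝ))) ∧
    (∃ C : ℝ, 0 ≤ C ∧ ∀ t ∈ Ioc (0 : ℝ) 1, ‖jB1 l p m ν t -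
      (if m = -p then Dlead l p ν * (p - ν) else 0) * (t : ℂ) ^ (-(l + ν))‖ ≤ C * t ^ (-(l : ℝ))) ∧
    ∃ C : ℝ, 0 ≤ C ∧ ∀ t ∈ Ici (1 : ℝ), ‖jB1 l p m ν t‖ ≤ C * t ^ (-((l : ℝ) + 3)) := by
  have hle : ∀ {m : ℤ}, |m| ≤ (l : ℤ) → ∃ C : ℝ, 0 ≤ C ∧ ∀ t ∈ Ioc (0 : ℝ) 3,
      ‖jB l p m ν t‖ ≤ C * t ^ (-(l : ℝ) - 3 / 4) := fun {m} hm => by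
    refine ⟨2 ^ (l : ℝ) / ν.re * ‖Gamma (l + 1 + ν)‖ * 3 ^ 1, by positivity,
      fun t ht => (norm_jB_le p hm h0 ht.1).trans ?_⟩
    rw [mul_assoc _ ((3 : ℝ) ^ 1)]
    exact mul_le_mul_of_nonneg_left (rpow_le_mul_rpow_of_le ht.1 ht.2 (by linarith)
      (by push_cast; linarith)) (by positivity)
  have hasy : ∃ C : ℝ, 0 ≤ C ∧ ∀ t ∈ Ioi (0 : ℝ), ‖jB l p m ν t -
      (if m = -p then Dlead l p ν else 0) * (t : ℂ) ^ (-(l + ν))‖ ≤ C * t ^ (-(l : ℝ)) := by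
    have hd : 0 < ν.re - ν.re / 2 := by linarith
    refine ⟨4 * 2 ^ (l : ℝ) / (ν.re - ν.re / 2) * ‖Gamma (l + 1 + ν)‖, by positivity,
      fun t ht => ?_⟩
    have := norm_jB_sub_le hm h0.le (by linarith) (by linarith) (mem_Ioi.1 ht) (p := p) (ν := ν)
    rwa [show -(l + ν.re) + ν.re = -(l : ℝ) by ring] at this
  have hnext : ∀ (P : ℤ → ℝ → ℂ) {S : Set ℝ} {d : ℝ}, (∀ {m : ℤ}, |m| ≤ (l : ℤ) → ∃ C : ℝ, 0 ≤ C ∧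
      ∀ t ∈ S, ‖P m t‖ ≤ C * t ^ d) → ∃ C : ℝ, 0 ≤ C ∧ ∀ t ∈ S,
      ‖((((l : ℤ) - m).toNat : ℕ) : ℂ) * P (m + 1) t‖ ≤ C * t ^ d := fun P {S d} h => by
    by_cases hml : m = l
    · exact ⟨0, le_rfl, fun t _ => by simp [hml]⟩
    · have := abs_le.1 hm
      obtain ⟨C, hC, h⟩ := h (m := m + 1) (abs_le.2 ⟨by omega, by omega⟩)
      refine ⟨(((l : ℤ) - m).toNat : ℕ) * C, by positivity, fun t ht => ?_⟩
      rw [norm_mul, Complex.norm_natCast, mul_assoc]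
      exact mul_le_mul_of_nonneg_left (h t ht) (by positivity)
  have ht : ∀ t : ℝ, 0 < t → jB2 l p m ν t = (fun _ => 0 : ℝ → ℂ) t + ((ν - p) ^ 2 + 4 * t ^ 2) *
      jB l p m ν t - 4 * (((l : ℤ) - m).toNat : ℕ) * t * jB l p (m + 1) ν t := fun t _ => by
    simp [jB2]
  have hz : ∀ (S : Set ℝ) (d : ℝ), ∃ C : ℝ, 0 ≤ C ∧ ∀ t ∈ S, ‖(fun _ => 0 : ℝ → ℂ) t‖ ≤ C * t ^ d :=
    fun S d => ⟨0, le_rfl, fun t _ => by simp⟩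
  refine ⟨?_, ?_, ?_⟩
  · obtain ⟨C, hC, h⟩ := hasy
    exact ⟨C, hC, fun t ht => h t ht.1⟩
  · obtain ⟨C, hC, h⟩ := T1_asymptotics_zero (fun t ht => jB_hasDerivAt l p m ν ht)
      (fun t ht => jB1_hasDerivAt l p hm ν ht) ht (A := if m = -p then Dlead l p ν else 0)
      (μ := -(l + ν)) (d := -(l : ℝ))
      (by obtain ⟨C, hC, h⟩ := hasy; exact ⟨C, hC, fun t ht => h t ht.1⟩) (hle hm)
      (hnext (fun m t => jB l p m ν t) hle) (hz _ _) (by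
        split_ifs with hmp
        · rw [toNat_sub_cast hm, hmp]; push_cast; ring
        · simp)
    refine ⟨C, hC, fun t ht => ?_⟩
    convert h t ht using 4
    split_ifs with hmp
    · rw [toNat_sub_cast hm, hmp]; push_cast; ring
    · simp
  · have hinf : ∀ {m : ℤ}, |m| ≤ (l : ℤ) → ∃ C : ℝ, 0 ≤ C ∧ ∀ t ∈ Ici (1 : ℝ),
        ‖jB l p m ν t‖ ≤ C * t ^ (-((l : ℝ) + 3) - 2) := fun {m} hm => by
      obtain ⟨C, hC, h⟩ := jB_le_rpow_infty l p m ν (l + 5)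
      refine ⟨C, hC, fun t ht => (h t ht).trans_eq ?_⟩
      congr 2; push_cast; ring
    exact T1_bound_infty (fun t ht => jB_hasDerivAt l p m ν ht)
      (fun t ht => jB1_hasDerivAt l p hm ν ht) ht (hinf hm)
      (hnext (fun m t => jB l p m ν t) hinf) (hz _ _)

/-- Bounds for the solution of the inhomogeneous system. -/
theorem resolvent_asymptotics {l : ℕ} {f f₁ f₂ G : ℤ → ℝ → ℂ} {κ μ A : ℂ} {m : ℤ}
    (hm : |m| ≤ (l : ℤ))
    (h1 : ∀ t : ℝ, 0 < t →
        HasDerivAt (f m) ((f₁ m t - (((l : ℤ) - m).toNat : ℕ) * f m t) / t) t)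
    (h2 : ∀ t : ℝ, 0 < t →
        HasDerivAt (f₁ m) ((f₂ m t - (((l : ℤ) - m).toNat : ℕ) * f₁ m t) / t) t)
    (ht : ∀ t : ℝ, 0 < t → f₂ m t = G m t + (κ ^ 2 + 4 * t ^ 2) * f m t -
        4 * (((l : ℤ) - m).toNat : ℕ) * t * f (m + 1) t)
    (hA : A * (μ + (((l : ℤ) - m).toNat : ℕ)) ^ 2 = κ ^ 2 * A)
    (hG : ∃ C : ℝ, 0 ≤ C ∧ ∀ y ∈ Ioi (0 : ℝ), ‖G m y‖ ≤ C * y ^ (-(l : ℝ) + 1 / 4))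
    (hasy : ∃ C : ℝ, 0 ≤ C ∧ ∀ y ∈ Ioi (0 : ℝ),
        ‖f m y - A * (y : ℂ) ^ μ‖ ≤ C * y ^ (-(l : ℝ) + 1 / 4))
    (hb : ∀ m : ℤ, |m| ≤ (l : ℤ) → ∃ C : ℝ, 0 ≤ C ∧ ∀ y ∈ Ioi (0 : ℝ),
        ‖f m y‖ ≤ C * y ^ (-((l : ℝ) + 1 / 2))) :
    (∃ C : ℝ, 0 ≤ C ∧ ∀ y ∈ Ioc (0 : ℝ) 1,
        ‖f₁ m y - A * (μ + (((l : ℤ) - m).toNat : ℕ)) * (y : ℂ) ^ μ‖ ≤ C * y ^ (-(l : ℝ) + 1 / 4)) ∧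
    ∃ C : ℝ, 0 ≤ C ∧ ∀ y ∈ Ici (1 : ℝ), ‖f₁ m y‖ ≤ C * y ^ (-(l : ℝ) + 3 / 2) := by
  have hnext : ∃ C : ℝ, 0 ≤ C ∧ ∀ t ∈ Ioi (0 : ℝ),
      ‖((((l : ℤ) - m).toNat : ℕ) : ℂ) * f (m + 1) t‖ ≤ C * t ^ (-((l : ℝ) + 1 / 2)) := by
    by_cases hml : m = l
    · exact ⟨0, le_rfl, fun t _ => by simp [hml]⟩
    · have := abs_le.1 hm
      obtain ⟨C, hC, h⟩ := hb (m + 1) (abs_le.2 ⟨by omega, by omega⟩)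
      refine ⟨(((l : ℤ) - m).toNat : ℕ) * C, by positivity, fun t ht => ?_⟩
      rw [norm_mul, Complex.norm_natCast, mul_assoc]
      exact mul_le_mul_of_nonneg_left (h t ht) (by positivity)
  have restr : ∀ {P : ℝ → ℝ} {S : Set ℝ} {d e : ℝ}, S ⊆ Ioi 0 → d = e →
      (∃ C : ℝ, 0 ≤ C ∧ ∀ y ∈ Ioi (0 : ℝ), P y ≤ C * y ^ d) →
      ∃ C : ℝ, 0 ≤ C ∧ ∀ y ∈ S, P y ≤ C * y ^ e := fun {P S d e} hS hde ⟨C, hC, h⟩ =>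
    ⟨C, hC, fun y hy => hde ▸ h y (hS hy)⟩
  have s0 : Ioc (0 : ℝ) 3 ⊆ Ioi 0 := fun x hx => hx.1
  have s1 : Ici (1 : ℝ) ⊆ Ioi 0 := fun x hx => zero_lt_one.trans_le (mem_Ici.1 hx)
  refine ⟨T1_asymptotics_zero h1 h2 ht (restr s0 rfl hasy) (restr s0 (by ring) (hb m hm))
    (restr s0 (by ring) hnext) (restr s0 rfl hG) hA,
    T1_bound_infty h1 h2 ht (restr s1 (by ring) (hb m hm)) (restr s1 (by ring) hnext) ?_⟩
  obtain ⟨C, hC, h⟩ := hG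
  refine ⟨C, hC, fun y (hy : 1 ≤ y) => (h y (s1 hy)).trans ?_⟩
  exact mul_le_mul_of_nonneg_left (Real.rpow_le_rpow_of_exponent_le hy (by linarith)) hC

/-- The pairing of the components of the inverse transform with those of the Jacquet integral. -/
def lam (l : ℕ) (q : ℤ) (η : ℂ → ℤ → ℂ) (p : ℤ) (ν : ℂ) : ℂ :=
  ∑ m ∈ Finset.Icc (-(l : ℤ)) l, (nK l q m : ℂ) *
    ∫ t in Ioi (0 : ℝ), (t : ℂ) ^ (2 * l) / t * (gM l q η m t * jB l p m (-ν) t)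

section

variable {l : ℕ} {q : ℤ} {σ : ℝ} {η : ℂ → ℤ → ℂ}

theorem jB_continuousOn (l : ℕ) (p m : ℤ) (ν : ℂ) : ContinuousOn (jB l p m ν) (Ioi 0) :=
  fun _ ht => (jB_hasDerivAt l p m ν ht).continuousAt.continuousWithinAt

theorem pairing_continuousOn (hσ : 0 ≤ σ)
    (hη : RapidFamily l σ η) (p m m' : ℤ) (ν : ℂ) :
    ContinuousOn (fun t : ℝ => (t : ℂ) ^ (2 * l) / t * (gM l q η m t * jB l p m' ν t)) (Ioi 0) :=
  ((by fun_prop : ContinuousOn (fun t : ℝ => (t : ℂ) ^ (2 * l)) (Ioi 0)).div (by fun_prop)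
    fun t ht => by exact_mod_cast (ne_of_gt (mem_Ioi.1 ht))).mul
      ((gM_contDiffOn hσ hη m).continuousOn.mul (jB_continuousOn l p m' ν))

theorem pairing_majorant (hq : |q| ≤ (l : ℤ)) (hσ : 1 / 2 ≤ σ)
    (hη : RapidFamily l σ η)
    (h₃ : EvenFamily l σ η)
    {m m' : ℤ} (hm : |m| ≤ (l : ℤ)) (hm' : |m'| ≤ (l : ℤ)) {s : ℝ}
    (hs : ∃ C : ℝ, 0 ≤ C ∧ ∀ t ∈ Ioc (0 : ℝ) 1, ‖gM l q η m t‖ ≤ C * t ^ (-(l : ℝ) + s))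
    (p : ℤ) {ν₀ : ℂ} (hν : |ν₀.re| < s) :
    ∃ δ > 0, ∃ b : ℝ → ℝ, IntegrableOn b (Ioi 0) ∧ ∀ ν ∈ Metric.ball ν₀ δ, ∀ t ∈ Ioi (0 : ℝ),
      ‖(t : ℂ) ^ (2 * l) / t * (gM l q η m t * jB l p m' ν t)‖ ≤ b t := by
  obtain ⟨C₁, hC₁, k1⟩ := hs
  obtain ⟨C₂, hC₂, k2⟩ := (gM_bounds hq hσ hη h₃ hm).1
  obtain ⟨ρ, hρ, hρs⟩ := exists_between hν
  obtain ⟨C₃, hC₃, δ, hδ, k3⟩ := jB_local_bound l p hm' hρ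
  obtain ⟨C₄, hC₄, k4⟩ := jB_expDecay l p m' (|ν₀.re| + 1)
  obtain ⟨C₅, hC₅, k5⟩ := exp_neg_le_rpow (l + 3)
  obtain ⟨i1, i2⟩ := pairing_bound (l := l) (C₃ := C₃) (C₄ := C₄ * C₅) hρs hC₁ hC₂ k1
    fun t ht => k2 t (mem_Ioi.2 (zero_lt_one.trans (mem_Ioi.1 ht)))
  refine ⟨min δ 1, by positivity, _, i1, fun ν hν' => i2 (jB l p m' ν)
    (fun t ht => k3 ν (Metric.ball_subset_ball (min_le_left _ _) hν') t ht.1 ht.2) fun t ht => ?_⟩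
  have hd : ‖ν - ν₀‖ < 1 := (mem_ball_iff_norm.1 hν').trans_le (min_le_right _ _)
  have hre : |ν.re| ≤ |ν₀.re| + 1 := by
    have h1 := abs_re_le_norm (ν - ν₀)
    rw [sub_re] at h1
    have h2 := abs_sub_abs_le_abs_sub ν.re ν₀.re
    linarith
  have ht1 : 1 ≤ t := le_of_lt (mem_Ioi.1 ht)
  have h5 := k5 t ht1
  push_cast at h5
  rw [mul_assoc]
  exact (k4 ν hre t ht1).trans (mul_le_mul_of_nonneg_left h5 hC₄)

theorem pairing_integrable (hq : |q| ≤ (l : ℤ)) (hσ : 1 / 2 ≤ σ)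
    (hη : RapidFamily l σ η)
    (h₃ : EvenFamily l σ η)
    {m m' : ℤ} (hm : |m| ≤ (l : ℤ)) (hm' : |m'| ≤ (l : ℤ)) {s : ℝ}
    (hs : ∃ C : ℝ, 0 ≤ C ∧ ∀ t ∈ Ioc (0 : ℝ) 1, ‖gM l q η m t‖ ≤ C * t ^ (-(l : ℝ) + s))
    (p : ℤ) {ν : ℂ} (hν : |ν.re| < s) :
    IntegrableOn (fun t : ℝ => (t : ℂ) ^ (2 * l) / t * (gM l q η m t * jB l p m' ν t)) (Ioi 0) := by
  obtain ⟨δ, hδ, b, hb, h⟩ := pairing_majorant hq hσ hη h₃ hm hm' hs p hν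
  exact Integrable.mono' hb ((pairing_continuousOn (by linarith) hη p m m' ν).aestronglyMeasurable
    measurableSet_Ioi) ((ae_restrict_iff' measurableSet_Ioi).2 (Eventually.of_forall
      (h ν (Metric.mem_ball_self hδ))))

theorem lam_differentiableAt (hq : |q| ≤ (l : ℤ)) (hσ : 1 / 2 ≤ σ)
    (hη : RapidFamily l σ η)
    (h₃ : EvenFamily l σ η) {s : ℝ}
    (hs : ∀ m : ℤ, |m| ≤ (l : ℤ) →
      ∃ C : ℝ, 0 ≤ C ∧ ∀ t ∈ Ioc (0 : ℝ) 1, ‖gM l q η m t‖ ≤ C * t ^ (-(l : ℝ) + s))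
    (p : ℤ) {ν₀ : ℂ} (hν : |ν₀.re| < s) : DifferentiableAt ℂ (lam l q η p) ν₀ := by
  refine DifferentiableAt.fun_sum fun m hm => DifferentiableAt.const_mul ?_ _
  have hm := mem_Icc_iff_abs.1 hm
  obtain ⟨δ, hδ, b, hb, h⟩ := pairing_majorant hq hσ hη h₃ hm hm (hs m hm) p (ν₀ := -ν₀)
    (by rwa [neg_re, abs_neg])
  have hball : ∀ ν ∈ Metric.ball ν₀ δ, -ν ∈ Metric.ball (-ν₀) δ := fun ν hν' => by
    rw [Metric.mem_ball, dist_neg_neg]; exact hν'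
  refine differentiableAt_integral hδ (fun ν _ => (pairing_continuousOn (by linarith) hη p m m
    (-ν)).aestronglyMeasurable measurableSet_Ioi) ?_ ((ae_restrict_iff' measurableSet_Ioi).2
      (Eventually.of_forall fun t ht ν hν' => h (-ν) (hball ν hν') t ht)) hb
  refine (ae_restrict_iff' measurableSet_Ioi).2 (Eventually.of_forall fun t ht => ?_)
  exact ((((jB_differentiable l p m (mem_Ioi.1 ht)).comp differentiable_neg).const_mul
    (gM l q η m t)).const_mul ((t : ℂ) ^ (2 * l) / t)).differentiableOn

set_option maxHeartbeats 800000 in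
theorem lam_eq (hq : |q| ≤ (l : ℤ)) (hσ : 1 / 2 ≤ σ)
    (hη : RapidFamily l σ η)
    (h₃ : EvenFamily l σ η)
    {p : ℤ} (hp : |p| ≤ (l : ℤ)) {ν₀ : ℂ} (h1 : -1 / 4 < ν₀.re) (h2 : ν₀.re < 0) :
    lam l q η p ν₀ = 2 * (π : ℂ) ^ 3 * I * normPhi l p q *
      (factor l p ν₀ * η ν₀ p) := by
  obtain ⟨f, f₁, f₂, hf, hf₁, hf₂, hasy, hb⟩ := exists_resolvent hq hσ hη h₃ hp h1 h2
  set R : ℂ := (normPhi l p q : ℂ)⁻¹ * I * (2 * π *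
          (η ν₀ p / (ν₀ - p) * sinD l p ν₀)) with hR
  have hneg : ∀ {m : ℤ}, |m| ≤ (l : ℤ) → |-m| ≤ (l : ℤ) := fun h => by rwa [abs_neg]
  have hre : 0 < (-ν₀).re := by rw [neg_re]; linarith
  have hre' : (-ν₀).re < 1 / 4 := by rw [neg_re]; linarith
  have hD : Dlead l (-p) (-ν₀) = Dlead l p (-ν₀) := by simp [Dlead]
  set D := Dlead l p (-ν₀) with hDdef
  have hfa : ∀ m : ℤ, |m| ≤ (l : ℤ) → _ := fun m hm => resolvent_asymptotics hm (hf m) (hf₁ m hm)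
    (hf₂ m hm) (μ := -(l + ν₀)) (A := if m = -p then R else 0) (by
        split_ifs with hmp
        · rw [toNat_sub_cast hm, hmp]; push_cast; ring
        · simp) (gM_bounds hq hσ hη h₃ hm).1 (hasy m hm) hb
  have haa : ∀ m : ℤ, |m| ≤ (l : ℤ) → _ := fun m hm =>
    jB_jB1_asymptotics (p := -p) (hneg hm) hre hre'
  have hlead : ∀ m : ℤ, (if -m = - -p then Dlead l (-p) (-ν₀) else 0) = if m = -p then D else 0 :=
    fun m => by
      have : (-m = - -p) ↔ (m = -p) := by omega
      simp only [this, hD]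
  have hlead1 : ∀ m : ℤ, (if -m = - -p then Dlead l (-p) (-ν₀) * (((-p : ℤ) : ℂ) - -ν₀) else 0) =
      if m = -p then D * (ν₀ - p) else 0 := fun m => by
    have : (-m = - -p) ↔ (m = -p) := by omega
    simp only [this, hD]
    push_cast
    split_ifs <;> ring
  have hμ : (-(l + ν₀)).re = -(l : ℝ) + -ν₀.re := by simp; ring
  have hμ' : (-(l + -ν₀)).re = -(l : ℝ) - -ν₀.re := by simp; ring
  have hsum : -(l + ν₀) + -(l + -ν₀) = -((2 * l : ℕ) : ℂ) := by push_cast; ring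
  have hint : ∀ m : ℤ, |m| ≤ (l : ℤ) → IntegrableOn (fun t : ℝ => (t : ℂ) ^ (2 * l) / t *
      (gM l q η m t * jB l (-p) (-m) (-ν₀) t)) (Ioi 0) := fun m hm => by
    obtain ⟨C, hC, h⟩ := (gM_bounds hq hσ hη h₃ hm).1
    simp only [jB_neg_neg l p hm]
    exact pairing_integrable hq hσ hη h₃ hm hm ⟨C, hC, fun t ht => h t ht.1⟩ p
      (by rw [abs_of_pos hre]; exact hre')
  have hG := green (N := nK l q) (G := gM l q η) (κ := ν₀ - p) (f := f) (f₁ := f₁) (f₂ := f₂)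
    (a := fun m => jB l (-p) (-m) (-ν₀)) (a₁ := fun m => jB1 l (-p) (-m) (-ν₀))
    (a₂ := fun m => jB2 l (-p) (-m) (-ν₀))
    (L := (nK l q (-p) : ℂ) * (R * (p - ν₀) * D - R * (D * (ν₀ - p))))
    (nK_succ hq)
    (fun m hm t ht => by rw [← toNat_sub_cast hm]; exact hf m t ht)
    (fun m hm t ht => by rw [← toNat_sub_cast hm]; exact hf₁ m hm t ht)
    (fun m hm t ht => by rw [← toNat_sub_cast hm]; exact hf₂ m hm t ht)
    (fun m hm t ht => by
      have := jB_hasDerivAt l (-p) (-m) (-ν₀) ht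
      rw [toNat_sub_cast (hneg hm)] at this
      push_cast at this; rwa [sub_neg_eq_add] at this)
    (fun m hm t ht => by
      have := jB1_hasDerivAt l (-p) (hneg hm) (-ν₀) ht
      rw [toNat_sub_cast (hneg hm)] at this
      push_cast at this; rwa [sub_neg_eq_add] at this)
    (fun m hm t ht => by
      simp only [jB2]
      rw [toNat_sub_cast (hneg hm), show -m + 1 = -(m - 1) by ring]
      push_cast; ring) hint ?_ ?_
  · have hcongr : lam l q η p ν₀ = ∑ m ∈ Finset.Icc (-(l : ℤ)) l, (nK l q m : ℂ) *
        ∫ t in Ioi (0 : ℝ), (t : ℂ) ^ (2 * l) / t * (gM l q η m t * jB l (-p) (-m) (-ν₀) t) :=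
      Finset.sum_congr rfl fun m hm => by
        simp only [jB_neg_neg l p (mem_Icc_iff_abs.1 hm)]
    rw [hcongr, hG]
    have hν : ν₀ ≠ 0 := by rintro rfl; simp at h2
    have n1 : ν₀ - p ≠ 0 := fun h => by
      have h' := congrArg Complex.re h
      simp only [sub_re, Complex.intCast_re, Complex.zero_re] at h'
      have k1 : -1 < p := by exact_mod_cast (by linarith : (-1 : ℝ) < p)
      have k2 : p < 0 := by exact_mod_cast (by linarith : (p : ℝ) < 0)
      omega
    have hs : Complex.sin (π * ν₀) ≠ 0 := fun h0 => by
      obtain ⟨k, hk⟩ := Complex.sin_eq_zero_iff.1 h0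
      have hpi : (π : ℂ) ≠ 0 := by exact_mod_cast pi_pos.ne'
      have e : ν₀ = k := mul_left_cancel₀ hpi (by rw [hk]; ring)
      have h' := congrArg Complex.re e
      simp only [Complex.intCast_re] at h'
      have k1 : -1 < k := by exact_mod_cast (by linarith : (-1 : ℝ) < k)
      have k2 : k < 0 := by exact_mod_cast (by linarith : (k : ℝ) < 0)
      omega
    have key := sinD_mul_Dlead l hp hν hs
    have hn : (nK l q (-p) : ℂ) = (normPhi l p q : ℂ) ^ 2 := by
      rw [nK_neg hq, normPhi_sq hp hq, ← Complex.ofReal_pow, Real.sq_sqrt (nK_pos hq hp).le]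
    have hn0 : (normPhi l p q : ℂ) ≠ 0 := by exact_mod_cast (normPhi_pos hp hq).ne'
    have e : -((normPhi l p q : ℂ) ^ 2 * (R * (p - ν₀) * D - R * (D * (ν₀ - p)))) =
        4 * π * I * normPhi l p q * η ν₀ p * (sinD l p ν₀ * D) := by
      rw [hR]; field_simp; ring
    rw [hn, e, key]
    ring
  · have hsingle : (nK l q (-p) : ℂ) * (R * (p - ν₀) * D - R * (D * (ν₀ - p))) =
        ∑ m ∈ Finset.Icc (-(l : ℤ)) l, (nK l q m : ℂ) *
          ((if m = -p then R else 0) * (-(l + ν₀) + (((l : ℤ) - m).toNat : ℕ)) *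
            (if m = -p then D else 0) -
          (if m = -p then R else 0) * (if m = -p then D * (ν₀ - p) else 0)) := by
      rw [Finset.sum_eq_single_of_mem (-p) (mem_Icc_iff_abs.2 (hneg hp))]
      · simp only [if_true]
        rw [toNat_sub_cast (hneg hp)]; push_cast; ring
      · intro m _ hmp; simp [hmp]
    rw [hsingle]
    refine tendsto_finsetSum _ fun m hm => ?_
    have hm := mem_Icc_iff_abs.1 hm
    obtain ⟨⟨C₁, -, k1⟩, -⟩ := hfa m hm
    obtain ⟨⟨C₂, -, k2⟩, ⟨C₃, -, k3⟩, -⟩ := haa m hm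
    obtain ⟨C₄, -, k4⟩ := hasy m hm
    simp only [hlead] at k2
    simp only [hlead1] at k3
    exact ((tendsto_mul_zero (by linarith) (by linarith) hμ hμ' hsum k1 k2).sub
      (tendsto_mul_zero (by linarith) (by linarith) hμ hμ' hsum (fun t ht => k4 t ht.1) k3)).const_mul _
  · rw [← Finset.sum_const_zero (s := Finset.Icc (-(l : ℤ)) l)]
    refine tendsto_finsetSum _ fun m hm => ?_
    have hm := mem_Icc_iff_abs.1 hm
    obtain ⟨-, ⟨C₁, -, k1⟩⟩ := hfa m hm
    obtain ⟨-, -, ⟨C₂, -, k2⟩⟩ := haa m hm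
    obtain ⟨C₃, hC₃, k3⟩ := hb m hm
    obtain ⟨C₄, -, k4⟩ := jB_le_rpow_infty l (-p) (-m) (-ν₀) (l + 3)
    have := ((tendsto_mul_infty (l := l) k1 fun t ht => by
        have := k4 t ht; push_cast at this; exact this).sub
      (tendsto_mul_infty (l := l) (f := f m) (fun t ht => (k3 t (mem_Ioi.2
        (zero_lt_one.trans_le (mem_Ici.1 ht)))).trans
        (mul_le_mul_of_nonneg_left (Real.rpow_le_rpow_of_exponent_le ht (by linarith)) hC₃))
        k2)).const_mul (nK l q m : ℂ)
    rwa [sub_zero, mul_zero] at this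

end

theorem eulerElt_eq_kElt (x : ℝ × ℝ × ℝ) :
    normSq (eulerElt x 0 0) + normSq (eulerElt x 0 1) = 1 ∧
      eulerElt x = kElt (eulerElt x 0 0) (eulerElt x 0 1) := by
  obtain ⟨h1, h2⟩ := eulerElt_eq x
  obtain ⟨k1, k2, -, -⟩ := kElt_00 h1
  rw [h2, k1, k2]
  exact ⟨h1, rfl⟩

theorem Phi_eulerElt_continuous {l : ℕ} {m q : ℤ} (hm : |m| ≤ (l : ℤ)) (hq : |q| ≤ (l : ℤ)) :
    Continuous fun x : ℝ × ℝ × ℝ => Phi l m q (eulerElt x 0 0) (eulerElt x 0 1) := by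
  have := dB_continuous hq m
  rw [funext fun x => Phi_eulerElt hm hq x]
  fun_prop

theorem integrable_Phi_mul_conj {l : ℕ} {m m' q : ℤ} (hm : |m| ≤ (l : ℤ)) (hm' : |m'| ≤ (l : ℤ))
    (hq : |q| ≤ (l : ℤ)) :
    Integrable (fun x => Phi l m q (eulerElt x 0 0) (eulerElt x 0 1) *
      conj (Phi l m' q (eulerElt x 0 0) (eulerElt x 0 1))) haarK := by
  obtain ⟨C, hC, h⟩ := Phi_bounded l m q
  obtain ⟨C', hC', h'⟩ := Phi_bounded l m' q
  refine Integrable.of_bound ((Phi_eulerElt_continuous hm hq).mul (Complex.continuous_conj.comp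
    (Phi_eulerElt_continuous hm' hq))).aestronglyMeasurable (C * C') (Eventually.of_forall fun x => ?_)
  rw [norm_mul, RCLike.norm_conj]
  exact mul_le_mul (h _ _ (eulerElt_eq_kElt x).1) (h' _ _ (eulerElt_eq_kElt x).1) (norm_nonneg _) hC

/-- The components of a function of given `K`-type inherit its growth at `0`. -/
theorem component_growthZero {l : ℕ} {q : ℤ} (hq : |q| ≤ (l : ℤ)) {ω : ℂ} {F : ℤ → ℝ → ℂ} {s : ℝ}
    (h : GrowthZero (fK ω F l q) s) {m : ℤ} (hm : |m| ≤ (l : ℤ)) : ∃ C : ℝ, 0 ≤ C ∧ ∃ δ > 0,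
    ∀ r : ℝ, 0 < r → r < δ → ‖F m r‖ ≤ C * r ^ s := by
  obtain ⟨C, δ, hδ, h⟩ := h
  obtain ⟨K, hK, hPhi⟩ := Phi_bounded l m q
  have hN := nK_pos hq hm
  refine ⟨(nK l q m)⁻¹ * (|C| * K * haarK.real univ), by positivity, δ, hδ, fun r hr hrδ => ?_⟩
  have e : ∫ x, fK ω F l q (aElt r * eulerElt x) *
      conj (Phi l m q (eulerElt x 0 0) (eulerElt x 0 1)) ∂haarK = F m r * nK l q m := by
    have e1 : ∀ x, fK ω F l q (aElt r * eulerElt x) *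
        conj (Phi l m q (eulerElt x 0 0) (eulerElt x 0 1)) =
        ∑ m' ∈ Finset.Icc (-(l : ℤ)) l, F m' r * (Phi l m' q (eulerElt x 0 0) (eulerElt x 0 1) *
          conj (Phi l m q (eulerElt x 0 0) (eulerElt x 0 1))) := fun x => by
      obtain ⟨k1, k2⟩ := eulerElt_eq_kElt x
      conv_lhs => rw [k2, fK_aElt_mul_kElt ω F l q hr k1, ← k2]
      rw [Finset.sum_mul]
      exact Finset.sum_congr rfl fun _ _ => by ring
    simp only [e1]
    rw [integral_finsetSum _ fun m' hm' =>
      (integrable_Phi_mul_conj (mem_Icc_iff_abs.1 hm') hm hq).const_mul _,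
      Finset.sum_eq_single_of_mem m (mem_Icc_iff_abs.2 hm)]
    · rw [integral_const_mul, integral_Phi_mul_conj hm hm hq, if_pos rfl]
    · intro m' hm' hne
      rw [integral_const_mul, integral_Phi_mul_conj (mem_Icc_iff_abs.1 hm') hm hq, if_neg hne, mul_zero]
  have hb := norm_integral_le_of_norm_le_const (μ := haarK) (C := |C| * r ^ s * K)
    (f := fun x => fK ω F l q (aElt r * eulerElt x) *
      conj (Phi l m q (eulerElt x 0 0) (eulerElt x 0 1))) (Eventually.of_forall fun x => by
    obtain ⟨k1, k2⟩ := eulerElt_eq_kElt x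
    rw [norm_mul, RCLike.norm_conj]
    have h1 := h r hr hrδ _ _ k1
    rw [← k2] at h1
    have h0 : 0 ≤ r ^ s := rpow_nonneg hr.le s
    exact mul_le_mul (h1.trans (mul_le_mul_of_nonneg_right (le_abs_self C) h0)) (hPhi _ _ k1)
      (norm_nonneg _) (by positivity))
  rw [e, norm_mul, norm_real, norm_of_nonneg hN.le] at hb
  rw [mul_assoc, inv_mul_eq_div, le_div_iff₀ hN]
  linarith

section

variable {l : ℕ} {q : ℤ} {σ : ℝ} {η : ℂ → ℤ → ℂ} {ω : ℂ}

theorem gM_growthZero (hq : |q| ≤ (l : ℤ)) (hω : ω ≠ 0) (hσ : 1 / 2 ≤ σ)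
    (hη : RapidFamily l σ η)
    (h₃ : EvenFamily l σ η) {s : ℝ} (hs : 0 < s)
    (h : GrowthZero (inverseTransform l q ω η) (1 + s)) (m : ℤ) (hm : |m| ≤ (l : ℤ)) :
    ∃ C : ℝ, 0 ≤ C ∧ ∀ t ∈ Ioc (0 : ℝ) 1, ‖gM l q η m t‖ ≤ C * t ^ (-(l : ℝ) + s) := by
  rw [inverseTransform_eq hq hω (by linarith) hη] at h
  obtain ⟨C, hC, δ, hδ, h⟩ := component_growthZero hq h hm
  obtain ⟨C', hC', h'⟩ := (gM_bounds hq hσ hη h₃ hm).1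
  have hκ : 0 < π * ‖ω‖ := by positivity
  set κ := π * ‖ω‖ with hκdef
  refine ⟨2 * π ^ 2 * C / κ ^ (1 + s) * κ + C' * (κ * δ) ^ (-s), by positivity, fun t ht => ?_⟩
  have ht0 := ht.1
  have hts : 0 ≤ t ^ (-(l : ℝ) + s) := rpow_nonneg ht0.le _
  rw [add_mul]
  by_cases htδ : t < κ * δ
  · refine le_add_of_le_of_nonneg ?_ (by positivity)
    have hr : 0 < t / κ := div_pos ht0 hκ
    have h1 := h (t / κ) hr (by rw [div_lt_iff₀ hκ]; linarith)
    rw [norm_cM hω m hr, ← hκdef, mul_div_cancel₀ _ hκ.ne', Real.div_rpow ht0.le hκ.le] at h1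
    have e : t ^ (1 + s) = t ^ (l + 1) * t ^ (-(l : ℝ) + s) := by
      rw [← rpow_natCast, ← rpow_add ht0]; congr 1; push_cast; ring
    rw [e] at h1
    have hp : 0 < (2 * π ^ 2)⁻¹ * κ ^ l * (t / κ) ^ (l + 1) := by positivity
    refine le_of_mul_le_mul_left (h1.trans_eq ?_) hp
    rw [div_pow, pow_succ κ l]
    field_simp
  · refine le_add_of_nonneg_of_le (by positivity) ((h' t ht0).trans ?_)
    rw [mul_assoc]
    refine mul_le_mul_of_nonneg_left ?_ hC'
    have e : t ^ (-(l : ℝ) + 1 / 4) = t ^ (1 / 4 : ℝ) * t ^ (-s) * t ^ (-(l : ℝ) + s) := by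
      rw [← rpow_add ht0, ← rpow_add ht0]; congr 1; ring
    rw [e]
    refine mul_le_mul_of_nonneg_right ?_ hts
    have h1 : t ^ (1 / 4 : ℝ) ≤ 1 := Real.rpow_le_one ht0.le ht.2 (by norm_num)
    have h2 : t ^ (-s) ≤ (κ * δ) ^ (-s) :=
      Real.rpow_le_rpow_of_nonpos (by positivity) (not_lt.1 htδ) (by linarith)
    calc t ^ (1 / 4 : ℝ) * t ^ (-s) ≤ 1 * (κ * δ) ^ (-s) := by gcongr
      _ = _ := one_mul _

/-- The constant in `radial_eq`. -/
def radialC (l : ℕ) (ω ν : ℂ) (p m m' : ℤ) : ℂ :=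
  1 / (2 * (π : ℂ) ^ 3 * I) * (π * ((π * ‖ω‖ : ℝ) : ℂ) ^ l *
    (-I * conj (unitPart ω)) ^ ((l : ℤ) + m) * (-I * unitPart ω) ^ l) *
  ((Gamma (l + 1 - ν))⁻¹ * (π * ((π * ‖ω‖ : ℝ) : ℂ) ^ (l - ν) *
    (I * unitPart ω) ^ ((l : ℤ) + m') *
    (I * conj (unitPart ω)) ^ ((l : ℤ) - p))) *
  (((π * ‖ω‖ : ℝ) : ℂ) / ((π * ‖ω‖ : ℝ) : ℂ) ^ (2 * l))

theorem radial_eq (hω : ω ≠ 0) (p m m' : ℤ) (ν : ℂ) {h : ℝ} (hh : 0 < h) :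
    (h : ℂ) ^ (-3 : ℤ) * (cM l q ω η m h *
      conj (jacW l p m' ω (-(conj ν)) h)) =
    radialC l ω ν p m m' * ((((π * ‖ω‖) * h : ℝ) : ℂ) ^ (2 * l) /
      (((π * ‖ω‖) * h : ℝ) : ℂ) *
      (gM l q η m ((π * ‖ω‖) * h) * jB l p m' (-ν) ((π * ‖ω‖) * h))) := by
  have hκ : 0 < π * ‖ω‖ := by positivity
  have hc : ∀ w : ℂ, conj (((π * ‖ω‖ : ℝ) : ℂ) ^ w) =
      ((π * ‖ω‖ : ℝ) : ℂ) ^ conj w := fun w => by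
    rw [Complex.cpow_conj _ _ (by rw [arg_ofReal_of_nonneg hκ.le]; exact pi_pos.ne),
      conj_ofReal]
  have hκC : ((π * ‖ω‖ : ℝ) : ℂ) ≠ 0 := by exact_mod_cast hκ.ne'
  have hhC : (h : ℂ) ≠ 0 := by exact_mod_cast hh.ne'
  rw [cM, jacW, radialC]
  simp only [map_mul, map_inv₀, map_pow, map_zpow₀, hc, ← Complex.Gamma_conj, jB_conj, map_add,
    map_neg, Complex.conj_conj, conj_ofReal, conj_I, neg_neg, map_natCast, map_one,
    map_sub, ← sub_eq_add_neg]
  rw [show ((-3 : ℤ)) = -((3 : ℕ) : ℤ) by norm_num, zpow_neg, zpow_natCast]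
  push_cast at hκC ⊢
  generalize (-I * conj (unitPart ω)) ^ ((l : ℤ) + m) = A1
  generalize (I * unitPart ω) ^ ((l : ℤ) + m') = A2
  generalize (I * conj (unitPart ω)) ^ ((l : ℤ) - p) = A3
  generalize (Gamma (l + 1 - ν))⁻¹ = A4
  generalize (π * ‖ω‖ : ℂ) ^ (l - ν) = A5
  generalize (-I * unitPart ω) ^ l = A6
  generalize (π * ‖ω‖ : ℂ) = κ at *
  generalize gM l q η m _ = g
  generalize jB l p m' _ _ = j
  generalize 1 / (2 * (π : ℂ) ^ 3 * I) = A7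
  have e : (h ^ 3 : ℂ)⁻¹ * (h ^ (l + 1) * h ^ (l + 1)) = κ / κ ^ (2 * l) * ((κ * h) ^ (2 * l) / (κ * h)) := by
    rw [mul_pow]; field_simp; ring
  linear_combination (A7 * π ^ 2 * κ ^ l * A1 * A6 * g * A4 * A5 * A2 * A3 * j) * e

theorem radialC_self (hω : ω ≠ 0) (p m : ℤ) (ν : ℂ) : radialC l ω ν p m m =
    1 / (2 * π * I) * (((π * ‖ω‖ : ℝ) : ℂ) ^ (-ν) * ((π * ‖ω‖ : ℝ) : ℂ)) *
      (Gamma (l + 1 - ν))⁻¹ * (-I * unitPart ω) ^ p := by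
  have hκ : 0 < π * ‖ω‖ := by positivity
  have hκC : ((π * ‖ω‖ : ℝ) : ℂ) ≠ 0 := by exact_mod_cast hκ.ne'
  have hpi : (π : ℂ) ≠ 0 := by exact_mod_cast pi_pos.ne'
  have hu : conj (unitPart ω) * unitPart ω = 1 := by
    rw [mul_comm, mul_conj, normSq_eq_norm_sq, norm_unitPart hω]; simp
  have hE := neg_I_mul_unitPart_ne_zero hω
  have e1 : (-I * conj (unitPart ω)) ^ ((l : ℤ) + m) *
      (I * unitPart ω) ^ ((l : ℤ) + m) = 1 := by
    rw [← mul_zpow, show -I * conj (unitPart ω) * (I * unitPart ω) = 1 by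
      linear_combination (-I * I) * hu - Complex.I_mul_I, one_zpow]
  have e2 : (-I * unitPart ω) ^ l * (I * conj (unitPart ω)) ^ ((l : ℤ) - p) =
      (-I * unitPart ω) ^ p := by
    have : I * conj (unitPart ω) = (-I * unitPart ω)⁻¹ := by
      refine eq_inv_of_mul_eq_one_left ?_
      linear_combination (-I * I) * hu - Complex.I_mul_I
    rw [this, inv_zpow', ← zpow_natCast, ← zpow_add₀ hE]; congr 1; ring
  have e3 : ((π * ‖ω‖ : ℝ) : ℂ) ^ (l - ν) =
      ((π * ‖ω‖ : ℝ) : ℂ) ^ l * ((π * ‖ω‖ : ℝ) : ℂ) ^ (-ν) := by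
    rw [sub_eq_add_neg, cpow_add _ _ hκC, Complex.cpow_natCast]
  rw [radialC, e3, ← e2]
  generalize ((π * ‖ω‖ : ℝ) : ℂ) = κ at *
  generalize κ ^ (-ν) = A5
  generalize (-I * conj (unitPart ω)) ^ ((l : ℤ) + m) = A1 at *
  generalize (I * unitPart ω) ^ ((l : ℤ) + m) = A2 at *
  generalize (I * conj (unitPart ω)) ^ ((l : ℤ) - p) = A3
  generalize (Gamma (l + 1 - ν))⁻¹ = A4
  generalize (-I * unitPart ω) ^ l = A6
  rw [pow_mul']
  field_simp
  linear_combination (A6 * A4 * A5 * A3) * e1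

end

/-- The measure `r⁻³ dr` on the half line. -/
def radialMeasure : Measure ℝ :=
  (volume.restrict (Set.Ioi 0)).withDensity (fun r : ℝ => ENNReal.ofReal (r ^ (-3 : ℤ)))

theorem measurable_radial : Measurable fun r : ℝ => ENNReal.ofReal (r ^ (-3 : ℤ)) := by
  refine ENNReal.measurable_ofReal.comp ?_
  exact measurable_id.pow_const _

theorem radial_smul_eq {r : ℝ} (hr : r ∈ Ioi (0 : ℝ)) (z : ℂ) :
    (ENNReal.ofReal (r ^ (-3 : ℤ))).toReal • z = (r : ℂ) ^ (-3 : ℤ) * z := by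
  rw [ENNReal.toReal_ofReal (zpow_nonneg (le_of_lt (mem_Ioi.1 hr)) _), Complex.real_smul,
    Complex.ofReal_zpow]

theorem integral_radialMeasure (g : ℝ → ℂ) :
    ∫ r, g r ∂radialMeasure = ∫ r in Ioi (0 : ℝ), (r : ℂ) ^ (-3 : ℤ) * g r := by
  rw [radialMeasure, integral_withDensity_eq_integral_toReal_smul measurable_radial
    (Eventually.of_forall fun _ => ENNReal.ofReal_lt_top)]
  exact setIntegral_congr_fun measurableSet_Ioi fun r hr => radial_smul_eq hr (g r)

theorem integrable_radialMeasure {g : ℝ → ℂ}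
    (h : IntegrableOn (fun r : ℝ => (r : ℂ) ^ (-3 : ℤ) * g r) (Ioi 0)) :
    Integrable g radialMeasure := by
  rw [radialMeasure, integrable_withDensity_iff_integrable_smul' measurable_radial
    (Eventually.of_forall fun _ => ENNReal.ofReal_lt_top)]
  exact h.congr_fun (fun r hr => (radial_smul_eq hr (g r)).symm) measurableSet_Ioi

section

variable {l : ℕ} {q : ℤ} {σ : ℝ} {η : ℂ → ℤ → ℂ} {ω : ℂ}

theorem lebedevIntegrand_eq (hq : |q| ≤ (l : ℤ)) (hω : ω ≠ 0) (F : ℤ → ℝ → ℂ) (ν : ℂ) {p : ℤ}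
    (hp : |p| ≤ (l : ℤ)) {x : ℝ × ℝ × ℝ × ℝ} (hx : 0 < x.1) :
    lebedevIntegrand l q ω (fK ω F l q) ν p x =
      ∑ m ∈ Finset.Icc (-(l : ℤ)) l, ∑ m' ∈ Finset.Icc (-(l : ℤ)) l,
        (F m x.1 * conj (jacW l p m' ω (-(conj ν)) x.1)) *
        (Phi l m q (eulerElt x.2 0 0) (eulerElt x.2 0 1) *
          conj (Phi l m' q (eulerElt x.2 0 0) (eulerElt x.2 0 1))) := by
  obtain ⟨k1, k2⟩ := eulerElt_eq_kElt x.2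
  obtain ⟨c1, c2, c3, c4⟩ := coords_aElt_mul_kElt hx k1
  rw [lebedevIntegrand, k2, fK_aElt_mul_kElt ω F l q hx k1, jacquet_eq hp hq hω, c1, c2, c3, c4,
    ← k2, psi, mul_zero, Complex.zero_re, Complex.ofReal_zero, mul_zero, Complex.exp_zero, one_mul,
    map_sum, Finset.sum_mul_sum]
  refine Finset.sum_congr rfl fun m _ => Finset.sum_congr rfl fun m' _ => ?_
  rw [map_mul]; ring

theorem radial_integrable (hq : |q| ≤ (l : ℤ)) (hω : ω ≠ 0) (hσ : 1 / 2 ≤ σ)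
    (hη : RapidFamily l σ η)
    (h₃ : EvenFamily l σ η)
    {m m' : ℤ} (hm : |m| ≤ (l : ℤ)) (hm' : |m'| ≤ (l : ℤ)) {s : ℝ}
    (hs : ∃ C : ℝ, 0 ≤ C ∧ ∀ t ∈ Ioc (0 : ℝ) 1, ‖gM l q η m t‖ ≤ C * t ^ (-(l : ℝ) + s))
    (p : ℤ) {ν : ℂ} (hν : |ν.re| < s) :
    Integrable (fun r => cM l q ω η m r * conj (jacW l p m' ω (-(conj ν)) r))
      radialMeasure ∧
    ∫ r, cM l q ω η m r * conj (jacW l p m' ω (-(conj ν)) r) ∂radialMeasure =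
      radialC l ω ν p m m' * (((π * ‖ω‖ : ℝ) : ℂ)⁻¹ *
        ∫ t in Ioi (0 : ℝ), (t : ℂ) ^ (2 * l) / t * (gM l q η m t * jB l p m' (-ν) t)) := by
  have hκ : 0 < π * ‖ω‖ := by positivity
  have hi := pairing_integrable hq hσ hη h₃ hm hm' hs p (ν := -ν) (by rwa [neg_re, abs_neg])
  have hi' := (integrableOn_Ioi_comp_mul_left_iff (fun t : ℝ => (t : ℂ) ^ (2 * l) / t *
    (gM l q η m t * jB l p m' (-ν) t)) 0 hκ).2 (by rwa [mul_zero])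
  have hc := integral_comp_mul_left_Ioi (fun t : ℝ => (t : ℂ) ^ (2 * l) / t *
    (gM l q η m t * jB l p m' (-ν) t)) 0 hκ
  rw [mul_zero, Complex.real_smul, Complex.ofReal_inv] at hc
  constructor
  · exact integrable_radialMeasure (IntegrableOn.congr_fun
      (Integrable.const_mul hi' (radialC l ω ν p m m'))
      (fun r hr => (radial_eq hω p m m' ν hr).symm) measurableSet_Ioi)
  · rw [integral_radialMeasure, setIntegral_congr_fun measurableSet_Ioi
      fun r hr => radial_eq hω p m m' ν hr, integral_const_mul, hc]

theorem lebedevIntegrand_integral (hq : |q| ≤ (l : ℤ)) (hω : ω ≠ 0) (hσ : 1 / 2 ≤ σ)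
    (hη : RapidFamily l σ η)
    (h₃ : EvenFamily l σ η) {s : ℝ}
    (hs : ∀ m : ℤ, |m| ≤ (l : ℤ) →
      ∃ C : ℝ, 0 ≤ C ∧ ∀ t ∈ Ioc (0 : ℝ) 1, ‖gM l q η m t‖ ≤ C * t ^ (-(l : ℝ) + s))
    {p : ℤ} (hp : |p| ≤ (l : ℤ)) {ν : ℂ} (hν : |ν.re| < s) :
    Integrable (lebedevIntegrand l q ω (inverseTransform l q ω η) ν p) measNG ∧
    ∫ x, lebedevIntegrand l q ω (inverseTransform l q ω η) ν p x ∂measNG =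
      1 / (2 * π * I) * ((π * ‖ω‖ : ℝ) : ℂ) ^ (-ν) *
      (Gamma (l + 1 - ν))⁻¹ * (-I * unitPart ω) ^ p * lam l q η p ν := by
  have hκ : 0 < π * ‖ω‖ := by positivity
  have hκC : ((π * ‖ω‖ : ℝ) : ℂ) ≠ 0 := by exact_mod_cast hκ.ne'
  rw [inverseTransform_eq hq hω (by linarith) hη]
  have hpos : ∀ᵐ r ∂radialMeasure, 0 < r :=
    (withDensity_absolutelyContinuous _ _).ae_le (ae_restrict_mem measurableSet_Ioi)
  have hae : lebedevIntegrand l q ω (fK ω (cM l q ω η) l q) ν p =ᵐ[measNG] fun x =>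
      ∑ m ∈ Finset.Icc (-(l : ℤ)) l, ∑ m' ∈ Finset.Icc (-(l : ℤ)) l,
        (cM l q ω η m x.1 * conj (jacW l p m' ω (-(conj ν)) x.1)) *
        (Phi l m q (eulerElt x.2 0 0) (eulerElt x.2 0 1) *
          conj (Phi l m' q (eulerElt x.2 0 0) (eulerElt x.2 0 1))) := by
    have : ∀ᵐ x ∂measNG, 0 < x.1 := Measure.quasiMeasurePreserving_fst.ae hpos
    filter_upwards [this] with x hx using lebedevIntegrand_eq hq hω _ ν hp hx
  have hterm : ∀ m ∈ Finset.Icc (-(l : ℤ)) l, ∀ m' ∈ Finset.Icc (-(l : ℤ)) l,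
      Integrable (fun x : ℝ × ℝ × ℝ × ℝ =>
        (cM l q ω η m x.1 * conj (jacW l p m' ω (-(conj ν)) x.1)) *
        (Phi l m q (eulerElt x.2 0 0) (eulerElt x.2 0 1) *
          conj (Phi l m' q (eulerElt x.2 0 0) (eulerElt x.2 0 1)))) measNG :=
    fun m hm m' hm' => by
      have hm := mem_Icc_iff_abs.1 hm
      have hm' := mem_Icc_iff_abs.1 hm'
      exact (radial_integrable hq hω hσ hη h₃ hm hm' (hs m hm) p hν).1.mul_prod
        (integrable_Phi_mul_conj hm hm' hq)
  refine ⟨(integrable_finsetSum _ fun m hm => integrable_finsetSum _ fun m' hm' =>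
    hterm m hm m' hm').congr hae.symm, ?_⟩
  rw [integral_congr_ae hae, integral_finsetSum _ fun m hm =>
    integrable_finsetSum _ fun m' hm' => hterm m hm m' hm', lam, Finset.mul_sum]
  refine Finset.sum_congr rfl fun m hmI => ?_
  have hmI' := mem_Icc_iff_abs.1 hmI
  have : SFinite radialMeasure := by unfold radialMeasure; infer_instance
  have hprod : ∀ m' : ℤ, ∫ x : ℝ × ℝ × ℝ × ℝ,
      (cM l q ω η m x.1 * conj (jacW l p m' ω (-(conj ν)) x.1)) *
        (Phi l m q (eulerElt x.2 0 0) (eulerElt x.2 0 1) *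
          conj (Phi l m' q (eulerElt x.2 0 0) (eulerElt x.2 0 1))) ∂measNG =
      (∫ r, cM l q ω η m r * conj (jacW l p m' ω (-(conj ν)) r) ∂radialMeasure) *
      ∫ x, Phi l m q (eulerElt x 0 0) (eulerElt x 0 1) *
          conj (Phi l m' q (eulerElt x 0 0) (eulerElt x 0 1)) ∂haarK := fun m' =>
    integral_prod_mul (μ := radialMeasure) (ν := haarK)
      (fun r => cM l q ω η m r * conj (jacW l p m' ω (-(conj ν)) r))
      (fun x => Phi l m q (eulerElt x 0 0) (eulerElt x 0 1) *
          conj (Phi l m' q (eulerElt x 0 0) (eulerElt x 0 1)))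
  rw [integral_finsetSum _ fun m' hm' => hterm m hmI m' hm', Finset.sum_eq_single_of_mem m hmI]
  · rw [hprod, (radial_integrable hq hω hσ hη h₃ hmI' hmI' (hs m hmI') p hν).2,
      integral_Phi_mul_conj hmI' hmI' hq, if_pos rfl, radialC_self hω]
    generalize ((π * ‖ω‖ : ℝ) : ℂ) ^ (-ν) = A
    field_simp
  · intro m' hm' hne
    rw [hprod, integral_Phi_mul_conj hmI' (mem_Icc_iff_abs.1 hm') hq,
      if_neg hne.symm, mul_zero]

theorem lebedev_eq_lam (hq : |q| ≤ (l : ℤ)) (hω : ω ≠ 0) (hσ : 1 / 2 ≤ σ)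
    (hη : RapidFamily l σ η)
    (h₃ : EvenFamily l σ η) {s : ℝ}
    (hs : ∀ m : ℤ, |m| ≤ (l : ℤ) →
      ∃ C : ℝ, 0 ≤ C ∧ ∀ t ∈ Ioc (0 : ℝ) 1, ‖gM l q η m t‖ ≤ C * t ^ (-(l : ℝ) + s))
    {p : ℤ} (hp : |p| ≤ (l : ℤ)) {ν : ℂ} (hν : |ν.re| < s) (hΓ : ∀ n : ℕ, ν ≠ l + 1 + n) :
    lebedev l q ω (inverseTransform l q ω η) ν p =
      lam l q η p ν / (2 * (π : ℂ) ^ 3 * I * normPhi l p q) := by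
  have hκ : 0 < π * ‖ω‖ := by positivity
  have hκC : ((π * ‖ω‖ : ℝ) : ℂ) ≠ 0 := by exact_mod_cast hκ.ne'
  have hG : Gamma (l + 1 - ν) ≠ 0 := Complex.Gamma_ne_zero fun n h =>
    hΓ n (by linear_combination -h)
  have hpi : (π : ℂ) ≠ 0 := by exact_mod_cast pi_pos.ne'
  have hn0 : (normPhi l p q : ℂ) ≠ 0 := by exact_mod_cast (normPhi_pos hp hq).ne'
  have e1 : ((π * ‖ω‖ : ℝ) : ℂ) ^ (-ν) * ((π * ‖ω‖ : ℝ) : ℂ) ^ ν = 1 := by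
    rw [← cpow_add _ _ hκC, neg_add_cancel, Complex.cpow_zero]
  have e2 : (-I * unitPart ω) ^ p * (-I * unitPart ω) ^ (-p) = 1 := by
    rw [← zpow_add₀ (neg_I_mul_unitPart_ne_zero hω), add_neg_cancel, zpow_zero]
  rw [lebedev, (lebedevIntegrand_integral hq hω hσ hη h₃ hs hp hν).2]
  generalize ((π * ‖ω‖ : ℝ) : ℂ) ^ (-ν) = A at *
  generalize ((π * ‖ω‖ : ℝ) : ℂ) ^ ν = B at *
  generalize (-I * unitPart ω) ^ p = X at *
  generalize (-I * unitPart ω) ^ (-p) = Y at *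
  calc _ = (A * B) * (X * Y) * (lam l q η p ν / (2 * (π : ℂ) ^ 3 * I *
        normPhi l p q)) := by field_simp
    _ = _ := by rw [e1, e2, one_mul, one_mul]

theorem factor_differentiable (l : ℕ) (p : ℤ) : Differentiable ℂ (factor l p) := by
  have h : ∀ s : Finset ℕ, Differentiable ℂ fun ν : ℂ => ∏ j ∈ s, ((j : ℂ) ^ 2 - ν ^ 2) :=
    fun s => by fun_prop
  by_cases hp : p = 0
  · have e : factor l p = fun ν => -(2 / (π : ℂ)) * ∏ j ∈ Finset.Icc 1 l, ((j : ℂ) ^ 2 - ν ^ 2) := by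
      ext ν; simp [factor, hp]
    rw [e]; exact (h _).const_mul _
  · have e : factor l p = fun ν => (2 / (π : ℂ)) * ∏ j ∈ (Finset.Icc 1 l).erase p.natAbs,
        ((j : ℂ) ^ 2 - ν ^ 2) := by
      ext ν; simp [factor, hp]
    rw [e]; exact (h _).const_mul _

theorem lam_eq_of_growth (hq : |q| ≤ (l : ℤ)) (hσ : 1 / 2 ≤ σ)
    (hη : RapidFamily l σ η)
    (h₃ : EvenFamily l σ η) {s : ℝ} (hs0 : 0 < s)
    (hs : ∀ m : ℤ, |m| ≤ (l : ℤ) →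
      ∃ C : ℝ, 0 ≤ C ∧ ∀ t ∈ Ioc (0 : ℝ) 1, ‖gM l q η m t‖ ≤ C * t ^ (-(l : ℝ) + s))
    {p : ℤ} (hp : |p| ≤ (l : ℤ)) {ν : ℂ} (hν : |ν.re| ≤ σ) (hν' : |ν.re| < s) :
    lam l q η p ν = 2 * (π : ℂ) ^ 3 * I * normPhi l p q *
      (factor l p ν * η ν p) := by
  set g : ℂ → ℂ := fun ν => 2 * (π : ℂ) ^ 3 * I * normPhi l p q *
      (factor l p ν * η ν p) with hg
  have dL : ∀ z : ℂ, |z.re| < s → DifferentiableAt ℂ (lam l q η p) z := fun z hz =>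
    lam_differentiableAt hq hσ hη h₃ hs p hz
  have dg : ∀ z : ℂ, |z.re| ≤ σ → DifferentiableAt ℂ g z := fun z hz =>
    ((factor_differentiable l p z).mul ((hη p hp).1 z (neg_le_of_abs_le hz)
      (le_of_abs_le hz))).const_mul _
  set d : ℝ := min s σ with hd
  have hd0 : 0 < d := lt_min hs0 (by linarith)
  set U : Set ℂ := Complex.re ⁻¹' Ioo (-d) d with hU
  have hUo : IsOpen U := isOpen_Ioo.preimage continuous_re
  have hUc : Convex ℝ U := (convex_Ioo (-d) d).linear_preimage Complex.reLm
  have hU1 : ∀ z ∈ U, |z.re| < s ∧ |z.re| < σ := fun z hz =>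
    lt_min_iff.1 (abs_lt.2 hz)
  have hE : EqOn (lam l q η p) g U := by
    refine AnalyticOnNhd.eqOn_of_preconnected_of_eventuallyEq
      (DifferentiableOn.analyticOnNhd (fun z hz => (dL z (hU1 z hz).1).differentiableWithinAt) hUo)
      (DifferentiableOn.analyticOnNhd (fun z hz => (dg z (hU1 z hz).2.le).differentiableWithinAt) hUo)
      hUc.isPreconnected (z₀ := ((-(min d (1 / 4) / 2) : ℝ) : ℂ)) ?_ ?_
    · have h1 : min d (1 / 4) ≤ d := min_le_left _ _
      have h2 : 0 < min d (1 / 4) := lt_min hd0 (by norm_num)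
      simp only [hU, mem_preimage, Complex.ofReal_re, mem_Ioo]
      constructor <;> linarith
    · have h1 : min d (1 / 4) ≤ 1 / 4 := min_le_right _ _
      have h2 : 0 < min d (1 / 4) := lt_min hd0 (by norm_num)
      have : Complex.re ⁻¹' Ioo (-1 / 4) 0 ∈ 𝓝 ((-(min d (1 / 4) / 2) : ℝ) : ℂ) :=
        (isOpen_Ioo.preimage continuous_re).mem_nhds
          (by simp only [mem_preimage, Complex.ofReal_re, mem_Ioo]; constructor <;> linarith)
      filter_upwards [this] with z hz using lam_eq hq hσ hη h₃ hp hz.1 hz.2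
  have hpath : Tendsto (fun t : ℝ => (t : ℂ) * ν) (𝓝[<] 1) (𝓝 ν) := by
    have : Tendsto (fun t : ℝ => (t : ℂ) * ν) (𝓝 1) (𝓝 (((1 : ℝ) : ℂ) * ν)) :=
      (by fun_prop : Continuous fun t : ℝ => (t : ℂ) * ν).tendsto 1
    rw [Complex.ofReal_one, one_mul] at this
    exact this.mono_left nhdsWithin_le_nhds
  refine tendsto_nhds_unique_of_eventuallyEq ((dL ν hν').continuousAt.tendsto.comp hpath)
    ((dg ν hν).continuousAt.tendsto.comp hpath) ?_
  filter_upwards [Ioo_mem_nhdsLT zero_lt_one] with t ht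
  refine hE ?_
  simp only [hU, mem_preimage, Complex.re_ofReal_mul, mem_Ioo]
  rw [← abs_lt, abs_mul, abs_of_pos ht.1]
  have hle : |ν.re| ≤ d := le_min hν'.le hν
  nlinarith [ht.1, ht.2, abs_nonneg ν.re]

theorem rapid_of_decay {f : ℂ → ℂ} (h₁ : AnalyticOnNhd ℂ f {ν : ℂ | |ν.re| ≤ σ})
    (h₂ : ∀ A : ℝ, 0 < A → ∃ B : ℝ, ∀ ν : ℂ, |ν.re| ≤ σ →
      ‖f ν‖ ≤ B * (Real.exp (-π * |ν.im| / 2) * (1 + |ν.im|) ^ (-A))) :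
    Rapid (-σ) σ (-π / 2) f := by
  refine ⟨fun z h1 h2 => (h₁ z (abs_le.2 ⟨h1, h2⟩)).differentiableAt, fun N => ?_⟩
  obtain ⟨B, hB⟩ := h₂ (N + 1) (by positivity)
  refine ⟨|B|, abs_nonneg _, fun z h1 h2 => ?_⟩
  have h0 : 1 ≤ 1 + |z.im| := le_add_of_nonneg_right (abs_nonneg _)
  have hpos : 0 < 1 + |z.im| := by linarith
  have e : (1 + |z.im|) ^ (-((N : ℝ) + 1)) * (1 + |z.im|) ^ N ≤ 1 := by
    rw [← rpow_natCast, ← rpow_add hpos]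
    exact Real.rpow_le_one_of_one_le_of_nonpos h0 (by linarith)
  calc ‖f z‖ * (1 + |z.im|) ^ N
      ≤ |B| * (Real.exp (-π * |z.im| / 2) * (1 + |z.im|) ^ (-((N : ℝ) + 1))) *
        (1 + |z.im|) ^ N := by
        refine mul_le_mul_of_nonneg_right ((hB z (abs_le.2 ⟨h1, h2⟩)).trans ?_) (by positivity)
        exact mul_le_mul_of_nonneg_right (le_abs_self B) (by positivity)
    _ = |B| * Real.exp (-π * |z.im| / 2) *
        ((1 + |z.im|) ^ (-((N : ℝ) + 1)) * (1 + |z.im|) ^ N) := by ring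
    _ ≤ |B| * Real.exp (-π * |z.im| / 2) * 1 := by gcongr
    _ = |B| * Real.exp (-π / 2 * |z.im|) := by rw [mul_one]; congr 2; ring

theorem eventually_ne_gamma_pole (l : ℕ) (ν : ℂ) :
    ∀ᶠ μ : ℂ in 𝓝[≠] ν, ∀ n : ℕ, μ ≠ l + 1 + n := by
  have hd : Differentiable ℂ fun μ : ℂ => (Gamma (l + 1 - μ))⁻¹ :=
    Complex.differentiable_one_div_Gamma.comp (differentiable_id.const_sub _)
  have ha : AnalyticOnNhd ℂ (fun μ : ℂ => (Gamma (l + 1 - μ))⁻¹) univ :=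
    hd.differentiableOn.analyticOnNhd isOpen_univ
  rcases (ha ν (mem_univ _)).eventually_eq_zero_or_eventually_ne_zero with h | h
  · have h0 := ha.eqOn_zero_of_preconnected_of_eventuallyEq_zero isPreconnected_univ (mem_univ _) h
      (mem_univ 0)
    simp only [sub_zero, Pi.zero_apply, inv_eq_zero, Complex.Gamma_nat_eq_factorial] at h0
    exact absurd h0 (by exact_mod_cast l.factorial_ne_zero)
  · filter_upwards [h] with μ hμ n hn
    refine hμ ?_
    rw [hn, show (l : ℂ) + 1 - (l + 1 + n) = -n by ring, Complex.Gamma_neg_nat_eq_zero, inv_zero]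

end

end Lebedev

end

theorem theorem7p1 (l : ℕ) (q : ℤ) (hq : |q| ≤ (l : ℤ)) (ω : ℂ) (hω : ω ≠ 0)
    (σ : ℝ) (hσ : 1 < σ) (η : ℂ → ℤ → ℂ)
    -- holomorphic on a neighbourhood of the closed strip
    (h₁ : ∀ p : ℤ, |p| ≤ (l : ℤ) → AnalyticOnNhd ℂ (fun ν => η ν p) {ν : ℂ | |ν.re| ≤ σ})
    (h₂ : ∀ A : ℝ, 0 < A → ∃ B : ℝ, ∀ p : ℤ, |p| ≤ (l : ℤ) → ∀ ν : ℂ, |ν.re| ≤ σ →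
      ‖η ν p‖ ≤ B * (Real.exp (-Real.pi * |ν.im| / 2) * (1 + |ν.im|) ^ (-A)))
    (h₃ : ∀ p : ℤ, |p| ≤ (l : ℤ) → ∀ ν : ℂ, |ν.re| ≤ σ → η ν p = η (-ν) (-p)) :
    -- the integrals defining the transform of `η` converge absolutely
    (∀ (g : Lebedev.SL2) (p : ℤ), |p| ≤ (l : ℤ) → MeasureTheory.Integrable
      (fun t : ℝ => Lebedev.inverseIntegrand l q ω η g p (t * Complex.I))) ∧
    Lebedev.MemP l q ω (Lebedev.inverseTransform l q ω η) ∧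
    -- one-sided inversion, at every point of the strip in the domain `|Re ν| < σ₀` of the Lebedev
    -- transform, for every admissible exponent `σ₀`
    ∀ σ₀ : ℝ, 0 < σ₀ → Lebedev.GrowthZero (Lebedev.inverseTransform l q ω η) (1 + σ₀) →
      ∀ p : ℤ, |p| ≤ (l : ℤ) → ∀ ν : ℂ, |ν.re| ≤ σ → |ν.re| < σ₀ →
        MeasureTheory.Integrable
          (Lebedev.lebedevIntegrand l q ω (Lebedev.inverseTransform l q ω η) ν p)
          Lebedev.measNG ∧
        ((∀ n : ℕ, ν ≠ l + 1 + n) →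
          Lebedev.lebedev l q ω (Lebedev.inverseTransform l q ω η) ν p
            = Lebedev.factor l p ν * η ν p) ∧
        -- including the removable singularities at the poles of the gamma factor
        Filter.Tendsto
          (fun μ => Lebedev.lebedev l q ω (Lebedev.inverseTransform l q ω η) μ p)
          (nhdsWithin ν {ν}ᶜ) (nhds (Lebedev.factor l p ν * η ν p)) := by
  have hη : ∀ p : ℤ, |p| ≤ (l : ℤ) → Lebedev.Rapid (-σ) σ (-Real.pi / 2) fun ν => η ν p := fun p hp =>
    Lebedev.rapid_of_decay (h₁ p hp) fun A hA => (h₂ A hA).imp fun B hB ν hν => hB p hp ν hν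
  have hσ' : 1 / 2 ≤ σ := by linarith
  refine ⟨fun g p hp => (Lebedev.inverseIntegrand_integrable hq hω (by linarith) hη g hp).1,
    Lebedev.inverseTransform_memP hq hω hσ' hη h₃, fun σ₀ hσ₀ hg p hp ν hν hν₀ => ?_⟩
  have hs := Lebedev.gM_growthZero hq hω hσ' hη h₃ hσ₀ hg
  have hn : (2 * (Real.pi : ℂ) ^ 3 * Complex.I * Lebedev.normPhi l p q) ≠ 0 := by
    have h1 : (Real.pi : ℂ) ≠ 0 := by exact_mod_cast Real.pi_pos.ne'
    have h2 : (Lebedev.normPhi l p q : ℂ) ≠ 0 := by exact_mod_cast (Lebedev.normPhi_pos hp hq).ne'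
    simp [h1, h2]
  have hlam : Lebedev.lam l q η p ν / (2 * (Real.pi : ℂ) ^ 3 * Complex.I * Lebedev.normPhi l p q) =
      Lebedev.factor l p ν * η ν p := by
    rw [Lebedev.lam_eq_of_growth hq hσ' hη h₃ hσ₀ hs hp hν hν₀, mul_div_cancel_left₀ _ hn]
  refine ⟨(Lebedev.lebedevIntegrand_integral hq hω hσ' hη h₃ hs hp hν₀).1, fun hΓ => ?_, ?_⟩
  · rw [Lebedev.lebedev_eq_lam hq hω hσ' hη h₃ hs hp hν₀ hΓ, hlam]
  · rw [← hlam]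
    have hc := ((Lebedev.lam_differentiableAt hq hσ' hη h₃ hs p hν₀).continuousAt.tendsto.div_const
      (2 * (Real.pi : ℂ) ^ 3 * Complex.I * Lebedev.normPhi l p q)).mono_left
        (nhdsWithin_le_nhds (s := {ν}ᶜ))
    refine hc.congr' ?_
    have hopen : ∀ᶠ μ in nhdsWithin ν {ν}ᶜ, |μ.re| < σ₀ := nhdsWithin_le_nhds
      ((isOpen_lt (Complex.continuous_re.abs) continuous_const).mem_nhds hν₀)
    filter_upwards [hopen, Lebedev.eventually_ne_gamma_pole l ν] with μ h1 h2
      using (Lebedev.lebedev_eq_lam hq hω hσ' hη h₃ hs hp h1 h2).symm
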